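/- Let $\Phi_0$ be the 4-form on $\mathbb R^8$ (coordinates numbered $0,\dots,7$, $e^{ijkl}=e^i\wedge e^j\wedge e^k\wedge e^l$) $$\Phi_0=-e^{0123}-e^{0145}-e^{0167}-e^{0246}+e^{0257}+e^{0347}+e^{0356}-e^{4567}-e^{2367}-e^{2345}-e^{1357}+e^{1346}+e^{1256}+e^{1247}.$$ A Cayley form on a smooth 8-manifold $M$ is a smooth 4-form $\Phi$ such that every tangent space has a basis in which $\Phi$ has the components of $\Phi_0$ (an adapted basis). Its metric $g$ is the one for which adapted bases are orthonormal; then $\Phi_{ijpq}\Phi_{ab}{}^{pq}=6g_{ia}g_{jb}-6g_{ib}g_{ja}-4\Phi_{ijab}$. Indices are raised with $g$, $\nabla$ is the Levi-Civita connection, round and square brackets are symmetrisation and antisymmetrisation with total weight one, $(\nabla_a\nabla_b-\nabla_b\nabla_a)X_i=R_{abi}{}^pX_p$, $R_{ab}=g^{cd}R_{acbd}$ and $R=g^{ab}R_{ab}$. Let $\Lambda^2_{21}=\{\beta\in\Lambda^2:\tfrac12\Phi_{ij}{}^{pq}\beta_{pq}=\beta_{ij}\}$ and $\Lambda^2_7=\{\beta\in\Lambda^2:\tfrac12\Phi_{ij}{}^{pq}\beta_{pq}=-3\beta_{ij}\}$.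 Theorem. Let $\Phi$ be a Cayley form on a smooth 8-manifold. There is a unique 3-form $T$ (the torsion 3-form) with $$\nabla_a\Phi_{ijkl}=4T_{a[i}{}^p\Phi_{|p|jkl]},$$ and it is smooth. Let $T_{a;ij}=\tfrac14T_{aij}-\tfrac18\Phi_{ij}{}^{kl}T_{akl}$ be the intrinsic torsion, a section of $\Lambda^1\otimes\Lambda^2_7$. Then: 1. $R=-\Phi^{abcd}\nabla_aT_{bcd}+T^{abc}T_{abc}+\Phi^{abcd}T_{ab}{}^pT_{cdp}$. 2. $R_{ab}=-\tfrac12\Phi_{(a}{}^{ijk}\nabla_{b)}T_{ijk}+\tfrac12\Phi_{(a}{}^{ijk}\nabla_{|i|}T_{b)jk}+T_a{}^{pq}T_{bpq}+\Phi_{(a}{}^{ijk}T_{b)i}{}^pT_{jkp}$. 3. $4\nabla^aT_{a;mn}=\tfrac12\Phi_{[m}{}^{abc}\nabla_{n]}T_{abc}-\tfrac32\Phi_{[m}{}^{abc}\nabla_{|a|}T_{n]bc}-3\Phi_{[m}{}^{abc}T_{n]a}{}^pT_{bcp}$. 4. All of the Riemann curvature except its $168$ part is determined by $T$. Precisely,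 $$R_{abij}-\tfrac12\Phi_{ij}{}^{pq}R_{abpq}=S_{abij},$$ $$S_{abij}:=\nabla_aT_{bij}-\nabla_bT_{aij}-\tfrac12\Phi_{ij}{}^{cd}\nabla_aT_{bcd}+\tfrac12\Phi_{ij}{}^{cd}\nabla_bT_{acd}+T_{ai}{}^pT_{bjp}-T_{bi}{}^pT_{ajp}-\Phi_{ij}{}^{pq}T_{ap}{}^kT_{bqk}.$$ At each point let $W_{168}$ be the space of tensors with the algebraic symmetries of the Riemann tensor (including the first Bianchi identity) that lie in $\Lambda^2_{21}\otimes_S\Lambda^2_{21}$. Then $\dim W_{168}=168$, and $W_{168}$ consists of Weyl tensors, i.e. its elements have vanishing Ricci contraction. The component of the Riemann tensor in the orthogonal complement of $W_{168}$ is $F_\Phi(S)$, where $F_\Phi$ is a linear map on tensors of rank four that depends only on the value of $\Phi$ at the point: it is the same at all points of all 8-manifolds with a Cayley form at which $\Phi$ has the same components. 5. If $d\Phi=0$, then $R_{ab}=0$. -/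

import Mathlib

open scoped Manifold ContDiff

/-! ## Tensors on `ℝ⁸` in components -/

/-- The model space `ℝ⁸`. -/
abbrev R8 : Type := EuclideanSpace ℝ (Fin 8)

/-- The `i`-th standard basis vector of `ℝ⁸`. -/
noncomputable abbrev stdVec (i : Fin 8) : R8 := EuclideanSpace.single i (1 : ℝ)

/-- Covariant tensors of rank two, three and four, by their components. -/
abbrev Tensor2 : Type := Fin 8 → Fin 8 → ℝ
abbrev Tensor3 : Type := Fin 8 → Fin 8 → Fin 8 → ℝ
abbrev Tensor4 : Type := Fin 8 → Fin 8 → Fin 8 → Fin 8 → ℝ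

/-- The components of a 3-form and of a 4-form on `ℝ⁸`. -/
noncomputable def comp3 (τ : R8 [⋀^Fin 3]→L[ℝ] ℝ) : Tensor3 := fun i j k =>
  τ ![stdVec i, stdVec j, stdVec k]

noncomputable def comp4 (φ : R8 [⋀^Fin 4]→L[ℝ] ℝ) : Tensor4 := fun i j k l =>
  φ ![stdVec i, stdVec j, stdVec k, stdVec l]

/-! ## Cayley forms and their metrics -/

/-- The supports of the fourteen terms of the standard Cayley form. -/
def cayleyIndex : Fin 14 → Fin 4 → Fin 8 :=
  ![![0, 1, 2, 3], ![0, 1, 4, 5], ![0, 1, 6, 7], ![0, 2, 4, 6], ![0, 2, 5, 7], ![0, 3, 4, 7],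
    ![0, 3, 5, 6], ![4, 5, 6, 7], ![2, 3, 6, 7], ![2, 3, 4, 5], ![1, 3, 5, 7], ![1, 3, 4, 6],
    ![1, 2, 5, 6], ![1, 2, 4, 7]]

/-- The signs of the fourteen terms of the standard Cayley form. -/
def cayleySign : Fin 14 → ℤ :=
  ![-1, -1, -1, -1, 1, 1, 1, -1, -1, -1, -1, 1, 1, 1]

/-- The components of the standard Cayley form: the sum over the fourteen terms of
`± e^p ∧ e^q ∧ e^r ∧ e^s`.  Its overall sign is the one for which
`Φ_{ijpq} Φ_{abpq} = 6 δ_{ia} δ_{jb} - 6 δ_{ib} δ_{ja} - 4 Φ_{ijab}`. -/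
def stdCayley (i j k l : Fin 8) : ℤ :=
  ∑ t : Fin 14, cayleySign t *
    (Matrix.of fun a b : Fin 4 => if cayleyIndex t a = ![i, j, k, l] b then (1 : ℤ) else 0).det

section Cayley

variable {V : Type*} [AddCommGroup V] [Module ℝ V] [TopologicalSpace V]

/-- A basis in which the 4-form `φ` has the components of the standard Cayley form. -/
def IsAdaptedBasis (φ : V [⋀^Fin 4]→L[ℝ] ℝ) (b : Module.Basis (Fin 8) ℝ V) : Prop :=
  ∀ i j k l : Fin 8, φ ![b i, b j, b k, b l] = (stdCayley i j k l : ℝ)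

/-- A Cayley form: a 4-form that is linearly equivalent to the standard one. -/
def IsCayleyForm (φ : V [⋀^Fin 4]→L[ℝ] ℝ) : Prop :=
  ∃ b : Module.Basis (Fin 8) ℝ V, IsAdaptedBasis φ b

open Classical in
/-- The metric of a Cayley form: the inner product for which adapted bases are orthonormal.  (Two
adapted bases differ by an element of the stabiliser `Spin(7) ⊆ SO(8)` of the standard form, so
they give the same inner product.) -/
noncomputable def cayleyMetric (φ : V [⋀^Fin 4]→L[ℝ] ℝ) (v w : V) : ℝ :=
  if h : IsCayleyForm φ then ∑ i : Fin 8, h.choose.repr v i * h.choose.repr w i else 0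

end Cayley

/-- The matrix `g_{ij}` of the metric of a Cayley form on `ℝ⁸`. -/
noncomputable def metricMatrix (φ : R8 [⋀^Fin 4]→L[ℝ] ℝ) : Matrix (Fin 8) (Fin 8) ℝ :=
  Matrix.of fun i j => cayleyMetric φ (stdVec i) (stdVec j)

/-! ## Levi-Civita calculus in coordinates

Here `g` is a field of metric matrices on (an open subset of) `ℝ⁸`, and `(g y)⁻¹` has the
entries `g^{ij}`. -/

/-- The partial derivative `∂_a f` at `y`. -/
noncomputable def pderiv (a : Fin 8) (f : R8 → ℝ) (y : R8) : ℝ := fderiv ℝ f y (stdVec a)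

/-- The Christoffel symbol `Γ^k_{ij}`. -/
noncomputable def christoffel (g : R8 → Matrix (Fin 8) (Fin 8) ℝ) (k i j : Fin 8) (y : R8) : ℝ :=
  (1 / 2) * ∑ l, (g y)⁻¹ k l *
    (pderiv i (fun z => g z j l) y + pderiv j (fun z => g z i l) y - pderiv l (fun z => g z i j) y)

/-- `∇_a S_{ijk}` -/
noncomputable def nabla3 (g : R8 → Matrix (Fin 8) (Fin 8) ℝ) (S : R8 → Tensor3) (y : R8) :
    Tensor4 := fun a i j k =>
  pderiv a (fun z => S z i j k) y
    - ∑ p, (christoffel g p a i y * S y p j k + christoffel g p a j y * S y i p k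
        + christoffel g p a k y * S y i j p)

/-- `∇_a S_{ijkl}` -/
noncomputable def nabla4 (g : R8 → Matrix (Fin 8) (Fin 8) ℝ) (S : R8 → Tensor4) (y : R8)
    (a i j k l : Fin 8) : ℝ :=
  pderiv a (fun z => S z i j k l) y
    - ∑ p, (christoffel g p a i y * S y p j k l + christoffel g p a j y * S y i p k l
        + christoffel g p a k y * S y i j p l + christoffel g p a l y * S y i j k p)

/-- The Riemann tensor `R_{abij}`, with the sign conventions
`(∇_a ∇_b - ∇_b ∇_a) X_i = R_{abi}^p X_p` (so `R_{abij} = g_{ai} g_{bj} - g_{aj} g_{bi}` on the unit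
sphere). -/
noncomputable def riemann (g : R8 → Matrix (Fin 8) (Fin 8) ℝ) (y : R8) : Tensor4 := fun a b i j =>
  ∑ p, (pderiv b (christoffel g p a i) y - pderiv a (christoffel g p b i) y
    + ∑ q, (christoffel g p b q y * christoffel g q a i y
        - christoffel g p a q y * christoffel g q b i y)) * g y p j

/-- The contraction `h^{cd} S_{acbd}`. -/
def ricciContraction (h : Matrix (Fin 8) (Fin 8) ℝ) (S : Tensor4) : Tensor2 := fun a b =>
  ∑ c, ∑ d, h c d * S a c b d

/-- The Ricci tensor `R_{ab} = g^{cd} R_{acbd}`. -/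
noncomputable def ricci (g : R8 → Matrix (Fin 8) (Fin 8) ℝ) (y : R8) : Tensor2 :=
  ricciContraction (g y)⁻¹ (riemann g y)

/-- The scalar curvature `R = g^{ab} R_{ab}`. -/
noncomputable def scalarCurvature (g : R8 → Matrix (Fin 8) (Fin 8) ℝ) (y : R8) : ℝ :=
  ∑ a, ∑ b, (g y)⁻¹ a b * ricci g y a b

/-! ## Contractions with an inverse metric `h^{ij}` -/

/-- `T_{ab}^c` -/
def raise1 (h : Matrix (Fin 8) (Fin 8) ℝ) (T : Tensor3) : Tensor3 := fun a b c =>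
  ∑ r, T a b r * h r c

/-- `T_a^{bc}` -/
def raise2 (h : Matrix (Fin 8) (Fin 8) ℝ) (T : Tensor3) : Tensor3 := fun a b c =>
  ∑ q, ∑ r, T a q r * h q b * h r c

/-- `T^{abc}` -/
def raise3 (h : Matrix (Fin 8) (Fin 8) ℝ) (T : Tensor3) : Tensor3 := fun a b c =>
  ∑ p, ∑ q, ∑ r, T p q r * h p a * h q b * h r c

/-- `S_{ij}^{pq}` -/
def raiseLast2 (h : Matrix (Fin 8) (Fin 8) ℝ) (S : Tensor4) : Tensor4 := fun i j p q =>
  ∑ r, ∑ s, S i j r s * h r p * h s q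

/-- `S_b^{ijk}` -/
def raiseLast3 (h : Matrix (Fin 8) (Fin 8) ℝ) (S : Tensor4) : Tensor4 := fun b i j k =>
  ∑ p, ∑ q, ∑ r, S b p q r * h p i * h q j * h r k

/-- `S^{abcd}` -/
def raise4 (h : Matrix (Fin 8) (Fin 8) ℝ) (S : Tensor4) : Tensor4 := fun a b c d =>
  ∑ p, ∑ q, ∑ r, ∑ s, S p q r s * h p a * h q b * h r c * h s d

/-- `X_{(ab)} = (X_{ab} + X_{ba}) / 2` -/
noncomputable def symPart (X : Tensor2) : Tensor2 := fun a b => (1 / 2) * (X a b + X b a)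

/-- `X_{[ab]} = (X_{ab} - X_{ba}) / 2` -/
noncomputable def skewPart (X : Tensor2) : Tensor2 := fun a b => (1 / 2) * (X a b - X b a)

/-! ## Algebraic expressions in `Φ`, `T` and `N = ∇T` -/

/-- `T_{aip} Φ_{pjkl} - T_{ajp} Φ_{pkli} + T_{akp} Φ_{plij} - T_{alp} Φ_{pijk}`, that is
`4 T_{a[i}^p Φ_{|p|jkl]}`. -/
def torsionAction (h : Matrix (Fin 8) (Fin 8) ℝ) (T : Tensor3) (Φ : Tensor4)
    (a i j k l : Fin 8) : ℝ :=
  ∑ p, (raise1 h T a i p * Φ p j k l - raise1 h T a j p * Φ p k l i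
    + raise1 h T a k p * Φ p l i j - raise1 h T a l p * Φ p i j k)

/-- `Φ_a^{ijk} ∇_b T_{ijk}` -/
def phiGradT (h : Matrix (Fin 8) (Fin 8) ℝ) (Φ N : Tensor4) : Tensor2 := fun a b =>
  ∑ i, ∑ j, ∑ k, raiseLast3 h Φ a i j k * N b i j k

/-- `Φ_a^{ijk} ∇_i T_{bjk}` -/
def phiCurlT (h : Matrix (Fin 8) (Fin 8) ℝ) (Φ N : Tensor4) : Tensor2 := fun a b =>
  ∑ i, ∑ j, ∑ k, raiseLast3 h Φ a i j k * N i b j k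

/-- `Φ_a^{ijk} T_{bi}^p T_{jkp}` -/
def phiTT (h : Matrix (Fin 8) (Fin 8) ℝ) (Φ : Tensor4) (T : Tensor3) : Tensor2 := fun a b =>
  ∑ i, ∑ j, ∑ k, ∑ p, raiseLast3 h Φ a i j k * raise1 h T b i p * T j k p

/-- `T_a^{pq} T_{bpq}` -/
def contractTT (h : Matrix (Fin 8) (Fin 8) ℝ) (T : Tensor3) : Tensor2 := fun a b =>
  ∑ p, ∑ q, raise2 h T a p q * T b p q

/-- The intrinsic torsion `T_{a;ij} = T_{aij} / 4 - Φ_{ij}^{kl} T_{akl} / 8`, the component of `T` in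
`Λ¹ ⊗ Λ²₇`. -/
noncomputable def intrinsicTorsion (h : Matrix (Fin 8) (Fin 8) ℝ) (Φ : Tensor4) (T : Tensor3) :
    Tensor3 := fun a i j =>
  (1 / 4) * T a i j - (1 / 8) * ∑ k, ∑ l, raiseLast2 h Φ i j k l * T a k l

/-- `S_{abij} - Φ_{ij}^{pq} S_{abpq} / 2`, four times the projection of `S` to `Λ²₇` in the second
pair of indices. -/
noncomputable def fourPi7 (h : Matrix (Fin 8) (Fin 8) ℝ) (Φ S : Tensor4) : Tensor4 := fun a b i j =>
  S a b i j - (1 / 2) * ∑ p, ∑ q, raiseLast2 h Φ i j p q * S a b p q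

/-- The expression in `T` and `∇T` to which the torsion equates `R_{abij} - Φ_{ij}^{pq} R_{abpq} / 2`. -/
noncomputable def torsionCurvature (h : Matrix (Fin 8) (Fin 8) ℝ) (Φ : Tensor4) (T : Tensor3)
    (N : Tensor4) : Tensor4 := fun a b i j =>
  N a b i j - N b a i j
    - (1 / 2) * ∑ c, ∑ d, raiseLast2 h Φ i j c d * N a b c d
    + (1 / 2) * ∑ c, ∑ d, raiseLast2 h Φ i j c d * N b a c d
    + ∑ p, raise1 h T a i p * T b j p - ∑ p, raise1 h T b i p * T a j p
    - ∑ p, ∑ q, ∑ k, raiseLast2 h Φ i j p q * raise1 h T a p k * T b q k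

/-! ## Algebraic curvature tensors -/

/-- The tensors with the algebraic symmetries of the Riemann tensor. -/
def curvatureTensors : Submodule ℝ Tensor4 where
  carrier := {S | (∀ a b c d, S a b c d = -S b a c d) ∧ (∀ a b c d, S a b c d = -S a b d c) ∧
    (∀ a b c d, S a b c d = S c d a b) ∧ (∀ a b c d, S a b c d + S a c d b + S a d b c = 0)}
  zero_mem' := by simp
  add_mem' := by
    rintro S S' ⟨h1, h2, h3, h4⟩ ⟨k1, k2, k3, k4⟩
    refine ⟨fun a b c d => ?_, fun a b c d => ?_, fun a b c d => ?_, fun a b c d => ?_⟩ <;>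
      simp only [Pi.add_apply]
    · linarith [h1 a b c d, k1 a b c d]
    · linarith [h2 a b c d, k2 a b c d]
    · linarith [h3 a b c d, k3 a b c d]
    · linarith [h4 a b c d, k4 a b c d]
  smul_mem' := by
    rintro r S ⟨h1, h2, h3, h4⟩
    refine ⟨fun a b c d => ?_, fun a b c d => ?_, fun a b c d => ?_, fun a b c d => ?_⟩ <;>
      simp only [Pi.smul_apply, smul_eq_mul]
    · linear_combination r * h1 a b c d
    · linear_combination r * h2 a b c d
    · linear_combination r * h3 a b c d
    · linear_combination r * h4 a b c d

/-- The Weyl tensors: algebraic curvature tensors without Ricci contraction. -/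
def weylTensors (h : Matrix (Fin 8) (Fin 8) ℝ) : Submodule ℝ Tensor4 where
  carrier := {S | S ∈ curvatureTensors ∧ ∀ a b, ricciContraction h S a b = 0}
  zero_mem' := ⟨zero_mem _, by simp [ricciContraction]⟩
  add_mem' := by
    rintro S S' ⟨h1, h2⟩ ⟨k1, k2⟩
    refine ⟨add_mem h1 k1, fun a b => ?_⟩
    have := congrArg₂ (· + ·) (h2 a b) (k2 a b)
    simpa [ricciContraction, mul_add, Finset.sum_add_distrib] using this
  smul_mem' := by
    rintro r S ⟨h1, h2⟩
    refine ⟨Submodule.smul_mem _ r h1, fun a b => ?_⟩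
    have := congrArg (r * ·) (h2 a b)
    simpa [ricciContraction, Finset.mul_sum, mul_left_comm] using this

/-- The `168` part of the space of curvature tensors: the algebraic curvature tensors with both pairs
of indices in `Λ²₂₁ = {β | Φ_{ij}^{pq} β_{pq} / 2 = β_{ij}}`.  It is the part of
`Λ²₂₁ ⊗_S Λ²₂₁ = 1 ⊕ 27 ⊕ 35 ⊕ 168` on which the projection to `Λ⁴` vanishes. -/
def part168 (h : Matrix (Fin 8) (Fin 8) ℝ) (Φ : Tensor4) : Submodule ℝ Tensor4 where
  carrier := {S | S ∈ curvatureTensors ∧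
    (∀ a b i j, (1 / 2) * ∑ p, ∑ q, raiseLast2 h Φ i j p q * S p q a b = S i j a b) ∧
    ∀ a b i j, (1 / 2) * ∑ p, ∑ q, raiseLast2 h Φ i j p q * S a b p q = S a b i j}
  zero_mem' := ⟨zero_mem _, by simp, by simp⟩
  add_mem' := by
    rintro S S' ⟨h1, h2, h3⟩ ⟨k1, k2, k3⟩
    refine ⟨add_mem h1 k1, fun a b i j => ?_, fun a b i j => ?_⟩
    · have := congrArg₂ (· + ·) (h2 a b i j) (k2 a b i j)
      simpa [mul_add, Finset.sum_add_distrib] using this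
    · have := congrArg₂ (· + ·) (h3 a b i j) (k3 a b i j)
      simpa [mul_add, Finset.sum_add_distrib] using this
  smul_mem' := by
    rintro r S ⟨h1, h2, h3⟩
    refine ⟨Submodule.smul_mem _ r h1, fun a b i j => ?_, fun a b i j => ?_⟩
    · have := congrArg (r * ·) (h2 a b i j)
      simpa [Finset.mul_sum, mul_left_comm] using this
    · have := congrArg (r * ·) (h3 a b i j)
      simpa [Finset.mul_sum, mul_left_comm] using this

/-- The inner product `S^{abcd} S'_{abcd}` of tensors of rank four. -/
def tensorInner (h : Matrix (Fin 8) (Fin 8) ℝ) (S S' : Tensor4) : ℝ :=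
  ∑ a, ∑ b, ∑ c, ∑ d, raise4 h S a b c d * S' a b c d

/-! ## Forms on an 8-manifold -/

section Manifold

variable {M : Type*} [TopologicalSpace M] [ChartedSpace R8 M]

/-- The differential forms of degree `k` on `M`, without a condition on smoothness. -/
abbrev FormField (M : Type*) [TopologicalSpace M] [ChartedSpace R8 M] (k : ℕ) : Type _ :=
  (x : M) → TangentSpace (𝓡 8) x [⋀^Fin k]→L[ℝ] ℝ

/-- A form in the chart `e`: its pull-back under `e⁻¹`, a form on `e.target ⊆ ℝ⁸`. -/
noncomputable def inChart {k : ℕ} (e : OpenPartialHomeomorph M R8) (α : FormField M k) (y : R8) :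
    R8 [⋀^Fin k]→L[ℝ] ℝ :=
  (α (e.symm y)).compContinuousLinearMap (mfderiv (𝓡 8) (𝓡 8) e.symm y)

/-- A form is smooth if it is smooth in all charts. -/
def IsSmoothForm {k : ℕ} (α : FormField M k) : Prop :=
  ∀ e ∈ IsManifold.maximalAtlas (𝓡 8) ∞ M, ContDiffOn ℝ ∞ (inChart e α) e.target

/-- `dα = 0` -/
def IsClosedForm {k : ℕ} (α : FormField M k) : Prop :=
  ∀ e ∈ IsManifold.maximalAtlas (𝓡 8) ∞ M, ∀ y ∈ e.target, extDeriv (inChart e α) y = 0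

/-- A `Spin(7)` structure on `M`: a smooth 4-form that is a Cayley form at every point. -/
def IsCayleyField (Φ : FormField M 4) : Prop :=
  IsSmoothForm Φ ∧ ∀ x : M, IsCayleyForm (Φ x)

/-- The metric of `Φ` in the chart `e`. -/
noncomputable def chartMetric (e : OpenPartialHomeomorph M R8) (Φ : FormField M 4) (y : R8) :
    Matrix (Fin 8) (Fin 8) ℝ := metricMatrix (inChart e Φ y)

/-- The components of `Φ`, of `T`, of `∇T` and of the divergence `∇^a T_{a;mn}` of the intrinsic
torsion in the chart `e`. -/
noncomputable def chartPhi (e : OpenPartialHomeomorph M R8) (Φ : FormField M 4) (y : R8) : Tensor4 :=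
  comp4 (inChart e Φ y)

noncomputable def chartT (e : OpenPartialHomeomorph M R8) (T : FormField M 3) (y : R8) : Tensor3 :=
  comp3 (inChart e T y)

noncomputable def chartNablaT (e : OpenPartialHomeomorph M R8) (Φ : FormField M 4)
    (T : FormField M 3) (y : R8) : Tensor4 :=
  nabla3 (chartMetric e Φ) (chartT e T) y

noncomputable def chartDivTorsion (e : OpenPartialHomeomorph M R8) (Φ : FormField M 4)
    (T : FormField M 3) (y : R8) : Tensor2 := fun m n =>
  ∑ a, ∑ c, (chartMetric e Φ y)⁻¹ a c *
    nabla3 (chartMetric e Φ)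
      (fun z => intrinsicTorsion (chartMetric e Φ z)⁻¹ (chartPhi e Φ z) (chartT e T z)) y c a m n

/-- `T` is the torsion 3-form of `Φ`: `∇_a Φ_{ijkl} = 4 T_{a[i}^p Φ_{|p|jkl]}` for the Levi-Civita
connection `∇` of the metric of `Φ`. -/
def IsTorsionForm (Φ : FormField M 4) (T : FormField M 3) : Prop :=
  ∀ e ∈ IsManifold.maximalAtlas (𝓡 8) ∞ M, ∀ y ∈ e.target, ∀ a i j k l : Fin 8,
    nabla4 (chartMetric e Φ) (chartPhi e Φ) y a i j k l =
      torsionAction (chartMetric e Φ y)⁻¹ (chartT e T y) (chartPhi e Φ y) a i j k l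

end Manifold

/-! Everything rests on one pointwise identity: the contraction of two copies of the Cayley form `φ`
over a single index (`IsSpinTensor.contract`). It is checked by evaluation for the standard form,
and the later tensor algebra uses only this identity and the alternation of `φ`. It implies that the
operator `β ↦ φ_{ij}^{pq} β_{pq}` on 2-forms satisfies `λ² + 4λ - 12 = 0`; the eigenvalues 2 and -6
define `Λ²₂₁` and `Λ²₇`. A 2-form acts on `φ` as a derivation, and contracting the result with `φ`
gives back 96 times its `Λ²₇` part (`tripleContraction_derivation4`). So `Λ²₂₁` is exactly the space
of 2-forms that annihilate `φ`.

Torsion. Differentiating the identity for `φ_{ijpq} φ_{abpq}` with `∇g = 0` shows that every `∇_a Φ`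
satisfies the linearised identity, and 4-forms with this property are of the form `β · φ` with `β`
in `Λ²₇` (`derivation4_tripleContraction`). Hence `∇Φ` is a section of `Λ¹ ⊗ Λ²₇`. That space has
dimension 56, like `Λ³`, and `threeFormOf` lifts it to 3-forms (`fourProj7_threeFormOf`); this gives
`T`. Uniqueness is read off from `dΦ`: alternating the torsion equation removes the Christoffel
symbols, and the result still determines `T` (`eq_zero_of_alternate5`). Exterior derivatives and
adapted bases are natural under changes of coordinates, so this description of `T`
(`IsExteriorTorsion`) also shows that `T` does not depend on the chart, and that `dΦ = 0` forces `T
= 0`. Smoothness of `T` follows by solving an injective linear system with smooth coefficients. It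
needs a smooth metric: `exists_inverseMetric` recovers `g⁻¹` from the components of `Φ` by an
explicit formula, which at the same time shows that all adapted bases define the same metric.

Curvature. The torsion equation reads `∂_a Φ = η_a · Φ` with `η_a = Γ_a + T_a`. Second partial
derivatives commute, so the curvature of `η` annihilates `Φ` and lies in `Λ²₂₁`; applying the
projection to `Λ²₇` gives the formula for `S` (`fourPi7_riemann`). In its trace over one index of
each pair the term with `Φ` on the left vanishes by the Bianchi identity and the Ricci tensor
remains. The symmetric part is the Ricci formula and its trace the scalar curvature. The skew part
must vanish, which computes `∇^a T_{amn}` (`divergence_eq`); one more contraction with `Φ` yields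
the divergence of the intrinsic torsion.

The `168` part. On curvature tensors the projection to `Λ² ⊗ Λ²₇` has kernel `W₁₆₈`, so it is
injective on the orthogonal complement, and a left inverse there is `F` (`exists_orthogonalPart`).
For the dimension, the cyclic sum maps `Λ²₂₁ ⊗_S Λ²₂₁`, of dimension 231, onto the 4-forms with
symmetric contraction with `φ`, of dimension 70 - 7 = 63, and its kernel is `W₁₆₈`. It is onto
because projecting such a 4-form to `Λ²₂₁ ⊗ Λ²₂₁` and then taking the cyclic sum is injective. The
contraction of a cyclic sum with `φ` is six times the Ricci contraction, so the kernel consists of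
Weyl tensors.

The tensor identities are proved in an adapted frame, where the metric is the Kronecker symbol, and
carried to coordinates by the naturality of contractions under `pull`. -/

/-! ## The standard Cayley form -/

/-- A closed formula for the components of the standard Cayley form, which vanish unless the indices
are distinct and sum to zero in `𝔽₂³`. -/
def octCayley (i j k l : Fin 8) : ℤ :=
  if l.val = (i.val ^^^ j.val) ^^^ k.val then
    if i = j then 0 else if j = k then 0 else if i = k then 0 else
      -- Bit `8 i + j` of the constant records the sign `ε_{ij}` in `ē_i e_j = ε_{ij} e_{i xor j}`
      -- for octonion units numbered by `𝔽₂³`. The nonzero components of the form are `-ε_{ij}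
      -- ε_{kl}`.
      if Nat.testBit 0x4d1bd1873563a900 (8 * i.val + j.val) =
        Nat.testBit 0x4d1bd1873563a900 (8 * k.val + l.val) then -1 else 1
  else 0

/-- Determinants of matrices of Kronecker symbols, expanded along the first row. -/
def kronDet2 (r s k l : Fin 8) : ℤ :=
  (if r = k then if s = l then 1 else 0 else 0) - if r = l then if s = k then 1 else 0 else 0

def kronDet3 (q r s j k l : Fin 8) : ℤ :=
  (if q = j then kronDet2 r s k l else 0) - (if q = k then kronDet2 r s j l else 0)
    + if q = l then kronDet2 r s j k else 0

def kronDet4 (p q r s i j k l : Fin 8) : ℤ :=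
  (if p = i then kronDet3 q r s j k l else 0) - (if p = j then kronDet3 q r s i k l else 0)
    + (if p = k then kronDet3 q r s i j l else 0) - if p = l then kronDet3 q r s i j k else 0

theorem det_fin_four' {R : Type*} [CommRing R] (A : Matrix (Fin 4) (Fin 4) R) :
    A.det =
      A 0 0 * (A 1 1 * (A 2 2 * A 3 3 - A 2 3 * A 3 2) - A 1 2 * (A 2 1 * A 3 3 - A 2 3 * A 3 1)
        + A 1 3 * (A 2 1 * A 3 2 - A 2 2 * A 3 1))
      - A 0 1 * (A 1 0 * (A 2 2 * A 3 3 - A 2 3 * A 3 2) - A 1 2 * (A 2 0 * A 3 3 - A 2 3 * A 3 0)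
        + A 1 3 * (A 2 0 * A 3 2 - A 2 2 * A 3 0))
      + A 0 2 * (A 1 0 * (A 2 1 * A 3 3 - A 2 3 * A 3 1) - A 1 1 * (A 2 0 * A 3 3 - A 2 3 * A 3 0)
        + A 1 3 * (A 2 0 * A 3 1 - A 2 1 * A 3 0))
      - A 0 3 * (A 1 0 * (A 2 1 * A 3 2 - A 2 2 * A 3 1) - A 1 1 * (A 2 0 * A 3 2 - A 2 2 * A 3 0)
        + A 1 2 * (A 2 0 * A 3 1 - A 2 1 * A 3 0)) := by
  rw [Matrix.det_succ_row_zero]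
  simp only [Fin.sum_univ_four, Matrix.det_fin_three, Matrix.submatrix_apply]
  have s0 : (0 : Fin 3).succ = (1 : Fin 4) := rfl
  have s1 : (1 : Fin 3).succ = (2 : Fin 4) := rfl
  have s2 : (2 : Fin 3).succ = (3 : Fin 4) := rfl
  have h00 : (0 : Fin 4).succAbove (0 : Fin 3) = 1 := rfl
  have h01 : (0 : Fin 4).succAbove (1 : Fin 3) = 2 := rfl
  have h02 : (0 : Fin 4).succAbove (2 : Fin 3) = 3 := rfl
  have h10 : (1 : Fin 4).succAbove (0 : Fin 3) = 0 := rfl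
  have h11 : (1 : Fin 4).succAbove (1 : Fin 3) = 2 := rfl
  have h12 : (1 : Fin 4).succAbove (2 : Fin 3) = 3 := rfl
  have h20 : (2 : Fin 4).succAbove (0 : Fin 3) = 0 := rfl
  have h21 : (2 : Fin 4).succAbove (1 : Fin 3) = 1 := rfl
  have h22 : (2 : Fin 4).succAbove (2 : Fin 3) = 3 := rfl
  have h30 : (3 : Fin 4).succAbove (0 : Fin 3) = 0 := rfl
  have h31 : (3 : Fin 4).succAbove (1 : Fin 3) = 1 := rfl
  have h32 : (3 : Fin 4).succAbove (2 : Fin 3) = 2 := rfl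
  have v0 : ((0 : Fin 4) : ℕ) = 0 := rfl
  have v1 : ((1 : Fin 4) : ℕ) = 1 := rfl
  have v2 : ((2 : Fin 4) : ℕ) = 2 := rfl
  have v3 : ((3 : Fin 4) : ℕ) = 3 := rfl
  rw [s0, s1, s2, h00, h01, h02, h10, h11, h12, h20, h21, h22, h30, h31, h32, v0, v1, v2, v3]
  ring

theorem det_kron_four (u v : Fin 4 → Fin 8) :
    (Matrix.of fun a b : Fin 4 => if u a = v b then (1 : ℤ) else 0).det =
      kronDet4 (u 0) (u 1) (u 2) (u 3) (v 0) (v 1) (v 2) (v 3) := by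
  -- With an opaque factor `δ` in place of each case distinction both sides are polynomials in the
  -- `δ`, so that `ring` decides the identity.
  obtain ⟨δ, hδ⟩ : ∃ δ : Fin 8 → Fin 8 → ℤ, ∀ p q x, (if p = q then x else 0) = δ p q * x :=
    ⟨fun p q => if p = q then 1 else 0, fun p q x => by by_cases h : p = q <;> simp [h]⟩
  rw [det_fin_four']
  simp only [Matrix.of_apply, kronDet4, kronDet3, kronDet2]
  generalize u 0 = p, u 1 = q, u 2 = r, u 3 = s, v 0 = i, v 1 = j, v 2 = k, v 3 = l
  simp only [hδ]
  ring

theorem stdCayley_eq_octCayley (i j k l : Fin 8) : stdCayley i j k l = octCayley i j k l := by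
  have key : ∀ i j k l : Fin 8, (∑ t : Fin 14, cayleySign t * kronDet4 (cayleyIndex t 0)
      (cayleyIndex t 1) (cayleyIndex t 2) (cayleyIndex t 3) i j k l) = octCayley i j k l := by
    simp only [Fin.sum_univ_succ, Fin.sum_univ_zero]
    decide +kernel
  rw [← key, stdCayley]
  exact Finset.sum_congr rfl fun t _ => congrArg _ (det_kron_four _ _)

theorem octCayley_swap : ∀ i j k l : Fin 8, octCayley j i k l = -octCayley i j k l ∧
    octCayley i k j l = -octCayley i j k l ∧ octCayley i j l k = -octCayley i j k l := by
  decide +kernel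

/-- The Kronecker symbol. -/
def kron {R : Type*} [Zero R] [One R] (i j : Fin 8) : R := if i = j then 1 else 0

/-- The contraction of two Cayley forms in one index, as an expression in the Kronecker symbol and
the form. -/
def cayleyContraction {R : Type*} [Ring R] (φ : Fin 8 → Fin 8 → Fin 8 → Fin 8 → R)
    (i j k a b c : Fin 8) : R :=
  kron i a * (kron j b * kron k c - kron j c * kron k b - φ j k b c)
    + kron i b * (kron j c * kron k a - kron j a * kron k c - φ j k c a)
    + kron i c * (kron j a * kron k b - kron j b * kron k a - φ j k a b)
    - kron j a * φ k i b c - kron j b * φ k i c a - kron j c * φ k i a b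
    - kron k a * φ i j b c - kron k b * φ i j c a - kron k c * φ i j a b

/-- Cuts a check over all `8³` triples of indices down to the 56 increasing ones. -/
theorem eq_zero_of_skew_of_sorted {f : Fin 8 → Fin 8 → Fin 8 → ℤ}
    (h1 : ∀ i j k, f j i k = -f i j k) (h2 : ∀ i j k, f i k j = -f i j k)
    (h : ∀ i j, i < j → ∀ k, j < k → f i j k = 0) (i j k : Fin 8) : f i j k = 0 := by
  have e1 : ∀ i k, f i i k = 0 := fun i k => by have := h1 i i k; omega
  have e2 : ∀ i k, f k i i = 0 := fun i k => by have := h2 k i i; omega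
  have e3 : ∀ i k, f i k i = 0 := fun i k => by have := h1 k i i; have := e2 i k; omega
  have := h1 i j k; have := h1 i k j; have := h1 j k i
  have := h2 i j k; have := h2 j i k; have := h2 k i j
  rcases lt_trichotomy i j with a | rfl | a
  · rcases lt_trichotomy j k with b | rfl | b
    · exact h i j a k b
    · exact e2 _ _
    · rcases lt_trichotomy i k with c | rfl | c
      · have := h i k c j b; omega
      · exact e3 _ _
      · have := h k i c j a; omega
  · exact e1 _ _
  · rcases lt_trichotomy i k with b | rfl | b
    · have := h j i a k b; omega
    · exact e3 _ _
    · rcases lt_trichotomy j k with c | rfl | c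
      · have := h j k c i b; omega
      · exact e2 _ _
      · have := h k j c i a; omega

/-- Both sides alternate in `i, j, k` and in `a, b, c`, so `56²` evaluations suffice. -/
theorem octCayley_contract (i j k a b c : Fin 8) :
    ∑ p, octCayley i j k p * octCayley a b c p = cayleyContraction octCayley i j k a b c := by
  have key : ∀ i j, i < j → ∀ k, j < k → ∀ a b, a < b → ∀ c, b < c →
      ∑ p, octCayley i j k p * octCayley a b c p - cayleyContraction octCayley i j k a b c = 0 := by
    simp only [Fin.sum_univ_succ, Fin.sum_univ_zero]
    decide +kernel
  have s1 := fun i j k l => (octCayley_swap i j k l).1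
  have s2 := fun i j k l => (octCayley_swap i j k l).2.1
  have s3 := fun i j k l => (octCayley_swap i j k l).2.2
  refine sub_eq_zero.1 (eq_zero_of_skew_of_sorted
    (f := fun i j k => ∑ p, octCayley i j k p * octCayley a b c p
      - cayleyContraction octCayley i j k a b c) ?_ ?_ (fun i j hij k hjk =>
      eq_zero_of_skew_of_sorted (f := fun a b c => ∑ p, octCayley i j k p * octCayley a b c p
      - cayleyContraction octCayley i j k a b c) ?_ ?_
      (fun a b hab c hbc => key i j hij k hjk a b hab c hbc) a b c) i j k)
  · intro i j k
    simp only [s1 i j, neg_mul, Finset.sum_neg_distrib, cayleyContraction]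
    rw [s1 i k b c, s1 i k c a, s1 i k a b, s1 k j b c, s1 k j c a, s1 k j a b]
    ring
  · intro i j k
    simp only [s2 i j k, neg_mul, Finset.sum_neg_distrib, cayleyContraction]
    rw [s1 j k b c, s1 j k c a, s1 j k a b, s1 i j b c, s1 i j c a, s1 i j a b,
      s1 k i b c, s1 k i c a, s1 k i a b]
    ring
  · intro a b c
    simp only [s1 a b, mul_neg, Finset.sum_neg_distrib, cayleyContraction]
    rw [s3 j k a c, s3 j k c b, s3 j k b a, s3 k i a c, s3 k i c b, s3 k i b a,
      s3 i j a c, s3 i j c b, s3 i j b a]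
    ring
  · intro a b c
    simp only [s2 a b c, mul_neg, Finset.sum_neg_distrib, cayleyContraction]
    rw [s3 j k b c, s3 j k a b, s3 j k c a, s3 k i b c, s3 k i a b, s3 k i c a,
      s3 i j b c, s3 i j a b, s3 i j c a]
    ring

/-- The components of a Cayley form in an adapted basis, through the identities they satisfy. -/
structure IsSpinTensor (φ : Tensor4) : Prop where
  swap12 : ∀ i j k l, φ j i k l = -φ i j k l
  swap23 : ∀ i j k l, φ i k j l = -φ i j k l
  swap34 : ∀ i j k l, φ i j l k = -φ i j k l
  contract : ∀ i j k a b c, ∑ p, φ i j k p * φ a b c p = cayleyContraction φ i j k a b c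

/-- The components of the standard Cayley form. -/
def stdPhi : Tensor4 := fun i j k l => (stdCayley i j k l : ℝ)

theorem isSpinTensor_stdPhi : IsSpinTensor stdPhi := by
  have e : stdPhi = fun i j k l => (octCayley i j k l : ℝ) := by
    funext i j k l
    rw [stdPhi, stdCayley_eq_octCayley]
  rw [e]
  refine ⟨fun i j k l => ?_, fun i j k l => ?_, fun i j k l => ?_, fun i j k a b c => ?_⟩
  · exact_mod_cast (octCayley_swap i j k l).1
  · exact_mod_cast (octCayley_swap i j k l).2.1
  · exact_mod_cast (octCayley_swap i j k l).2.2
  · have := congrArg (Int.cast : ℤ → ℝ) (octCayley_contract i j k a b c)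
    have k1 : ∀ i j : Fin 8, ((kron i j : ℤ) : ℝ) = kron i j := fun i j => by
      unfold kron; split_ifs <;> simp
    simp only [cayleyContraction] at this ⊢
    push_cast [k1] at this
    exact this

/-! ## Algebra of tensors satisfying the Cayley identities -/

section SumLemmas

variable {ι M : Type*} [Fintype ι] [AddCommMonoid M]

theorem sum_rot3 (f : ι → ι → ι → M) :
    ∑ a, ∑ b, ∑ c, f a b c = ∑ b, ∑ c, ∑ a, f a b c := by
  rw [Finset.sum_comm]
  exact Finset.sum_congr rfl fun _ _ => Finset.sum_comm

theorem sum_rot4 (f : ι → ι → ι → ι → M) :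
    ∑ a, ∑ b, ∑ c, ∑ d, f a b c d = ∑ b, ∑ c, ∑ d, ∑ a, f a b c d := by
  rw [Finset.sum_comm]
  exact Finset.sum_congr rfl fun _ _ => sum_rot3 _

theorem sum_swap23 (f : ι → ι → ι → M) :
    ∑ a, ∑ b, ∑ c, f a b c = ∑ a, ∑ c, ∑ b, f a b c :=
  Finset.sum_congr rfl fun _ _ => Finset.sum_comm

end SumLemmas

theorem sum_kron_mul (i : Fin 8) (f : Fin 8 → ℝ) : ∑ p, kron i p * f p = f i := by
  simp [kron]

theorem sum_kron_mul' (i : Fin 8) (f : Fin 8 → ℝ) : ∑ p, kron p i * f p = f i := by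
  simp [kron]

theorem kron_comm (i j : Fin 8) : (kron i j : ℝ) = kron j i := by
  simp [kron, eq_comm]

theorem kron_self (i : Fin 8) : (kron i i : ℝ) = 1 := by simp [kron]

/-- The action of a matrix on a tensor of rank four as a derivation, one index at a time. -/
def derivation4 (β : Tensor2) (S : Tensor4) : Tensor4 := fun i j k l =>
  ∑ p, (β i p * S p j k l + β j p * S i p k l + β k p * S i j p l + β l p * S i j k p)

namespace IsSpinTensor

variable {φ : Tensor4} (h : IsSpinTensor φ)
include h

theorem zero12 (i k l) : φ i i k l = 0 := by linarith [h.swap12 i i k l]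
theorem zero23 (i k l) : φ k i i l = 0 := by linarith [h.swap23 k i i l]
theorem zero34 (i k l) : φ k l i i = 0 := by linarith [h.swap34 k l i i]
theorem zero13 (i k l) : φ i k i l = 0 := by linarith [h.swap23 i i k l, h.zero12 i k l]
theorem zero24 (i k l) : φ k i l i = 0 := by linarith [h.swap23 k l i i, h.zero34 i k l]
theorem zero14 (i k l) : φ i k l i = 0 := by linarith [h.swap12 k i l i, h.zero24 i k l]

theorem pair_swap (i j k l) : φ k l i j = φ i j k l := by
  linarith [h.swap23 k i l j, h.swap12 i k l j, h.swap34 i k j l, h.swap23 i j k l]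

theorem cyc234 (i j k l) : φ i k l j = φ i j k l := by
  linarith [h.swap34 i k j l, h.swap23 i j k l]

theorem cyc123 (i j k l) : φ j k i l = φ i j k l := by
  linarith [h.swap23 j i k l, h.swap12 i j k l]

theorem rot (i j k l) : φ j k l i = -φ i j k l := by
  linarith [h.cyc123 i j k l, h.swap34 j k i l]

/-- The trace of `contract` over `k = c`, with `δ_kk = 8`. As a statement on 2-forms it is the
quadratic equation of `φ_{ij}^{pq}`, whose roots are 2 on `Λ²₂₁` and -6 on `Λ²₇`. -/
theorem contract_two (i j a b) : ∑ k, ∑ p, φ i j k p * φ a b k p =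
    6 * (kron i a * kron j b) - 6 * (kron i b * kron j a) - 4 * φ i j a b := by
  have k8 : ∑ k : Fin 8, (kron k k : ℝ) = 8 := by simp [kron]
  have k2 : ∀ k, cayleyContraction φ i j k a b k =
     kron i a * (kron j b * kron k k) - kron i a * (kron j k * kron k b) - kron i a * φ j k b k
    + (kron i b * (kron j k * kron k a) - kron i b * (kron j a * kron k k) - kron i b * φ j k k a)
    + (kron i k * (kron j a * kron k b) - kron i k * (kron j b * kron k a) - kron i k * φ j k a b)
    - kron j a * φ k i b k - kron j b * φ k i k a - kron j k * φ k i a b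
    - kron k a * φ i j b k - kron k b * φ i j k a - kron k k * φ i j a b := fun k => by
      rw [cayleyContraction]; ring
  simp only [h.contract, k2, Finset.sum_add_distrib, Finset.sum_sub_distrib, h.zero24,
    h.zero23, h.zero13, h.zero14, ← Finset.mul_sum, k8, sum_kron_mul, sum_kron_mul',
    ← Finset.sum_mul]
  rw [h.swap12 i j a b, h.swap34 i j a b, Finset.sum_const_zero]
  ring

theorem contract_three (i a) : ∑ j, ∑ k, ∑ p, φ i j k p * φ a j k p = 42 * kron i a := by
  have k8 : ∑ k : Fin 8, (kron k k : ℝ) = 8 := by simp [kron]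
  simp only [h.contract_two, Finset.sum_sub_distrib, ← Finset.mul_sum, k8, h.zero24, sum_kron_mul]
  rw [Finset.sum_const_zero]
  ring

/-- The contraction of `Y` with two Cayley forms that share an index. -/
theorem contract_tensor (Y : Tensor3) (i j k) :
    ∑ a, ∑ b, ∑ c, Y a b c * ∑ p, φ i j k p * φ a b c p =
      Y i j k + Y j k i + Y k i j - Y i k j - Y j i k - Y k j i
        - ∑ b, ∑ c, ((Y i b c + Y c i b + Y b c i) * φ j k b c
          + (Y j b c + Y c j b + Y b c j) * φ k i b c
          + (Y k b c + Y c k b + Y b c k) * φ i j b c) := by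
  have e : ∀ a b c, Y a b c * cayleyContraction φ i j k a b c =
     kron i a * (kron j b * (kron k c * Y a b c)) - kron i a * (kron j c * (kron k b * Y a b c))
      + kron i b * (kron j c * (kron k a * Y a b c)) - kron i b * (kron j a * (kron k c * Y a b c))
      + kron i c * (kron j a * (kron k b * Y a b c)) - kron i c * (kron j b * (kron k a * Y a b c))
      - (kron i a * (Y a b c * φ j k b c) + kron i b * (Y a b c * φ j k c a)
      + kron i c * (Y a b c * φ j k a b)
      + kron j a * (Y a b c * φ k i b c) + kron j b * (Y a b c * φ k i c a)
      + kron j c * (Y a b c * φ k i a b)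
      + kron k a * (Y a b c * φ i j b c) + kron k b * (Y a b c * φ i j c a)
      + kron k c * (Y a b c * φ i j a b)) := fun a b c => by
    rw [cayleyContraction]; ring
  have s : ∀ x y z, ∑ b, ∑ a, Y a x b * φ y z b a = ∑ a, ∑ b, Y a x b * φ y z b a :=
    fun x y z => Finset.sum_comm
  simp only [h.contract, e, Finset.sum_add_distrib, Finset.sum_sub_distrib, ← Finset.mul_sum,
    sum_kron_mul, add_mul, s]
  ring

end IsSpinTensor

/-! ### The action of 2-forms on a Cayley form -/

/-- Four times the projection of a 2-form to `Λ²₇`. -/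
noncomputable def fourProj7 (φ : Tensor4) (β : Tensor2) : Tensor2 := fun i j =>
  β i j - (1 / 2) * ∑ p, ∑ q, φ i j p q * β p q

/-- The contraction `X_{iabc} φ_{mabc}`. -/
def tripleContraction (X φ : Tensor4) : Tensor2 := fun i m =>
  ∑ j, ∑ k, ∑ l, X i j k l * φ m j k l

/-- The contraction `X_{ijab} φ_{klab}`. -/
def pairContraction (X φ : Tensor4) : Tensor4 := fun i j k l =>
  ∑ a, ∑ b, X i j a b * φ k l a b

namespace IsSpinTensor

variable {φ : Tensor4} (h : IsSpinTensor φ)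
include h

/-- The derivation has four terms. The one that rotates the uncontracted index gives `42 β` by
`contract_three`; each of the other three gives `-6 β - 4 φβ` by `contract_two`. The total is `24 β
- 12 φβ`, a multiple of the `Λ²₇` part. In particular a 2-form that annihilates `φ` lies in `Λ²₂₁`.
-/
theorem tripleContraction_derivation4 {β : Tensor2} (hβ : ∀ i j, β j i = -β i j) :
    tripleContraction (derivation4 β φ) φ = (24 : ℝ) • fourProj7 φ β := by
  funext i m
  have t1 : ∑ j, ∑ k, ∑ l, ∑ p, β i p * φ p j k l * φ m j k l = 42 * β i m := by
    have : ∀ j k l p, β i p * φ p j k l * φ m j k l = β i p * (φ p j k l * φ m j k l) :=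
      fun _ _ _ _ => mul_assoc _ _ _
    simp only [this]
    rw [← sum_rot4]
    simp only [← Finset.mul_sum, h.contract_three]
    have : ∀ p, β i p * (42 * kron p m) = kron p m * (42 * β i p) := fun p => by ring
    simp only [this, sum_kron_mul']
  have t2 : ∑ j, ∑ k, ∑ l, ∑ p, β j p * φ i p k l * φ m j k l =
      -18 * β i m - 12 * ∑ p, ∑ q, φ i m p q * β p q + 12 * β i m
        + 8 * ∑ p, ∑ q, φ i m p q * β p q  := by
    have e1 : ∀ j, ∑ k, ∑ l, ∑ p, β j p * φ i p k l * φ m j k l =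
        ∑ p, (kron i m * (6 * (kron p j * β j p)) - kron p m * (6 * (kron i j * β j p))
          - 4 * (φ i m j p * β j p)) := fun j => by
      rw [← sum_rot3]
      refine Finset.sum_congr rfl fun p _ => ?_
      simp only [mul_assoc, ← Finset.mul_sum, h.contract_two]
      rw [← h.cyc234 i m j p, ← h.cyc234 i p m j, h.cyc234 i m j p]
      ring
    have e2 : ∀ j, β j j = 0 := fun j => by linarith [hβ j j]
    simp only [e1, Finset.sum_sub_distrib, ← Finset.mul_sum, sum_kron_mul, sum_kron_mul', e2]
    rw [Finset.sum_const_zero]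
    ring
  -- The three terms in which a contracted index is rotated agree after renaming the summation
  -- indices.
  have t3 : ∑ j, ∑ k, ∑ l, ∑ p, β k p * φ i j p l * φ m j k l =
      ∑ j, ∑ k, ∑ l, ∑ p, β j p * φ i p k l * φ m j k l := by
    refine Finset.sum_comm.trans ?_
    refine Finset.sum_congr rfl fun j _ => Finset.sum_congr rfl fun k _ =>
      Finset.sum_congr rfl fun l _ => Finset.sum_congr rfl fun p _ => ?_
    rw [h.swap23 i p k l, h.swap23 m j k l]
    ring
  have t4 : ∑ j, ∑ k, ∑ l, ∑ p, β l p * φ i j k p * φ m j k l =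
      ∑ j, ∑ k, ∑ l, ∑ p, β k p * φ i j p l * φ m j k l := by
    refine (sum_swap23 _).trans ?_
    refine Finset.sum_congr rfl fun j _ => Finset.sum_congr rfl fun k _ =>
      Finset.sum_congr rfl fun l _ => Finset.sum_congr rfl fun p _ => ?_
    rw [h.swap34 i j p l, h.swap34 m j k l]
    ring
  simp only [tripleContraction, derivation4, Finset.sum_mul, add_mul, Finset.sum_add_distrib,
    Pi.smul_apply, smul_eq_mul, fourProj7]
  rw [t4, t3, t1, t2]
  ring

/-- Converse of the above: `Λ²₂₁` annihilates `φ`. Replacing `β` by `½ φβ` in the first of the four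
terms produces two Cayley forms with a common index, and `contract_tensor` turns them into the
negative of the other three terms. Skewness of `β` is part of the hypothesis, since `½ φβ` is skew.
-/
theorem derivation4_eq_zero {β : Tensor2} (h0 : fourProj7 φ β = 0) : derivation4 β φ = 0 := by
  have hb : ∀ i j, β i j = (1 / 2) * ∑ p, ∑ q, φ i j p q * β p q := fun i j =>
    sub_eq_zero.1 (congrFun (congrFun h0 i) j)
  have hs : ∀ i j, β j i = -β i j := fun i j => by
    rw [hb j i, hb i j]
    simp only [h.swap12 i j, neg_mul, Finset.sum_neg_distrib, mul_neg]
  have hc : ∀ i j, ∑ p, ∑ q, φ i j p q * β p q = 2 * β i j := fun i j => by rw [hb i j]; ring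
  funext i j k l
  have t1 : ∑ p, β i p * φ p j k l =
      ∑ p, (β j p * φ k l p i + β k p * φ l j p i + β l p * φ j k p i) := by
    have e1 : ∑ p, β i p * φ p j k l =
        -(1 / 2) * ∑ x, ∑ a, ∑ b, (kron x i * β a b) * ∑ p, φ j k l p * φ x a b p := by
      simp only [mul_assoc, ← Finset.mul_sum, sum_kron_mul']
      simp only [Finset.mul_sum]
      rw [← sum_rot3]
      refine Finset.sum_congr rfl fun p _ => ?_
      rw [hb i p, mul_assoc, Finset.sum_mul, Finset.mul_sum]
      refine Finset.sum_congr rfl fun a _ => ?_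
      rw [Finset.sum_mul, Finset.mul_sum]
      refine Finset.sum_congr rfl fun b _ => ?_
      rw [h.rot p j k l, h.cyc234 i p a b]
      ring
    have e2 : ∀ x y z, ∑ b, ∑ c, (kron x i * β b c + kron c i * β x b + kron b i * β c x) * φ y z b c
        = 2 * kron x i * β y z + 2 * ∑ p, β x p * φ y z p i := fun x y z => by
      have e3 : ∀ b c, (kron x i * β b c + kron c i * β x b + kron b i * β c x) * φ y z b c =
          kron x i * (φ y z b c * β b c) + kron c i * (β x b * φ y z b c)
            + kron b i * (β x c * φ y z c b) := fun b c => by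
        rw [hs x c, h.swap34 y z b c]; ring
      simp only [e3, Finset.sum_add_distrib, ← Finset.mul_sum, hc, sum_kron_mul']
      ring
    rw [e1, h.contract_tensor]
    simp only [Finset.sum_add_distrib, e2]
    rw [hs k l, hs l j, hs j k]
    ring
  have e : ∀ p, φ k l p i = -φ i p k l ∧ φ l j p i = -φ i j p l ∧ φ j k p i = -φ i j k p :=
    fun p => ⟨by rw [h.pair_swap, h.swap12], by
      rw [h.pair_swap, h.swap12, h.cyc234 i j p l], by rw [h.rot]⟩
  simp only [derivation4, Finset.sum_add_distrib, Pi.zero_apply, t1]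
  simp only [e, mul_neg, Finset.sum_neg_distrib]
  ring

/-- This is `contract_tensor` for `Y = X_i`: the alternation of `X` makes the six terms without `φ`
equal, and makes the three contractions of each kind equal. -/
theorem tripleContraction_mul {X : Tensor4} (h23 : ∀ i j k l, X i k j l = -X i j k l)
    (h34 : ∀ i j k l, X i j l k = -X i j k l) (i j k l) :
    ∑ p, tripleContraction X φ i p * φ p j k l = 6 * X i j k l
      - 3 * (pairContraction X φ i j k l + pairContraction X φ i k l j
        + pairContraction X φ i l j k) := by
  have e1 : ∑ p, tripleContraction X φ i p * φ p j k l =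
      ∑ a, ∑ b, ∑ c, X i a b c * ∑ p, φ j k l p * φ a b c p := by
    simp only [tripleContraction, Finset.sum_mul, Finset.mul_sum]
    rw [sum_rot4]
    refine Finset.sum_congr rfl fun a _ => Finset.sum_congr rfl fun b _ =>
      Finset.sum_congr rfl fun c _ => Finset.sum_congr rfl fun p _ => ?_
    rw [h.rot p j k l, h.rot p a b c]
    ring
  have c234 : ∀ a b c, X i b c a = X i a b c := fun a b c => by
    linarith [h34 i b a c, h23 i a b c]
  have e2 : ∀ x y z, ∑ b, ∑ c, (X i x b c + X i c x b + X i b c x) * φ y z b c =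
      3 * pairContraction X φ i x y z := fun x y z => by
    simp only [pairContraction, Finset.mul_sum]
    refine Finset.sum_congr rfl fun b _ => Finset.sum_congr rfl fun c _ => ?_
    rw [c234 x b c, ← c234 c x b]
    ring
  rw [e1, h.contract_tensor (fun a b c => X i a b c)]
  simp only [Finset.sum_add_distrib, e2]
  linarith [c234 j k l, c234 k l j, h23 i j k l, h34 i j k l, h23 i l k j, h34 i k l j, c234 k j l,
    c234 j l k]

/-- Infinitesimal deformations of a Cayley form with fixed metric come from the orthogonal Lie
algebra. -/
theorem derivation4_tripleContraction {X : Tensor4} (h12 : ∀ i j k l, X j i k l = -X i j k l)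
    (h23 : ∀ i j k l, X i k j l = -X i j k l) (h34 : ∀ i j k l, X i j l k = -X i j k l)
    (hX : ∀ i j k l, pairContraction X φ i j k l + pairContraction X φ k l i j = -4 * X i j k l) :
    derivation4 (tripleContraction X φ) φ = (96 : ℝ) • X := by
  have m12 : ∀ i j k l, pairContraction X φ j i k l = -pairContraction X φ i j k l :=
    fun i j k l => by simp only [pairContraction, h12 i j, neg_mul, Finset.sum_neg_distrib]
  have m34 : ∀ i j k l, pairContraction X φ i j l k = -pairContraction X φ i j k l :=
    fun i j k l => by simp only [pairContraction, h.swap12 k l, mul_neg, Finset.sum_neg_distrib]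
  funext i j k l
  have t := h.tripleContraction_mul h23 h34
  have e2 : ∀ p, φ i p k l = -φ p i k l := fun p => h.swap12 p i k l
  have e3 : ∀ p, φ i j p l = φ p i j l := fun p => h.cyc123 p i j l
  have e4 : ∀ p, φ i j k p = -φ p i j k := fun p => h.rot p i j k
  simp only [derivation4, Finset.sum_add_distrib, Pi.smul_apply, smul_eq_mul, e2, e3, e4, mul_neg,
    Finset.sum_neg_distrib, t]
  -- The four instances of `tripleContraction_mul` contribute `24 X` and twelve pair contractions
  -- with coefficient -3. These form six complementary pairs, each equal to `-4 X` by `hX`, so the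
  -- sum is `24 X + 72 X`.
  linarith [m12 i j k l, m12 i k l j, m12 i l j k, m12 j k i l, m12 j l i k, m12 k l i j,
    m34 i j k l, m34 i k l j, m34 i l j k, m34 j k i l, m34 j l i k, m34 k l i j,
    m34 k j i l, m34 l j i k, m34 l k i j, m34 j i k l, m34 k i l j, m34 l i j k, m34 k i j l,
    m34 l i k j,
    hX i j k l, hX i k l j, hX i l j k, h12 i j k l, h23 i j k l, h34 i j k l, h12 i k j l,
    h34 i k j l, h23 i k l j, h34 i k l j, h23 i l j k, h34 i l j k, h23 i j l k, h12 i l j k,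
    h23 j i k l, h34 j k i l, h23 k i j l, h34 k i j l, h12 i k j l, h23 k j i l, h34 l i j k,
    h23 l i j k, h12 i l j k, h12 i j l k, h34 l j i k, h34 k j i l, h34 j i l k, h23 j i l k]

omit h in
-- The trace of `hX` over the second index of each pair; the right-hand side drops out because `X`
-- has a repeated index.
theorem tripleContraction_skew {X : Tensor4}
    (hX : ∀ i j k l, pairContraction X φ i j k l + pairContraction X φ k l i j = -4 * X i j k l)
    (h24 : ∀ i j k, X i j k j = 0) (i m) :
    tripleContraction X φ m i = -tripleContraction X φ i m := by
  have e : ∀ i m, tripleContraction X φ i m = ∑ j, pairContraction X φ i j m j := fun i m => rfl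
  have := Finset.sum_congr rfl fun j (_ : j ∈ Finset.univ) => hX i j m j
  simp only [Finset.sum_add_distrib, h24, mul_zero, Finset.sum_const_zero] at this
  rw [e, e]
  linarith

/-- The contraction of an infinitesimal deformation lies in `Λ²₇`. -/
theorem fourProj7_tripleContraction {X : Tensor4} (h12 : ∀ i j k l, X j i k l = -X i j k l)
    (h23 : ∀ i j k l, X i k j l = -X i j k l) (h34 : ∀ i j k l, X i j l k = -X i j k l)
    (hX : ∀ i j k l, pairContraction X φ i j k l + pairContraction X φ k l i j = -4 * X i j k l) :
    fourProj7 φ (tripleContraction X φ) = (4 : ℝ) • tripleContraction X φ := by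
  have h24 : ∀ i j k, X i j k j = 0 := fun i j k => by linarith [h23 i j k j, h34 i k j j]
  -- Contracting `C · φ = 96 X` with `φ` gives `96 C` on one side and 24 times `fourProj7 φ C` on
  -- the other.
  have e := h.tripleContraction_derivation4 (tripleContraction_skew hX h24)
  rw [h.derivation4_tripleContraction h12 h23 h34 hX] at e
  funext i m
  have e' := congrFun (congrFun e i) m
  simp only [tripleContraction, Pi.smul_apply, smul_eq_mul, mul_assoc, ← Finset.mul_sum] at e' ⊢
  linarith

end IsSpinTensor

/-! ### Lifting `Λ¹ ⊗ Λ²₇` to 3-forms -/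

/-- The 3-form whose components in `Λ¹ ⊗ Λ²₇` are, up to a factor four, those of `A`. -/
noncomputable def threeFormOf (φ : Tensor4) (A : Tensor3) : Tensor3 := fun a i j =>
  (1 / 2) * (A a i j + A i j a + A j a i) + (1 / 6) * ∑ m, φ a i j m * ∑ l, A l l m

namespace IsSpinTensor

variable {φ : Tensor4} (h : IsSpinTensor φ)
include h

/-- A linear equation between the three cyclic versions of `φ_{ij}^{pq} A_{pqa}`. The eigenvalue
equation `h7` introduces a second Cayley form, and `contract_tensor` removes both. -/
theorem pairing_system {A : Tensor3} (hA : ∀ a i j, A a j i = -A a i j)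
    (h7 : ∀ a i j, ∑ p, ∑ q, φ i j p q * A a p q = -6 * A a i j) (i j a) :
    6 * ∑ p, ∑ q, φ i j p q * A p q a =
      8 * (A a i j - kron i a * (∑ l, A l l j) + kron j a * ∑ l, A l l i)
        + 2 * (∑ p, ∑ q, φ j a p q * A p q i + ∑ p, ∑ q, φ a i p q * A p q j)
        + 2 * ∑ b, φ i j a b * ∑ l, A l l b := by
  have e1 : 6 * ∑ p, ∑ q, φ i j p q * A p q a =
      ∑ p, ∑ x, ∑ r, ∑ s, (kron x a * A p r s) * ∑ q, φ i j p q * φ x r s q := by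
    simp only [mul_assoc, ← Finset.mul_sum, sum_kron_mul']
    rw [Finset.mul_sum]
    refine Finset.sum_congr rfl fun p _ => ?_
    simp only [Finset.mul_sum]
    rw [← sum_rot3]
    refine Finset.sum_congr rfl fun q _ => ?_
    have := h7 p a q
    rw [hA p q a] at this
    -- The equation `h7` is read backwards, so that `A_{pqa}` becomes a contraction with a form that
    -- shares the index `q`.
    rw [show 6 * (φ i j p q * A p q a) = φ i j p q * (∑ r, ∑ s, φ a q r s * A p r s) by
      rw [h7, hA]; ring]
    simp only [Finset.mul_sum]
    refine Finset.sum_congr rfl fun r _ => Finset.sum_congr rfl fun s _ => ?_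
    rw [h.cyc234 a q r s]
    ring
  have w1 : ∀ x, ∑ l, A l x l = -∑ l, A l l x := fun x => by
    rw [← Finset.sum_neg_distrib]
    exact Finset.sum_congr rfl fun l _ => by rw [hA]
  have e2 : ∀ p x y z, ∑ b, ∑ c, (kron x a * A p b c + kron c a * A p x b + kron b a * A p c x)
      * φ y z b c = kron x a * (-6 * A p y z) + 2 * ∑ b, A p x b * φ y z b a := fun p x y z => by
    have e3 : ∀ b c, (kron x a * A p b c + kron c a * A p x b + kron b a * A p c x) * φ y z b c =
        kron x a * (φ y z b c * A p b c) + kron c a * (A p x b * φ y z b c)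
          + kron b a * (A p x c * φ y z c b) := fun b c => by
      rw [hA p x c, h.swap34 y z b c]; ring
    simp only [e3, Finset.sum_add_distrib, ← Finset.mul_sum, sum_kron_mul', h7]
    ring
  have v1 : ∑ p, ∑ b, A p i b * φ j p b a = -∑ p, ∑ q, φ j a p q * A p q i := by
    simp only [← Finset.sum_neg_distrib]
    refine Finset.sum_congr rfl fun p _ => Finset.sum_congr rfl fun b _ => ?_
    rw [hA p b i, h.cyc234 j a p b]; ring
  have v2 : ∑ p, ∑ b, A p j b * φ p i b a = -∑ p, ∑ q, φ a i p q * A p q j := by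
    simp only [← Finset.sum_neg_distrib]
    refine Finset.sum_congr rfl fun p _ => Finset.sum_congr rfl fun b _ => ?_
    rw [hA p b j, ← h.cyc234 p i b a, h.pair_swap a i p b]
    ring
  have v3 : ∑ p, ∑ b, A p p b * φ i j b a = -∑ b, φ i j a b * ∑ l, A l l b := by
    rw [Finset.sum_comm, ← Finset.sum_neg_distrib]
    refine Finset.sum_congr rfl fun b _ => ?_
    rw [← Finset.sum_mul, h.swap34 i j a b]
    ring
  rw [e1]
  simp only [h.contract_tensor, Finset.sum_add_distrib, e2, Finset.sum_sub_distrib,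
    ← Finset.mul_sum, sum_kron_mul', v1, v2, v3]
  simp only [w1]
  rw [hA a i j]
  ring

/-- The projection of the cyclic sum of `A` involves the cyclic versions of `φ_{ij}^{pq} A_{pqa}`,
and the three instances of `pairing_system` eliminate them. What remains consists of traces of `A`;
the trace term in `threeFormOf`, with coefficient 1/6, cancels these. -/
theorem fourProj7_threeFormOf {A : Tensor3} (hA : ∀ a i j, A a j i = -A a i j)
    (h7 : ∀ a i j, ∑ p, ∑ q, φ i j p q * A a p q = -6 * A a i j) (a) :
    fourProj7 φ (threeFormOf φ A a) = A a := by
  funext i j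
  have s1 := h.pairing_system hA h7 i j a
  have s2 := h.pairing_system hA h7 j a i
  have s3 := h.pairing_system hA h7 a i j
  have c1 : ∑ b, φ j a i b * ∑ l, A l l b = ∑ b, φ i j a b * ∑ l, A l l b :=
    Finset.sum_congr rfl fun b _ => by rw [h.cyc123]
  have c2 : ∑ b, φ a i j b * ∑ l, A l l b = ∑ b, φ i j a b * ∑ l, A l l b :=
    Finset.sum_congr rfl fun b _ => by rw [h.cyc123, h.cyc123]
  rw [c1] at s2
  rw [c2] at s3
  have p1 : ∑ p, ∑ q, φ i j p q * A q a p = ∑ p, ∑ q, φ i j p q * A p q a := by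
    rw [Finset.sum_comm]
    refine Finset.sum_congr rfl fun p _ => Finset.sum_congr rfl fun b _ => ?_
    rw [h.swap34, hA p b a]; ring
  have p2 : ∑ p, ∑ q, φ i j p q * ∑ m, φ a p q m * ∑ l, A l l m =
      6 * (kron i a * ∑ l, A l l j) - 6 * (kron j a * ∑ l, A l l i)
        - 4 * ∑ b, φ i j a b * ∑ l, A l l b := by
    simp only [Finset.mul_sum (s := Finset.univ) (f := fun m => φ a _ _ m * _)]
    rw [← sum_rot3]
    have : ∀ m, ∑ p, ∑ q, φ i j p q * (φ a p q m * ∑ l, A l l m) =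
        kron j m * (6 * (kron i a * ∑ l, A l l m)) - kron i m * (6 * (kron j a * ∑ l, A l l m))
          - 4 * (φ i j a m * ∑ l, A l l m) := fun m => by
      have t := h.contract_two i j a m
      have : ∑ p, ∑ q, φ i j p q * (φ a p q m * ∑ l, A l l m) =
          (∑ p, ∑ q, φ i j p q * φ a m p q) * ∑ l, A l l m := by
        simp only [Finset.sum_mul]
        refine Finset.sum_congr rfl fun p _ => Finset.sum_congr rfl fun b _ => ?_
        rw [h.cyc234 a m p b]; ring
      rw [this, t]
      ring
    simp only [this, Finset.sum_sub_distrib, sum_kron_mul, ← Finset.mul_sum]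
  have p3 : ∑ p, ∑ q, φ i j p q * threeFormOf φ A a p q =
      (1 / 2) * (∑ p, ∑ q, φ i j p q * A a p q + ∑ p, ∑ q, φ i j p q * A p q a
        + ∑ p, ∑ q, φ i j p q * A q a p)
      + (1 / 6) * ∑ p, ∑ q, φ i j p q * ∑ m, φ a p q m * ∑ l, A l l m := by
    rw [← Finset.sum_add_distrib, ← Finset.sum_add_distrib, Finset.mul_sum, Finset.mul_sum,
      ← Finset.sum_add_distrib]
    refine Finset.sum_congr rfl fun p _ => ?_
    rw [← Finset.sum_add_distrib, ← Finset.sum_add_distrib, Finset.mul_sum, Finset.mul_sum,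
      ← Finset.sum_add_distrib]
    refine Finset.sum_congr rfl fun q _ => ?_
    rw [threeFormOf]
    ring
  rw [fourProj7, p3, p2, p1, h7, threeFormOf, c2]
  rw [kron_comm j i] at s2
  rw [kron_comm a i] at s2
  rw [kron_comm a j] at s3
  linarith

theorem threeFormOf_skew {A : Tensor3} (hA : ∀ a i j, A a j i = -A a i j) (a i j) :
    threeFormOf φ A i a j = -threeFormOf φ A a i j ∧
      threeFormOf φ A a j i = -threeFormOf φ A a i j := by
  constructor
  · have : ∑ m, φ i a j m * ∑ l, A l l m = -∑ m, φ a i j m * ∑ l, A l l m := by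
      simp only [h.swap12 a i, neg_mul, Finset.sum_neg_distrib]
    rw [threeFormOf, threeFormOf, this]
    linarith [hA i a j, hA a j i, hA j i a]
  · have : ∑ m, φ a j i m * ∑ l, A l l m = -∑ m, φ a i j m * ∑ l, A l l m := by
      simp only [h.swap23 a i j, neg_mul, Finset.sum_neg_distrib]
    rw [threeFormOf, threeFormOf, this]
    linarith [hA i a j, hA a j i, hA j i a]

end IsSpinTensor

/-! ### Recovering the torsion from the exterior derivative -/

/-- The alternation of a tensor of rank five that is alternating in its last four indices, as in
the formula for the exterior derivative. -/
def alternate5 (X : Fin 8 → Tensor4) (a b i j k : Fin 8) : ℝ :=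
  X a b i j k - X b a i j k + X i a b j k - X j a b i k + X k a b i j

namespace IsSpinTensor

variable {φ : Tensor4} (h : IsSpinTensor φ)
include h

/-- A symmetric contraction in the exterior derivative of a Cayley form. -/
theorem contract_derivation4_threeForm {t : Tensor3} (t12 : ∀ i j k, t j i k = -t i j k)
    (t23 : ∀ i j k, t i k j = -t i j k) (a b c) :
    ∑ i, ∑ j, ∑ k, derivation4 (t i) φ a b j k * φ c i j k =
      -8 * t a b c - 2 * ∑ p, ∑ q, φ a b p q * t p q c
        - 2 * (kron a c * ∑ i, ∑ j, ∑ k, φ b i j k * t i j k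
          - kron b c * ∑ i, ∑ j, ∑ k, φ a i j k * t i j k) := by
  have tc : ∀ i j k, t j k i = t i j k := fun i j k => by linarith [t23 j i k, t12 i j k]
  have z13 : ∀ i j, t i j i = 0 := fun i j => by linarith [t12 i j i, t23 j i i]
  have z1 : ∑ i, ∑ j, ∑ k, ∑ p, t i a p * φ p b j k * φ c i j k =
      -6 * t a b c - 4 * ∑ p, ∑ q, φ b c p q * t p q a := by
    have : ∀ i, ∑ j, ∑ k, ∑ p, t i a p * φ p b j k * φ c i j k =
        ∑ p, (kron b i * (6 * (kron p c * t i a p)) - kron p i * (6 * (kron b c * t i a p))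
          - 4 * (φ b c i p * t i p a)) := fun i => by
      rw [← sum_rot3]
      refine Finset.sum_congr rfl fun p _ => ?_
      simp only [mul_assoc, ← Finset.mul_sum, h.contract_two]
      rw [h.rot p b c i, t23 i a p]
      ring
    simp only [this, Finset.sum_sub_distrib, ← Finset.mul_sum, sum_kron_mul, sum_kron_mul', z13]
    rw [t12 a b c, Finset.sum_const_zero]
    ring
  have z2 : ∑ i, ∑ j, ∑ k, ∑ p, t i b p * φ a p j k * φ c i j k =
      -6 * t a b c - 4 * ∑ p, ∑ q, φ c a p q * t p q b := by
    have : ∀ i, ∑ j, ∑ k, ∑ p, t i b p * φ a p j k * φ c i j k =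
        ∑ p, (kron p i * (6 * (kron a c * t i b p)) - kron p c * (6 * (kron a i * t i b p))
          - 4 * (φ c a i p * t i p b)) := fun i => by
      rw [← sum_rot3]
      refine Finset.sum_congr rfl fun p _ => ?_
      simp only [mul_assoc, ← Finset.mul_sum, h.contract_two]
      rw [h.pair_swap c i a p, h.swap23 c a i p, t23 i b p]
      ring
    simp only [this, Finset.sum_sub_distrib, ← Finset.mul_sum, sum_kron_mul, sum_kron_mul', z13]
    rw [Finset.sum_const_zero]
    ring
  have z4 : ∑ i, ∑ j, ∑ k, ∑ p, t i k p * φ a b j p * φ c i j k =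
      ∑ i, ∑ j, ∑ k, ∑ p, t i j p * φ a b p k * φ c i j k := by
    refine (sum_swap23 _).trans ?_
    refine Finset.sum_congr rfl fun i _ => Finset.sum_congr rfl fun j _ =>
      Finset.sum_congr rfl fun k _ => Finset.sum_congr rfl fun p _ => ?_
    rw [h.swap34 a b p k, h.swap34 c i j k]
    ring
  -- Here the two Cayley forms share the single index `k`, so the full identity `contract_tensor` is
  -- needed; in `z1` and `z2` they share two indices.
  have z3 : ∑ i, ∑ j, ∑ k, ∑ p, t i j p * φ a b p k * φ c i j k =
      2 * t a b c - (kron a c * ∑ i, ∑ j, ∑ k, φ b i j k * t i j k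
        - kron b c * ∑ i, ∑ j, ∑ k, φ a i j k * t i j k
        - 2 * ∑ p, ∑ q, φ b c p q * t p q a - 2 * ∑ p, ∑ q, φ c a p q * t p q b
        + ∑ p, ∑ q, φ a b p q * t p q c) := by
    have e1 : ∑ i, ∑ j, ∑ k, ∑ p, t i j p * φ a b p k * φ c i j k =
        ∑ p, ∑ x, ∑ i, ∑ j, (kron x c * t i j p) * ∑ k, φ a b p k * φ x i j k := by
      simp only [mul_assoc, ← Finset.mul_sum, sum_kron_mul']
      simp only [Finset.mul_sum]
      exact (sum_rot4 _).symm
    have e2 : ∀ p x y z, ∑ i, ∑ j, (kron x c * t i j p + kron j c * t x i p + kron i c * t j x p)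
        * φ y z i j = kron x c * (∑ i, ∑ j, φ y z i j * t i j p)
          + 2 * ∑ i, φ y z i c * t x i p := fun p x y z => by
      have e3 : ∀ i j, (kron x c * t i j p + kron j c * t x i p + kron i c * t j x p) * φ y z i j =
          kron x c * (φ y z i j * t i j p) + kron j c * (φ y z i j * t x i p)
            + kron i c * (φ y z j i * t x j p) := fun i j => by
        rw [t12 x j p, h.swap34 y z i j]; ring
      simp only [e3, Finset.sum_add_distrib, ← Finset.mul_sum, sum_kron_mul']
      ring
    have y1 : ∑ p, ∑ i, ∑ j, φ b p i j * t i j p = ∑ i, ∑ j, ∑ k, φ b i j k * t i j k :=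
      Finset.sum_congr rfl fun i _ => Finset.sum_congr rfl fun j _ =>
        Finset.sum_congr rfl fun k _ => by rw [tc]
    have y2 : ∑ p, ∑ i, ∑ j, φ p a i j * t i j p = -∑ i, ∑ j, ∑ k, φ a i j k * t i j k := by
      simp only [← Finset.sum_neg_distrib]
      exact Finset.sum_congr rfl fun i _ => Finset.sum_congr rfl fun j _ =>
        Finset.sum_congr rfl fun k _ => by rw [tc, h.swap12]; ring
    have y3 : ∑ p, ∑ i, φ b p i c * t a i p = -∑ p, ∑ q, φ b c p q * t p q a := by
      simp only [← Finset.sum_neg_distrib]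
      exact Finset.sum_congr rfl fun i _ => Finset.sum_congr rfl fun j _ => by
        rw [h.cyc234 b c i j, t23 a i j, tc a i j]; ring
    have y4 : ∑ p, ∑ i, φ p a i c * t b i p = -∑ p, ∑ q, φ c a p q * t p q b := by
      simp only [← Finset.sum_neg_distrib]
      exact Finset.sum_congr rfl fun i _ => Finset.sum_congr rfl fun j _ => by
        rw [h.rot c i a j, h.swap23 c a i j, t23 b i j, tc b i j]; ring
    have z33 : ∀ i j, t i j j = 0 := fun i j => by linarith [t23 i j j]
    rw [e1]
    simp only [h.contract_tensor, Finset.sum_add_distrib, e2, Finset.sum_sub_distrib,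
      ← Finset.mul_sum, sum_kron_mul', y1, y2, y3, y4]
    simp only [z13, z33, mul_zero, Finset.sum_const_zero]
    rw [t12 a b c]
    ring
  simp only [derivation4, Finset.sum_mul, add_mul, Finset.sum_add_distrib]
  rw [z4, z3, z1, z2]
  ring

/-- In two of the five terms of the alternation the direction of differentiation stays free, and
`tripleContraction_derivation4` applies. In the other three it is contracted; they agree up to
renaming and are given by `contract_derivation4_threeForm`. -/
theorem contract_alternate5 {t : Tensor3} (t12 : ∀ i j k, t j i k = -t i j k)
    (t23 : ∀ i j k, t i k j = -t i j k) (a b c) :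
    ∑ i, ∑ j, ∑ k, alternate5 (fun a => derivation4 (t a) φ) a b i j k * φ c i j k =
      24 * t a b c - 12 * ∑ p, ∑ q, φ b c p q * t p q a - 12 * ∑ p, ∑ q, φ c a p q * t p q b
        - 6 * ∑ p, ∑ q, φ a b p q * t p q c
        - 6 * (kron a c * ∑ i, ∑ j, ∑ k, φ b i j k * t i j k
          - kron b c * ∑ i, ∑ j, ∑ k, φ a i j k * t i j k) := by
  have tc : ∀ i j k, t j k i = t i j k := fun i j k => by linarith [t23 j i k, t12 i j k]
  have c1 : ∀ a b, ∑ i, ∑ j, ∑ k, derivation4 (t a) φ b i j k * φ c i j k =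
      24 * t a b c - 12 * ∑ p, ∑ q, φ b c p q * t p q a := fun a b => by
    have := congrFun (congrFun (h.tripleContraction_derivation4 (t23 a)) b) c
    simp only [tripleContraction, Pi.smul_apply, smul_eq_mul, fourProj7] at this
    rw [this]
    simp only [fun p q => tc a p q]
    ring
  have s0 := h.contract_derivation4_threeForm t12 t23 a b c
  have s2 : ∑ i, ∑ j, ∑ k, derivation4 (t j) φ a b i k * φ c i j k =
      -∑ i, ∑ j, ∑ k, derivation4 (t i) φ a b j k * φ c i j k := by
    simp only [← Finset.sum_neg_distrib]
    refine Finset.sum_comm.trans ?_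
    refine Finset.sum_congr rfl fun i _ => Finset.sum_congr rfl fun j _ =>
      Finset.sum_congr rfl fun k _ => ?_
    rw [h.swap23]; ring
  have s3 : ∑ i, ∑ j, ∑ k, derivation4 (t k) φ a b i j * φ c i j k =
      ∑ i, ∑ j, ∑ k, derivation4 (t i) φ a b j k * φ c i j k := by
    refine (sum_rot3 _).symm.trans ?_
    refine Finset.sum_congr rfl fun i _ => Finset.sum_congr rfl fun j _ =>
      Finset.sum_congr rfl fun k _ => ?_
    rw [h.cyc234]
  have v : ∑ p, ∑ q, φ a c p q * t p q b = -∑ p, ∑ q, φ c a p q * t p q b := by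
    simp only [h.swap12 c a, neg_mul, Finset.sum_neg_distrib]
  simp only [alternate5, add_mul, sub_mul, Finset.sum_add_distrib, Finset.sum_sub_distrib]
  rw [s2, s3, s0, c1, c1, v, t12 a b c]
  ring

/-- The exterior derivative of a Cayley form determines its torsion. -/
theorem eq_zero_of_alternate5 {t : Tensor3} (t12 : ∀ i j k, t j i k = -t i j k)
    (t23 : ∀ i j k, t i k j = -t i j k)
    (h0 : ∀ a b i j k, alternate5 (fun a => derivation4 (t a) φ) a b i j k = 0) : t = 0 := by
  have tc : ∀ i j k, t j k i = t i j k := fun i j k => by linarith [t23 j i k, t12 i j k]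
  have e := h.contract_alternate5 t12 t23
  simp only [h0, zero_mul, Finset.sum_const_zero] at e
  -- The trace over `b = c` isolates the vector `φ_b^{ijk} t_{ijk}`, which therefore vanishes.
  have tr : ∀ b, ∑ i, ∑ j, ∑ k, φ b i j k * t i j k = 0 := fun a => by
    have e1 := Finset.sum_congr rfl fun b (_ : b ∈ Finset.univ) => e a b b
    have z : ∀ b, t a b b = 0 := fun b => by linarith [t23 a b b]
    have k8 : ∑ k : Fin 8, (kron k k : ℝ) = 8 := by simp [kron]
    have y1 : ∑ b, ∑ p, ∑ q, φ a b p q * t p q b = ∑ i, ∑ j, ∑ k, φ a i j k * t i j k :=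
      Finset.sum_congr rfl fun i _ => Finset.sum_congr rfl fun j _ =>
        Finset.sum_congr rfl fun k _ => by rw [tc]
    have y2 : ∑ b, ∑ p, ∑ q, φ b a p q * t p q b = -∑ i, ∑ j, ∑ k, φ a i j k * t i j k := by
      simp only [h.swap12 a, neg_mul, Finset.sum_neg_distrib, y1]
    simp only [Finset.sum_sub_distrib, ← Finset.mul_sum, z, h.zero12, sum_kron_mul, y1, y2,
      ← Finset.sum_mul, k8, zero_mul, Finset.sum_const_zero] at e1
    linarith
  simp only [tr, mul_zero] at e
  -- Without the trace the equation and its cyclic versions form a 3 × 3 system for the contractions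
  -- `φ_{ab}^{pq} t_{pqc}`. The sum of the three unknowns is `12/5 t`, and each is then `4/5 t`.
  have v : ∀ a b c, ∑ p, ∑ q, φ a b p q * t p q c = (4 / 5) * t a b c := fun a b c => by
    linarith [e a b c, e b c a, e c a b, tc a b c, tc b c a]
  funext c d x
  -- On the first two indices the operator `φ` satisfies `λ² = 12 - 4 λ`. Since 4/5 is not a root,
  -- `t` must be zero.
  have e2 : ∑ a, ∑ b, φ c d a b * ∑ p, ∑ q, φ a b p q * t p q x =
      12 * t c d x - 4 * ∑ p, ∑ q, φ c d p q * t p q x := by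
    have : ∑ a, ∑ b, φ c d a b * ∑ p, ∑ q, φ a b p q * t p q x =
        ∑ p, ∑ q, (∑ a, ∑ b, φ c d a b * φ p q a b) * t p q x := by
      simp only [Finset.mul_sum, Finset.sum_mul]
      refine (sum_rot4 _).trans ((sum_rot4 _).trans ?_)
      refine Finset.sum_congr rfl fun p _ => Finset.sum_congr rfl fun q _ =>
        Finset.sum_congr rfl fun a _ => Finset.sum_congr rfl fun b _ => ?_
      rw [h.pair_swap p q a b, mul_assoc]
    rw [this]
    have e3 : ∀ p q, (∑ a, ∑ b, φ c d a b * φ p q a b) * t p q x =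
        kron c p * (kron d q * (6 * t p q x)) - kron d p * (kron c q * (6 * t p q x))
          - 4 * (φ c d p q * t p q x) := fun p q => by
      rw [h.contract_two]; ring
    simp only [e3, Finset.sum_sub_distrib, ← Finset.mul_sum, sum_kron_mul]
    rw [t12 c d x]
    ring
  simp only [v, fun a b => mul_left_comm (φ c d a b) (4 / 5 : ℝ), ← Finset.mul_sum] at e2
  simp only [Pi.zero_apply]
  linarith

end IsSpinTensor

/-! ## The curvature identities in an orthonormal frame -/

theorem raise1_one (T : Tensor3) : raise1 1 T = T := by
  funext a b c; simp [raise1, Matrix.one_apply]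

theorem raise2_one (T : Tensor3) : raise2 1 T = T := by
  funext a b c; simp [raise2, Matrix.one_apply]

theorem raise3_one (T : Tensor3) : raise3 1 T = T := by
  funext a b c; simp [raise3, Matrix.one_apply]

theorem raiseLast2_one (S : Tensor4) : raiseLast2 1 S = S := by
  funext a b c d; simp [raiseLast2, Matrix.one_apply]

theorem raiseLast3_one (S : Tensor4) : raiseLast3 1 S = S := by
  funext a b c d; simp [raiseLast3, Matrix.one_apply]

theorem raise4_one (S : Tensor4) : raise4 1 S = S := by
  funext a b c d; simp [raise4, Matrix.one_apply]

theorem ricciContraction_one (S : Tensor4) (a b) : ricciContraction 1 S a b = ∑ c, S a c b c := by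
  simp [ricciContraction, Matrix.one_apply]

/-- The contraction `N_{aamn}`. -/
def divergence (N : Tensor4) : Tensor2 := fun m n => ∑ a, N a a m n

namespace IsSpinTensor

variable {φ : Tensor4} (h : IsSpinTensor φ)
include h

section Grad

variable {N : Tensor4} (n23 : ∀ a i j k, N a j i k = -N a i j k)
  (n34 : ∀ a i j k, N a i k j = -N a i j k)
include n23 n34

/-- This and the next lemma are `contract_tensor` applied to `∇T`. Together with `contract_phiTT`
they allow both sides of `divergence_eq` to be contracted with `φ` once more, which the divergence
of the intrinsic torsion requires. -/
theorem contract_phiGradT (m n) : ∑ k, ∑ l, φ m n k l * phiGradT 1 φ N k l =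
    6 * divergence N m n + 6 * skewPart (phiCurlT 1 φ N) m n
      - 3 * ∑ k, ∑ l, φ m n k l * divergence N k l := by
  have nc : ∀ a i j k, N a j k i = N a i j k := fun a i j k => by
    linarith [n34 a j i k, n23 a i j k]
  have e1 : ∑ k, ∑ l, φ m n k l * phiGradT 1 φ N k l =
      ∑ l, ∑ a, ∑ b, ∑ c, N l a b c * ∑ k, φ m n l k * φ a b c k := by
    rw [Finset.sum_comm]
    refine Finset.sum_congr rfl fun l _ => ?_
    simp only [phiGradT, raiseLast3_one, Finset.mul_sum]
    rw [sum_rot4]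
    refine Finset.sum_congr rfl fun a _ => Finset.sum_congr rfl fun b _ =>
      Finset.sum_congr rfl fun c _ => Finset.sum_congr rfl fun k _ => ?_
    rw [h.swap34 m n k l, h.rot k a b c]
    ring
  have e2 : ∀ l x y z, ∑ b, ∑ c, (N l x b c + N l c x b + N l b c x) * φ y z b c =
      3 * ∑ b, ∑ c, φ y z b c * N l x b c := fun l x y z => by
    simp only [Finset.mul_sum]
    refine Finset.sum_congr rfl fun b _ => Finset.sum_congr rfl fun c _ => ?_
    rw [nc l x b c, ← nc l c x b]
    ring
  have c1 : ∑ l, ∑ b, ∑ c, φ n l b c * N l m b c = phiCurlT 1 φ N n m := by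
    rw [phiCurlT, raiseLast3_one]
  have c2 : ∑ l, ∑ b, ∑ c, φ l m b c * N l n b c = -phiCurlT 1 φ N m n := by
    rw [phiCurlT, raiseLast3_one]
    simp only [h.swap12 m, neg_mul, Finset.sum_neg_distrib]
  have c3 : ∑ l, ∑ b, ∑ c, φ m n b c * N l l b c = ∑ k, ∑ l, φ m n k l * divergence N k l := by
    simp only [divergence, Finset.mul_sum]
    rw [sum_rot3]
  have d1 : ∑ l, N l m n l = divergence N m n := Finset.sum_congr rfl fun l _ => nc l l m n
  have d2 : ∀ l, N l m n l + N l n l m + N l l m n - N l m l n - N l n m l - N l l n m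
      = 6 * N l m n l := fun l => by
    linarith [nc l m n l, nc l n l m, n34 l m n l, n23 l m n l, n34 l l m n]
  rw [e1]
  simp only [h.contract_tensor, e2, Finset.sum_add_distrib, Finset.sum_sub_distrib,
    ← Finset.mul_sum, c1, c2, c3, d2, d1, skewPart]
  ring

theorem contract_phiCurlT (m n) : ∑ k, ∑ l, φ m n k l * phiCurlT 1 φ N k l =
    2 * divergence N m n + 2 * skewPart (phiGradT 1 φ N) m n - 4 * skewPart (phiCurlT 1 φ N) m n
      - ∑ k, ∑ l, φ m n k l * divergence N k l := by
  have nc : ∀ a i j k, N a j k i = N a i j k := fun a i j k => by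
    linarith [n34 a j i k, n23 a i j k]
  have e1 : ∑ k, ∑ l, φ m n k l * phiCurlT 1 φ N k l =
      ∑ l, ∑ a, ∑ b, ∑ c, N a l b c * ∑ k, φ m n l k * φ a b c k := by
    rw [Finset.sum_comm]
    refine Finset.sum_congr rfl fun l _ => ?_
    simp only [phiCurlT, raiseLast3_one, Finset.mul_sum]
    rw [sum_rot4]
    refine Finset.sum_congr rfl fun a _ => Finset.sum_congr rfl fun b _ =>
      Finset.sum_congr rfl fun c _ => Finset.sum_congr rfl fun k _ => ?_
    rw [h.swap34 m n k l, h.rot k a b c]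
    ring
  have g1 : ∀ x y, ∑ l, ∑ b, ∑ c, (N x l b c + N c l x b + N b l c x) * φ y l b c =
      phiGradT 1 φ N y x - 2 * phiCurlT 1 φ N y x := fun x y => by
    have q1 : ∑ l, ∑ b, ∑ c, N c l x b * φ y l b c = -phiCurlT 1 φ N y x := by
      simp only [phiCurlT, raiseLast3_one, ← Finset.sum_neg_distrib]
      refine (sum_rot3 (fun c l b => N c l x b * φ y l b c)).symm.trans ?_
      refine Finset.sum_congr rfl fun c _ => Finset.sum_congr rfl fun l _ =>
        Finset.sum_congr rfl fun b _ => ?_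
      rw [h.cyc234 y c l b, n23 c x l b]
      ring
    have q2 : ∑ l, ∑ b, ∑ c, N b l c x * φ y l b c = -phiCurlT 1 φ N y x := by
      simp only [phiCurlT, raiseLast3_one, ← Finset.sum_neg_distrib]
      rw [Finset.sum_comm]
      refine Finset.sum_congr rfl fun b _ => Finset.sum_congr rfl fun l _ =>
        Finset.sum_congr rfl fun c _ => ?_
      rw [h.swap23 y b l c, nc b x l c]
      ring
    simp only [add_mul, Finset.sum_add_distrib, q1, q2, phiGradT, raiseLast3_one, mul_comm (φ y _ _ _)]
    ring
  have g2 : ∑ l, ∑ b, ∑ c, (N n l b c + N c l n b + N b l c n) * φ l m b c =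
      -(phiGradT 1 φ N m n - 2 * phiCurlT 1 φ N m n) := by
    rw [← g1]
    simp only [h.swap12 m, mul_neg, Finset.sum_neg_distrib]
  have g3 : ∑ l, ∑ b, ∑ c, (N l l b c + N c l l b + N b l c l) * φ m n b c =
      ∑ k, ∑ l, φ m n k l * divergence N k l := by
    have z : ∀ l b c, (N l l b c + N c l l b + N b l c l) * φ m n b c = φ m n b c * N l l b c :=
      fun l b c => by
        have z1 : N c l l b = 0 := by linarith [n23 c l l b]
        have z2 : N b l c l = 0 := by linarith [nc b l l c, n23 b l l c]
        rw [z1, z2]; ring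
    simp only [z, divergence, Finset.mul_sum]
    rw [sum_rot3]
  have d2 : ∀ l, N m l n l + N n l l m + N l l m n - N m l l n - N n l m l - N l l n m
      = 2 * N l l m n := fun l => by
    linarith [n23 m l n l, nc m l n l, n34 m n l l, n23 n l l m, n23 m l l n, n34 n l l m,
      n34 l l m n, n34 m l l n, nc n l l m, nc m l l n]
  rw [e1]
  simp only [fun l => h.contract_tensor (fun a b c => N a l b c) m n l, d2, Finset.sum_add_distrib,
    Finset.sum_sub_distrib, g1, g2, g3, ← Finset.mul_sum, skewPart]
  rw [divergence]
  ring

end Grad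

section Torsion

variable {t : Tensor3} (t12 : ∀ i j k, t j i k = -t i j k) (t23 : ∀ i j k, t i k j = -t i j k)
include t12 t23

omit t23 in
theorem contract_phiTT (m n) : ∑ k, ∑ l, φ m n k l * phiTT 1 φ t k l =
    -6 * skewPart (phiTT 1 φ t) m n := by
  have e0 : ∀ a b, phiTT 1 φ t a b = ∑ i, ∑ j, ∑ k, φ a i j k * ∑ p, t b i p * t j k p :=
    fun a b => by simp only [phiTT, raiseLast3_one, raise1_one, Finset.mul_sum, mul_assoc]
  -- Only the symmetries of `Q` matter below: it is skew in each pair and symmetric under exchange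
  -- of the pairs.
  set Q : Tensor4 := fun l a b c => ∑ p, t l a p * t b c p with hQ
  have e0 : ∀ a b, phiTT 1 φ t a b = ∑ i, ∑ j, ∑ k, φ a i j k * Q b i j k := e0
  have Q12 : ∀ a b c d, Q b a c d = -Q a b c d := fun a b c d => by
    simp only [hQ, t12 a b, neg_mul, Finset.sum_neg_distrib]
  have Q34 : ∀ a b c d, Q a b d c = -Q a b c d := fun a b c d => by
    simp only [hQ, t12 c d, mul_neg, Finset.sum_neg_distrib]
  have Qp : ∀ a b c d, Q c d a b = Q a b c d := fun a b c d => by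
    simp only [hQ, mul_comm]
  have Qz : ∀ a b c, Q a a b c = 0 := fun a b c => by linarith [Q12 a a b c]
  clear_value Q
  have e1 : ∑ k, ∑ l, φ m n k l * phiTT 1 φ t k l =
      ∑ l, ∑ a, ∑ b, ∑ c, Q l a b c * ∑ k, φ m n l k * φ a b c k := by
    rw [Finset.sum_comm]
    refine Finset.sum_congr rfl fun l _ => ?_
    simp only [e0, Finset.mul_sum]
    rw [sum_rot4]
    refine Finset.sum_congr rfl fun a _ => Finset.sum_congr rfl fun b _ =>
      Finset.sum_congr rfl fun c _ => Finset.sum_congr rfl fun k _ => ?_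
    rw [h.swap34 m n k l, h.rot k a b c]
    ring
  have g1 : ∀ x y, ∑ l, ∑ b, ∑ c, (Q l x b c + Q l c x b + Q l b c x) * φ y l b c =
      -3 * phiTT 1 φ t y x := fun x y => by
    have q0 : ∑ l, ∑ b, ∑ c, Q l x b c * φ y l b c = -phiTT 1 φ t y x := by
      simp only [e0, ← Finset.sum_neg_distrib]
      refine Finset.sum_congr rfl fun c _ => Finset.sum_congr rfl fun l _ =>
        Finset.sum_congr rfl fun b _ => ?_
      rw [Q12]
      ring
    have q1 : ∑ l, ∑ b, ∑ c, Q l c x b * φ y l b c = -phiTT 1 φ t y x := by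
      simp only [e0, ← Finset.sum_neg_distrib]
      refine (sum_rot3 _).trans ?_
      refine Finset.sum_congr rfl fun c _ => Finset.sum_congr rfl fun l _ =>
        Finset.sum_congr rfl fun b _ => ?_
      rw [← h.cyc234 y b c l, Qp, Q34 x c l b]
      ring
    have q2 : ∑ l, ∑ b, ∑ c, Q l b c x * φ y l b c = -phiTT 1 φ t y x := by
      simp only [e0, ← Finset.sum_neg_distrib]
      refine (sum_rot3 (fun c l b => Q l b c x * φ y l b c)).symm.trans ?_
      refine Finset.sum_congr rfl fun c _ => Finset.sum_congr rfl fun l _ =>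
        Finset.sum_congr rfl fun b _ => ?_
      rw [h.cyc234 y c l b, Qp, Q12]
      ring
    simp only [add_mul, Finset.sum_add_distrib, q0, q1, q2]
    ring
  have g2 : ∑ l, ∑ b, ∑ c, (Q l n b c + Q l c n b + Q l b c n) * φ l m b c =
      3 * phiTT 1 φ t m n := by
    have := g1 n m
    simp only [h.swap12 m, mul_neg, Finset.sum_neg_distrib]
    linarith
  have g3 : ∑ l, ∑ b, ∑ c, (Q l l b c + Q l c l b + Q l b c l) * φ m n b c = 0 := by
    have z : ∀ l b c, (Q l l b c + Q l c l b + Q l b c l) * φ m n b c = 0 := fun l b c => by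
      rw [Qz, Q34 l b l c, Qp l c l b]
      ring
    simp only [z, Finset.sum_const_zero]
  have d2 : ∀ l, Q l m n l + Q l n l m + Q l l m n - Q l m l n - Q l n m l - Q l l n m = 0 :=
    fun l => by
      linarith [Q34 l m l n, Q34 l n l m, Qz l m n, Qz l n m, Qp l m l n]
  rw [e1]
  simp only [h.contract_tensor, d2, Finset.sum_add_distrib,
    Finset.sum_sub_distrib, g1, g2, g3, skewPart, Finset.sum_const_zero]
  ring

/-- The contribution of `∇Φ` to the divergence of the intrinsic torsion. Rotating `k` or `l`
contributes nothing, because `φ` is skew in the two indices that meet a symmetric product of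
torsions. -/
theorem contract_derivation4_torsion (m n) :
    ∑ a, ∑ k, ∑ l, derivation4 (t a) φ m n k l * t a k l = 2 * skewPart (phiTT 1 φ t) m n := by
  have z1 : ∀ m n, ∑ a, ∑ k, ∑ l, ∑ p, t a m p * φ p n k l * t a k l = -phiTT 1 φ t n m :=
    fun m n => by
      simp only [phiTT, raiseLast3_one, raise1_one, ← Finset.sum_neg_distrib]
      refine (sum_rot4 _).trans ((sum_rot3
        (fun p k l => ∑ a, t a m p * φ p n k l * t a k l)).symm.trans ?_)
      refine Finset.sum_congr rfl fun p _ => Finset.sum_congr rfl fun k _ =>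
        Finset.sum_congr rfl fun l _ => Finset.sum_congr rfl fun a _ => ?_
      rw [h.swap12 n p, t12 m a, t23 m p a, t12 k a, t23 k l a]
      ring
  have z2 : ∑ a, ∑ k, ∑ l, ∑ p, t a n p * φ m p k l * t a k l = phiTT 1 φ t m n := by
    have := z1 n m
    simp only [h.swap12 m, mul_neg, neg_mul, Finset.sum_neg_distrib] at this ⊢
    linarith
  have z3 : ∀ a, ∑ k, ∑ l, ∑ p, t a k p * φ m n p l * t a k l = 0 := fun a => by
    refine Finset.sum_eq_zero fun k _ => ?_
    have : ∑ l, ∑ p, t a k p * φ m n p l * t a k l = -∑ l, ∑ p, t a k p * φ m n p l * t a k l := by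
      conv_lhs => rw [Finset.sum_comm]
      simp only [← Finset.sum_neg_distrib]
      refine Finset.sum_congr rfl fun b _ => Finset.sum_congr rfl fun c _ => ?_
      rw [h.swap34 m n b c]
      ring
    linarith
  have z4 : ∀ a, ∑ k, ∑ l, ∑ p, t a l p * φ m n k p * t a k l = 0 := fun a => by
    rw [Finset.sum_comm, ← z3 a]
    refine Finset.sum_congr rfl fun b _ => Finset.sum_congr rfl fun c _ =>
      Finset.sum_congr rfl fun p _ => ?_
    rw [h.swap34 m n p c, t23 a b c]
    ring
  simp only [derivation4, Finset.sum_mul, add_mul, Finset.sum_add_distrib]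
  rw [z1, z2]
  simp only [z3, z4, Finset.sum_const_zero, skewPart]
  ring

end Torsion

end IsSpinTensor

namespace IsSpinTensor

variable {φ : Tensor4} (h : IsSpinTensor φ)
include h

section

variable {N R : Tensor4} {t : Tensor3} (t12 : ∀ i j k, t j i k = -t i j k)
  (t23 : ∀ i j k, t i k j = -t i j k) (n23 : ∀ a i j k, N a j i k = -N a i j k)
  (n34 : ∀ a i j k, N a i k j = -N a i j k) (hR : R ∈ curvatureTensors)
  (hS : fourPi7 1 φ R = torsionCurvature 1 φ t N)
include t12 t23 n23 n34 hR hS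

omit t23 in
/-- The Ricci tensor in terms of the torsion, before its symmetry is used. -/
theorem ricciContraction_eq (a i) : ricciContraction 1 R a i =
    -divergence N a i - (1 / 2) * phiGradT 1 φ N i a + (1 / 2) * phiCurlT 1 φ N i a
      + contractTT 1 t i a + phiTT 1 φ t i a := by
  have e := fun b => congrFun (congrFun (congrFun (congrFun hS a) b) i) b
  have e := Finset.sum_congr rfl fun b (_ : b ∈ Finset.univ) => e b
  simp only [fourPi7, torsionCurvature, raiseLast2_one, raise1_one, Finset.sum_sub_distrib,
    Finset.sum_add_distrib, ← Finset.mul_sum] at e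
  -- By the first Bianchi identity: `φ` is invariant under cyclic permutations of `b, p, q`, so the
  -- sum is a third of a contraction of `φ` with the cyclic sum of `R`.
  have r : ∑ b, ∑ p, ∑ q, φ i b p q * R a b p q = 0 := by
    have r1 : ∑ b, ∑ p, ∑ q, φ i b p q * R a p q b = ∑ b, ∑ p, ∑ q, φ i b p q * R a b p q := by
      refine (sum_rot3 (fun b p q => φ i b p q * R a p q b)).trans ?_
      refine Finset.sum_congr rfl fun k _ => Finset.sum_congr rfl fun l _ =>
        Finset.sum_congr rfl fun a _ => ?_
      rw [← h.cyc234]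
    have r2 : ∑ b, ∑ p, ∑ q, φ i b p q * R a q b p = ∑ b, ∑ p, ∑ q, φ i b p q * R a b p q := by
      refine (sum_rot3 (fun b p q => φ i p q b * R a b p q)).symm.trans ?_
      refine Finset.sum_congr rfl fun k _ => Finset.sum_congr rfl fun l _ =>
        Finset.sum_congr rfl fun a _ => ?_
      rw [h.cyc234]
    have : ∑ b, ∑ p, ∑ q, (φ i b p q * R a b p q + φ i b p q * R a p q b
        + φ i b p q * R a q b p) = 0 :=
      Finset.sum_eq_zero fun b _ => Finset.sum_eq_zero fun p _ => Finset.sum_eq_zero fun q _ => by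
        rw [← mul_add, ← mul_add, hR.2.2.2, mul_zero]
    simp only [Finset.sum_add_distrib, r1, r2] at this
    linarith
  have s1 : ∑ b, N a b i b = 0 := Finset.sum_eq_zero fun b _ => by
    linarith [n23 a b i b, n34 a i b b]
  have s2 : ∑ b, N b a i b = divergence N a i := Finset.sum_congr rfl fun b _ => by
    linarith [n34 b a i b, n23 b a b i]
  have s3 : ∑ b, ∑ p, t a i p * t b b p = 0 := Finset.sum_eq_zero fun b _ =>
    Finset.sum_eq_zero fun p _ => by
      have : t b b p = 0 := by linarith [t12 b b p]
      rw [this, mul_zero]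
  have s4 : ∑ b, ∑ p, t b i p * t a b p = -contractTT 1 t i a := by
    simp only [contractTT, raise2_one, ← Finset.sum_neg_distrib]
    exact Finset.sum_congr rfl fun b _ => Finset.sum_congr rfl fun p _ => by
      rw [t12, neg_mul]
  have s5 : ∑ b, ∑ p, ∑ q, ∑ k, φ i b p q * t a p k * t b q k = -phiTT 1 φ t i a := by
    simp only [phiTT, raiseLast3_one, raise1_one, ← Finset.sum_neg_distrib]
    rw [Finset.sum_comm]
    exact Finset.sum_congr rfl fun b _ => Finset.sum_congr rfl fun p _ =>
      Finset.sum_congr rfl fun q _ => Finset.sum_congr rfl fun k _ => by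
        rw [h.swap23 i b p q]; ring
  have g1 : ∑ b, ∑ c, ∑ d, φ i b c d * N a b c d = phiGradT 1 φ N i a := by
    simp only [phiGradT, raiseLast3_one]
  have g2 : ∑ b, ∑ c, ∑ d, φ i b c d * N b a c d = phiCurlT 1 φ N i a := by
    simp only [phiCurlT, raiseLast3_one]
  rw [r, s1, s2, s3, s4, s5, g1, g2] at e
  rw [ricciContraction_one]
  linarith

omit t23 in
-- The Ricci contraction is symmetric, while its expression through the torsion is not visibly so.
-- The skew part of that expression is zero, and the divergence is the one term in it that is purely
-- skew.
theorem divergence_eq (m n) : divergence N m n = (1 / 2) * skewPart (phiGradT 1 φ N) m n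
    - (1 / 2) * skewPart (phiCurlT 1 φ N) m n - skewPart (phiTT 1 φ t) m n := by
  have s : ricciContraction 1 R m n = ricciContraction 1 R n m := by
    simp only [ricciContraction_one]
    exact Finset.sum_congr rfl fun c _ => hR.2.2.1 _ _ _ _
  rw [h.ricciContraction_eq t12 n23 n34 hR hS, h.ricciContraction_eq t12 n23 n34 hR hS] at s
  have d : divergence N n m = -divergence N m n := by
    simp only [divergence, n34 _ _ m n, Finset.sum_neg_distrib]
  have c : contractTT 1 t n m = contractTT 1 t m n := by
    simp only [contractTT, raise2_one, mul_comm]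
  rw [d, c] at s
  simp only [skewPart]
  linarith

omit t23 in
theorem ricciContraction_frame (a b) : ricciContraction 1 R a b =
    -(1 / 2) * symPart (phiGradT 1 φ N) a b + (1 / 2) * symPart (phiCurlT 1 φ N) a b
      + contractTT 1 t a b + symPart (phiTT 1 φ t) a b := by
  have s := h.ricciContraction_eq t12 n23 n34 hR hS a b
  rw [h.divergence_eq t12 n23 n34 hR hS] at s
  have c : contractTT 1 t b a = contractTT 1 t a b := by
    simp only [contractTT, raise2_one, mul_comm]
  rw [s, c]
  simp only [skewPart, symPart]
  ring

omit t23 in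
theorem scalarCurvature_frame : ∑ a, ricciContraction 1 R a a =
    -(∑ a, ∑ b, ∑ c, ∑ d, raise4 1 φ a b c d * N a b c d)
      + ∑ a, ∑ b, ∑ c, raise3 1 t a b c * t a b c
      + ∑ a, ∑ b, ∑ c, ∑ d, ∑ p, raise4 1 φ a b c d * raise1 1 t a b p * t c d p := by
  have e : ∀ X : Tensor2, ∀ a, symPart X a a = X a a := fun X a => by rw [symPart]; ring
  -- The traces of the two derivative terms are opposite, so the coefficients -1/2 and 1/2 of the
  -- Ricci formula add up to -1.
  have g : ∑ a, phiCurlT 1 φ N a a = -∑ a, phiGradT 1 φ N a a := by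
    simp only [phiCurlT, phiGradT, raiseLast3_one, ← Finset.sum_neg_distrib]
    rw [Finset.sum_comm]
    refine Finset.sum_congr rfl fun p _ => Finset.sum_congr rfl fun k _ =>
        Finset.sum_congr rfl fun l _ => Finset.sum_congr rfl fun a _ => ?_
    rw [h.swap12 p k]
    ring
  have g1 : ∑ a, phiGradT 1 φ N a a = ∑ a, ∑ b, ∑ c, ∑ d, raise4 1 φ a b c d * N a b c d := by
    simp only [phiGradT, raiseLast3_one, raise4_one]
  have g2 : ∑ a, contractTT 1 t a a = ∑ a, ∑ b, ∑ c, raise3 1 t a b c * t a b c := by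
    simp only [contractTT, raise2_one, raise3_one]
  have g3 : ∑ a, phiTT 1 φ t a a =
      ∑ a, ∑ b, ∑ c, ∑ d, ∑ p, raise4 1 φ a b c d * raise1 1 t a b p * t c d p := by
    simp only [phiTT, raise1_one, raiseLast3_one, raise4_one]
  simp only [h.ricciContraction_frame t12 n23 n34 hR hS, e, Finset.sum_add_distrib,
    ← Finset.mul_sum, g, g1, g2, g3]
  ring

/-- The left side is the divergence of four times the intrinsic torsion, expanded by the product
rule with `∇_a φ = t_a · φ`. Its only unknown is `φ_{mn}^{kl}` contracted with the divergence of
`T`. Contracting `divergence_eq` with `φ` gives a linear equation for it, whose solution is twice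
the sum of the skew parts of the curl and quadratic terms. -/
theorem divergence_frame (m n) :
    ∑ a, (N a a m n - (1 / 2) * ∑ k, ∑ l, (derivation4 (t a) φ m n k l * t a k l
      + φ m n k l * N a a k l)) =
    (1 / 2) * skewPart (phiGradT 1 φ N) m n - (3 / 2) * skewPart (phiCurlT 1 φ N) m n
      - 3 * skewPart (phiTT 1 φ t) m n := by
  have k1 : ∑ a, ∑ k, ∑ l, φ m n k l * N a a k l = ∑ k, ∑ l, φ m n k l * divergence N k l := by
    simp only [divergence, Finset.mul_sum]
    rw [sum_rot3]
  have k2 : ∑ a, N a a m n = divergence N m n := rfl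
  have k3 : ∑ k, ∑ l, φ m n k l * divergence N k l =
      (1 / 2) * ∑ k, ∑ l, φ m n k l * phiGradT 1 φ N k l
      - (1 / 2) * ∑ k, ∑ l, φ m n k l * phiCurlT 1 φ N k l
      - ∑ k, ∑ l, φ m n k l * phiTT 1 φ t k l := by
    have sk : ∀ X : Tensor2, ∑ k, ∑ l, φ m n k l * skewPart X k l = ∑ k, ∑ l, φ m n k l * X k l :=
      fun X => by
      have : ∑ k, ∑ l, φ m n k l * X l k = -∑ k, ∑ l, φ m n k l * X k l := by
        rw [Finset.sum_comm]
        simp only [← Finset.sum_neg_distrib]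
        refine Finset.sum_congr rfl fun k _ => Finset.sum_congr rfl fun l _ => ?_
        rw [h.swap34 m n k l, neg_mul]
      have e : ∀ k l, φ m n k l * skewPart X k l =
          (1 / 2) * (φ m n k l * X k l) - (1 / 2) * (φ m n k l * X l k) := fun k l => by
        rw [skewPart]; ring
      simp only [e, Finset.sum_sub_distrib, ← Finset.mul_sum, this]
      ring
    rw [← sk (phiGradT 1 φ N), ← sk (phiCurlT 1 φ N), ← sk (phiTT 1 φ t)]
    have e : ∀ k l, φ m n k l * divergence N k l =
        (1 / 2) * (φ m n k l * skewPart (phiGradT 1 φ N) k l)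
          - (1 / 2) * (φ m n k l * skewPart (phiCurlT 1 φ N) k l)
          - φ m n k l * skewPart (phiTT 1 φ t) k l := fun k l => by
      rw [h.divergence_eq t12 n23 n34 hR hS]; ring
    simp only [e, Finset.sum_sub_distrib, ← Finset.mul_sum]
  have f1 := h.contract_phiGradT n23 n34 m n
  have f2 := h.contract_phiCurlT n23 n34 m n
  have f3 := h.contract_phiTT t12 m n
  have f4 := h.contract_derivation4_torsion t12 t23 m n
  have f5 := h.divergence_eq t12 n23 n34 hR hS m n
  simp only [Finset.sum_sub_distrib, ← Finset.mul_sum, Finset.sum_add_distrib, k1, k2, f4]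
  linarith

end

end IsSpinTensor

/-! ## The dimension of the space of curvature tensors of type `168` -/

/-- The dimensions of the spaces of tensors are computed as traces of projections, and the trace on
tensors as a sum over components. -/
theorem trace_pi {ι M : Type*} [Fintype ι] [DecidableEq ι] [AddCommGroup M] [Module ℝ M]
    [Module.Free ℝ M] [Module.Finite ℝ M] (f : (ι → M) →ₗ[ℝ] (ι → M)) :
    LinearMap.trace ℝ (ι → M) f =
      ∑ i, LinearMap.trace ℝ M (LinearMap.proj i ∘ₗ f ∘ₗ LinearMap.single ℝ (fun _ => M) i) := by
  have e : f = ∑ i, (f ∘ₗ LinearMap.single ℝ (fun _ => M) i) ∘ₗ LinearMap.proj i := by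
    refine LinearMap.ext fun x => ?_
    conv_lhs => rw [← LinearMap.sum_single_apply (fun _ : ι => M) x]
    simp
  conv_lhs => rw [e]
  rw [map_sum]
  exact Finset.sum_congr rfl fun i _ => LinearMap.trace_comp_comm' _ _

theorem trace_real (f : ℝ →ₗ[ℝ] ℝ) : LinearMap.trace ℝ ℝ f = f 1 := by
  have : f = f 1 • LinearMap.id := by ext; simp
  conv_lhs => rw [this]
  simp

/-- The tensors with one component equal to one. -/
def unit2 (a b : Fin 8) : Tensor2 := fun i j => kron a i * kron b j

def unit4 (a b c d : Fin 8) : Tensor4 := fun i j k l =>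
  kron a i * (kron b j * (kron c k * kron d l))

theorem single_eq_kron {M : Type*} [AddCommGroup M] [Module ℝ M] (a : Fin 8) (x : M) (i : Fin 8) :
    (Pi.single a x : Fin 8 → M) i = (kron a i : ℝ) • x := by
  by_cases h : a = i
  · subst h; simp [kron]
  · simp [kron, h]

theorem trace_tensor2 (f : Tensor2 →ₗ[ℝ] Tensor2) :
    LinearMap.trace ℝ Tensor2 f = ∑ a, ∑ b, f (unit2 a b) a b := by
  simp only [trace_pi, trace_real, LinearMap.coe_comp, Function.comp_apply, LinearMap.proj_apply]
  refine Finset.sum_congr rfl fun a _ => Finset.sum_congr rfl fun b _ => ?_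
  refine congrArg (fun S : Tensor2 => f S a b) ?_
  funext i j
  simp [single_eq_kron, unit2]

theorem trace_tensor4 (f : Tensor4 →ₗ[ℝ] Tensor4) :
    LinearMap.trace ℝ Tensor4 f = ∑ a, ∑ b, ∑ c, ∑ d, f (unit4 a b c d) a b c d := by
  simp only [trace_pi, trace_real, LinearMap.coe_comp, Function.comp_apply, LinearMap.proj_apply]
  refine Finset.sum_congr rfl fun a _ => Finset.sum_congr rfl fun b _ =>
    Finset.sum_congr rfl fun c _ => Finset.sum_congr rfl fun d _ => ?_
  refine congrArg (fun S : Tensor4 => f S a b c d) ?_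
  funext i j k l
  simp [single_eq_kron, unit4]

theorem finrank_of_isProj {M : Type*} [AddCommGroup M] [Module ℝ M] [Module.Finite ℝ M]
    {p : Submodule ℝ M} {f : M →ₗ[ℝ] M} (h1 : ∀ x, f x ∈ p) (h2 : ∀ x ∈ p, f x = x) (n : ℕ)
    (hn : LinearMap.trace ℝ M f = n) : Module.finrank ℝ p = n := by
  have := LinearMap.IsProj.trace (p := p) (f := f) ⟨h1, h2⟩
  rw [hn] at this
  exact_mod_cast this.symm

/-- Alternating tensors of rank four. -/
def alternating4 : Submodule ℝ Tensor4 where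
  carrier := {S | (∀ i j k l, S j i k l = -S i j k l) ∧ (∀ i j k l, S i k j l = -S i j k l) ∧
    ∀ i j k l, S i j l k = -S i j k l}
  zero_mem' := by simp
  add_mem' := by
    rintro S S' ⟨h1, h2, h3⟩ ⟨k1, k2, k3⟩
    refine ⟨fun a b c d => ?_, fun a b c d => ?_, fun a b c d => ?_⟩ <;>
      simp only [Pi.add_apply]
    · linarith [h1 a b c d, k1 a b c d]
    · linarith [h2 a b c d, k2 a b c d]
    · linarith [h3 a b c d, k3 a b c d]
  smul_mem' := by
    rintro r S ⟨h1, h2, h3⟩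
    refine ⟨fun a b c d => ?_, fun a b c d => ?_, fun a b c d => ?_⟩ <;>
      simp only [Pi.smul_apply, smul_eq_mul]
    · rw [h1 a b c d, mul_neg]
    · rw [h2 a b c d, mul_neg]
    · rw [h3 a b c d, mul_neg]

/-- The alternation of a tensor in its last three indices. -/
def alternateLast3 (S : Tensor4) (i j k l : Fin 8) : ℝ :=
  S i j k l + S i k l j + S i l j k - S i k j l - S i j l k - S i l k j

/-- The projection to alternating tensors. -/
noncomputable def alternation4 : Tensor4 →ₗ[ℝ] Tensor4 where
  toFun S := fun i j k l => (1 / 24) * (alternateLast3 S i j k l - alternateLast3 S j i k l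
    + alternateLast3 S k i j l - alternateLast3 S l i j k)
  map_add' S S' := by
    funext i j k l; simp only [alternateLast3, Pi.add_apply]; ring
  map_smul' r S := by
    funext i j k l; simp only [alternateLast3, Pi.smul_apply, smul_eq_mul, RingHom.id_apply]; ring

theorem finrank_alternating4 : Module.finrank ℝ alternating4 = 70 := by
  refine finrank_of_isProj (p := alternating4) (f := alternation4) (fun S => ⟨?_, ?_, ?_⟩) ?_ 70 ?_
  · intro i j k l
    simp only [alternation4, alternateLast3, LinearMap.coe_mk, AddHom.coe_mk]; ring
  · intro i j k l
    simp only [alternation4, alternateLast3, LinearMap.coe_mk, AddHom.coe_mk]; ring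
  · intro i j k l
    simp only [alternation4, alternateLast3, LinearMap.coe_mk, AddHom.coe_mk]; ring
  · rintro S ⟨h1, h2, h3⟩
    have c1 : ∀ i j k l, S i k l j = S i j k l := fun i j k l => by rw [h3 i k j l, h2]; ring
    have e : ∀ i j k l, alternateLast3 S i j k l = 6 * S i j k l := fun i j k l => by
      rw [alternateLast3, h2 i j k l, h3 i j k l, h3 i l j k, c1 i j k l, ← c1 i l j k]; ring
    funext i j k l
    simp only [alternation4, LinearMap.coe_mk, AddHom.coe_mk, e]
    rw [h1 i j k l, h1 i k j l, h2 i j k l, h1 i l j k, ← c1 i l j k]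
    ring
  · rw [trace_tensor4]
    -- The summand is 1 for the `8 · 7 · 6 · 5` tuples of distinct indices and 0 otherwise. Division
    -- by 24 gives the 70 of `finrank_alternating4`.
    have key : ∑ a, ∑ b, ∑ c, ∑ d, kronDet4 a b c d a b c d = 1680 := by
      simp only [Fin.sum_univ_succ, Fin.sum_univ_zero]
      decide +kernel
    have e : ∀ a b c d, alternation4 (unit4 a b c d) a b c d =
        (1 / 24) * ((kronDet4 a b c d a b c d : ℤ) : ℝ) := fun a b c d => by
      obtain ⟨δ, hδ, hk, hd⟩ : ∃ δ : Fin 8 → Fin 8 → ℤ,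
          (∀ p q x, (if p = q then x else 0) = δ p q * x) ∧ (∀ p q, (kron p q : ℝ) = δ p q) ∧
            ∀ p, δ p p = 1 :=
        ⟨fun p q => if p = q then 1 else 0, fun p q x => by by_cases h : p = q <;> simp [h],
          fun p q => by by_cases h : p = q <;> simp [h, kron], fun p => by simp⟩
      simp only [alternation4, alternateLast3, unit4, LinearMap.coe_mk, AddHom.coe_mk, kronDet4,
        kronDet3, kronDet2, hδ, hk, hd, if_true]
      push_cast
      ring
    simp only [e, ← Finset.mul_sum]
    have key' := congrArg (Int.cast : ℤ → ℝ) key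
    push_cast at key'
    rw [key']
    norm_num

/-! ### The space `Λ²₂₁ ⊗_S Λ²₂₁` -/

/-- The projection of a tensor of rank two to `Λ²₂₁`. -/
noncomputable def proj21 (φ : Tensor4) : Tensor2 →ₗ[ℝ] Tensor2 where
  -- On 2-forms this is `3/4 + φ/8`, which is 1 at the eigenvalue 2 and 0 at the eigenvalue -6;
  -- symmetric tensors are mapped to 0.
  toFun β := fun i j => (3 / 8) * (β i j - β j i) + (1 / 8) * ∑ p, ∑ q, φ i j p q * β p q
  map_add' β β' := by
    funext i j
    simp only [Pi.add_apply, mul_add, Finset.sum_add_distrib]; ring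
  map_smul' r β := by
    funext i j
    simp only [Pi.smul_apply, smul_eq_mul, mul_left_comm _ r, ← Finset.mul_sum, RingHom.id_apply]
    ring

/-- Exchange of the two pairs of indices. -/
def pairSwap : Tensor4 →ₗ[ℝ] Tensor4 where
  toFun S := fun a b i j => S i j a b
  map_add' _ _ := rfl
  map_smul' _ _ := rfl

/-- The projection to `Λ²₂₁` in the last pair of indices. -/
noncomputable def projLast21 (φ : Tensor4) : Tensor4 →ₗ[ℝ] Tensor4 where
  toFun S := fun a b => proj21 φ (S a b)
  map_add' S S' := by funext a b; simp only [Pi.add_apply, map_add]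
  map_smul' r S := by funext a b; simp only [Pi.smul_apply, map_smul, RingHom.id_apply]

/-- The projection to `Λ²₂₁ ⊗ Λ²₂₁`. -/
noncomputable def projBoth21 (φ : Tensor4) : Tensor4 →ₗ[ℝ] Tensor4 :=
  projLast21 φ ∘ₗ pairSwap ∘ₗ projLast21 φ ∘ₗ pairSwap

/-- The 2-forms of type `21`. -/
def IsForm21 (φ : Tensor4) (β : Tensor2) : Prop :=
  (∀ i j, β j i = -β i j) ∧ ∀ i j, ∑ p, ∑ q, φ i j p q * β p q = 2 * β i j

/-- The tensors in `Λ²₂₁ ⊗_S Λ²₂₁`. -/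
def symSquare21 (φ : Tensor4) : Submodule ℝ Tensor4 where
  carrier := {S | (∀ a b i j, S i j a b = S a b i j) ∧ ∀ a b, IsForm21 φ (S a b)}
  zero_mem' := by simp [IsForm21]
  add_mem' := by
    rintro S S' ⟨h1, h2⟩ ⟨k1, k2⟩
    refine ⟨fun a b i j => ?_, fun a b => ⟨fun i j => ?_, fun i j => ?_⟩⟩ <;>
      simp only [Pi.add_apply]
    · rw [h1 a b i j, k1 a b i j]
    · rw [(h2 a b).1 i j, (k2 a b).1 i j]; ring
    · simp only [mul_add, Finset.sum_add_distrib, (h2 a b).2, (k2 a b).2]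
  smul_mem' := by
    rintro r S ⟨h1, h2⟩
    refine ⟨fun a b i j => ?_, fun a b => ⟨fun i j => ?_, fun i j => ?_⟩⟩ <;>
      simp only [Pi.smul_apply, smul_eq_mul]
    · rw [h1 a b i j]
    · rw [(h2 a b).1 i j, mul_neg]
    · simp only [mul_left_comm _ r, ← Finset.mul_sum, (h2 a b).2]

theorem pairSwap_apply (S : Tensor4) (a b i j) : pairSwap S a b i j = S i j a b := rfl

theorem projLast21_apply (φ S : Tensor4) (a b) : projLast21 φ S a b = proj21 φ (S a b) := rfl

theorem proj21_apply (φ : Tensor4) (β : Tensor2) (i j) : proj21 φ β i j =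
    (3 / 8) * (β i j - β j i) + (1 / 8) * ∑ p, ∑ q, φ i j p q * β p q := rfl

theorem proj21_unit2 (φ : Tensor4) (p q i j : Fin 8) : proj21 φ (unit2 p q) i j =
    (3 / 8) * (kron p i * kron q j - kron p j * kron q i) + (1 / 8) * φ i j p q := by
  have : ∀ x y, φ i j x y * (kron p x * kron q y) = kron p x * (kron q y * φ i j x y) :=
    fun x y => by ring
  simp only [proj21_apply, unit2, this, ← Finset.mul_sum, sum_kron_mul]

namespace IsSpinTensor

variable {φ : Tensor4} (h : IsSpinTensor φ)
include h

theorem sum_sum_mul (β : Tensor2) (i j) :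
    ∑ a, ∑ b, φ i j a b * ∑ p, ∑ q, φ a b p q * β p q =
      6 * β i j - 6 * β j i - 4 * ∑ p, ∑ q, φ i j p q * β p q := by
  have e1 : ∑ a, ∑ b, φ i j a b * ∑ p, ∑ q, φ a b p q * β p q =
      ∑ p, ∑ q, (∑ a, ∑ b, φ i j a b * φ p q a b) * β p q := by
    simp only [Finset.mul_sum, Finset.sum_mul]
    refine (sum_rot4 _).trans ((sum_rot4 _).trans ?_)
    refine Finset.sum_congr rfl fun p _ => Finset.sum_congr rfl fun q _ =>
      Finset.sum_congr rfl fun a _ => Finset.sum_congr rfl fun b _ => ?_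
    rw [h.pair_swap p q a b, mul_assoc]
  have e3 : ∀ p q, (∑ a, ∑ b, φ i j a b * φ p q a b) * β p q =
      kron i p * (kron j q * (6 * β p q)) - kron j p * (kron i q * (6 * β p q))
        - 4 * (φ i j p q * β p q) := fun p q => by
    rw [h.contract_two]; ring
  rw [e1]
  simp only [e3, Finset.sum_sub_distrib, ← Finset.mul_sum, sum_kron_mul]

theorem sum_sum_mul_swap (β : Tensor2) (i j) :
    ∑ p, ∑ q, φ i j p q * β q p = -∑ p, ∑ q, φ i j p q * β p q := by
  rw [Finset.sum_comm]
  simp only [← Finset.sum_neg_distrib]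
  refine Finset.sum_congr rfl fun k _ => Finset.sum_congr rfl fun l _ => ?_
  rw [h.swap34 i j k l, neg_mul]

theorem isForm21_proj21 (β : Tensor2) : IsForm21 φ (proj21 φ β) := by
  constructor
  · intro i j
    simp only [proj21_apply, h.swap12 i j, neg_mul, Finset.sum_neg_distrib]
    ring
  · intro i j
    have e : ∀ p q, φ i j p q * proj21 φ β p q = (3 / 8) * (φ i j p q * β p q)
      - (3 / 8) * (φ i j p q * β q p)
      + (1 / 8) * (φ i j p q * ∑ a, ∑ b, φ p q a b * β a b) := fun p q => by
      rw [proj21_apply]; ring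
    simp only [e, Finset.sum_add_distrib, Finset.sum_sub_distrib, ← Finset.mul_sum, h.sum_sum_mul,
      h.sum_sum_mul_swap β]
    rw [proj21_apply]
    ring

omit h in
theorem _root_.IsForm21.proj21_eq {β : Tensor2} (hb : IsForm21 φ β) : proj21 φ β = β := by
  funext i j
  rw [proj21_apply, hb.1 i j, hb.2]
  ring

omit h in
theorem projBoth21_apply (S : Tensor4) (a b i j) : projBoth21 φ S a b i j =
    proj21 φ (fun p q => proj21 φ (fun r s => S r s p q) a b) i j := rfl

omit h in
/-- The projections in the two pairs of indices commute. -/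
theorem projBoth21_comm (S : Tensor4) :
    pairSwap (projBoth21 φ S) = projBoth21 φ (pairSwap S) := by
  funext a b i j
  have e : ∑ p, ∑ q, ∑ r, ∑ s, φ a b p q * (φ i j r s * S r s p q) =
      ∑ p, ∑ q, ∑ r, ∑ s, φ i j p q * (φ a b r s * S p q r s) := by
    refine (sum_rot4 _).trans ((sum_rot4 _).trans ?_)
    simp only [mul_left_comm]
  have e2 : ∀ F A B X : Tensor2, ∑ p, ∑ q, F p q * ((3 / 8) * (A p q - B p q) + (1 / 8) * X p q) =
      (3 / 8) * ∑ p, ∑ q, F p q * A p q - (3 / 8) * ∑ p, ∑ q, F p q * B p q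
        + (1 / 8) * ∑ p, ∑ q, F p q * X p q := fun F A B X => by
    simp only [Finset.mul_sum, ← Finset.sum_sub_distrib, ← Finset.sum_add_distrib]
    refine Finset.sum_congr rfl fun p _ => Finset.sum_congr rfl fun q _ => ?_
    ring
  simp only [← Finset.mul_sum] at e
  simp only [pairSwap_apply, projBoth21_apply, proj21_apply, e2]
  rw [e]
  ring

/-- The last pair is of type 21 because that projection acts last. The pair symmetry survives since
the projections in the two pairs commute. -/
theorem projBoth21_mem {S : Tensor4} (hs : ∀ a b i j, S i j a b = S a b i j) :
    projBoth21 φ S ∈ symSquare21 φ := by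
  refine ⟨fun a b i j => ?_, fun a b => h.isForm21_proj21 _⟩
  have := congrFun (congrFun (congrFun (congrFun (projBoth21_comm (φ := φ) S) a) b) i) j
  rw [pairSwap_apply] at this
  rw [this]
  have : pairSwap S = S := by funext a b i j; exact hs _ _ _ _
  rw [this]

omit h in
theorem projBoth21_of_mem {S : Tensor4} (hs : S ∈ symSquare21 φ) : projBoth21 φ S = S := by
  have e : pairSwap S = S := by funext a b i j; exact hs.1 _ _ _ _
  have e2 : projLast21 φ S = S := by
    funext a b
    rw [projLast21_apply, (hs.2 a b).proj21_eq]
  simp only [projBoth21, LinearMap.coe_comp, Function.comp_apply, e, e2]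

omit h in
theorem proj21_mul (r : ℝ) (β : Tensor2) (i j) :
    proj21 φ (fun p q => r * β p q) i j = r * proj21 φ β i j :=
  congrFun (congrFun ((proj21 φ).map_smul r β) i) j

omit h in
theorem projBoth21_unit4 (a b c d x y u v) : projBoth21 φ (unit4 a b c d) x y u v =
    proj21 φ (unit2 a b) x y * proj21 φ (unit2 c d) u v := by
  have e : ∀ p q, (fun r s => unit4 a b c d r s p q) = fun r s => unit2 c d p q * unit2 a b r s :=
    fun p q => by funext r s; simp only [unit4, unit2]; ring
  rw [projBoth21_apply]
  simp only [e, proj21_mul]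
  simp only [mul_comm _ (proj21 φ (unit2 a b) x y), proj21_mul]

omit h in
theorem sum_proj21_unit2_mul (β : Tensor2) (a b) :
    ∑ c, ∑ d, proj21 φ (unit2 c d) a b * β c d = proj21 φ β a b := by
  have e : ∀ c d, proj21 φ (unit2 c d) a b * β c d =
      kron a c * (kron b d * ((3 / 8) * β c d)) - kron b c * (kron a d * ((3 / 8) * β c d))
        + (1 / 8) * (φ a b c d * β c d) := fun c d => by
    rw [proj21_unit2, kron_comm c a, kron_comm d b, kron_comm c b, kron_comm d a]; ring
  simp only [e, Finset.sum_add_distrib, Finset.sum_sub_distrib, ← Finset.mul_sum, sum_kron_mul]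
  rw [proj21_apply]
  ring

theorem sum_proj21_unit2 : ∑ a, ∑ b, proj21 φ (unit2 a b) a b = 21 := by
  have z : ∀ a b, φ a b a b = 0 := fun a b => h.zero13 a b b
  have e : ∀ a b : Fin 8, proj21 φ (unit2 a b) a b = 3 / 8 - kron a b * (kron b a * (3 / 8)) :=
    fun a b => by rw [proj21_unit2, z, kron_self, kron_self, kron_comm b a]; ring
  simp only [e, Finset.sum_sub_distrib, sum_kron_mul, kron_self]
  simp
  norm_num

/-- The trace of the projection is `(21² + 21)/2`: the identity contributes the square of the trace
of `proj21`, and the exchange of the pairs contributes the trace of `proj21` itself. -/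
theorem finrank_symSquare21 : Module.finrank ℝ (symSquare21 φ) = 231 := by
  refine finrank_of_isProj (p := symSquare21 φ)
    (f := projBoth21 φ ∘ₗ ((1 / 2 : ℝ) • (LinearMap.id + pairSwap))) (fun S => ?_) (fun S hs => ?_)
    231 ?_
  · refine h.projBoth21_mem fun a b i j => ?_
    simp only [LinearMap.smul_apply, LinearMap.add_apply, LinearMap.id_apply, Pi.smul_apply,
      Pi.add_apply, pairSwap_apply]
    rw [add_comm]
  · have e : pairSwap S = S := by funext a b i j; exact hs.1 _ _ _ _
    simp only [LinearMap.coe_comp, Function.comp_apply, LinearMap.smul_apply, LinearMap.add_apply,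
      LinearMap.id_apply, e, map_smul, map_add, projBoth21_of_mem hs]
    rw [← two_smul ℝ S, smul_smul]
    norm_num
  · rw [trace_tensor4]
    have sw : ∀ a b c d, pairSwap (unit4 a b c d) = unit4 c d a b := fun a b c d => by
      funext i j k l; simp only [pairSwap_apply, unit4]; ring
    simp only [LinearMap.coe_comp, Function.comp_apply, LinearMap.smul_apply, LinearMap.add_apply,
      LinearMap.id_apply, map_smul, map_add, sw, Pi.smul_apply, Pi.add_apply, projBoth21_unit4,
      smul_eq_mul, mul_add, Finset.sum_add_distrib, ← Finset.mul_sum, sum_proj21_unit2_mul,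
      (h.isForm21_proj21 _).proj21_eq, ← Finset.sum_mul, h.sum_proj21_unit2]
    norm_num

end IsSpinTensor

/-! ### 4-forms whose contraction with the Cayley form is symmetric -/

/-- The 2-forms of type `7`. -/
def forms7 (φ : Tensor4) : Submodule ℝ Tensor2 where
  carrier := {β | (∀ i j, β j i = -β i j) ∧ ∀ i j, ∑ p, ∑ q, φ i j p q * β p q = -6 * β i j}
  zero_mem' := by simp
  add_mem' := by
    rintro S S' ⟨h1, h2⟩ ⟨k1, k2⟩
    refine ⟨fun i j => ?_, fun i j => ?_⟩ <;> simp only [Pi.add_apply]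
    · rw [h1 i j, k1 i j]; ring
    · simp only [mul_add, Finset.sum_add_distrib, h2, k2]
  smul_mem' := by
    rintro r S ⟨h1, h2⟩
    refine ⟨fun i j => ?_, fun i j => ?_⟩ <;> simp only [Pi.smul_apply, smul_eq_mul]
    · rw [h1 i j, mul_neg]
    · simp only [mul_left_comm _ r, ← Finset.mul_sum, h2]

/-- The alternation of a tensor of rank two. -/
noncomputable def alternation2 : Tensor2 →ₗ[ℝ] Tensor2 where
  toFun β := fun i j => (1 / 2) * (β i j - β j i)
  map_add' β β' := by funext i j; simp only [Pi.add_apply]; ring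
  map_smul' r β := by funext i j; simp only [Pi.smul_apply, smul_eq_mul, RingHom.id_apply]; ring

theorem alternation2_apply (β : Tensor2) (i j) : alternation2 β i j = (1 / 2) * (β i j - β j i) :=
  rfl

/-- The sum over the cyclic permutations of the last three indices. -/
def bianchiSum : Tensor4 →ₗ[ℝ] Tensor4 where
  toFun S := fun a b c d => S a b c d + S a c d b + S a d b c
  map_add' S S' := by funext a b c d; simp only [Pi.add_apply]; ring
  map_smul' r S := by
    funext a b c d; simp only [Pi.smul_apply, smul_eq_mul, RingHom.id_apply]; ring

theorem bianchiSum_apply (S : Tensor4) (a b c d) :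
    bianchiSum S a b c d = S a b c d + S a c d b + S a d b c := rfl

/-- A tensor with skew pairs that satisfies the Bianchi identity is symmetric in its pairs. -/
theorem pair_symm_of_bianchi {S : Tensor4} (h12 : ∀ a b c d, S b a c d = -S a b c d)
    (h34 : ∀ a b c d, S a b d c = -S a b c d) (hb : ∀ a b c d, S a b c d + S a c d b + S a d b c = 0)
    (a b c d) : S a b c d = S c d a b := by
  linarith [hb a b c d, hb b c d a, hb c d a b, hb d a b c, h12 a b c d, h12 b c d a, h12 c d a b,
    h12 d a b c, h12 a c d b, h12 b d a c, h34 a b c d, h34 b c d a, h34 c d a b, h34 d a b c,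
    h34 a c d b, h34 b d a c, h12 a c b d, h12 b d c a]

namespace IsSpinTensor

variable {φ : Tensor4} (h : IsSpinTensor φ)
include h

theorem alternation2_sub_proj21_mem (β : Tensor2) : alternation2 β - proj21 φ β ∈ forms7 φ := by
  refine ⟨fun i j => ?_, fun i j => ?_⟩
  · simp only [Pi.sub_apply, alternation2_apply, (h.isForm21_proj21 β).1 i j]; ring
  · simp only [Pi.sub_apply, mul_sub, Finset.sum_sub_distrib, (h.isForm21_proj21 β).2]
    have e : ∀ p q, φ i j p q * alternation2 β p q =
        (1 / 2) * (φ i j p q * β p q) - (1 / 2) * (φ i j p q * β q p) := fun p q => by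
      rw [alternation2_apply]; ring
    simp only [e, Finset.sum_sub_distrib, ← Finset.mul_sum, h.sum_sum_mul_swap β]
    rw [proj21_apply, alternation2_apply]
    ring

/-- The complementary projection has trace 28 - 21. -/
theorem finrank_forms7 : Module.finrank ℝ (forms7 φ) = 7 := by
  refine finrank_of_isProj (p := forms7 φ) (f := alternation2 - proj21 φ)
    (fun β => h.alternation2_sub_proj21_mem β) (fun β hb => ?_) 7 ?_
  · funext i j
    simp only [LinearMap.sub_apply, Pi.sub_apply, alternation2_apply, proj21_apply, hb.1 i j, hb.2]
    ring
  · rw [trace_tensor2]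
    have e : ∀ a b : Fin 8, alternation2 (unit2 a b) a b =
        1 / 2 - kron a b * (kron b a * (1 / 2)) := fun a b => by
      rw [alternation2_apply]; simp only [unit2]
      rw [kron_self, kron_self, kron_comm b a]; ring
    simp only [LinearMap.sub_apply, Pi.sub_apply, Finset.sum_sub_distrib, h.sum_proj21_unit2]
    simp only [e, Finset.sum_sub_distrib, sum_kron_mul, kron_self]
    simp
    norm_num

/-- By `contract_tensor`, applied to `X_k` with `k` afterwards summed over an index it shares with
the form. It says that the skew part of the contraction has eigenvalue -6. -/
theorem sum_mul_tripleContraction {X : Tensor4} (hX : X ∈ alternating4) (m n) :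
    ∑ k, ∑ l, φ m n k l * tripleContraction X φ k l =
      -3 * (tripleContraction X φ m n - tripleContraction X φ n m) := by
  obtain ⟨h12, h23, h34⟩ := hX
  have e1 : ∀ k, ∑ l, φ m n k l * tripleContraction X φ k l =
      -∑ a, ∑ b, ∑ c, X k a b c * ∑ p, φ m n k p * φ a b c p := fun k => by
    simp only [tripleContraction, Finset.mul_sum, ← Finset.sum_neg_distrib]
    refine (sum_rot4 _).trans ?_
    refine Finset.sum_congr rfl fun a _ => Finset.sum_congr rfl fun b _ =>
      Finset.sum_congr rfl fun c _ => Finset.sum_congr rfl fun p _ => ?_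
    rw [h.rot p a b c]
    ring
  have x13 : ∀ i j k, X i j i k = 0 := fun i j k => by linarith [h23 i i j k, h12 i i j k]
  have x12 : ∀ i j k, X i i j k = 0 := fun i j k => by linarith [h12 i i j k]
  have x14 : ∀ i j k, X i j k i = 0 := fun i j k => by linarith [h34 i j i k, x13 i j k]
  have cy : ∀ i j k l, X i k l j = X i j k l := fun i j k l => by
    rw [h34 i k j l, h23 i j k l, neg_neg]
  have e2 : ∀ k a b, (X k m a b + X k b m a + X k a b m) * φ n k a b
      + (X k n a b + X k b n a + X k a b n) * φ k m a b
      + (X k k a b + X k b k a + X k a b k) * φ m n a b =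
      3 * (X n k a b * φ m k a b) - 3 * (X m k a b * φ n k a b) := fun k a b => by
    rw [x12, x13, x14, cy k m a b, ← cy k b m a, cy k n a b, ← cy k b n a, h12 m k, h12 n k,
      h.swap12 m k]
    ring
  have e3 : ∀ k, ∑ l, φ m n k l * tripleContraction X φ k l = ∑ a, ∑ b,
      (3 * (X n k a b * φ m k a b) - 3 * (X m k a b * φ n k a b)) := fun k => by
    rw [e1, h.contract_tensor, Finset.sum_congr rfl fun a _ => Finset.sum_congr rfl fun b _ =>
      e2 k a b, x13, x12, x14, x13, x12, x14]
    ring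
  simp only [e3, Finset.sum_sub_distrib, ← Finset.mul_sum]
  rw [tripleContraction, tripleContraction]
  ring

theorem derivation4_mem_alternating4 (β : Tensor2) : derivation4 β φ ∈ alternating4 := by
  refine ⟨fun i j k l => ?_, fun i j k l => ?_, fun i j k l => ?_⟩ <;>
    simp only [derivation4, ← Finset.sum_neg_distrib] <;>
    refine Finset.sum_congr rfl fun p _ => ?_
  · linear_combination β j p * h.swap12 i p k l + β i p * h.swap12 p j k l
      + β k p * h.swap12 i j p l + β l p * h.swap12 i j k p
  · linear_combination β i p * h.swap23 p j k l + β k p * h.swap23 i j p l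
      + β j p * h.swap23 i p k l + β l p * h.swap23 i j k p
  · linear_combination β i p * h.swap34 p j k l + β j p * h.swap34 i p k l
      + β k p * h.swap34 i j p l + β l p * h.swap34 i j k p


/-- The skew part of the contraction of an alternating tensor with a Cayley form is of type `7`. -/
noncomputable def _root_.skewContraction (φ : Tensor4) : Tensor4 →ₗ[ℝ] Tensor2 where
  toFun X := alternation2 (tripleContraction X φ)
  map_add' X Y := by
    have : tripleContraction (X + Y) φ = tripleContraction X φ + tripleContraction Y φ := by
      funext i j
      simp only [tripleContraction, Pi.add_apply, add_mul, Finset.sum_add_distrib]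
    rw [this, map_add]
  map_smul' r X := by
    have : tripleContraction (r • X) φ = r • tripleContraction X φ := by
      funext i j
      simp only [tripleContraction, Pi.smul_apply, smul_eq_mul, mul_assoc, Finset.mul_sum]
    rw [this, map_smul, RingHom.id_apply]

theorem skewContraction_mem {X : Tensor4} (hX : X ∈ alternating4) :
    skewContraction φ X ∈ forms7 φ := by
  refine ⟨fun i j => ?_, fun i j => ?_⟩
  · change alternation2 _ _ _ = -alternation2 _ _ _
    simp only [alternation2_apply]; ring
  · change ∑ p, ∑ q, φ i j p q * alternation2 (tripleContraction X φ) p q =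
      -6 * alternation2 (tripleContraction X φ) i j
    have e : ∀ p q, φ i j p q * alternation2 (tripleContraction X φ) p q =
        (1 / 2) * (φ i j p q * tripleContraction X φ p q)
          - (1 / 2) * (φ i j p q * tripleContraction X φ q p) := fun p q => by
      rw [alternation2_apply]; ring
    simp only [e, Finset.sum_sub_distrib, ← Finset.mul_sum,
      h.sum_sum_mul_swap (tripleContraction X φ), h.sum_mul_tripleContraction hX]
    rw [alternation2_apply]
    ring

/-- Shows that every 2-form of type 7 is the skew contraction of some 4-form. -/
theorem skewContraction_derivation4 {β : Tensor2} (hβ : β ∈ forms7 φ) :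
    skewContraction φ (derivation4 β φ) = (96 : ℝ) • β := by
  change alternation2 (tripleContraction (derivation4 β φ) φ) = _
  rw [h.tripleContraction_derivation4 hβ.1]
  funext i j
  simp only [alternation2_apply, Pi.smul_apply, smul_eq_mul, fourProj7, hβ.2, hβ.1 i j]
  ring

/-- The alternating tensors whose contraction with the Cayley form is symmetric. -/
noncomputable def _root_.symContraction (φ : Tensor4) : Submodule ℝ Tensor4 :=
  alternating4 ⊓ LinearMap.ker (skewContraction φ)

/-- The skew contraction maps the 70-dimensional space of 4-forms onto the 7-dimensional `Λ²₇`, and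
the symmetric ones are its kernel. -/
theorem finrank_symContraction : Module.finrank ℝ (symContraction φ) = 63 := by
  let f : alternating4 →ₗ[ℝ] forms7 φ :=
    (skewContraction φ).restrict fun X hX => h.skewContraction_mem hX
  have hf : Function.Surjective f := fun β =>
    ⟨(1 / 96 : ℝ) • ⟨derivation4 β φ, h.derivation4_mem_alternating4 β⟩, Subtype.ext (by
      rw [map_smul]
      change (1 / 96 : ℝ) • skewContraction φ (derivation4 β φ) = β
      rw [h.skewContraction_derivation4 β.2, smul_smul]
      norm_num)⟩
  have e := LinearMap.finrank_range_add_finrank_ker f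
  rw [LinearMap.range_eq_top.2 hf, finrank_top, h.finrank_forms7, finrank_alternating4] at e
  have e2 : symContraction φ = (LinearMap.ker f).map alternating4.subtype := by
    ext X
    simp only [symContraction, Submodule.mem_inf, LinearMap.mem_ker, Submodule.mem_map,
      Submodule.coe_subtype, Subtype.exists, exists_and_right, exists_eq_right]
    constructor
    · rintro ⟨h1, h2⟩
      exact ⟨h1, Subtype.ext h2⟩
    · rintro ⟨h1, h2⟩
      exact ⟨h1, congrArg Subtype.val h2⟩
  rw [e2, Submodule.finrank_map_subtype_eq]
  omega

omit h in
theorem bianchiSum_mem_alternating4 {S : Tensor4} (hS : S ∈ symSquare21 φ) :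
    bianchiSum S ∈ alternating4 := by
  have s34 : ∀ i j k l, S i j l k = -S i j k l := fun i j k l => (hS.2 i j).1 k l
  have s12 : ∀ i j k l, S j i k l = -S i j k l := fun i j k l => by
    rw [← hS.1 j i k l, s34, hS.1 i j]
  refine ⟨fun i j k l => ?_, fun i j k l => ?_, fun i j k l => ?_⟩ <;>
    simp only [bianchiSum_apply]
  · linarith [s12 i j k l, hS.1 i k j l, hS.1 i l j k, s34 i k j l, s12 j l i k, s34 i k l j,
      hS.1 i k l j, s12 j l k i, s34 j l i k, s12 i l k j, hS.1 i l k j, s34 k j i l, s12 j k i l,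
      s34 i l j k, hS.1 j k l i, hS.1 j k i l, s34 j k i l]
  · linarith [s34 i k j l, s34 i j k l, s34 i l j k, s34 i k l j]
  · linarith [s34 i j k l, s34 i k j l, s34 i l j k, s34 i k l j]

/-- Contracted with `φ`, the three cyclic terms give the same result. Each is twice the Ricci
contraction, as the last pair of `S` is in the eigenspace of eigenvalue 2. Pair symmetry makes the
Ricci contraction symmetric. -/
theorem bianchiSum_mem {S : Tensor4} (hS : S ∈ symSquare21 φ) :
    bianchiSum S ∈ symContraction φ ∧
      ∀ i m, tripleContraction (bianchiSum S) φ i m = 6 * ∑ j, S i j m j := by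
  have c : ∀ i m, tripleContraction (bianchiSum S) φ i m = 6 * ∑ j, S i j m j := fun i m => by
    have e : ∀ i m, ∑ j, ∑ k, ∑ l, S i j k l * φ m j k l = 2 * ∑ j, S i j m j := fun i m => by
      rw [Finset.mul_sum]
      refine Finset.sum_congr rfl fun j _ => ?_
      rw [← (hS.2 i j).2]
      simp only [mul_comm]
    have e1 : ∑ j, ∑ k, ∑ l, S i k l j * φ m j k l = ∑ j, ∑ k, ∑ l, S i j k l * φ m j k l := by
      rw [sum_rot3]
      simp only [h.cyc234]
    have e2 : ∑ j, ∑ k, ∑ l, S i l j k * φ m j k l = ∑ j, ∑ k, ∑ l, S i j k l * φ m j k l := by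
      rw [← sum_rot3]
      simp only [h.cyc234]
    simp only [tripleContraction, bianchiSum_apply, add_mul, Finset.sum_add_distrib, e1, e2, e]
    ring
  refine ⟨⟨bianchiSum_mem_alternating4 hS, ?_⟩, c⟩
  change alternation2 (tripleContraction (bianchiSum S) φ) = 0
  funext i j
  rw [alternation2_apply, c, c]
  have : ∀ p, S j p i p = S i p j p := fun p => hS.1 _ _ _ _
  simp only [this, sub_self, mul_zero, Pi.zero_apply]

end IsSpinTensor

/-! ### Surjectivity of the cyclic sum and the dimension 168 -/

namespace IsSpinTensor

variable {φ : Tensor4} (h : IsSpinTensor φ)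
include h

omit h in
theorem projBoth21_alternating {X : Tensor4} (hX : X ∈ alternating4) (a b i j) :
    16 * projBoth21 φ X a b i j = 9 * X a b i j + (3 / 2) * (pairContraction X φ i j a b
      + pairContraction X φ a b i j)
      + (1 / 4) * ∑ p, ∑ q, φ i j p q * pairContraction X φ p q a b := by
  obtain ⟨h12, h23, h34⟩ := hX
  have ps : ∀ i j k l, X i j k l = X k l i j := fun i j k l => by
    linarith [h23 k i l j, h12 i k l j, h34 i k j l, h23 i j k l]
  have e1 : ∀ p q, proj21 φ (fun r s => X r s p q) a b =
      (3 / 4) * X a b p q + (1 / 8) * pairContraction X φ p q a b := fun p q => by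
    rw [proj21_apply, h12 a b, pairContraction]
    have : ∀ r s, φ a b r s * X r s p q = X p q r s * φ a b r s := fun r s => by
      rw [ps r s]; ring
    simp only [this]
    ring
  have e2 : ∀ p q, φ i j p q * ((3 / 4) * X a b p q + (1 / 8) * pairContraction X φ p q a b) =
      (3 / 4) * (X a b p q * φ i j p q) + (1 / 8) * (φ i j p q * pairContraction X φ p q a b) :=
    fun p q => by ring
  have e3 : pairContraction X φ j i a b = -pairContraction X φ i j a b := by
    simp only [pairContraction, h12 i j, neg_mul, Finset.sum_neg_distrib]
  rw [projBoth21_apply]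
  simp only [e1]
  rw [proj21_apply, e3, h34 a b i j]
  simp only [e2, Finset.sum_add_distrib, ← Finset.mul_sum]
  rw [pairContraction.eq_def X φ a b i j]
  ring

/-- The Ricci contraction of the projected 4-form, in terms of the contraction of the 4-form with
`φ`. Of the terms of `projBoth21_alternating` only the one with three Cayley forms needs
`contract_tensor`. -/
theorem contract_projBoth21 {X : Tensor4} (hX : X ∈ alternating4) (i m) :
    16 * ∑ j, projBoth21 φ X i j m j =
      2 * (tripleContraction X φ i m + tripleContraction X φ m i)
        - (1 / 4) * (kron i m * ∑ k, tripleContraction X φ k k) := by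
  have h12 := hX.1
  have h23 := hX.2.1
  have h34 := hX.2.2
  have ps : ∀ i j k l, X i j k l = X k l i j := fun i j k l => by
    linarith [h23 k i l j, h12 i k l j, h34 i k j l, h23 i j k l]
  have x13 : ∀ i j k, X i j i k = 0 := fun i j k => by linarith [h23 i i j k, h12 i i j k]
  have x14 : ∀ i j k, X i j k i = 0 := fun i j k => by linarith [h34 i j i k, x13 i j k]
  have x23 : ∀ i j k, X i j j k = 0 := fun i j k => by linarith [h23 i j j k]
  have x24 : ∀ i j k, X i j k j = 0 := fun i j k => by linarith [h34 i j k j, x23 i j k]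
  have e : ∑ j, ∑ p, ∑ q, φ m j p q * pairContraction X φ p q i j =
      ∑ p, ∑ q, ∑ a, ∑ b, ∑ c, X p q a b * kron c i * ∑ j, φ p q m j * φ a b c j := by
    have : ∀ p q a b, ∑ c, X p q a b * kron c i * ∑ j, φ p q m j * φ a b c j =
        ∑ j, φ m j p q * (X p q a b * φ i j a b) := fun p q a b => by
      have : ∀ c, X p q a b * kron c i * ∑ j, φ p q m j * φ a b c j =
        kron i c * (X p q a b * ∑ j, φ p q m j * φ a b c j) := fun c => by
          rw [kron_comm c i]; ring
      simp only [this, sum_kron_mul]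
      rw [Finset.mul_sum]
      refine Finset.sum_congr rfl fun j _ => ?_
      rw [h.pair_swap m j p q, h.pair_swap i j a b]; ring
    simp only [this]
    simp only [pairContraction, Finset.mul_sum]
    rw [sum_rot3]
    refine Finset.sum_congr rfl fun p _ => Finset.sum_congr rfl fun q _ => ?_
    rw [sum_rot3]
  have e2 : ∀ p q, ∑ a, ∑ b, ∑ c, X p q a b * kron c i * ∑ j, φ p q m j * φ a b c j =
      kron p i * ∑ b, ∑ c, X p q b c * φ m q b c - kron q i * ∑ b, ∑ c, X p q b c * φ m p b c
       + ∑ b, X p q m b * φ i b p q + ∑ b, X p q m b * φ i b p q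
       - kron m i * ∑ b, ∑ c, X p q b c * φ p q b c := fun p q => by
    have := h.contract_tensor (fun a b c => X p q a b * kron c i) p q m
    simp only [x13, x14, x23, x24, zero_mul, zero_add, add_zero, sub_zero] at this
    rw [this]
    have e3 : ∀ b c, X p q b c * kron p i * φ q m b c + X p q b c * kron q i * φ m p b c
        + (X p q m b * kron c i + X p q c m * kron b i + X p q b c * kron m i) * φ p q b c =
        kron q i * (X p q b c * φ m p b c) - kron p i * (X p q b c * φ m q b c)
          + kron i c * (X p q m b * φ p q b c) + kron i b * (X p q c m * φ p q b c)
          + kron m i * (X p q b c * φ p q b c) := fun b c => by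
      rw [h.swap12 m q, kron_comm i c, kron_comm i b]; ring
    have e4 : ∀ b, X p q m b * φ p q b i = -(X p q m b * φ i b p q) := fun b => by
      rw [← h.pair_swap i b p q, h.swap34 p q i b]; ring
    have e5 : ∀ b, X p q b m * φ p q i b = -(X p q m b * φ i b p q) := fun b => by
      rw [← h.pair_swap i b p q, h34 p q m b]; ring
    simp only [e3, Finset.sum_add_distrib, Finset.sum_sub_distrib, ← Finset.mul_sum, sum_kron_mul,
      e4, e5, Finset.sum_neg_distrib]
    simp
    ring
  have t1 : ∑ p, ∑ q, kron p i * ∑ b, ∑ c, X p q b c * φ m q b c = tripleContraction X φ i m := by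
    simp only [← Finset.mul_sum, sum_kron_mul']
    rfl
  have t2 : ∑ p, ∑ q, kron q i * ∑ b, ∑ c, X p q b c * φ m p b c = -tripleContraction X φ i m := by
    rw [Finset.sum_comm]
    simp only [← Finset.mul_sum, sum_kron_mul']
    simp only [h12 i, neg_mul, Finset.sum_neg_distrib]
    rfl
  have t3 : ∑ p, ∑ q, ∑ b, X p q m b * φ i b p q = tripleContraction X φ m i := by
    refine (sum_rot3 fun b p q => X p q m b * φ i b p q).symm.trans ?_
    simp only [tripleContraction]
    refine Finset.sum_congr rfl fun b _ => Finset.sum_congr rfl fun p _ =>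
      Finset.sum_congr rfl fun q _ => ?_
    rw [ps m b]
  have t4 : ∑ p, ∑ q, ∑ b, ∑ c, X p q b c * φ p q b c = ∑ k, tripleContraction X φ k k := rfl
  have e6 : ∀ j, 16 * projBoth21 φ X i j m j = (3 / 2) * pairContraction X φ m j i j
      + (3 / 2) * pairContraction X φ i j m j
      + (1 / 4) * ∑ p, ∑ q, φ m j p q * pairContraction X φ p q i j := fun j => by
    rw [projBoth21_alternating hX, x24]; ring
  rw [Finset.mul_sum]
  simp only [e6, Finset.sum_add_distrib, ← Finset.mul_sum]
  rw [e]
  simp only [e2, Finset.sum_add_distrib, Finset.sum_sub_distrib, t1, t2, t3]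
  simp only [← Finset.mul_sum, t4, kron_comm m i]
  have t5 : ∀ i m, ∑ j, pairContraction X φ i j m j = tripleContraction X φ i m := fun _ _ => rfl
  rw [t5, t5]
  ring

/-- If the cyclic sum of the projection of `X` vanishes, so does its Ricci contraction, and
`contract_projBoth21` forces the contraction of `X` with `φ` to be zero. Then the projection
simplifies to a combination of `X` and its pair contraction, whose cyclic sum is a nonzero multiple
of `X`. -/
theorem eq_zero_of_bianchiSum_projBoth21 {X : Tensor4} (hX : X ∈ symContraction φ)
    (h0 : bianchiSum (projBoth21 φ X) = 0) : X = 0 := by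
  have h12 := hX.1.1
  have h23 := hX.1.2.1
  have h34 := hX.1.2.2
  have ps : ∀ i j k l, X k l i j = X i j k l := fun i j k l => by
    linarith [h23 k i l j, h12 i k l j, h34 i k j l, h23 i j k l]
  have cs : ∀ i j, tripleContraction X φ i j = tripleContraction X φ j i := fun i j => by
    have := congrFun (congrFun (show alternation2 (tripleContraction X φ) = 0 from hX.2) i) j
    rw [alternation2_apply] at this
    simpa [sub_eq_zero] using this
  have hm := h.projBoth21_mem ps
  have hr : ∀ i m, ∑ j, projBoth21 φ X i j m j = 0 := fun i m => by
    have := (h.bianchiSum_mem hm).2 i m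
    rw [h0] at this
    simp only [tripleContraction, Pi.zero_apply, zero_mul, Finset.sum_const_zero] at this
    linarith
  have hc : ∀ i m, 4 * tripleContraction X φ i m =
      (1 / 4) * (kron i m * ∑ k, tripleContraction X φ k k) := fun i m => by
    have := h.contract_projBoth21 hX.1 i m
    rw [hr, ← cs i m] at this
    linarith
  -- The trace of `hc` reads `4 τ = 2 τ`, where `δ_kk = 8` enters.
  have ht : ∑ k, tripleContraction X φ k k = 0 := by
    have := Finset.sum_congr rfl fun k (_ : k ∈ Finset.univ) => hc k k
    simp only [← Finset.mul_sum, kron_self, one_mul, Finset.sum_const, Finset.card_univ,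
      Fintype.card_fin, nsmul_eq_mul] at this
    push_cast at this
    linarith
  have hc0 : ∀ i m, tripleContraction X φ i m = 0 := fun i m => by
    have := hc i m
    rw [ht] at this
    linarith
  have cyc : ∀ i j k l, pairContraction X φ i j k l + pairContraction X φ i k l j
      + pairContraction X φ i l j k = 2 * X i j k l := fun i j k l => by
    have := h.tripleContraction_mul h23 h34 i j k l
    simp only [hc0, zero_mul, Finset.sum_const_zero] at this
    linarith
  have m12 : ∀ i j k l, pairContraction X φ j i k l = -pairContraction X φ i j k l :=
    fun i j k l => by simp only [pairContraction, h12 i j, neg_mul, Finset.sum_neg_distrib]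
  have m34 : ∀ i j k l, pairContraction X φ i j l k = -pairContraction X φ i j k l :=
    fun i j k l => by simp only [pairContraction, h.swap12 k l, mul_neg, Finset.sum_neg_distrib]
  have x1 : ∀ i j k l, X i k l j = X i j k l := fun i j k l => by
    rw [h34 i k j l, h23 i j k l, neg_neg]
  -- The tensor with `2/3 X` subtracted satisfies the Bianchi identity by `cyc`, and is skew in both
  -- pairs; hence it is symmetric in its pairs.
  have mp : ∀ i j k l, pairContraction X φ k l i j = pairContraction X φ i j k l :=
    fun i j k l => by
    have := pair_symm_of_bianchi (S := fun i j k l => pairContraction X φ i j k l - (2 / 3) * X i j k l)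
      (fun i j k l => by rw [m12, h12 i j]; ring) (fun i j k l => by rw [m34, h34 i j]; ring)
      (fun i j k l => by
        linarith [cyc i j k l, x1 i j k l, x1 i k l j]) i j k l
    rw [ps i j k l] at this
    linarith
  have e : ∀ a b i j, 16 * projBoth21 φ X a b i j =
      12 * X a b i j + 2 * pairContraction X φ a b i j := fun a b i j => by
    have e1 : ∑ p, ∑ q, φ i j p q * pairContraction X φ p q a b =
        12 * X a b i j - 4 * pairContraction X φ a b i j := by
      have e2 : ∀ p q, pairContraction X φ p q a b = ∑ c, ∑ d, φ p q c d * X a b c d :=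
        fun p q => by
        rw [mp]; simp only [pairContraction, mul_comm]
      simp only [e2]
      rw [h.sum_sum_mul (X a b), h34 a b i j]
      simp only [pairContraction, mul_comm]
      ring
    rw [projBoth21_alternating hX.1, e1, mp a b i j]
    ring
  -- The cyclic sum of `e` is `36 X + 4 X`, by alternation and `cyc`.
  funext i j k l
  have := congrFun (congrFun (congrFun (congrFun h0 i) j) k) l
  rw [bianchiSum_apply, Pi.zero_apply, Pi.zero_apply, Pi.zero_apply, Pi.zero_apply] at this
  have := cyc i j k l
  have x2 := x1 i k l j
  have x3 := x1 i j k l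
  have := e i j k l
  have := e i k l j
  have := e i l j k
  simp only [Pi.zero_apply]
  linarith

omit h in
theorem mem_part168_iff {S : Tensor4} :
    S ∈ part168 1 φ ↔ S ∈ symSquare21 φ ∧ bianchiSum S = 0 := by
  have hr : ∀ i j p q, raiseLast2 1 φ i j p q = φ i j p q := fun i j p q => by
    rw [raiseLast2_one]
  constructor
  · rintro ⟨⟨h1, h2, h3, h4⟩, h5, h6⟩
    refine ⟨⟨fun a b i j => (h3 a b i j).symm, fun a b => ⟨fun i j => ?_, fun i j => ?_⟩⟩, ?_⟩
    · linarith [h2 a b i j]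
    · have := h6 a b i j
      simp only [hr] at this
      linarith
    · funext a b c d
      exact h4 a b c d
  · rintro ⟨⟨h1, h2⟩, h3⟩
    have k : ∀ a b i j, (1 / 2) * ∑ p, ∑ q, raiseLast2 1 φ i j p q * S a b p q = S a b i j :=
      fun a b i j => by
        simp only [hr]
        rw [(h2 a b).2]; ring
    refine ⟨⟨fun a b c d => ?_, fun a b c d => ?_, fun a b c d => (h1 a b c d).symm,
      fun a b c d => congrFun (congrFun (congrFun (congrFun h3 a) b) c) d⟩, fun a b i j => ?_, k⟩
    · rw [← h1 a b, ← h1 b a]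
      linarith [(h2 c d).1 a b]
    · linarith [(h2 a b).1 c d]
    · have := k a b i j
      rw [← h1 a b i j] at this
      simp only [h1 _ _ a b] at this ⊢
      exact this

/-- The composite of projection and cyclic sum is an injective endomorphism of a finite-dimensional
space, hence onto, so the cyclic sum is onto. Its kernel has dimension 231 - 63. -/
theorem finrank_part168 : Module.finrank ℝ (part168 1 φ) = 168 := by
  let f : symSquare21 φ →ₗ[ℝ] symContraction φ :=
    bianchiSum.restrict fun X hX => (h.bianchiSum_mem hX).1
  let s : symContraction φ →ₗ[ℝ] symSquare21 φ :=
    (projBoth21 φ).restrict fun X hX => h.projBoth21_mem fun i j k l => by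
      linarith [hX.1.2.1 k i l j, hX.1.1 i k l j, hX.1.2.2 i k j l, hX.1.2.1 i j k l]
  have hinj : Function.Injective (f ∘ₗ s) := by
    rw [← LinearMap.ker_eq_bot, LinearMap.ker_eq_bot']
    intro X hX
    exact Subtype.ext (h.eq_zero_of_bianchiSum_projBoth21 X.2 (congrArg Subtype.val hX))
  have hsurj : Function.Surjective f :=
    Function.Surjective.of_comp (g := s) (LinearMap.injective_iff_surjective.1 hinj)
  have e := LinearMap.finrank_range_add_finrank_ker f
  rw [LinearMap.range_eq_top.2 hsurj, finrank_top, h.finrank_symContraction,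
    h.finrank_symSquare21] at e
  have e2 : part168 1 φ = (LinearMap.ker f).map (symSquare21 φ).subtype := by
    ext S
    simp only [mem_part168_iff, LinearMap.mem_ker, Submodule.mem_map,
      Submodule.coe_subtype, Subtype.exists, exists_and_right, exists_eq_right]
    constructor
    · rintro ⟨h1, h2⟩
      exact ⟨h1, Subtype.ext h2⟩
    · rintro ⟨h1, h2⟩
      exact ⟨h1, congrArg Subtype.val h2⟩
  rw [e2, Submodule.finrank_map_subtype_eq]
  omega

/-- Six times the Ricci contraction is the contraction of the cyclic sum with `φ`, and the cyclic
sum is zero. -/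
theorem part168_le_weylTensors : part168 1 φ ≤ weylTensors 1 := by
  intro S hS
  refine ⟨hS.1, fun a b => ?_⟩
  have h1 := mem_part168_iff.1 hS
  have := (h.bianchiSum_mem h1.1).2 a b
  rw [h1.2] at this
  simp only [tripleContraction, Pi.zero_apply, zero_mul, Finset.sum_const_zero] at this
  rw [ricciContraction_one]
  linarith

end IsSpinTensor

/-! ## Change of frame -/

section Pull

variable {V V' V'' W W' : Type*} [AddCommMonoid V] [Module ℝ V] [AddCommMonoid V'] [Module ℝ V']
  [AddCommMonoid V''] [Module ℝ V''] [AddCommMonoid W] [Module ℝ W] [AddCommMonoid W'] [Module ℝ W']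

/-- The change of frame with matrix `B` in the first index and `f` in the others. -/
def pull (B : Matrix (Fin 8) (Fin 8) ℝ) (f : V →ₗ[ℝ] V') : (Fin 8 → V) →ₗ[ℝ] (Fin 8 → V') :=
  LinearMap.pi fun i => ∑ p, B i p • f ∘ₗ LinearMap.proj p

theorem pull_apply (B : Matrix (Fin 8) (Fin 8) ℝ) (f : V →ₗ[ℝ] V') (X i) :
    pull B f X i = ∑ p, B i p • f (X p) := by
  simp [pull]

theorem pull_pull (A B : Matrix (Fin 8) (Fin 8) ℝ) (f : V' →ₗ[ℝ] V'') (g : V →ₗ[ℝ] V') (X) :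
    pull A f (pull B g X) = pull (A * B) (f ∘ₗ g) X := by
  funext i
  simp only [pull_apply, map_sum, map_smul, Finset.smul_sum, smul_smul, Matrix.mul_apply,
    Finset.sum_smul, LinearMap.comp_apply]
  exact Finset.sum_comm

theorem pull_one_id : pull 1 (LinearMap.id : V →ₗ[ℝ] V) = LinearMap.id := by
  ext X i
  simp [pull_apply, Matrix.one_apply]

theorem pull_swap (A : Matrix (Fin 8) (Fin 8) ℝ) (f : V →ₗ[ℝ] V') (X : Fin 8 → Fin 8 → V) (i j) :
    pull A (pull A f) (fun p q => X q p) i j = pull A (pull A f) X j i := by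
  simp only [pull_apply, Finset.sum_apply, Pi.smul_apply, Finset.smul_sum]
  rw [Finset.sum_comm]
  simp only [smul_smul, mul_comm]

/-- The pairing of tensors by contraction in the first index. -/
def pairing (c : V →ₗ[ℝ] W →ₗ[ℝ] ℝ) : (Fin 8 → V) →ₗ[ℝ] (Fin 8 → W) →ₗ[ℝ] ℝ :=
  ∑ i, c.compl₁₂ (LinearMap.proj i) (LinearMap.proj i)

theorem pairing_apply (c : V →ₗ[ℝ] W →ₗ[ℝ] ℝ) (X Y) : pairing c X Y = ∑ i, c (X i) (Y i) := by
  simp [pairing]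

theorem pairing_pull_transpose (A : Matrix (Fin 8) (Fin 8) ℝ) (c : V →ₗ[ℝ] W →ₗ[ℝ] ℝ)
    (c' : V' →ₗ[ℝ] W' →ₗ[ℝ] ℝ) (f : V' →ₗ[ℝ] V) (g : W →ₗ[ℝ] W')
    (hfg : ∀ v w, c (f v) w = c' v (g w)) (X Y) :
    pairing c (pull A.transpose f X) Y = pairing c' X (pull A g Y) := by
  simp only [pairing_apply, pull_apply, map_sum, map_smul, LinearMap.sum_apply,
    LinearMap.smul_apply, hfg, Matrix.transpose_apply]
  exact Finset.sum_comm

/-- The source of all naturality statements: a bilinear pairing in the remaining indices passes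
through a change of frame in the free ones. -/
theorem pull_bilin (A : Matrix (Fin 8) (Fin 8) ℝ) (c : V →ₗ[ℝ] W →ₗ[ℝ] ℝ) (X : Fin 8 → V)
    (Y : Fin 8 → W) (i j) : pull A (pull A LinearMap.id) (fun p q => c (X p) (Y q)) i j =
      c (pull A LinearMap.id X i) (pull A LinearMap.id Y j) := by
  simp only [pull_apply, Finset.sum_apply, Pi.smul_apply, map_sum, map_smul, LinearMap.sum_apply,
    LinearMap.smul_apply, LinearMap.id_apply, Finset.smul_sum]
  rw [Finset.sum_comm]
  simp only [smul_smul, mul_comm]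

theorem pull_bilin₂ (A : Matrix (Fin 8) (Fin 8) ℝ) (c : V →ₗ[ℝ] W →ₗ[ℝ] ℝ)
    (X : Fin 8 → Fin 8 → V) (Y : Fin 8 → Fin 8 → W) (i j k l) :
    pull A (pull A (pull A (pull A (LinearMap.id : ℝ →ₗ[ℝ] ℝ)))) (fun p q r s => c (X p q) (Y r s)) i j k l =
      c (pull A (pull A LinearMap.id) X i j) (pull A (pull A LinearMap.id) Y k l) := by
  simp only [pull_apply, Finset.sum_apply, Pi.smul_apply, map_sum, map_smul, LinearMap.sum_apply,
    LinearMap.smul_apply, LinearMap.id_apply, Finset.smul_sum, smul_smul]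
  rw [sum_rot4, sum_rot4]
  refine Finset.sum_congr rfl fun p _ => Finset.sum_congr rfl fun q _ =>
    Finset.sum_congr rfl fun r _ => Finset.sum_congr rfl fun s _ => ?_
  congr 1
  ring

end Pull

section Frames

variable (B : Matrix (Fin 8) (Fin 8) ℝ)

def pull1 : (Fin 8 → ℝ) →ₗ[ℝ] (Fin 8 → ℝ) := pull B LinearMap.id

def pull2 : Tensor2 →ₗ[ℝ] Tensor2 := pull B (pull1 B)

/-- The change of frame with matrix `B` for tensors of rank three. -/
def pull3 : Tensor3 →ₗ[ℝ] Tensor3 := pull B (pull2 B)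

/-- The change of frame with matrix `B` for tensors of rank four. -/
def pull4 : Tensor4 →ₗ[ℝ] Tensor4 := pull B (pull3 B)

/-- The complete contractions of pairs of tensors. -/
def dot1 : (Fin 8 → ℝ) →ₗ[ℝ] (Fin 8 → ℝ) →ₗ[ℝ] ℝ := pairing (LinearMap.mul ℝ ℝ)

def dot2 : Tensor2 →ₗ[ℝ] Tensor2 →ₗ[ℝ] ℝ := pairing dot1

def dot3 : Tensor3 →ₗ[ℝ] Tensor3 →ₗ[ℝ] ℝ := pairing dot2

def dot4 : Tensor4 →ₗ[ℝ] Tensor4 →ₗ[ℝ] ℝ := pairing dot3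

/-- The contractions of tensors with a bilinear form. -/
def ip1 : (Fin 8 → ℝ) →ₗ[ℝ] (Fin 8 → ℝ) →ₗ[ℝ] ℝ :=
  dot1 ∘ₗ pull1 B.transpose

def ip2 : Tensor2 →ₗ[ℝ] Tensor2 →ₗ[ℝ] ℝ :=
  dot2 ∘ₗ pull2 B.transpose

def ip3 : Tensor3 →ₗ[ℝ] Tensor3 →ₗ[ℝ] ℝ :=
  dot3 ∘ₗ pull3 B.transpose

def ip4 : Tensor4 →ₗ[ℝ] Tensor4 →ₗ[ℝ] ℝ :=
  dot4 ∘ₗ pull4 B.transpose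

end Frames

section Compose

variable (A B : Matrix (Fin 8) (Fin 8) ℝ)

theorem pull1_pull1 (X) : pull1 A (pull1 B X) = pull1 (A * B) X := pull_pull A B _ _ X

theorem pull2_pull2 (X) : pull2 A (pull2 B X) = pull2 (A * B) X := by
  have e : pull1 A ∘ₗ pull1 B = pull1 (A * B) := LinearMap.ext (pull1_pull1 A B)
  rw [pull2, pull2, pull_pull, e]; rfl

theorem pull3_pull3 (X) : pull3 A (pull3 B X) = pull3 (A * B) X := by
  have e : pull2 A ∘ₗ pull2 B = pull2 (A * B) := LinearMap.ext (pull2_pull2 A B)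
  rw [pull3, pull3, pull_pull, e]; rfl

theorem pull4_pull4 (X) : pull4 A (pull4 B X) = pull4 (A * B) X := by
  have e : pull3 A ∘ₗ pull3 B = pull3 (A * B) := LinearMap.ext (pull3_pull3 A B)
  rw [pull4, pull4, pull_pull, e]; rfl

theorem pull1_one : pull1 1 = LinearMap.id := pull_one_id

theorem pull2_one : pull2 1 = LinearMap.id := by rw [pull2, pull1_one, pull_one_id]

theorem pull3_one : pull3 1 = LinearMap.id := by rw [pull3, pull2_one, pull_one_id]

theorem pull4_one : pull4 1 = LinearMap.id := by rw [pull4, pull3_one, pull_one_id]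

theorem pull2_injective (h : A * B = 1) : Function.Injective (pull2 B) := fun X Y e => by
  have := congrArg (pull2 A) e
  rwa [pull2_pull2, pull2_pull2, h, pull2_one] at this

theorem pull3_injective (h : A * B = 1) : Function.Injective (pull3 B) := fun X Y e => by
  have := congrArg (pull3 A) e
  rwa [pull3_pull3, pull3_pull3, h, pull3_one] at this

theorem pull4_injective (h : A * B = 1) : Function.Injective (pull4 B) := fun X Y e => by
  have := congrArg (pull4 A) e
  rwa [pull4_pull4, pull4_pull4, h, pull4_one] at this

theorem pull4_apply (S : Tensor4) (i j k l) : pull4 B S i j k l =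
    ∑ p, ∑ q, ∑ r, ∑ s, S p q r s * B i p * B j q * B k r * B l s := by
  simp only [pull4, pull3, pull2, pull1, pull_apply, Finset.sum_apply, Pi.smul_apply, smul_eq_mul,
    LinearMap.id_apply, Finset.mul_sum]
  refine Finset.sum_congr rfl fun p _ => Finset.sum_congr rfl fun q _ =>
    Finset.sum_congr rfl fun r _ => Finset.sum_congr rfl fun s _ => ?_
  ring

theorem pull3_apply (S : Tensor3) (i j k) : pull3 B S i j k =
    ∑ p, ∑ q, ∑ r, S p q r * B i p * B j q * B k r := by
  simp only [pull3, pull2, pull1, pull_apply, Finset.sum_apply, Pi.smul_apply, smul_eq_mul,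
    LinearMap.id_apply, Finset.mul_sum]
  refine Finset.sum_congr rfl fun p _ => Finset.sum_congr rfl fun q _ =>
    Finset.sum_congr rfl fun r _ => ?_
  ring

theorem pull2_apply (S : Tensor2) (i j) : pull2 B S i j = ∑ p, ∑ q, S p q * B i p * B j q := by
  simp only [pull2, pull1, pull_apply, Finset.sum_apply, Pi.smul_apply, smul_eq_mul,
    LinearMap.id_apply, Finset.mul_sum]
  refine Finset.sum_congr rfl fun p _ => Finset.sum_congr rfl fun q _ => ?_
  ring

theorem pull1_apply (S : Fin 8 → ℝ) (i) : pull1 B S i = ∑ p, S p * B i p := by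
  simp only [pull1, pull_apply, smul_eq_mul, LinearMap.id_apply, mul_comm]

end Compose

section Contractions

variable (A H : Matrix (Fin 8) (Fin 8) ℝ)

theorem dot1_pull1 (X Y) : dot1 (pull1 A.transpose X) Y = dot1 X (pull1 A Y) :=
  pairing_pull_transpose A _ _ LinearMap.id LinearMap.id (fun _ _ => rfl) X Y

theorem dot2_pull2 (X Y) : dot2 (pull2 A.transpose X) Y = dot2 X (pull2 A Y) :=
  pairing_pull_transpose A dot1 dot1 (pull1 A.transpose) (pull1 A) (dot1_pull1 A) X Y

theorem dot3_pull3 (X Y) : dot3 (pull3 A.transpose X) Y = dot3 X (pull3 A Y) := by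
  simp only [dot3, pull3, pairing_apply, pull_apply, map_sum, map_smul, LinearMap.sum_apply,
    LinearMap.smul_apply, dot2_pull2, Matrix.transpose_apply]
  exact Finset.sum_comm

theorem dot4_pull4 (X Y) : dot4 (pull4 A.transpose X) Y = dot4 X (pull4 A Y) := by
  simp only [dot4, pull4, pairing_apply, pull_apply, map_sum, map_smul, LinearMap.sum_apply,
    LinearMap.smul_apply, dot3_pull3, Matrix.transpose_apply]
  exact Finset.sum_comm

theorem transpose_mul_mul : (A.transpose * H * A).transpose =
    A.transpose * (H.transpose * A) := by
  simp [Matrix.transpose_mul, Matrix.mul_assoc]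

/-- A contraction with `Aᵀ H A` is a contraction with `H` after the change of frame `A`. For `H = 1`
and `A` an adapted frame this removes the metric. -/
theorem ip1_mul (X Y) : ip1 (A.transpose * H * A) X Y = ip1 H (pull1 A X) (pull1 A Y) := by
  simp only [ip1, LinearMap.comp_apply]
  rw [transpose_mul_mul, ← pull1_pull1, dot1_pull1, pull1_pull1]

theorem ip2_mul (X Y) : ip2 (A.transpose * H * A) X Y = ip2 H (pull2 A X) (pull2 A Y) := by
  simp only [ip2, LinearMap.comp_apply]
  rw [transpose_mul_mul, ← pull2_pull2, dot2_pull2, pull2_pull2]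

theorem ip3_mul (X Y) : ip3 (A.transpose * H * A) X Y = ip3 H (pull3 A X) (pull3 A Y) := by
  simp only [ip3, LinearMap.comp_apply]
  rw [transpose_mul_mul, ← pull3_pull3, dot3_pull3, pull3_pull3]

theorem ip4_mul (X Y) : ip4 (A.transpose * H * A) X Y = ip4 H (pull4 A X) (pull4 A Y) := by
  simp only [ip4, LinearMap.comp_apply]
  rw [transpose_mul_mul, ← pull4_pull4, dot4_pull4, pull4_pull4]

variable (h : Matrix (Fin 8) (Fin 8) ℝ) (T : Tensor3) (Φ S N : Tensor4)

theorem raise1_eq (a b) : raise1 h T a b = pull1 h.transpose (T a b) := by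
  funext c; simp only [raise1, pull1_apply, Matrix.transpose_apply]

theorem raise2_eq (a) : raise2 h T a = pull2 h.transpose (T a) := by
  funext b c; simp only [raise2, pull2_apply, Matrix.transpose_apply]

theorem raise3_eq : raise3 h T = pull3 h.transpose T := by
  funext a b c; simp only [raise3, pull3_apply, Matrix.transpose_apply]

theorem raiseLast2_eq (a b) : raiseLast2 h S a b = pull2 h.transpose (S a b) := by
  funext i j; simp only [raiseLast2, pull2_apply, Matrix.transpose_apply]

theorem raiseLast3_eq (a) : raiseLast3 h S a = pull3 h.transpose (S a) := by
  funext i j k; simp only [raiseLast3, pull3_apply, Matrix.transpose_apply]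

theorem raise4_eq : raise4 h S = pull4 h.transpose S := by
  funext i j k l; simp only [raise4, pull4_apply, Matrix.transpose_apply]

theorem sum_raise1_mul (a b) (X : Fin 8 → ℝ) :
    ∑ p, raise1 h T a b p * X p = ip1 h (T a b) X := by
  simp only [ip1, LinearMap.comp_apply, dot1, pairing_apply, LinearMap.mul_apply',
    raise1_eq]

theorem sum_raise2_mul (a) (X : Tensor2) :
    ∑ p, ∑ q, raise2 h T a p q * X p q = ip2 h (T a) X := by
  simp only [ip2, LinearMap.comp_apply, dot1, dot2, pairing_apply, LinearMap.mul_apply',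
    raise2_eq]

theorem sum_raise3_mul (X : Tensor3) :
    ∑ p, ∑ q, ∑ r, raise3 h T p q r * X p q r = ip3 h T X := by
  simp only [ip3, LinearMap.comp_apply, dot1, dot2, dot3, pairing_apply, LinearMap.mul_apply',
    raise3_eq]

theorem sum_raiseLast2_mul (a b) (X : Tensor2) :
    ∑ p, ∑ q, raiseLast2 h S a b p q * X p q = ip2 h (S a b) X := by
  simp only [ip2, LinearMap.comp_apply, dot1, dot2, pairing_apply, LinearMap.mul_apply',
    raiseLast2_eq]

theorem sum_raiseLast3_mul (a) (X : Tensor3) :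
    ∑ p, ∑ q, ∑ r, raiseLast3 h S a p q r * X p q r = ip3 h (S a) X := by
  simp only [ip3, LinearMap.comp_apply, dot1, dot2, dot3, pairing_apply, LinearMap.mul_apply',
    raiseLast3_eq]

theorem sum_raise4_mul (X : Tensor4) :
    ∑ p, ∑ q, ∑ r, ∑ s, raise4 h S p q r s * X p q r s = ip4 h S X := by
  simp only [ip4, LinearMap.comp_apply, dot1, dot2, dot3, dot4, pairing_apply, LinearMap.mul_apply',
    raise4_eq]

/-- `T_{ab}^p T_{cdp}` -/
def torsionSquare : Tensor4 := fun a b c d => ip1 h (T a b) (T c d)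

theorem phiGradT_eq (a b) : phiGradT h Φ N a b = ip3 h (Φ a) (N b) := sum_raiseLast3_mul h Φ a (N b)

theorem phiCurlT_eq : phiCurlT h Φ N = phiGradT h Φ fun b i => N i b := rfl

theorem phiTT_eq : phiTT h Φ T = phiGradT h Φ (torsionSquare h T) := by
  funext a b
  simp only [phiTT, phiGradT, torsionSquare, ← sum_raise1_mul, Finset.mul_sum, mul_assoc]

theorem contractTT_eq (a b) : contractTT h T a b = ip2 h (T a) (T b) := sum_raise2_mul h T a (T b)

/-- `Φ_{ij}^{pq} S_{abpq}` -/
def contractLast : Tensor4 := fun a b i j => ip2 h (Φ i j) (S a b)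

theorem fourPi7_eq : fourPi7 h Φ S = S - (1 / 2 : ℝ) • contractLast h Φ S := by
  funext a b i j
  simp only [fourPi7, sum_raiseLast2_mul, contractLast, Pi.sub_apply, Pi.smul_apply, smul_eq_mul]

theorem torsionCurvature_eq : torsionCurvature h Φ T N =
    N - (fun a b => N b a) - (1 / 2 : ℝ) • contractLast h Φ N
      + (1 / 2 : ℝ) • contractLast h Φ (fun a b => N b a)
      + (fun a b i j => torsionSquare h T a i b j) - (fun a b i j => torsionSquare h T b i a j)
      - contractLast h Φ (fun a b i j => torsionSquare h T a i b j) := by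
  funext a b i j
  have e : ∑ p, ∑ q, ∑ k, raiseLast2 h Φ i j p q * raise1 h T a p k * T b q k =
      ip2 h (Φ i j) fun p q => ip1 h (T a p) (T b q) := by
    simp only [← sum_raiseLast2_mul, ← sum_raise1_mul, Finset.mul_sum, mul_assoc]
  simp only [torsionCurvature, sum_raiseLast2_mul, sum_raise1_mul, contractLast, Pi.sub_apply,
    Pi.add_apply, Pi.smul_apply, smul_eq_mul, torsionSquare, e]

theorem intrinsicTorsion_eq (a i j) : intrinsicTorsion h Φ T a i j =
    (1 / 4) * T a i j - (1 / 8) * ip2 h (Φ i j) (T a) := by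
  rw [intrinsicTorsion, sum_raiseLast2_mul]

end Contractions

section Pull

variable {V V' : Type*} [AddCommMonoid V] [Module ℝ V] [AddCommMonoid V'] [Module ℝ V']
variable (A H : Matrix (Fin 8) (Fin 8) ℝ)

theorem pull_id_map (f : V →ₗ[ℝ] V') (X : Fin 8 → V) :
    pull A LinearMap.id (fun p => f (X p)) = pull A f X := by
  funext i; simp only [pull_apply, LinearMap.id_apply]

theorem pull_pull_id_map (f : V →ₗ[ℝ] V') (X : Fin 8 → Fin 8 → V) :
    pull A (pull A LinearMap.id) (fun p q => f (X p q)) = pull A (pull A f) X := by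
  funext i; simp only [pull_apply A (pull A _), pull_id_map]

theorem pull3_swap12 (S : Tensor3) : pull3 A (fun a b => S b a) = fun a b => pull3 A S b a := by
  funext a b
  rw [pull3, pull2]
  have := pull_swap A (pull1 A) S a b
  with_reducible exact this

theorem pull3_swap23 (S : Tensor3) :
    pull3 A (fun a b c => S a c b) = fun a b c => pull3 A S a c b := by
  funext a b c
  have e : ∀ p, pull2 A (fun b c => S p c b) b c = pull2 A (S p) c b := fun p =>
    pull_swap A LinearMap.id (S p) b c
  simp only [pull3, pull_apply, Finset.sum_apply, Pi.smul_apply, e]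

theorem pull4_swap12 (S : Tensor4) : pull4 A (fun a b => S b a) = fun a b => pull4 A S b a := by
  funext a b
  rw [pull4, pull3]
  have := pull_swap A (pull2 A) S a b
  with_reducible exact this

theorem pull4_swap23 (S : Tensor4) :
    pull4 A (fun a b c => S a c b) = fun a b c => pull4 A S a c b := by
  funext a b c
  have e : ∀ p, pull3 A (fun b c => S p c b) b c = pull3 A (S p) c b := fun p =>
    congrFun (congrFun (pull3_swap12 A (S p)) b) c
  simp only [pull4, pull_apply, Finset.sum_apply, Pi.smul_apply, e]

theorem pull4_swap34 (S : Tensor4) :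
    pull4 A (fun a b c d => S a b d c) = fun a b c d => pull4 A S a b d c := by
  funext a b c d
  have e : ∀ p, pull3 A (fun b c d => S p b d c) b c d = pull3 A (S p) b d c := fun p =>
    congrFun (congrFun (congrFun (pull3_swap23 A (S p)) b) c) d
  simp only [pull4, pull_apply, Finset.sum_apply, Pi.smul_apply, e]

theorem pull4_pairSwap (S : Tensor4) :
    pull4 A (fun a b c d => S c d a b) = fun a b c d => pull4 A S c d a b := by
  rw [pull4_swap23 A fun a b c d => S b d a c, pull4_swap12 A fun a b c d => S a d b c,
    pull4_swap34 A fun a b c d => S a c b d, pull4_swap23 A S]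

theorem pull4_cyc234 (S : Tensor4) :
    pull4 A (fun a b c d => S a c d b) = fun a b c d => pull4 A S a c d b := by
  rw [pull4_swap23 A fun a b c d => S a b d c, pull4_swap34 A S]

theorem pull4_cyc243 (S : Tensor4) :
    pull4 A (fun a b c d => S a d b c) = fun a b c d => pull4 A S a d b c := by
  rw [pull4_swap34 A fun a b c d => S a c b d, pull4_swap23 A S]

/-! The contractions of tensors are natural. -/

theorem pull4_contractLast (Φ S : Tensor4) :
    pull4 A (contractLast (A.transpose * H * A) Φ S) = contractLast H (pull4 A Φ) (pull4 A S) := by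
  have e : contractLast (A.transpose * H * A) Φ S = fun a b i j =>
      (ip2 H).flip (pull2 A (S a b)) (pull2 A (Φ i j)) := by
    funext a b i j
    rw [contractLast, ip2_mul, LinearMap.flip_apply]
  funext a b i j
  rw [e]
  have := pull_bilin₂ A (ip2 H).flip (fun a b => pull2 A (S a b)) (fun a b => pull2 A (Φ a b))
    a b i j
  rw [pull_pull_id_map, pull_pull_id_map, LinearMap.flip_apply] at this
  simp only [pull4, pull3, pull2, pull1, contractLast] at this ⊢
  with_reducible exact this

theorem pull4_torsionSquare (T : Tensor3) :
    pull4 A (torsionSquare (A.transpose * H * A) T) = torsionSquare H (pull3 A T) := by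
  have e : torsionSquare (A.transpose * H * A) T = fun a b i j =>
      ip1 H (pull1 A (T a b)) (pull1 A (T i j)) := by
    funext a b i j
    rw [torsionSquare, ip1_mul]
  funext a b i j
  rw [e]
  have := pull_bilin₂ A (ip1 H) (fun a b => pull1 A (T a b)) (fun a b => pull1 A (T a b)) a b i j
  rw [pull_pull_id_map] at this
  simp only [pull4, pull3, pull2, pull1, torsionSquare] at this ⊢
  exact this

theorem pull2_phiGradT (Φ N : Tensor4) :
    pull2 A (phiGradT (A.transpose * H * A) Φ N) = phiGradT H (pull4 A Φ) (pull4 A N) := by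
  have e : phiGradT (A.transpose * H * A) Φ N = fun a b =>
      ip3 H (pull3 A (Φ a)) (pull3 A (N b)) := by
    funext a b
    rw [phiGradT_eq, ip3_mul]
  funext a b
  rw [e, phiGradT_eq]
  have := pull_bilin A (ip3 H) (fun a => pull3 A (Φ a)) (fun b => pull3 A (N b)) a b
  rw [pull_id_map, pull_id_map] at this
  simp only [pull4, pull2, pull1] at this ⊢
  with_reducible exact this

theorem pull2_phiCurlT (Φ N : Tensor4) :
    pull2 A (phiCurlT (A.transpose * H * A) Φ N) = phiCurlT H (pull4 A Φ) (pull4 A N) := by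
  rw [phiCurlT_eq, phiCurlT_eq, pull2_phiGradT, pull4_swap12 A N]

theorem pull2_phiTT (Φ : Tensor4) (T : Tensor3) :
    pull2 A (phiTT (A.transpose * H * A) Φ T) = phiTT H (pull4 A Φ) (pull3 A T) := by
  rw [phiTT_eq, phiTT_eq, pull2_phiGradT, pull4_torsionSquare]

theorem pull2_contractTT (T : Tensor3) :
    pull2 A (contractTT (A.transpose * H * A) T) = contractTT H (pull3 A T) := by
  have e : contractTT (A.transpose * H * A) T = fun a b =>
      ip2 H (pull2 A (T a)) (pull2 A (T b)) := by
    funext a b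
    rw [contractTT_eq, ip2_mul]
  funext a b
  rw [e, contractTT_eq]
  have := pull_bilin A (ip2 H) (fun a => pull2 A (T a)) (fun b => pull2 A (T b)) a b
  rw [pull_id_map] at this
  simp only [pull3, pull2, pull1] at this ⊢
  with_reducible exact this

theorem pull2_transpose (X : Tensor2) : pull2 A (fun a b => X b a) = fun a b => pull2 A X b a := by
  funext a b; exact pull_swap A LinearMap.id X a b

theorem symPart_eq (X : Tensor2) : symPart X = (1 / 2 : ℝ) • (X + fun a b => X b a) := rfl

theorem skewPart_eq (X : Tensor2) : skewPart X = (1 / 2 : ℝ) • (X - fun a b => X b a) := rfl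

theorem pull2_symPart (X : Tensor2) : pull2 A (symPart X) = symPart (pull2 A X) := by
  rw [symPart_eq, symPart_eq, map_smul, map_add, pull2_transpose]

theorem pull2_skewPart (X : Tensor2) : pull2 A (skewPart X) = skewPart (pull2 A X) := by
  rw [skewPart_eq, skewPart_eq, map_smul, map_sub, pull2_transpose]

theorem pull4_fourPi7 (Φ S : Tensor4) :
    pull4 A (fourPi7 (A.transpose * H * A) Φ S) = fourPi7 H (pull4 A Φ) (pull4 A S) := by
  rw [fourPi7_eq, fourPi7_eq, map_sub, map_smul, pull4_contractLast]

theorem pull4_torsionCurvature (Φ N : Tensor4) (T : Tensor3) :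
    pull4 A (torsionCurvature (A.transpose * H * A) Φ T N) =
      torsionCurvature H (pull4 A Φ) (pull3 A T) (pull4 A N) := by
  have e1 := pull4_swap23 A (torsionSquare (A.transpose * H * A) T)
  have e2 := pull4_swap12 A fun a b i j => torsionSquare (A.transpose * H * A) T a i b j
  rw [torsionCurvature_eq, torsionCurvature_eq]
  simp only [map_sub, map_add, map_smul, pull4_contractLast, pull4_swap12, e1, e2,
    pull4_torsionSquare]

theorem pull3_intrinsicTorsion (Φ : Tensor4) (T : Tensor3) :
    pull3 A (intrinsicTorsion (A.transpose * H * A) Φ T) =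
      intrinsicTorsion H (pull4 A Φ) (pull3 A T) := by
  have e : intrinsicTorsion (A.transpose * H * A) Φ T = (1 / 4 : ℝ) • T - (1 / 8 : ℝ) •
      fun a i j => ip2 H (pull2 A (Φ i j)) (pull2 A (T a)) := by
    funext a i j
    rw [intrinsicTorsion_eq, ip2_mul]
    rfl
  have e2 : pull3 A (fun a i j => ip2 H (pull2 A (Φ i j)) (pull2 A (T a))) =
      fun a i j => ip2 H (pull4 A Φ i j) (pull3 A T a) := by
    funext a i j
    have k1 : ∀ p, pull2 A (fun i j => ip2 H (pull2 A (Φ i j)) (pull2 A (T p))) =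
        fun i j => ip2 H (pull4 A Φ i j) (pull2 A (T p)) := fun p => by
      have : (fun i j => ip2 H (pull2 A (Φ i j)) (pull2 A (T p))) = fun i j =>
        ((ip2 H).flip (pull2 A (T p)) ∘ₗ pull2 A) (Φ i j) := rfl
      rw [this]
      refine (pull_pull_id_map A ((ip2 H).flip (pull2 A (T p)) ∘ₗ pull2 A) Φ).trans ?_
      funext i j
      simp only [pull4, pull3, pull_apply, Finset.sum_apply, Pi.smul_apply, map_sum, map_smul,
        LinearMap.sum_apply, LinearMap.smul_apply, LinearMap.comp_apply, LinearMap.flip_apply]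
    rw [pull3, pull_apply]
    simp only [k1, Finset.sum_apply, Pi.smul_apply, pull_apply, map_sum, map_smul]
  rw [e, map_sub, map_smul, map_smul, e2]
  funext a i j
  rw [intrinsicTorsion_eq]
  rfl

theorem ip4_torsionSquare (Φ : Tensor4) (T : Tensor3) :
    ∑ a, ∑ b, ∑ c, ∑ d, ∑ p, raise4 H Φ a b c d * raise1 H T a b p * T c d p =
      ip4 H Φ (torsionSquare H T) := by
  simp only [← sum_raise4_mul, torsionSquare, ← sum_raise1_mul, Finset.mul_sum, mul_assoc]

theorem pull2_ricciContraction (S : Tensor4) :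
    pull2 A (ricciContraction (A.transpose * A) S) = ricciContraction 1 (pull4 A S) := by
  funext i j
  simp only [ricciContraction_one, pull2_apply, pull4_apply]
  simp only [ricciContraction, Matrix.mul_apply, Matrix.transpose_apply, Finset.sum_mul]
  symm
  rw [Finset.sum_comm]
  refine Finset.sum_congr rfl fun a _ => ?_
  rw [sum_rot3, Finset.sum_comm]
  refine Finset.sum_congr rfl fun b _ => Finset.sum_congr rfl fun c _ => ?_
  rw [Finset.sum_comm]
  refine Finset.sum_congr rfl fun d _ => Finset.sum_congr rfl fun e _ => ?_
  ring

theorem sum_sum_mul_pull2 (X : Tensor2) : ∑ a, ∑ b, (A.transpose * A) a b * X a b =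
    ∑ a, pull2 A X a a := by
  simp only [pull2_apply, Matrix.mul_apply, Matrix.transpose_apply, Finset.sum_mul]
  refine (sum_rot3 fun e a b => A e a * A e b * X a b).symm.trans ?_
  refine Finset.sum_congr rfl fun c _ => Finset.sum_congr rfl fun d _ =>
    Finset.sum_congr rfl fun e _ => ?_
  ring

end Pull

section Pull

variable {V W : Type*} [AddCommMonoid V] [Module ℝ V] [AddCommMonoid W] [Module ℝ W]
variable (A B H : Matrix (Fin 8) (Fin 8) ℝ)

theorem pull_bilin₃ (c : V →ₗ[ℝ] W →ₗ[ℝ] ℝ) (X : Fin 8 → Fin 8 → Fin 8 → V) (Y : Fin 8 → W)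
    (i j k l) : pull A (pull A (pull A (pull A (LinearMap.id : ℝ →ₗ[ℝ] ℝ))))
      (fun p q r s => c (X p q r) (Y s)) i j k l =
      c (pull A (pull A (pull A LinearMap.id)) X i j k) (pull A LinearMap.id Y l) := by
  simp only [pull_apply, Finset.sum_apply, Pi.smul_apply, map_sum, map_smul, LinearMap.sum_apply,
    LinearMap.smul_apply, LinearMap.id_apply, Finset.smul_sum, smul_smul]
  rw [sum_rot4]
  rw [sum_rot4, sum_rot4]
  refine Finset.sum_congr rfl fun p _ => Finset.sum_congr rfl fun q _ =>
    Finset.sum_congr rfl fun r _ => Finset.sum_congr rfl fun s _ => ?_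
  congr 1
  ring

/-- The change of frame for families of tensors of rank four. -/
def pull5 : (Fin 8 → Tensor4) →ₗ[ℝ] (Fin 8 → Tensor4) := pull B (pull4 B)

theorem pull5_apply (X : Fin 8 → Tensor4) (i) : pull5 B X i = ∑ p, B i p • pull4 B (X p) := by
  rw [pull5, pull_apply]

/-- Four matrices acting on the four indices of a tensor. -/
def mixedPull (A B C D : Matrix (Fin 8) (Fin 8) ℝ) : Tensor4 →ₗ[ℝ] Tensor4 :=
  pull A (pull B (pull C (pull D LinearMap.id)))

theorem pull4_eq_mixedPull : pull4 B = mixedPull B B B B := by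
  rw [pull4, pull3, pull2, pull1, mixedPull]

theorem mixedPull_mixedPull (A B C D A' B' C' D' : Matrix (Fin 8) (Fin 8) ℝ) (S : Tensor4) :
    mixedPull A B C D (mixedPull A' B' C' D' S) = mixedPull (A * A') (B * B') (C * C') (D * D') S := by
  have e1 : pull D (LinearMap.id : ℝ →ₗ[ℝ] ℝ) ∘ₗ pull D' LinearMap.id =
      pull (D * D') LinearMap.id := LinearMap.ext fun X => by
    rw [LinearMap.comp_apply, pull_pull, LinearMap.comp_id]
  have e2 : pull C (pull D (LinearMap.id : ℝ →ₗ[ℝ] ℝ)) ∘ₗ pull C' (pull D' LinearMap.id) =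
      pull (C * C') (pull (D * D') LinearMap.id) := LinearMap.ext fun X => by
    rw [LinearMap.comp_apply, pull_pull, e1]
  have e3 : pull B (pull C (pull D (LinearMap.id : ℝ →ₗ[ℝ] ℝ))) ∘ₗ
      pull B' (pull C' (pull D' LinearMap.id)) =
      pull (B * B') (pull (C * C') (pull (D * D') LinearMap.id)) := LinearMap.ext fun X => by
    rw [LinearMap.comp_apply, pull_pull, e2]
  rw [mixedPull, mixedPull, pull_pull, e3, mixedPull]

theorem derivation4_eq_mixedPull (K : Matrix (Fin 8) (Fin 8) ℝ) (S : Tensor4) :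
    derivation4 (fun i j => K i j) S = mixedPull K 1 1 1 S + mixedPull 1 K 1 1 S
      + mixedPull 1 1 K 1 S + mixedPull 1 1 1 K S := by
  funext i j k l
  simp [derivation4, mixedPull, pull_apply, Matrix.one_apply, Finset.sum_add_distrib]

/-- Intertwined endomorphisms act compatibly on tensors. Splitting the derivation into four mixed
changes of frame reduces this to products of matrices. -/
theorem pull4_derivation4 {K K' : Matrix (Fin 8) (Fin 8) ℝ} (hK : B * K = K' * B) (S : Tensor4) :
    pull4 B (derivation4 (fun i j => K i j) S) = derivation4 (fun i j => K' i j) (pull4 B S) := by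
  simp only [derivation4_eq_mixedPull, pull4_eq_mixedPull, map_add, mixedPull_mixedPull, hK,
    Matrix.mul_one, Matrix.one_mul]

theorem pull2_eq_mul (X : Tensor2) (i j) :
    pull2 B X i j = (B * Matrix.of X * B.transpose) i j := by
  rw [pull2_apply, Matrix.mul_apply]
  simp only [Matrix.mul_apply, Matrix.transpose_apply, Finset.sum_mul, Matrix.of_apply]
  rw [Finset.sum_comm]
  refine Finset.sum_congr rfl fun p _ => Finset.sum_congr rfl fun q _ => ?_
  ring

theorem derivation4_sum (c : Fin 8 → ℝ) (X : Fin 8 → Tensor2) (S : Tensor4) :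
    derivation4 (∑ p, c p • X p) S = ∑ p, c p • derivation4 (X p) S := by
  funext i j k l
  simp only [derivation4, Finset.sum_apply, Pi.smul_apply, smul_eq_mul, Finset.sum_mul,
    Finset.mul_sum, ← Finset.sum_add_distrib]
  rw [Finset.sum_comm]
  refine Finset.sum_congr rfl fun p _ => Finset.sum_congr rfl fun q _ => ?_
  ring

theorem pull5_derivation4 (T : Tensor3) (S : Tensor4) (a) :
    pull5 B (fun a => derivation4 (raise1 (B.transpose * B) T a) S) a =
      derivation4 (pull3 B T a) (pull4 B S) := by
  have e : ∀ p, pull4 B (derivation4 (raise1 (B.transpose * B) T p) S) =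
      derivation4 (pull2 B (T p)) (pull4 B S) := fun p => by
    have := pull4_derivation4 B (K := Matrix.of (T p) * (B.transpose * B))
      (K' := B * Matrix.of (T p) * B.transpose) (by simp only [Matrix.mul_assoc]) S
    have e2 : pull2 B (T p) = fun i j => (B * Matrix.of (T p) * B.transpose) i j := by
      funext i j; exact pull2_eq_mul B (T p) i j
    have e3 : raise1 (B.transpose * B) T p =
      fun i j => (Matrix.of (T p) * (B.transpose * B)) i j := rfl
    rw [e2, e3]
    with_reducible exact this
  rw [pull5_apply]
  simp only [e]
  rw [← derivation4_sum, pull3, pull_apply]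

theorem torsionAction_eq_derivation4 {h : Matrix (Fin 8) (Fin 8) ℝ} {T : Tensor3} {Φ : Tensor4}
    (hΦ : Φ ∈ alternating4) (a) : torsionAction h T Φ a = derivation4 (raise1 h T a) Φ := by
  obtain ⟨h12, h23, h34⟩ := hΦ
  funext i j k l
  refine Finset.sum_congr rfl fun p _ => ?_
  have c : ∀ i j k l, Φ i k l j = Φ i j k l := fun i j k l => by linarith [h34 i k j l, h23 i j k l]
  have e1 : Φ p k l i = -Φ i p k l := by rw [c p i k l, ← h12]
  have e2 : Φ p l i j = Φ i j p l := by
    linarith [c p j l i, c p l i j, h12 p i j l, h23 i p j l, c i p l j, h34 p j i l, h23 p i j l]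
  have e3 : Φ p i j k = -Φ i j k p := by linarith [h12 p i j k, c i p j k]
  rw [e1, e2, e3]
  ring

/-- The covariant derivative of the intrinsic torsion in terms of `X = ∇Φ` and `N = ∇T`. -/
noncomputable def intrinsicGrad (h : Matrix (Fin 8) (Fin 8) ℝ) (Φ : Tensor4) (T : Tensor3)
    (X : Fin 8 → Tensor4) (N : Tensor4) : Tensor4 := fun c a m n =>
  (1 / 4) * N c a m n - (1 / 8) * (ip2 h (X c m n) (T a) + ip2 h (Φ m n) (N c a))

theorem pull4_intrinsicGrad (Φ : Tensor4) (T : Tensor3) (X : Fin 8 → Tensor4) (N : Tensor4) :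
    pull4 A (intrinsicGrad (A.transpose * H * A) Φ T X N) =
      intrinsicGrad H (pull4 A Φ) (pull3 A T) (pull5 A X) (pull4 A N) := by
  obtain ⟨Y, hY⟩ : ∃ Y : Tensor4, Y = fun c m n a => ip2 H (pull2 A (X c m n)) (pull2 A (T a)) :=
    ⟨_, rfl⟩
  have e : intrinsicGrad (A.transpose * H * A) Φ T X N = (1 / 4 : ℝ) • N - (1 / 8 : ℝ) •
      ((fun c a m n => Y c m n a) + contractLast (A.transpose * H * A) Φ N) := by
    funext c a m n
    rw [intrinsicGrad, ip2_mul, hY]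
    rfl
  have e2 : pull4 A Y = fun c m n a => ip2 H (pull5 A X c m n) (pull3 A T a) := by
    rw [hY]
    funext c m n a
    have := pull_bilin₃ A (ip2 H) (fun c m n => pull2 A (X c m n)) (fun a => pull2 A (T a)) c m n a
    rw [pull_id_map] at this
    have k : pull A (pull A (pull A LinearMap.id)) (fun c m n => pull2 A (X c m n)) =
        pull A (pull A (pull A (pull2 A))) X := by
      funext i; simp only [pull_apply A (pull A (pull A _)), pull_pull_id_map]
    rw [k] at this
    simp only [pull5, pull4, pull3, pull2, pull1] at this ⊢
    with_reducible exact this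
  rw [e, map_sub, map_smul, map_smul, map_add, pull4_contractLast, pull4_cyc234 A Y, e2]
  rfl

/-! ### The spaces of curvature tensors -/

theorem pull4_zero : pull4 A 0 = 0 := by
  funext i j k l; simp [pull4_apply]

theorem pull4_mem_curvatureTensors {S : Tensor4} (hS : S ∈ curvatureTensors) :
    pull4 A S ∈ curvatureTensors := by
  obtain ⟨h1, h2, h3, h4⟩ := hS
  have k1 : ∀ a b c d, pull4 A (fun a b => S b a) a b c d = pull4 A S b a c d := fun a b c d => by
    rw [pull4_swap12 A S]
  have k2 : ∀ a b c d, pull4 A (fun a b c d => S a b d c) a b c d = pull4 A S a b d c :=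
    fun a b c d => by rw [pull4_swap34 A S]
  have k3 : ∀ a b c d, pull4 A (fun a b c d => S c d a b) a b c d = pull4 A S c d a b :=
    fun a b c d => by rw [pull4_pairSwap A S]
  have k4 : ∀ a b c d, pull4 A (fun a b c d => S a c d b) a b c d = pull4 A S a c d b :=
    fun a b c d => by rw [pull4_cyc234 A S]
  have k5 : ∀ a b c d, pull4 A (fun a b c d => S a d b c) a b c d = pull4 A S a d b c :=
    fun a b c d => by rw [pull4_cyc243 A S]
  refine ⟨fun a b c d => ?_, fun a b c d => ?_, fun a b c d => ?_, fun a b c d => ?_⟩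
  · rw [← k1 a b, pull4_apply, pull4_apply]
    simp only [← Finset.sum_neg_distrib]
    refine Finset.sum_congr rfl fun p _ => Finset.sum_congr rfl fun q _ =>
      Finset.sum_congr rfl fun r _ => Finset.sum_congr rfl fun s _ => ?_
    rw [h1]; ring
  · rw [← k2 a b, pull4_apply, pull4_apply]
    simp only [← Finset.sum_neg_distrib]
    refine Finset.sum_congr rfl fun p _ => Finset.sum_congr rfl fun q _ =>
      Finset.sum_congr rfl fun r _ => Finset.sum_congr rfl fun s _ => ?_
    rw [h2]; ring
  · rw [← k3 a b, pull4_apply, pull4_apply]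
    refine Finset.sum_congr rfl fun p _ => Finset.sum_congr rfl fun q _ =>
      Finset.sum_congr rfl fun r _ => Finset.sum_congr rfl fun s _ => ?_
    rw [h3]
  · rw [← k4 a b, ← k5 a b, pull4_apply, pull4_apply, pull4_apply]
    simp only [← Finset.sum_add_distrib]
    refine Finset.sum_eq_zero fun p _ => Finset.sum_eq_zero fun q _ =>
      Finset.sum_eq_zero fun r _ => Finset.sum_eq_zero fun s _ => ?_
    linear_combination (A a p * A b q * A c r * A d s) * h4 p q r s

theorem transpose_mul_one_mul : B.transpose * 1 * B = B.transpose * B := by rw [Matrix.mul_one]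

/-- For curvature tensors the condition on the first pair follows from that on the second by pair
symmetry. -/
theorem mem_part168_iff_fourPi7 {h : Matrix (Fin 8) (Fin 8) ℝ} {Φ S : Tensor4} :
    S ∈ part168 h Φ ↔ S ∈ curvatureTensors ∧ fourPi7 h Φ S = 0 := by
  constructor
  · rintro ⟨h1, _, h3⟩
    refine ⟨h1, ?_⟩
    funext a b i j
    exact sub_eq_zero.2 (h3 a b i j).symm
  · rintro ⟨h1, h2⟩
    have k : ∀ a b i j, (1 / 2) * ∑ p, ∑ q, raiseLast2 h Φ i j p q * S a b p q = S a b i j :=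
      fun a b i j =>
        (sub_eq_zero.1 (congrFun (congrFun (congrFun (congrFun h2 a) b) i) j)).symm
    refine ⟨h1, fun a b i j => ?_, k⟩
    have := k a b i j
    rw [h1.2.2.1 a b i j] at this
    simp only [h1.2.2.1 a b] at this
    exact this

theorem mem_part168_pull {A B : Matrix (Fin 8) (Fin 8) ℝ} (hAB : A * B = 1) {Φ S : Tensor4} :
    S ∈ part168 (B.transpose * B) Φ ↔ pull4 B S ∈ part168 1 (pull4 B Φ) := by
  have e : pull4 B (fourPi7 (B.transpose * B) Φ S) = fourPi7 1 (pull4 B Φ) (pull4 B S) := by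
    rw [← pull4_fourPi7 B 1 Φ S, transpose_mul_one_mul]
  rw [mem_part168_iff_fourPi7, mem_part168_iff_fourPi7, ← e]
  constructor
  · rintro ⟨h1, h2⟩
    exact ⟨pull4_mem_curvatureTensors B h1, by rw [h2, pull4_zero]⟩
  · rintro ⟨h1, h2⟩
    refine ⟨?_, pull4_injective A B hAB (by rw [h2, pull4_zero])⟩
    have := pull4_mem_curvatureTensors A h1
    rwa [pull4_pull4, hAB, pull4_one] at this

end Pull

/-! ## The curvature identities in a general frame -/

section Frames

variable (A B : Matrix (Fin 8) (Fin 8) ℝ)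

theorem pull3_skew12 {T : Tensor3} (h : ∀ a i j, T i a j = -T a i j) (a i j) :
    pull3 A T i a j = -pull3 A T a i j := by
  have k : pull3 A (fun a b => T b a) a i j = pull3 A T i a j := by rw [pull3_swap12 A T]
  rw [← k, pull3_apply, pull3_apply]
  simp only [← Finset.sum_neg_distrib]
  refine Finset.sum_congr rfl fun p _ => Finset.sum_congr rfl fun q _ =>
    Finset.sum_congr rfl fun r _ => ?_
  rw [h]; ring

theorem pull3_skew23 {T : Tensor3} (h : ∀ a i j, T a j i = -T a i j) (a i j) :
    pull3 A T a j i = -pull3 A T a i j := by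
  have k : pull3 A (fun a b c => T a c b) a i j = pull3 A T a j i := by rw [pull3_swap23 A T]
  rw [← k, pull3_apply, pull3_apply]
  simp only [← Finset.sum_neg_distrib]
  refine Finset.sum_congr rfl fun p _ => Finset.sum_congr rfl fun q _ =>
    Finset.sum_congr rfl fun r _ => ?_
  rw [h]; ring

theorem pull4_skew23 {N : Tensor4} (h : ∀ a i j k, N a j i k = -N a i j k) (a i j k) :
    pull4 A N a j i k = -pull4 A N a i j k := by
  have e : pull4 A (fun a b c => N a c b) a i j k = pull4 A N a j i k := by rw [pull4_swap23 A N]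
  rw [← e, pull4_apply, pull4_apply]
  simp only [← Finset.sum_neg_distrib]
  refine Finset.sum_congr rfl fun p _ => Finset.sum_congr rfl fun q _ =>
    Finset.sum_congr rfl fun r _ => Finset.sum_congr rfl fun s _ => ?_
  rw [h]; ring

theorem pull4_skew34 {N : Tensor4} (h : ∀ a i j k, N a i k j = -N a i j k) (a i j k) :
    pull4 A N a i k j = -pull4 A N a i j k := by
  have e : pull4 A (fun a b c d => N a b d c) a i j k = pull4 A N a i k j := by
    rw [pull4_swap34 A N]
  rw [← e, pull4_apply, pull4_apply]
  simp only [← Finset.sum_neg_distrib]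
  refine Finset.sum_congr rfl fun p _ => Finset.sum_congr rfl fun q _ =>
    Finset.sum_congr rfl fun r _ => Finset.sum_congr rfl fun s _ => ?_
  rw [h]; ring

theorem pull2_sum_contract (D : Tensor4) (i j) :
    pull2 A (fun m n => ∑ a, ∑ c, (A.transpose * A) a c * D c a m n) i j =
      ∑ a, pull4 A D a a i j := by
  simp only [pull2_apply, pull4_apply, Matrix.mul_apply, Matrix.transpose_apply, Finset.sum_mul]
  symm
  rw [sum_rot4, sum_rot4, sum_rot4]
  refine Finset.sum_congr rfl fun p _ => ?_
  rw [sum_rot4, sum_rot4, sum_rot4]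
  refine Finset.sum_congr rfl fun q _ => ?_
  rw [sum_rot3, Finset.sum_comm]
  refine Finset.sum_congr rfl fun a _ => Finset.sum_congr rfl fun c _ =>
    Finset.sum_congr rfl fun e _ => ?_
  ring

variable {A B} (hAB : A * B = 1) {Φ : Tensor4} (hΦ : IsSpinTensor (pull4 B Φ))
include hAB hΦ

section Torsion

variable {R N : Tensor4} {t : Tensor3} (t12 : ∀ a i j, t i a j = -t a i j)
  (t23 : ∀ a i j, t a j i = -t a i j)
  (n23 : ∀ a i j k, N a j i k = -N a i j k) (n34 : ∀ a i j k, N a i k j = -N a i j k)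
  (hR : R ∈ curvatureTensors)
  (hS : fourPi7 (B.transpose * B) Φ R = torsionCurvature (B.transpose * B) Φ t N)

omit hAB hΦ in
include hS in
theorem pull4_curvature : fourPi7 1 (pull4 B Φ) (pull4 B R) =
    torsionCurvature 1 (pull4 B Φ) (pull3 B t) (pull4 B N) := by
  rw [← pull4_fourPi7 B 1 Φ R, ← pull4_torsionCurvature B 1 Φ N t, transpose_mul_one_mul, hS]

include t12 n23 n34 hR hS

/-- A change of frame is injective and commutes with every operation on both sides, while `BᵀB`
becomes the identity. So the identity of the orthonormal frame applies. -/
theorem ricciContraction_of_frame : ricciContraction (B.transpose * B) R =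
    (-(1 / 2) : ℝ) • symPart (phiGradT (B.transpose * B) Φ N)
      + (1 / 2 : ℝ) • symPart (phiCurlT (B.transpose * B) Φ N) + contractTT (B.transpose * B) t
      + symPart (phiTT (B.transpose * B) Φ t) := by
  apply pull2_injective A B hAB
  have e1 := pull2_phiGradT B 1 Φ N
  have e2 := pull2_phiCurlT B 1 Φ N
  have e3 := pull2_phiTT B 1 Φ t
  have e4 := pull2_contractTT B 1 t
  rw [transpose_mul_one_mul] at e1 e2 e3 e4
  simp only [map_add, map_smul, pull2_symPart, pull2_ricciContraction, e1, e2, e3, e4]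
  funext a b
  exact hΦ.ricciContraction_frame (pull3_skew12 B t12) (pull4_skew23 B n23) (pull4_skew34 B n34)
    (pull4_mem_curvatureTensors B hR) (pull4_curvature hS) a b

omit hAB in
theorem scalarCurvature_of_frame :
    ∑ a, ∑ b, (B.transpose * B) a b * ricciContraction (B.transpose * B) R a b =
      -(∑ a, ∑ b, ∑ c, ∑ d, raise4 (B.transpose * B) Φ a b c d * N a b c d)
        + ∑ a, ∑ b, ∑ c, raise3 (B.transpose * B) t a b c * t a b c
        + ∑ a, ∑ b, ∑ c, ∑ d, ∑ p, raise4 (B.transpose * B) Φ a b c d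
          * raise1 (B.transpose * B) t a b p * t c d p := by
  have := hΦ.scalarCurvature_frame (pull3_skew12 B t12) (pull4_skew23 B n23) (pull4_skew34 B n34)
    (pull4_mem_curvatureTensors B hR) (pull4_curvature hS)
  rw [ip4_torsionSquare, sum_raise4_mul, sum_raise3_mul] at this ⊢
  rw [sum_sum_mul_pull2, pull2_ricciContraction, this, ← transpose_mul_one_mul, ip4_mul, ip3_mul,
    ip4_mul, pull4_torsionSquare]

include t23

theorem divergence_of_frame (m n) :
    4 * ∑ a, ∑ c, (B.transpose * B) a c * intrinsicGrad (B.transpose * B) Φ t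
      (fun a => derivation4 (raise1 (B.transpose * B) t a) Φ) N c a m n =
      (1 / 2) * skewPart (phiGradT (B.transpose * B) Φ N) m n
        - (3 / 2) * skewPart (phiCurlT (B.transpose * B) Φ N) m n
        - 3 * skewPart (phiTT (B.transpose * B) Φ t) m n := by
  have key : (4 : ℝ) • (fun m n => ∑ a, ∑ c, (B.transpose * B) a c *
      intrinsicGrad (B.transpose * B) Φ t
      (fun a => derivation4 (raise1 (B.transpose * B) t a) Φ) N c a m n) =
      (1 / 2 : ℝ) • skewPart (phiGradT (B.transpose * B) Φ N)
        - (3 / 2 : ℝ) • skewPart (phiCurlT (B.transpose * B) Φ N)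
        - (3 : ℝ) • skewPart (phiTT (B.transpose * B) Φ t) := by
    apply pull2_injective A B hAB
    have e1 := pull2_phiGradT B 1 Φ N
    have e2 := pull2_phiCurlT B 1 Φ N
    have e3 := pull2_phiTT B 1 Φ t
    rw [transpose_mul_one_mul] at e1 e2 e3
    simp only [map_sub, map_smul, pull2_skewPart, e1, e2, e3]
    funext i j
    simp only [Pi.smul_apply, Pi.sub_apply, smul_eq_mul, pull2_sum_contract]
    have := hΦ.divergence_frame (pull3_skew12 B t12) (pull3_skew23 B t23) (pull4_skew23 B n23)
      (pull4_skew34 B n34) (pull4_mem_curvatureTensors B hR) (pull4_curvature hS) i j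
    rw [← this, Finset.mul_sum]
    refine Finset.sum_congr rfl fun a _ => ?_
    have e4 : ∀ X, pull4 B (intrinsicGrad (B.transpose * B) Φ t X N) =
        intrinsicGrad 1 (pull4 B Φ) (pull3 B t) (pull5 B X) (pull4 B N) := fun X => by
      rw [← pull4_intrinsicGrad B 1 Φ t X N, transpose_mul_one_mul]
    rw [e4, intrinsicGrad, pull5_derivation4, ← sum_raiseLast2_mul, ← sum_raiseLast2_mul,
      raiseLast2_one, raiseLast2_one]
    simp only [Finset.sum_add_distrib]
    ring
  exact congrFun (congrFun key m) n

end Torsion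

omit hΦ in
theorem part168_eq_comap : part168 (B.transpose * B) Φ = (part168 1 (pull4 B Φ)).comap (pull4 B) := by
  ext S
  exact mem_part168_pull hAB

theorem finrank_part168_of_frame : Module.finrank ℝ (part168 (B.transpose * B) Φ) = 168 := by
  have hBA : B * A = 1 := mul_eq_one_comm.1 hAB
  let e : Tensor4 ≃ₗ[ℝ] Tensor4 := LinearEquiv.ofBijective (pull4 B)
    ⟨pull4_injective A B hAB, fun S => ⟨pull4 A S, by rw [pull4_pull4, hBA, pull4_one]; rfl⟩⟩
  rw [← hΦ.finrank_part168]
  have k : (part168 (B.transpose * B) Φ).map (e : Tensor4 →ₗ[ℝ] Tensor4) =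
      part168 1 (pull4 B Φ) := by
    rw [part168_eq_comap hAB]
    exact Submodule.map_comap_eq_of_surjective e.surjective _
  rw [← k]
  exact (LinearEquiv.finrank_map_eq e _).symm

theorem part168_le_weylTensors_of_frame :
    part168 (B.transpose * B) Φ ≤ weylTensors (B.transpose * B) := by
  intro S hS
  refine ⟨hS.1, ?_⟩
  have e : ricciContraction (B.transpose * B) S = 0 := by
    apply pull2_injective A B hAB
    rw [pull2_ricciContraction]
    have := (hΦ.part168_le_weylTensors ((mem_part168_pull hAB).1 hS)).2
    funext i j
    rw [this, pull2_apply]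
    simp
  intro a b
  rw [e]
  rfl

omit hAB hΦ in
theorem tensorInner_of_frame (S S' : Tensor4) :
    tensorInner (B.transpose * B) S S' = dot4 (pull4 B S) (pull4 B S') := by
  have e : ip4 1 = dot4 := by
    rw [ip4, Matrix.transpose_one, pull4_one, LinearMap.comp_id]
  rw [tensorInner, sum_raise4_mul, ← transpose_mul_one_mul, ip4_mul, e]

omit hAB hΦ in
theorem dot4_apply (S S' : Tensor4) :
    dot4 S S' = ∑ a, ∑ b, ∑ c, ∑ d, S a b c d * S' a b c d := by
  simp only [dot4, dot3, dot2, dot1, pairing_apply, LinearMap.mul_apply']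

omit hAB hΦ in
theorem dot4_comm (S S' : Tensor4) : dot4 S S' = dot4 S' S := by
  simp only [dot4_apply, mul_comm]

omit hAB hΦ in
theorem dot4_self_eq_zero {S : Tensor4} (h0 : dot4 S S = 0) : S = 0 := by
  rw [dot4_apply] at h0
  funext a b c d
  have n := fun a b c d => mul_self_nonneg (S a b c d)
  have h1 := (Finset.sum_eq_zero_iff_of_nonneg fun a _ => Finset.sum_nonneg fun b _ =>
    Finset.sum_nonneg fun c _ => Finset.sum_nonneg fun d _ => n a b c d).1 h0 a (Finset.mem_univ a)
  have h2 := (Finset.sum_eq_zero_iff_of_nonneg fun b _ =>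
    Finset.sum_nonneg fun c _ => Finset.sum_nonneg fun d _ => n a b c d).1 h1 b (Finset.mem_univ b)
  have h3 := (Finset.sum_eq_zero_iff_of_nonneg fun c _ =>
    Finset.sum_nonneg fun d _ => n a b c d).1 h2 c (Finset.mem_univ c)
  have h4 := (Finset.sum_eq_zero_iff_of_nonneg fun d _ => n a b c d).1 h3 d (Finset.mem_univ d)
  exact mul_self_eq_zero.1 h4

omit hΦ in
/-- The part of a curvature tensor orthogonal to the `168` part is a linear function of its part
in `Λ² ⊗ Λ²₇`. -/
theorem exists_orthogonalPart : ∃ F : Tensor4 →ₗ[ℝ] Tensor4, ∀ R ∈ curvatureTensors,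
    (∃ W ∈ part168 (B.transpose * B) Φ, R = F (fourPi7 (B.transpose * B) Φ R) + W) ∧
    ∀ W ∈ part168 (B.transpose * B) Φ,
      tensorInner (B.transpose * B) (F (fourPi7 (B.transpose * B) Φ R)) W = 0 := by
  set h := B.transpose * B with hh
  let b : LinearMap.BilinForm ℝ Tensor4 := dot4.compl₁₂ (pull4 B) (pull4 B)
  have hb : ∀ S S', b S S' = tensorInner h S S' := fun S S' => by
    rw [hh, tensorInner_of_frame, LinearMap.compl₁₂_apply]
  have hb0 : ∀ S, b S S = 0 → S = 0 := fun S h0 =>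
    pull4_injective A B hAB (by
      rw [LinearMap.compl₁₂_apply] at h0
      rw [dot4_self_eq_zero h0, pull4_zero])
  have hsymm : ∀ S S', b S S' = b S' S := fun S S' => by
    rw [LinearMap.compl₁₂_apply, LinearMap.compl₁₂_apply, dot4_comm]
  have hrefl : b.IsRefl := fun S S' h0 => by rw [hsymm]; exact h0
  -- The form `b` is definite, so the `168` part meets its orthogonal space only in zero and the two
  -- are complementary.
  have hcompl := (LinearMap.BilinForm.isCompl_orthogonal_iff_disjoint (W := part168 h Φ) hrefl).2
    (Submodule.disjoint_def.2 fun S h1 h2 => hb0 S (h2 S h1))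
  let C := curvatureTensors ⊓ b.orthogonal (part168 h Φ)
  let L : Tensor4 →ₗ[ℝ] Tensor4 :=
    { toFun := fourPi7 h Φ
      map_add' := fun S S' => by
        have e : contractLast h Φ (S + S') = contractLast h Φ S + contractLast h Φ S' := by
          funext a b i j
          exact map_add (ip2 h (Φ i j)) (S a b) (S' a b)
        rw [fourPi7_eq, fourPi7_eq, fourPi7_eq, e, smul_add]
        abel
      map_smul' := fun r S => by
        have e : contractLast h Φ (r • S) = r • contractLast h Φ S := by
          funext a b i j
          exact map_smul (ip2 h (Φ i j)) r (S a b)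
        rw [fourPi7_eq, fourPi7_eq, e, RingHom.id_apply, smul_sub, smul_comm] }
  have hL : ∀ S, L S = fourPi7 h Φ S := fun S => rfl
  -- The kernel of `fourPi7` on curvature tensors is the `168` part, which meets `C` trivially. A
  -- left inverse on `C`, extended to all tensors, is the map sought.
  have hinj : LinearMap.ker (L ∘ₗ C.subtype) = ⊥ := by
    rw [LinearMap.ker_eq_bot']
    intro S hS
    have h1 : (S : Tensor4) ∈ part168 h Φ := mem_part168_iff_fourPi7.2 ⟨S.2.1, hS⟩
    exact Subtype.ext (hb0 S (S.2.2 S h1))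
  obtain ⟨G, hG⟩ := LinearMap.exists_leftInverse_of_injective _ hinj
  refine ⟨C.subtype ∘ₗ G, fun R hR => ?_⟩
  obtain ⟨W, hW, c, hc, rfl⟩ := Submodule.mem_sup.1 (hcompl.sup_eq_top ▸ Submodule.mem_top (x := R))
  have hc' : c ∈ C := ⟨(Submodule.add_mem_iff_right _ hW.1).1 hR, hc⟩
  have e : (C.subtype ∘ₗ G) (fourPi7 h Φ (W + c)) = c := by
    have e1 : fourPi7 h Φ (W + c) = L c := by
      rw [← hL, map_add, hL W, (mem_part168_iff_fourPi7.1 hW).2, zero_add]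
    rw [e1]
    exact congrArg C.subtype (LinearMap.congr_fun hG ⟨c, hc'⟩)
  rw [e]
  refine ⟨⟨W, hW, add_comm _ _⟩, fun W' hW' => ?_⟩
  rw [← hb, hsymm]
  exact hc W' hW'

end Frames

/-! ## The metric as a smooth function of the Cayley form -/

theorem contDiffAt_det {ι E : Type*} [Fintype ι] [DecidableEq ι] [NormedAddCommGroup E]
    [NormedSpace ℝ E] {f : E → Matrix ι ι ℝ} {x : E} {n : WithTop ℕ∞}
    (hf : ∀ i j, ContDiffAt ℝ n (fun y => f y i j) x) : ContDiffAt ℝ n (fun y => (f y).det) x := by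
  simp only [Matrix.det_apply']
  exact ContDiffAt.sum fun σ _ => contDiffAt_const.mul (contDiffAt_prod fun i _ => hf _ _)

/-- By Cramer's rule the entries are quotients of determinants. -/
theorem contDiffAt_matrix_inv {ι E : Type*} [Fintype ι] [DecidableEq ι] [NormedAddCommGroup E]
    [NormedSpace ℝ E] {f : E → Matrix ι ι ℝ} {x : E} {n : WithTop ℕ∞}
    (hf : ∀ i j, ContDiffAt ℝ n (fun y => f y i j) x) (hx : (f x).det ≠ 0) (i j) :
    ContDiffAt ℝ n (fun y => (f y)⁻¹ i j) x := by
  have e : (fun y => (f y)⁻¹ i j) =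
      fun y => (f y).det⁻¹ * ((f y).updateRow j (Pi.single i 1)).det := by
    funext y
    rw [Matrix.inv_def, Matrix.smul_apply, Matrix.adjugate_apply, Ring.inverse_eq_inv', smul_eq_mul]
  rw [e]
  refine ((contDiffAt_det hf).inv hx).mul (contDiffAt_det fun k l => ?_)
  by_cases hk : k = j
  · subst hk
    simpa using contDiffAt_const
  · simpa [Matrix.updateRow_ne hk] using hf k l

/-- The matrix of `X ↦ P X + X + Xᵀ` on tensors of rank two. -/
def pairMatrix (P : Tensor4) : Matrix (Fin 8 × Fin 8) (Fin 8 × Fin 8) ℝ :=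
  Matrix.of fun x y => P x.1 x.2 y.1 y.2 + kron x.1 y.1 * kron x.2 y.2 + kron x.1 y.2 * kron x.2 y.1

theorem pull2_sum_mul (A : Matrix (Fin 8) (Fin 8) ℝ) (φ : Tensor4) (X : Tensor2) (i j) :
    ∑ k, ∑ l, pull4 A φ i j k l * X k l =
      pull2 A (fun i j => ∑ k, ∑ l, φ i j k l * pull2 A.transpose X k l) i j := by
  have e : ∀ Y : Tensor2, ∑ k, ∑ l, Y k l * X k l = dot2 X Y := fun Y => by
    simp only [dot2, dot1, pairing_apply, LinearMap.mul_apply', mul_comm]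
  have e2 : ∀ Y : Tensor2, ∑ k, ∑ l, Y k l * pull2 A.transpose X k l =
      dot2 (pull2 A.transpose X) Y := fun Y => by
    simp only [dot2, dot1, pairing_apply, LinearMap.mul_apply', mul_comm]
  rw [e]
  simp only [e2, dot2_pull2]
  simp only [pull4, pull3, pull2_apply, pull_apply A (pull A _), pull_apply A (pull2 A),
    Finset.sum_apply, Pi.smul_apply, map_sum, map_smul, smul_eq_mul, Finset.mul_sum]
  refine Finset.sum_congr rfl fun p _ => Finset.sum_congr rfl fun q _ => ?_
  ring

namespace IsSpinTensor

variable {A B : Matrix (Fin 8) (Fin 8) ℝ} (hAB : A * B = 1) {Φ : Tensor4}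
  (hΦ : IsSpinTensor (pull4 B Φ))
include hAB hΦ

/-- On symmetric tensors the matrix is multiplication by 2. On skew ones it is `Φ`, and since `λ² +
4λ = 12` its inverse there is `(Φ + 4)/12` with indices raised. This writes the inverse of a matrix
built from `Φ` alone in terms of the inverse metric `BᵀB`. -/
theorem pairMatrix_mul : pairMatrix Φ * Matrix.of (fun x y =>
    (1 / 4) * (kron x.1 y.1 * kron x.2 y.2 + kron x.1 y.2 * kron x.2 y.1)
      + (1 / 12) * (raise4 (B.transpose * B) Φ x.1 x.2 y.1 y.2
        + 2 * ((B.transpose * B) x.1 y.1 * (B.transpose * B) x.2 y.2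
          - (B.transpose * B) x.1 y.2 * (B.transpose * B) x.2 y.1))) = 1 := by
  have hBA : B * A = 1 := mul_eq_one_comm.1 hAB
  have hΦA : Φ = pull4 A (pull4 B Φ) := by rw [pull4_pull4, hAB, pull4_one]; rfl
  have hr : raise4 (B.transpose * B) Φ = pull4 B.transpose (pull4 B Φ) := by
    rw [raise4_eq, pull4_pull4, Matrix.transpose_mul, Matrix.transpose_transpose]
  rw [hr]
  generalize pull4 B Φ = φ at hΦ hΦA ⊢
  subst hΦA
  ext ⟨i, j⟩ ⟨a, b⟩
  let Y : Tensor2 := fun k l => B k a * B l b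
  -- `Z` is `(φ + 4) Y` up to the symmetric part of `Y`, so that `φ Z` is twelve times the skew part
  -- of `Y`.
  let Z : Tensor2 := fun k l => (∑ r, ∑ s, φ k l r s * Y r s) + 2 * (Y k l - Y l k)
  have hZ : ∀ k l, pull4 B.transpose φ k l a b + 2 * ((B.transpose * B) k a * (B.transpose * B) l b
      - (B.transpose * B) k b * (B.transpose * B) l a) = pull2 B.transpose Z k l := fun k l => by
    have e : ∀ p q, Z p q * B p k * B q l =
        (∑ r, ∑ s, φ p q r s * B p k * B q l * B r a * B s b)
          + (2 * (B p k * B p a * (B q l * B q b)) - 2 * (B p k * B p b * (B q l * B q a))) :=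
      fun p q => by
      simp only [Z, Y, add_mul, Finset.sum_mul]
      congr 1
      · refine Finset.sum_congr rfl fun r _ => Finset.sum_congr rfl fun s _ => ?_
        ring
      · ring
    simp only [pull2_apply, pull4_apply, Matrix.transpose_apply, e, Finset.sum_add_distrib,
      Finset.sum_sub_distrib, ← Finset.mul_sum, ← Finset.sum_mul, Matrix.mul_apply]
    ring
  have hφZ : ∀ p q, ∑ k, ∑ l, φ p q k l * Z k l = 6 * Y p q - 6 * Y q p := fun p q => by
    have e : ∀ k l, φ p q k l * Z k l = φ p q k l * (∑ r, ∑ s, φ k l r s * Y r s)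
        + 2 * (φ p q k l * Y k l) - 2 * (φ p q k l * Y l k) := fun k l => by
      simp only [Z]; ring
    simp only [e, Finset.sum_add_distrib, Finset.sum_sub_distrib, ← Finset.mul_sum,
      hΦ.sum_sum_mul, hΦ.sum_sum_mul_swap Y]
    ring
  have hAA : ∀ i a, ∑ p, A i p * B p a = kron i a := fun i a => by
    rw [← Matrix.mul_apply, hAB, Matrix.one_apply]; simp [kron]
  have hPZ : ∑ k, ∑ l, pull4 A φ i j k l * pull2 B.transpose Z k l =
      6 * (kron i a * kron j b) - 6 * (kron i b * kron j a) := by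
    have hT : A.transpose * B.transpose = 1 := by
      rw [← Matrix.transpose_mul, hBA, Matrix.transpose_one]
    rw [pull2_sum_mul, pull2_pull2, hT, pull2_one]
    simp only [LinearMap.id_apply, hφZ, pull2_apply]
    have e : ∀ p q, (6 * Y p q - 6 * Y q p) * A i p * A j q =
        6 * (A i p * B p a * (A j q * B q b)) - 6 * (A i p * B p b * (A j q * B q a)) :=
      fun p q => by simp only [Y]; ring
    simp only [e, Finset.sum_sub_distrib, ← Finset.mul_sum, ← Finset.sum_mul, hAA]
  have hsk : ∀ k l, pull2 B.transpose Z l k = -pull2 B.transpose Z k l := fun k l => by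
    rw [pull2_apply, pull2_apply, Finset.sum_comm]
    simp only [← Finset.sum_neg_distrib]
    refine Finset.sum_congr rfl fun p _ => Finset.sum_congr rfl fun q _ => ?_
    have : Z q p = -Z p q := by
      simp only [Z, hΦ.swap12 p q, neg_mul, Finset.sum_neg_distrib]; ring
    rw [this]; ring
  have hP : ∀ i j k l, pull4 A φ i j l k = -pull4 A φ i j k l := fun i j k l =>
    pull4_skew34 A (fun a i j k => hΦ.swap34 a i j k) i j k l
  simp only [Matrix.mul_apply, Fintype.sum_prod_type, pairMatrix, Matrix.of_apply]
  simp only [← Matrix.mul_apply, hZ]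
  have e : ∀ k l, (pull4 A φ i j k l + kron i k * kron j l + kron i l * kron j k) *
      ((1 / 4) * (kron k a * kron l b + kron k b * kron l a) + (1 / 12) * pull2 B.transpose Z k l) =
      kron a k * (kron b l * ((1 / 4) * pull4 A φ i j k l))
        + kron b k * (kron a l * ((1 / 4) * pull4 A φ i j k l))
        + (1 / 12) * (pull4 A φ i j k l * pull2 B.transpose Z k l)
        + kron i k * (kron j l * ((1 / 4) * (kron k a * kron l b + kron k b * kron l a)
            + (1 / 12) * pull2 B.transpose Z k l))
        + kron j k * (kron i l * ((1 / 4) * (kron k a * kron l b + kron k b * kron l a)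
            + (1 / 12) * pull2 B.transpose Z k l)) := fun k l => by
    rw [kron_comm a k, kron_comm b l, kron_comm b k, kron_comm a l]; ring
  simp only [e, Finset.sum_add_distrib, ← Finset.mul_sum, sum_kron_mul, hPZ]
  rw [hsk i j, hP i j a b, Matrix.one_apply]
  have : (if (i, j) = (a, b) then (1 : ℝ) else 0) = kron i a * kron j b := by
    by_cases h1 : i = a <;> by_cases h2 : j = b <;> simp [kron, h1, h2]
  rw [this]
  ring

end IsSpinTensor

/-- The minors of order two of the inverse metric of a Cayley form. -/
noncomputable def inverseMinor (P : Tensor4) (i j k l : Fin 8) : ℝ :=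
  -- Without its symmetric part the inverse is a twelfth of a 4-form plus a sixth of the minors. The
  -- weights 4, -2, -2 over the cyclic permutations cancel the 4-form; the minors have cyclic sum
  -- zero and are multiplied by six.
  4 * ((pairMatrix P)⁻¹ (i, j) (k, l) - (1 / 4) * (kron i k * kron j l + kron i l * kron j k))
    - 2 * ((pairMatrix P)⁻¹ (i, k) (l, j) - (1 / 4) * (kron i l * kron k j + kron i j * kron k l))
    - 2 * ((pairMatrix P)⁻¹ (i, l) (j, k) - (1 / 4) * (kron i j * kron l k + kron i k * kron l j))

/-- The square of a minor of order three of the inverse metric of a Cayley form. -/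
noncomputable def inverseMinorSq (P : Tensor4) (i j k : Fin 8) : ℝ :=
  inverseMinor P i j i j * (inverseMinor P i k i k * inverseMinor P j k j k
      - inverseMinor P i k j k ^ 2)
    - inverseMinor P i j i k * (inverseMinor P i j i k * inverseMinor P j k j k
      - inverseMinor P i k j k * inverseMinor P i j j k)
    + inverseMinor P i j j k * (inverseMinor P i j i k * inverseMinor P i k j k
      - inverseMinor P i k i k * inverseMinor P i j j k)

/-- The entries of the inverse metric of a Cayley form, off the diagonal and on it; the other
indices are auxiliary. -/
noncomputable def inverseMetric (P : Tensor4) (i j k : Fin 8) : ℝ :=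
  (inverseMinor P i k j k * inverseMinor P i j i j - inverseMinor P i k i j * inverseMinor P i j j k)
    / √(inverseMinorSq P i j k)

noncomputable def inverseMetricDiag (P : Tensor4) (i j k : Fin 8) : ℝ :=
  (inverseMinor P i j i j * inverseMinor P i k i k - inverseMinor P i j i k * inverseMinor P i j i k)
    / √(inverseMinorSq P i j k)

namespace IsSpinTensor

variable {A B : Matrix (Fin 8) (Fin 8) ℝ} (hAB : A * B = 1) {Φ : Tensor4}
  (hΦ : IsSpinTensor (pull4 B Φ))
include hAB hΦ

theorem inverseMinor_eq (i j k l) : inverseMinor Φ i j k l =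
    (B.transpose * B) i k * (B.transpose * B) j l - (B.transpose * B) i l * (B.transpose * B) j k := by
  have hs : ∀ a b, (B.transpose * B) a b = (B.transpose * B) b a := fun a b => by
    simp only [Matrix.mul_apply, Matrix.transpose_apply, mul_comm]
  have hr : raise4 (B.transpose * B) Φ = pull4 B.transpose (pull4 B Φ) := by
    rw [raise4_eq, pull4_pull4, Matrix.transpose_mul, Matrix.transpose_transpose]
  have h34 : ∀ i j k l, raise4 (B.transpose * B) Φ i j l k = -raise4 (B.transpose * B) Φ i j k l := by
    rw [hr]; exact pull4_skew34 _ (fun a i j k => hΦ.swap34 a i j k)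
  have h23 : ∀ i j k l, raise4 (B.transpose * B) Φ i k j l = -raise4 (B.transpose * B) Φ i j k l := by
    rw [hr]; exact pull4_skew23 _ (fun a i j k => hΦ.swap23 a i j k)
  have c1 : raise4 (B.transpose * B) Φ i k l j = raise4 (B.transpose * B) Φ i j k l := by
    rw [h34, h23, neg_neg]
  have c2 : raise4 (B.transpose * B) Φ i l j k = raise4 (B.transpose * B) Φ i j k l := by
    rw [h23, h34, neg_neg]
  simp only [inverseMinor, Matrix.inv_eq_right_inv (hΦ.pairMatrix_mul hAB), Matrix.of_apply, c1, c2]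
  rw [hs k j, hs l k, hs l j]
  ring

/-- The determinant of the matrix of 2 × 2 minors of a 3 × 3 matrix is the square of its
determinant. -/
theorem inverseMinorSq_eq (i j k) : inverseMinorSq Φ i j k =
    ((B.transpose * B).submatrix ![i, j, k] ![i, j, k]).det ^ 2 := by
  have hs : ∀ a b, (B.transpose * B) a b = (B.transpose * B) b a := fun a b => by
    simp only [Matrix.mul_apply, Matrix.transpose_apply, mul_comm]
  simp only [inverseMinorSq, hΦ.inverseMinor_eq hAB, Matrix.det_fin_three, Matrix.submatrix_apply,
    Matrix.cons_val]
  rw [hs j i, hs k i, hs k j]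
  ring

omit hΦ in
theorem minor_pos {i j k : Fin 8} (hij : i ≠ j) (hik : i ≠ k) (hjk : j ≠ k) :
    0 < ((B.transpose * B).submatrix ![i, j, k] ![i, j, k]).det := by
  have hpd : (B.transpose * B).PosDef := by
    have := Matrix.PosDef.conjTranspose_mul_self B (Matrix.mulVec_injective_of_isUnit
      (IsUnit.of_mul_eq_one_right A hAB))
    rwa [Matrix.conjTranspose_eq_transpose_of_trivial] at this
  refine (hpd.submatrix (e := ![i, j, k]) ?_).det_pos
  intro a b hab
  fin_cases a <;> fin_cases b <;> simp_all

/-- The 2 × 2 minors of the matrix of minors of a 3 × 3 matrix are its entries times its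
determinant. That determinant is positive by `minor_pos`, so the square root recovers it with the
correct sign. -/
theorem inverseMetric_eq {i j k : Fin 8} (hij : i ≠ j) (hik : i ≠ k) (hjk : j ≠ k) :
    inverseMetric Φ i j k = (B.transpose * B) i j := by
  have hs : ∀ a b, (B.transpose * B) a b = (B.transpose * B) b a := fun a b => by
    simp only [Matrix.mul_apply, Matrix.transpose_apply, mul_comm]
  have hp := minor_pos hAB hij hik hjk
  rw [inverseMetric, hΦ.inverseMinorSq_eq hAB, Real.sqrt_sq hp.le, div_eq_iff hp.ne']
  simp only [hΦ.inverseMinor_eq hAB, Matrix.det_fin_three, Matrix.submatrix_apply, Matrix.cons_val]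
  rw [hs j i, hs k i, hs k j]
  ring

theorem contDiffAt_inverseMinor (i j k l) : ContDiffAt ℝ ∞ (fun P => inverseMinor P i j k l) Φ := by
  have hc : ∀ x y, ContDiffAt ℝ ∞ (fun P => (pairMatrix P)⁻¹ x y) Φ := fun x y => by
    refine contDiffAt_matrix_inv (fun x y => ?_) ?_ x y
    · simp only [pairMatrix, Matrix.of_apply]
      fun_prop
    · have := congrArg Matrix.det (hΦ.pairMatrix_mul hAB)
      rw [Matrix.det_mul, Matrix.det_one] at this
      exact left_ne_zero_of_mul_eq_one this
  unfold inverseMinor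
  exact (((contDiffAt_const.mul ((hc _ _).sub contDiffAt_const)).sub
    (contDiffAt_const.mul ((hc _ _).sub contDiffAt_const))).sub
    (contDiffAt_const.mul ((hc _ _).sub contDiffAt_const)))

theorem contDiffAt_sqrt_inverseMinorSq {i j k : Fin 8} (hij : i ≠ j) (hik : i ≠ k)
    (hjk : j ≠ k) : ContDiffAt ℝ ∞ (fun P => √(inverseMinorSq P i j k)) Φ ∧
      √(inverseMinorSq Φ i j k) ≠ 0 := by
  have hc := hΦ.contDiffAt_inverseMinor hAB
  have hp := minor_pos hAB hij hik hjk
  have hq : ContDiffAt ℝ ∞ (fun P => inverseMinorSq P i j k) Φ := by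
    unfold inverseMinorSq
    have := hc i j i j
    have := hc i k i k
    have := hc j k j k
    have := hc i k j k
    have := hc i j i k
    have := hc i j j k
    fun_prop
  constructor
  · refine hq.sqrt ?_
    rw [hΦ.inverseMinorSq_eq hAB]; positivity
  · rw [hΦ.inverseMinorSq_eq hAB, Real.sqrt_sq hp.le]; exact hp.ne'

theorem contDiffAt_inverseMetric {i j k : Fin 8} (hij : i ≠ j) (hik : i ≠ k) (hjk : j ≠ k) :
    ContDiffAt ℝ ∞ (fun P => inverseMetric P i j k) Φ := by
  have hc := hΦ.contDiffAt_inverseMinor hAB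
  have hs := hΦ.contDiffAt_sqrt_inverseMinorSq hAB hij hik hjk
  exact (((hc _ _ _ _).mul (hc _ _ _ _)).sub ((hc _ _ _ _).mul (hc _ _ _ _))).div hs.1 hs.2

theorem inverseMetricDiag_eq {i j k : Fin 8} (hij : i ≠ j) (hik : i ≠ k) (hjk : j ≠ k) :
    inverseMetricDiag Φ i j k = (B.transpose * B) i i := by
  have hs : ∀ a b, (B.transpose * B) a b = (B.transpose * B) b a := fun a b => by
    simp only [Matrix.mul_apply, Matrix.transpose_apply, mul_comm]
  have hp := minor_pos hAB hij hik hjk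
  rw [inverseMetricDiag, hΦ.inverseMinorSq_eq hAB, Real.sqrt_sq hp.le, div_eq_iff hp.ne']
  simp only [hΦ.inverseMinor_eq hAB, Matrix.det_fin_three, Matrix.submatrix_apply, Matrix.cons_val]
  rw [hs j i, hs k i, hs k j]
  ring

theorem contDiffAt_inverseMetricDiag {i j k : Fin 8} (hij : i ≠ j) (hik : i ≠ k) (hjk : j ≠ k) :
    ContDiffAt ℝ ∞ (fun P => inverseMetricDiag P i j k) Φ := by
  have hc := hΦ.contDiffAt_inverseMinor hAB
  have hs := hΦ.contDiffAt_sqrt_inverseMinorSq hAB hij hik hjk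
  exact (((hc _ _ _ _).mul (hc _ _ _ _)).sub ((hc _ _ _ _).mul (hc _ _ _ _))).div hs.1 hs.2

omit hAB hΦ in
/-- The inverse metric is a smooth function of the Cayley form. -/
theorem exists_inverseMetric (i j : Fin 8) : ∃ F : Tensor4 → ℝ,
    ∀ (A B : Matrix (Fin 8) (Fin 8) ℝ) (Φ : Tensor4), A * B = 1 → IsSpinTensor (pull4 B Φ) →
      F Φ = (B.transpose * B) i j ∧ ContDiffAt ℝ ∞ F Φ := by
  -- A 3 × 3 block containing the entry needs auxiliary indices distinct from `i` and `j`.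
  have h8 : ∀ i j : Fin 8, ∃ k, i ≠ k ∧ j ≠ k := by decide
  obtain ⟨k, hik, hjk⟩ := h8 i j
  by_cases hij : i = j
  · subst hij
    obtain ⟨l, hil, hkl⟩ := h8 i k
    exact ⟨fun P => inverseMetricDiag P i k l, fun A B Φ hAB hΦ =>
      ⟨hΦ.inverseMetricDiag_eq hAB hik hil hkl, hΦ.contDiffAt_inverseMetricDiag hAB hik hil hkl⟩⟩
  · exact ⟨fun P => inverseMetric P i j k, fun A B Φ hAB hΦ =>
      ⟨hΦ.inverseMetric_eq hAB hij hik hjk, hΦ.contDiffAt_inverseMetric hAB hij hik hjk⟩⟩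

end IsSpinTensor

/-! ## Components of forms -/

theorem sum_pi_succ {α M : Type*} [Fintype α] [AddCommMonoid M] {n : ℕ}
    (F : (Fin (n + 1) → α) → M) :
    ∑ r, F r = ∑ a, ∑ r : Fin n → α, F (Matrix.vecCons a r) := by
  rw [← (Fin.consEquiv fun _ => α).sum_comp, Fintype.sum_prod_type]
  rfl

theorem sum_pi_zero {α M : Type*} [Fintype α] [AddCommMonoid M] (F : (Fin 0 → α) → M) :
    ∑ r, F r = F ![] := by
  rw [Fintype.sum_unique]
  exact congrArg F (Subsingleton.elim _ _)

theorem alternatingMap_sum_smul {n : ℕ} (φ : R8 [⋀^Fin n]→L[ℝ] ℝ)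
    (c : Fin n → Fin 8 → ℝ) : φ (fun m => ∑ p, c m p • stdVec p) =
      ∑ r : Fin n → Fin 8, (∏ m, c m (r m)) * φ fun m => stdVec (r m) := by
  have := φ.toMultilinearMap.map_sum fun m p => c m p • stdVec p
  refine this.trans (Finset.sum_congr rfl fun r _ => ?_)
  exact φ.toMultilinearMap.map_smul_univ (fun m => c m (r m)) fun m => stdVec (r m)

theorem eq_sum_stdVec (v : R8) : v = ∑ p, v p • stdVec p := by
  ext i
  simp [Finset.sum_apply, Pi.single_apply]

/-- The matrix of components of a family of vectors. -/
def compMatrix (b : Fin 8 → R8) : Matrix (Fin 8) (Fin 8) ℝ := Matrix.of fun i p => b i p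

theorem apply_eq_pull4 (φ : R8 [⋀^Fin 4]→L[ℝ] ℝ) (b : Fin 8 → R8) (i j k l) :
    φ ![b i, b j, b k, b l] = pull4 (compMatrix b) (comp4 φ) i j k l := by
  have e : ![b i, b j, b k, b l] = fun m => ∑ p, (![b i, b j, b k, b l] m) p • stdVec p := by
    funext m
    exact eq_sum_stdVec _
  rw [e, alternatingMap_sum_smul, pull4_apply]
  simp only [sum_pi_succ, sum_pi_zero, Fin.prod_univ_four, comp4, compMatrix, Matrix.of_apply]
  refine Finset.sum_congr rfl fun p _ => Finset.sum_congr rfl fun q _ =>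
    Finset.sum_congr rfl fun r _ => Finset.sum_congr rfl fun s _ => ?_
  have : (fun m => stdVec (![p, q, r, s] m)) = ![stdVec p, stdVec q, stdVec r, stdVec s] := by
    funext m; fin_cases m <;> rfl
  rw [this]
  simp only [Matrix.cons_val]
  ring

theorem apply_eq_pull3 (φ : R8 [⋀^Fin 3]→L[ℝ] ℝ) (b : Fin 8 → R8) (i j k) :
    φ ![b i, b j, b k] = pull3 (compMatrix b) (comp3 φ) i j k := by
  have e : ![b i, b j, b k] = fun m => ∑ p, (![b i, b j, b k] m) p • stdVec p := by
    funext m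
    exact eq_sum_stdVec _
  rw [e, alternatingMap_sum_smul, pull3_apply]
  simp only [sum_pi_succ, sum_pi_zero, Fin.prod_univ_three, comp3, compMatrix, Matrix.of_apply]
  refine Finset.sum_congr rfl fun p _ => Finset.sum_congr rfl fun q _ =>
    Finset.sum_congr rfl fun r _ => ?_
  have : (fun m => stdVec (![p, q, r] m)) = ![stdVec p, stdVec q, stdVec r] := by
    funext m; fin_cases m <;> rfl
  rw [this]
  simp only [Matrix.cons_val]
  ring

theorem comp3_injective : Function.Injective comp3 := fun φ ψ e => by
  ext v
  have e2 : v = fun m => ∑ p, (v m) p • stdVec p := funext fun m => eq_sum_stdVec _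
  rw [e2, alternatingMap_sum_smul, alternatingMap_sum_smul]
  refine Finset.sum_congr rfl fun r _ => ?_
  have : (fun m => stdVec (r m)) = ![stdVec (r 0), stdVec (r 1), stdVec (r 2)] := by
    funext m; fin_cases m <;> rfl
  rw [this]
  exact congrArg _ (congrFun (congrFun (congrFun e (r 0)) (r 1)) (r 2))

theorem comp4_mem_alternating4 (φ : R8 [⋀^Fin 4]→L[ℝ] ℝ) : comp4 φ ∈ alternating4 := by
  refine ⟨fun i j k l => ?_, fun i j k l => ?_, fun i j k l => ?_⟩
  · have := φ.map_swap ![stdVec i, stdVec j, stdVec k, stdVec l] (i := 0) (j := 1) (by decide)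
    refine Eq.trans (congrArg φ.toAlternatingMap ?_) this
    funext m; fin_cases m <;> rfl
  · have := φ.map_swap ![stdVec i, stdVec j, stdVec k, stdVec l] (i := 1) (j := 2) (by decide)
    refine Eq.trans (congrArg φ.toAlternatingMap ?_) this
    funext m; fin_cases m <;> rfl
  · have := φ.map_swap ![stdVec i, stdVec j, stdVec k, stdVec l] (i := 2) (j := 3) (by decide)
    refine Eq.trans (congrArg φ.toAlternatingMap ?_) this
    funext m; fin_cases m <;> rfl

theorem threeForm_swap12 (φ : R8 [⋀^Fin 3]→L[ℝ] ℝ) (u v w : R8) : φ ![v, u, w] = -φ ![u, v, w] := by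
  have := φ.map_swap ![u, v, w] (i := 0) (j := 1) (by decide)
  refine Eq.trans (congrArg φ.toAlternatingMap ?_) this
  funext m; fin_cases m <;> rfl

theorem threeForm_swap23 (φ : R8 [⋀^Fin 3]→L[ℝ] ℝ) (u v w : R8) : φ ![u, w, v] = -φ ![u, v, w] := by
  have := φ.map_swap ![u, v, w] (i := 1) (j := 2) (by decide)
  refine Eq.trans (congrArg φ.toAlternatingMap ?_) this
  funext m; fin_cases m <;> rfl

theorem comp3_swap12 (φ : R8 [⋀^Fin 3]→L[ℝ] ℝ) (i j k) : comp3 φ j i k = -comp3 φ i j k :=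
  threeForm_swap12 φ _ _ _

theorem comp3_swap23 (φ : R8 [⋀^Fin 3]→L[ℝ] ℝ) (i j k) : comp3 φ i k j = -comp3 φ i j k :=
  threeForm_swap23 φ _ _ _

/-- The linear map from forms to components. -/
noncomputable def comp3L : (R8 [⋀^Fin 3]→L[ℝ] ℝ) →ₗ[ℝ] Tensor3 where
  toFun := comp3
  map_add' _ _ := rfl
  map_smul' _ _ := rfl

/-- An alternating tensor of rank three consists of the components of a form. -/
theorem exists_comp3_eq {t : Tensor3} (t12 : ∀ i j k, t j i k = -t i j k)
    (t23 : ∀ i j k, t i k j = -t i j k) : ∃ φ, comp3 φ = t := by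
  let e : Fin 8 → R8 →L[ℝ] ℝ := fun i => EuclideanSpace.proj i
  let m : MultilinearMap ℝ (fun _ : Fin 3 => R8) ℝ :=
    ∑ i, ∑ j, ∑ k, t i j k •
      (MultilinearMap.mkPiAlgebra ℝ (Fin 3) ℝ).compLinearMap fun n => (e (![i, j, k] n)).toLinearMap
  have hm : ∀ v, m v = ∑ i, ∑ j, ∑ k, t i j k * (v 0 i * v 1 j * v 2 k) := fun v => by
    simp [m, e, Fin.prod_univ_three]
  have h01 : ∀ v, v 0 = v 1 → m v = 0 := fun v hv => by
    have : m v = -m v := by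
      conv_lhs => rw [hm, Finset.sum_comm]
      rw [hm]
      simp only [← Finset.sum_neg_distrib]
      refine Finset.sum_congr rfl fun j _ => Finset.sum_congr rfl fun i _ =>
        Finset.sum_congr rfl fun k _ => ?_
      rw [hv, t12 j i k]
      ring
    linarith
  have h12 : ∀ v, v 1 = v 2 → m v = 0 := fun v hv => by
    have : m v = -m v := by
      rw [hm]
      simp only [← Finset.sum_neg_distrib]
      refine Finset.sum_congr rfl fun i _ => ?_
      rw [Finset.sum_comm]
      refine Finset.sum_congr rfl fun j _ => Finset.sum_congr rfl fun k _ => ?_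
      rw [hv, t23 i j k]
      ring
    linarith
  have h02 : ∀ v, v 0 = v 2 → m v = 0 := fun v hv => by
    have : m v = -m v := by
      have e1 : m v = ∑ k, ∑ j, ∑ i, t i j k * (v 0 i * v 1 j * v 2 k) :=
        (hm v).trans <| (Finset.sum_congr rfl fun i _ => Finset.sum_comm).trans <|
          Finset.sum_comm.trans <| Finset.sum_congr rfl fun k _ => Finset.sum_comm
      refine e1.trans ?_
      rw [hm]
      simp only [← Finset.sum_neg_distrib]
      refine Finset.sum_congr rfl fun i _ => Finset.sum_congr rfl fun j _ =>
        Finset.sum_congr rfl fun k _ => ?_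
      rw [hv, t12 j k i, t23 j i k, t12 i j k]
      ring
    linarith
  let a : R8 [⋀^Fin 3]→ₗ[ℝ] ℝ :=
    { m with
      map_eq_zero_of_eq' := fun v i j hv hij => by
        change m v = 0
        fin_cases i <;> fin_cases j <;>
          first
            | exact absurd rfl hij
            | exact h01 v hv
            | exact h12 v hv
            | exact h02 v hv
            | exact h01 v hv.symm
            | exact h12 v hv.symm
            | exact h02 v hv.symm }
  have hc : Continuous m := by
    have : (m : (Fin 3 → R8) → ℝ) = fun v => ∑ i, ∑ j, ∑ k, t i j k * (v 0 i * v 1 j * v 2 k) :=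
      funext hm
    rw [this]
    fun_prop
  refine ⟨{ a with cont := hc }, ?_⟩
  funext i j k
  refine (hm _).trans ?_
  simp

/-! ## Adapted frames -/

/-- The rows of `B` are the components of an adapted basis of `φ`, and `A` is the inverse of `B`. -/
structure IsFrame (φ : R8 [⋀^Fin 4]→L[ℝ] ℝ) (A B : Matrix (Fin 8) (Fin 8) ℝ) : Prop where
  mul_eq_one : A * B = 1
  pull4_eq : pull4 B (comp4 φ) = stdPhi
  isCayleyForm : IsCayleyForm φ

theorem isFrame_of_isAdaptedBasis {φ : R8 [⋀^Fin 4]→L[ℝ] ℝ} {b : Module.Basis (Fin 8) ℝ R8}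
    (hb : IsAdaptedBasis φ b) :
    IsFrame φ (Matrix.of fun i p => b.repr (stdVec i) p) (compMatrix b) := by
  refine ⟨?_, ?_, b, hb⟩
  · ext i j
    have e := congrArg (fun v : R8 => v j) (b.sum_repr (stdVec i))
    have e2 : (stdVec i : R8) j = (1 : Matrix (Fin 8) (Fin 8) ℝ) i j := by
      simp [Matrix.one_apply, eq_comm]
    rw [← e2]
    refine Eq.trans ?_ e
    simp [compMatrix, Matrix.mul_apply, Finset.sum_apply, -Module.Basis.sum_repr]
  · funext i j k l
    rw [← apply_eq_pull4]
    exact hb i j k l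

theorem IsCayleyForm.exists_isFrame {φ : R8 [⋀^Fin 4]→L[ℝ] ℝ} (hφ : IsCayleyForm φ) :
    ∃ A B, IsFrame φ A B ∧ metricMatrix φ = A * A.transpose := by
  refine ⟨_, _, isFrame_of_isAdaptedBasis hφ.choose_spec, ?_⟩
  ext i j
  simp only [metricMatrix, cayleyMetric, dif_pos hφ, Matrix.of_apply, Matrix.mul_apply,
    Matrix.transpose_apply]

namespace IsFrame

variable {φ : R8 [⋀^Fin 4]→L[ℝ] ℝ} {A B : Matrix (Fin 8) (Fin 8) ℝ}

theorem isSpinTensor (h : IsFrame φ A B) : IsSpinTensor (pull4 B (comp4 φ)) := by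
  rw [h.pull4_eq]
  exact isSpinTensor_stdPhi

/-- The function `F` of `exists_inverseMetric` depends on the components of the form only, so `BᵀB`
is the same for all adapted frames. This shows that the metric is well defined without a computation
of the stabiliser. -/
theorem inv_metricMatrix (h : IsFrame φ A B) : (metricMatrix φ)⁻¹ = B.transpose * B := by
  obtain ⟨A', B', h', e⟩ := h.isCayleyForm.exists_isFrame
  have e2 : (metricMatrix φ)⁻¹ = B'.transpose * B' := by
    refine Matrix.inv_eq_left_inv ?_
    rw [e, Matrix.mul_assoc, ← Matrix.mul_assoc B', mul_eq_one_comm.1 h'.mul_eq_one, Matrix.one_mul,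
      ← Matrix.transpose_mul, h'.mul_eq_one, Matrix.transpose_one]
  rw [e2]
  ext i j
  obtain ⟨F, hF⟩ := IsSpinTensor.exists_inverseMetric i j
  rw [← (hF _ _ _ h'.mul_eq_one h'.isSpinTensor).1, ← (hF _ _ _ h.mul_eq_one h.isSpinTensor).1]

theorem metricMatrix_eq (h : IsFrame φ A B) : metricMatrix φ = A * A.transpose := by
  obtain ⟨A', B', h', e⟩ := h.isCayleyForm.exists_isFrame
  have e1 : metricMatrix φ * (B.transpose * B) = 1 := by
    rw [← h.inv_metricMatrix, h'.inv_metricMatrix, e, Matrix.mul_assoc,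
      ← Matrix.mul_assoc A'.transpose, ← Matrix.transpose_mul,
      mul_eq_one_comm.1 h'.mul_eq_one, Matrix.transpose_one, Matrix.one_mul, h'.mul_eq_one]
  have e2 : (B.transpose * B) * (A * A.transpose) = 1 := by
    rw [Matrix.mul_assoc, ← Matrix.mul_assoc B, mul_eq_one_comm.1 h.mul_eq_one, Matrix.one_mul,
      ← Matrix.transpose_mul, h.mul_eq_one, Matrix.transpose_one]
  exact left_inv_eq_right_inv e1 e2

end IsFrame

theorem metricMatrix_comm (φ : R8 [⋀^Fin 4]→L[ℝ] ℝ) (i j) :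
    metricMatrix φ i j = metricMatrix φ j i := by
  simp only [metricMatrix, cayleyMetric, Matrix.of_apply]
  split_ifs <;> simp only [mul_comm]

theorem IsCayleyForm.metricMatrix_mul_inv {φ : R8 [⋀^Fin 4]→L[ℝ] ℝ} (hφ : IsCayleyForm φ) :
    metricMatrix φ * (metricMatrix φ)⁻¹ = 1 := by
  obtain ⟨A, B, h, e⟩ := hφ.exists_isFrame
  rw [h.inv_metricMatrix, e, Matrix.mul_assoc, ← Matrix.mul_assoc A.transpose,
    ← Matrix.transpose_mul, mul_eq_one_comm.1 h.mul_eq_one, Matrix.transpose_one, Matrix.one_mul,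
    h.mul_eq_one]

theorem IsCayleyForm.comp_equiv {φ : R8 [⋀^Fin 4]→L[ℝ] ℝ} (hφ : IsCayleyForm φ)
    (L : R8 ≃L[ℝ] R8) : IsCayleyForm (φ.compContinuousLinearMap (L : R8 →L[ℝ] R8)) := by
  obtain ⟨b, hb⟩ := hφ
  refine ⟨b.map L.symm.toLinearEquiv, fun i j k l => (Eq.trans (congrArg φ ?_) (hb i j k l))⟩
  funext m; fin_cases m <;> simp

/-! ## Derivatives of matrices -/

section MatrixDeriv

variable {A B : ℝ → Matrix (Fin 8) (Fin 8) ℝ} {A' B' : Matrix (Fin 8) (Fin 8) ℝ} {x : ℝ}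

theorem hasDerivAt_matrix_mul (hA : ∀ i j, HasDerivAt (fun s => A s i j) (A' i j) x)
    (hB : ∀ i j, HasDerivAt (fun s => B s i j) (B' i j) x) (i j) :
    HasDerivAt (fun s => (A s * B s) i j) ((A' * B x + A x * B') i j) x := by
  simp only [Matrix.mul_apply, Matrix.add_apply, ← Finset.sum_add_distrib]
  exact HasDerivAt.fun_sum fun p _ => (hA i p).mul (hB p j)

theorem differentiableAt_det {ι : Type*} [Fintype ι] [DecidableEq ι] {f : ℝ → Matrix ι ι ℝ} {x : ℝ}
    (hf : ∀ i j, DifferentiableAt ℝ (fun s => f s i j) x) :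
    DifferentiableAt ℝ (fun s => (f s).det) x := by
  simp only [Matrix.det_apply']
  exact DifferentiableAt.fun_sum fun σ _ =>
    (differentiableAt_const _).mul (DifferentiableAt.fun_finsetProd fun i _ => hf _ _)

/-- The inverse is differentiable by Cramer's rule, and its derivative is obtained from that of `A
A⁻¹ = 1`. -/
theorem hasDerivAt_matrix_inv (hA : ∀ i j, HasDerivAt (fun s => A s i j) (A' i j) x)
    (h0 : (A x).det ≠ 0) (i j) :
    HasDerivAt (fun s => (A s)⁻¹ i j) ((-((A x)⁻¹ * A' * (A x)⁻¹)) i j) x := by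
  have hd : DifferentiableAt ℝ (fun s i j => A s i j) x :=
    differentiableAt_pi.2 fun i => differentiableAt_pi.2 fun j => (hA i j).differentiableAt
  have hinv : ∀ i j, DifferentiableAt ℝ (fun s => (A s)⁻¹ i j) x := fun i j => by
    have h1 : ContDiffAt ℝ 1 (fun M : Fin 8 → Fin 8 → ℝ => (Matrix.of M)⁻¹ i j) (fun i j => A x i j) :=
      contDiffAt_matrix_inv (f := fun M : Fin 8 → Fin 8 → ℝ => Matrix.of M)
        (fun i j => by simp only [Matrix.of_apply]; fun_prop) h0 i j
    exact (h1.differentiableAt one_ne_zero).comp (f := fun s i j => A s i j) x hd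
  have hdet : ∀ᶠ s in nhds x, A s * (A s)⁻¹ = 1 := by
    have h2 : DifferentiableAt ℝ (fun s => (A s).det) x :=
      differentiableAt_det fun i j => (hA i j).differentiableAt
    filter_upwards [h2.continuousAt.eventually_ne h0] with s hs
    exact Matrix.mul_nonsing_inv _ (isUnit_iff_ne_zero.2 hs)
  let C : Matrix (Fin 8) (Fin 8) ℝ := Matrix.of fun i j => deriv (fun s => (A s)⁻¹ i j) x
  have hC : ∀ i j, HasDerivAt (fun s => (A s)⁻¹ i j) (C i j) x := fun i j => (hinv i j).hasDerivAt
  have e : A' * (A x)⁻¹ + A x * C = 0 := by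
    ext i j
    refine (hasDerivAt_matrix_mul hA hC i j).unique ?_
    refine (hasDerivAt_const x ((1 : Matrix (Fin 8) (Fin 8) ℝ) i j)).congr_of_eventuallyEq ?_
    filter_upwards [hdet] with s hs
    rw [hs]
  have e2 : C = -((A x)⁻¹ * A' * (A x)⁻¹) := by
    have := congrArg ((A x)⁻¹ * ·) (eq_neg_of_add_eq_zero_right e)
    simp only [← Matrix.mul_assoc, Matrix.nonsing_inv_mul _ (isUnit_iff_ne_zero.2 h0),
      Matrix.one_mul, Matrix.mul_neg] at this
    exact this
  rw [← e2]
  exact hC i j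

end MatrixDeriv

/-! ## Moving frames along a line -/

theorem hasDerivAt_line {f : R8 → ℝ} {y : R8} (hf : DifferentiableAt ℝ f y) (a : Fin 8) :
    HasDerivAt (fun s : ℝ => f (y + s • stdVec a)) (pderiv a f y) 0 :=
  hf.hasFDerivAt.hasLineDerivAt (stdVec a)

/-- The frames `1 + s K`. -/
def movingFrame (K : Matrix (Fin 8) (Fin 8) ℝ) (s : ℝ) : Matrix (Fin 8) (Fin 8) ℝ := 1 + s • K

section MovingFrame

variable (K : Matrix (Fin 8) (Fin 8) ℝ)

theorem movingFrame_zero : movingFrame K 0 = 1 := by simp [movingFrame]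

theorem hasDerivAt_movingFrame (i j) : HasDerivAt (fun s => movingFrame K s i j) (K i j) 0 := by
  simp only [movingFrame, Matrix.add_apply, Matrix.smul_apply, smul_eq_mul]
  simpa using ((hasDerivAt_id' (0 : ℝ)).mul_const (K i j)).const_add
    ((1 : Matrix (Fin 8) (Fin 8) ℝ) i j)

theorem hasDerivAt_sum_movingFrame_mul {F : ℝ → Fin 8 → ℝ} {F' : Fin 8 → ℝ}
    (hF : ∀ p, HasDerivAt (fun s => F s p) (F' p) 0) (i) :
    HasDerivAt (fun s => ∑ p, movingFrame K s i p * F s p) (∑ p, K i p * F 0 p + F' i) 0 := by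
  have := HasDerivAt.fun_sum (u := Finset.univ) fun p _ => (hasDerivAt_movingFrame K i p).mul (hF p)
  refine this.congr_deriv ?_
  simp [movingFrame_zero, Finset.sum_add_distrib, Matrix.one_apply]

theorem hasDerivAt_pull1_movingFrame {F : ℝ → Fin 8 → ℝ} {F' : Fin 8 → ℝ}
    (hF : ∀ p, HasDerivAt (fun s => F s p) (F' p) 0) (i) :
    HasDerivAt (fun s => pull1 (movingFrame K s) (F s) i) (∑ p, K i p * F 0 p + F' i) 0 :=
  (hasDerivAt_sum_movingFrame_mul K hF i).congr_of_eventuallyEq <|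
    .of_forall fun s => by simp [pull1, pull_apply]

theorem hasDerivAt_pull2_movingFrame {F : ℝ → Tensor2} {F' : Tensor2}
    (hF : ∀ i j, HasDerivAt (fun s => F s i j) (F' i j) 0) (i j) :
    HasDerivAt (fun s => pull2 (movingFrame K s) (F s) i j)
      (∑ p, (K i p * F 0 p j + K j p * F 0 i p) + F' i j) 0 := by
  have := hasDerivAt_sum_movingFrame_mul K
    (fun p => hasDerivAt_pull1_movingFrame K (hF p) j) i
  refine (this.congr_deriv ?_).congr_of_eventuallyEq <|
    .of_forall fun s => by simp [pull2, pull_apply]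
  simp only [movingFrame_zero, pull1_one, LinearMap.id_apply, Finset.sum_add_distrib]
  ring

theorem hasDerivAt_pull3_movingFrame {F : ℝ → Tensor3} {F' : Tensor3}
    (hF : ∀ i j k, HasDerivAt (fun s => F s i j k) (F' i j k) 0) (i j k) :
    HasDerivAt (fun s => pull3 (movingFrame K s) (F s) i j k)
      (∑ p, (K i p * F 0 p j k + K j p * F 0 i p k + K k p * F 0 i j p) + F' i j k) 0 := by
  have := hasDerivAt_sum_movingFrame_mul K
    (fun p => hasDerivAt_pull2_movingFrame K (hF p) j k) i
  refine (this.congr_deriv ?_).congr_of_eventuallyEq <|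
    .of_forall fun s => by simp [pull3, pull_apply]
  simp only [movingFrame_zero, pull2_one, LinearMap.id_apply, Finset.sum_add_distrib]
  ring

theorem hasDerivAt_pull4_movingFrame {F : ℝ → Tensor4} {F' : Tensor4}
    (hF : ∀ i j k l, HasDerivAt (fun s => F s i j k l) (F' i j k l) 0) (i j k l) :
    HasDerivAt (fun s => pull4 (movingFrame K s) (F s) i j k l)
      (∑ p, (K i p * F 0 p j k l + K j p * F 0 i p k l + K k p * F 0 i j p l + K l p * F 0 i j k p)
        + F' i j k l) 0 := by
  have := hasDerivAt_sum_movingFrame_mul K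
    (fun p => hasDerivAt_pull3_movingFrame K (hF p) j k l) i
  refine (this.congr_deriv ?_).congr_of_eventuallyEq <|
    .of_forall fun s => by simp [pull4, pull_apply]
  simp only [movingFrame_zero, pull3_one, LinearMap.id_apply, Finset.sum_add_distrib]
  ring

end MovingFrame

/-! ## The Levi-Civita connection and contractions -/

/-- The matrix of the connection in the direction `a`. -/
noncomputable def connectionMatrix (g : R8 → Matrix (Fin 8) (Fin 8) ℝ) (a : Fin 8) (y : R8) :
    Matrix (Fin 8) (Fin 8) ℝ := Matrix.of fun i p => christoffel g p a i y

section LeviCivita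

variable {g : R8 → Matrix (Fin 8) (Fin 8) ℝ} {y : R8}

/-- The frame `1 - s Γ_a` along the line in direction `a` is parallel to first order, so `∇_a S` is
the ordinary derivative of the components of `S` in it. Product rules for `∇` thereby follow from
naturality under `pull` and the product rule in one variable. -/
theorem nabla3_eq_of_hasDerivAt {S : R8 → Tensor3}
    (hS : ∀ i j k, DifferentiableAt ℝ (fun z => S z i j k) y) (a : Fin 8) {d : Tensor3}
    (hd : ∀ i j k, HasDerivAt (fun s : ℝ => pull3 (movingFrame (-connectionMatrix g a y) s)
      (S (y + s • stdVec a)) i j k) (d i j k) 0) (i j k) : nabla3 g S y a i j k = d i j k := by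
  refine HasDerivAt.unique ?_ (hd i j k)
  refine (hasDerivAt_pull3_movingFrame _ (fun i j k => hasDerivAt_line (hS i j k) a) i j k).congr_deriv ?_
  simp [nabla3, connectionMatrix, Finset.sum_add_distrib, Finset.sum_neg_distrib]
  ring

theorem nabla4_eq_of_hasDerivAt {S : R8 → Tensor4}
    (hS : ∀ i j k l, DifferentiableAt ℝ (fun z => S z i j k l) y) (a : Fin 8) {d : Tensor4}
    (hd : ∀ i j k l, HasDerivAt (fun s : ℝ => pull4 (movingFrame (-connectionMatrix g a y) s)
      (S (y + s • stdVec a)) i j k l) (d i j k l) 0) (i j k l) :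
    nabla4 g S y a i j k l = d i j k l := by
  refine HasDerivAt.unique ?_ (hd i j k l)
  refine (hasDerivAt_pull4_movingFrame _ (fun i j k l => hasDerivAt_line (hS i j k l) a)
    i j k l).congr_deriv ?_
  simp [nabla4, connectionMatrix, Finset.sum_add_distrib, Finset.sum_neg_distrib]
  ring

theorem hasDerivAt_pull3_nabla3 {S : R8 → Tensor3}
    (hS : ∀ i j k, DifferentiableAt ℝ (fun z => S z i j k) y) (a : Fin 8) (i j k) :
    HasDerivAt (fun s : ℝ => pull3 (movingFrame (-connectionMatrix g a y) s)
      (S (y + s • stdVec a)) i j k) (nabla3 g S y a i j k) 0 := by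
  refine (hasDerivAt_pull3_movingFrame _ (fun i j k => hasDerivAt_line (hS i j k) a) i j k).congr_deriv ?_
  simp [nabla3, connectionMatrix, Finset.sum_add_distrib, Finset.sum_neg_distrib]
  ring

theorem hasDerivAt_pull4_nabla4 {S : R8 → Tensor4}
    (hS : ∀ i j k l, DifferentiableAt ℝ (fun z => S z i j k l) y) (a : Fin 8) (i j k l) :
    HasDerivAt (fun s : ℝ => pull4 (movingFrame (-connectionMatrix g a y) s)
      (S (y + s • stdVec a)) i j k l) (nabla4 g S y a i j k l) 0 := by
  refine (hasDerivAt_pull4_movingFrame _ (fun i j k l => hasDerivAt_line (hS i j k l) a)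
    i j k l).congr_deriv ?_
  simp [nabla4, connectionMatrix, Finset.sum_add_distrib, Finset.sum_neg_distrib]
  ring

theorem ip2_apply (H : Matrix (Fin 8) (Fin 8) ℝ) (X Y : Tensor2) :
    ip2 H X Y = ∑ p, ∑ q, (∑ r, ∑ s, X r s * H r p * H s q) * Y p q := by
  simp [ip2, dot2, dot1, pairing_apply, pull2_apply, Finset.sum_mul]

theorem hasDerivAt_ip2 {H : ℝ → Matrix (Fin 8) (Fin 8) ℝ} {X Y : ℝ → Tensor2} {X' Y' : Tensor2} {x : ℝ}
    (hH : ∀ i j, HasDerivAt (fun s => H s i j) 0 x)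
    (hX : ∀ i j, HasDerivAt (fun s => X s i j) (X' i j) x)
    (hY : ∀ i j, HasDerivAt (fun s => Y s i j) (Y' i j) x) :
    HasDerivAt (fun s => ip2 (H s) (X s) (Y s)) (ip2 (H x) X' (Y x) + ip2 (H x) (X x) Y') x := by
  simp only [ip2_apply, ← Finset.sum_add_distrib]
  refine HasDerivAt.fun_sum fun p _ => HasDerivAt.fun_sum fun q _ => HasDerivAt.mul ?_ (hY p q)
  refine HasDerivAt.fun_sum fun r _ => HasDerivAt.fun_sum fun s _ => ?_
  refine (((hX r s).mul (hH r p)).mul (hH s q)).congr_deriv ?_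
  simp

variable (hsymm : ∀ z i j, g z i j = g z j i)
include hsymm

theorem christoffel_comm (k i j) : christoffel g k i j y = christoffel g k j i y := by
  unfold christoffel
  refine congrArg _ (Finset.sum_congr rfl fun l _ => ?_)
  simp only [hsymm _ i j]
  ring

variable (h0 : (g y).det ≠ 0)
include h0

/-- The Christoffel symbols with the upper index lowered. Symmetrising in `i` and `j` gives `∇g = 0`
in the next lemma. -/
theorem sum_christoffel_mul (a i j) : ∑ p, christoffel g p a i y * g y p j =
    (1 / 2) * (pderiv a (fun z => g z i j) y + pderiv i (fun z => g z a j) y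
      - pderiv j (fun z => g z a i) y) := by
  simp only [christoffel, mul_assoc, ← Finset.mul_sum, Finset.sum_mul]
  rw [Finset.sum_comm]
  have e : ∀ l, ∑ p, (g y)⁻¹ p l * g y p j = (1 : Matrix (Fin 8) (Fin 8) ℝ) j l := fun l => by
    rw [← Matrix.mul_nonsing_inv (g y) (isUnit_iff_ne_zero.2 h0), Matrix.mul_apply]
    exact Finset.sum_congr rfl fun p _ => by rw [hsymm y p j, mul_comm]
  have e2 : ∀ l E, ∑ p, (g y)⁻¹ p l * (E * g y p j) = (1 : Matrix (Fin 8) (Fin 8) ℝ) j l * E :=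
    fun l E => by
      rw [← e, Finset.sum_mul]
      exact Finset.sum_congr rfl fun p _ => by ring
  simp [e2, Matrix.one_apply]

theorem pderiv_metric (a i j) : pderiv a (fun z => g z i j) y =
    ∑ p, (christoffel g p a i y * g y p j + christoffel g p a j y * g y i p) := by
  have e := sum_christoffel_mul hsymm h0 a j i
  simp only [hsymm y _ i] at e
  rw [Finset.sum_add_distrib, sum_christoffel_mul hsymm h0, e]
  simp only [hsymm _ j i]
  ring

variable (hg : ∀ i j, ContDiffAt ℝ 1 (fun z => g z i j) y)
include hg

theorem hasDerivAt_metric_movingFrame (a i j) : HasDerivAt (fun s : ℝ =>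
    (movingFrame (-connectionMatrix g a y) s * g (y + s • stdVec a) *
      (movingFrame (-connectionMatrix g a y) s).transpose) i j) 0 0 := by
  have := hasDerivAt_pull2_movingFrame (-connectionMatrix g a y)
    (F := fun s => fun i j => g (y + s • stdVec a) i j)
    (fun i j => hasDerivAt_line ((hg i j).differentiableAt one_ne_zero) a) i j
  simp only [pull2_eq_mul] at this
  refine this.congr_deriv ?_
  rw [pderiv_metric hsymm h0]
  simp [connectionMatrix, Finset.sum_add_distrib, Finset.sum_neg_distrib]
  ring

/-- The inverse metric is constant to first order in the moving frame. The factorisation has the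
shape `AᵀHA` required by the naturality lemmas, with `H` contributing nothing to derivatives. -/
theorem exists_inverseMetric_movingFrame (a) : ∃ H : ℝ → Matrix (Fin 8) (Fin 8) ℝ,
    H 0 = (g y)⁻¹ ∧ (∀ i j, HasDerivAt (fun s => H s i j) 0 0) ∧
    ∀ᶠ s in nhds 0, (g (y + s • stdVec a))⁻¹ =
      (movingFrame (-connectionMatrix g a y) s).transpose * H s *
        movingFrame (-connectionMatrix g a y) s := by
  have e0 : movingFrame (-connectionMatrix g a y) 0 * g (y + (0 : ℝ) • stdVec a) *
      (movingFrame (-connectionMatrix g a y) 0).transpose = g y := by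
    simp [movingFrame_zero]
  refine ⟨fun s => (movingFrame (-connectionMatrix g a y) s * g (y + s • stdVec a) *
      (movingFrame (-connectionMatrix g a y) s).transpose)⁻¹, ?_, fun i j => ?_, ?_⟩
  · simp only [e0]
  · have := hasDerivAt_matrix_inv (A' := 0) (hasDerivAt_metric_movingFrame hsymm h0 hg a)
      (by rw [e0]; exact h0) i j
    simpa using this
  · have hd : DifferentiableAt ℝ (fun s => (movingFrame (-connectionMatrix g a y) s).det) 0 :=
      differentiableAt_det fun i j => (hasDerivAt_movingFrame _ i j).differentiableAt
    have h1 : (movingFrame (-connectionMatrix g a y) 0).det ≠ 0 := by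
      rw [movingFrame_zero, Matrix.det_one]; exact one_ne_zero
    filter_upwards [hd.continuousAt.eventually_ne h1] with s hs
    have u := isUnit_iff_ne_zero.2 hs
    rw [Matrix.mul_inv_rev, Matrix.mul_inv_rev, ← Matrix.mul_assoc,
      Matrix.mul_nonsing_inv _ (by rwa [Matrix.det_transpose]), Matrix.one_mul, Matrix.mul_assoc,
      Matrix.nonsing_inv_mul _ u, Matrix.mul_one]

theorem pderiv_inverseMetric (a i j) : pderiv a (fun z => (g z)⁻¹ i j) y =
    (-((connectionMatrix g a y).transpose * (g y)⁻¹ + (g y)⁻¹ * connectionMatrix g a y)) i j := by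
  have h1 : HasDerivAt (fun s : ℝ => (g (y + s • stdVec a))⁻¹ i j) _ 0 :=
    hasDerivAt_line ((contDiffAt_matrix_inv hg h0 i j).differentiableAt one_ne_zero) a
  obtain ⟨H, H0, hH, e⟩ := exists_inverseMetric_movingFrame hsymm h0 hg a
  have hA := hasDerivAt_movingFrame (-connectionMatrix g a y)
  have h2 := hasDerivAt_matrix_mul (hasDerivAt_matrix_mul
    (A := fun s => (movingFrame (-connectionMatrix g a y) s).transpose)
    (A' := (-connectionMatrix g a y).transpose) (B' := 0) (fun i j => hA j i) hH) hA i j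
  refine (h1.congr_of_eventuallyEq (f₁ := fun s => ((movingFrame (-connectionMatrix g a y) s).transpose
    * H s * movingFrame (-connectionMatrix g a y) s) i j) ?_).unique (h2.congr_deriv ?_)
  · filter_upwards [e] with s hs
    rw [hs]
  · simp only [movingFrame_zero, H0, Matrix.mul_zero, add_zero, Matrix.mul_one, Matrix.transpose_one,
      Matrix.one_mul, Matrix.transpose_neg, Matrix.neg_mul, Matrix.mul_neg, neg_add]

theorem nabla4_contractLast {Φ S : R8 → Tensor4}
    (hΦ : ∀ i j k l, ContDiffAt ℝ 1 (fun z => Φ z i j k l) y)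
    (hS : ∀ i j k l, ContDiffAt ℝ 1 (fun z => S z i j k l) y)
    (hΦS : ∀ i j k l, DifferentiableAt ℝ (fun z => contractLast (g z)⁻¹ (Φ z) (S z) i j k l) y)
    (c a b i j) :
    nabla4 g (fun z => contractLast (g z)⁻¹ (Φ z) (S z)) y c a b i j =
      ip2 (g y)⁻¹ (nabla4 g Φ y c i j) (S y a b) + ip2 (g y)⁻¹ (Φ y i j) (nabla4 g S y c a b) := by
  refine nabla4_eq_of_hasDerivAt hΦS c (d := fun a b i j =>
    ip2 (g y)⁻¹ (nabla4 g Φ y c i j) (S y a b) + ip2 (g y)⁻¹ (Φ y i j) (nabla4 g S y c a b))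
    (fun a b i j => ?_) a b i j
  obtain ⟨H, H0, hH, e⟩ := exists_inverseMetric_movingFrame hsymm h0 hg c
  have hX := hasDerivAt_pull4_nabla4 (g := g) (fun i j k l => (hΦ i j k l).differentiableAt one_ne_zero) c
  have hY := hasDerivAt_pull4_nabla4 (g := g) (fun i j k l => (hS i j k l).differentiableAt one_ne_zero) c
  have := hasDerivAt_ip2 hH (hX i j) (hY a b)
  simp only [H0, movingFrame_zero, pull4_one, LinearMap.id_apply, zero_smul, add_zero] at this
  refine this.congr_of_eventuallyEq ?_
  filter_upwards [e] with s hs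
  rw [hs, pull4_contractLast]
  rfl

theorem nabla3_intrinsicTorsion {Φ : R8 → Tensor4} {T : R8 → Tensor3}
    (hΦ : ∀ i j k l, ContDiffAt ℝ 1 (fun z => Φ z i j k l) y)
    (hT : ∀ i j k, ContDiffAt ℝ 1 (fun z => T z i j k) y) :
    nabla3 g (fun z => intrinsicTorsion (g z)⁻¹ (Φ z) (T z)) y =
      intrinsicGrad (g y)⁻¹ (Φ y) (T y) (nabla4 g Φ y) (nabla3 g T y) := by
  have hΦT : ∀ i j k, DifferentiableAt ℝ (fun z => intrinsicTorsion (g z)⁻¹ (Φ z) (T z) i j k) y :=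
    fun i j k => by
      have hΦ' := fun i j k l => (hΦ i j k l).differentiableAt one_ne_zero
      have hT' := fun i j k => (hT i j k).differentiableAt one_ne_zero
      have hh := fun i j => (contDiffAt_matrix_inv hg h0 i j).differentiableAt one_ne_zero
      exact ((hT' i j k).const_mul _).sub <| DifferentiableAt.const_mul (.fun_sum fun p _ =>
        .fun_sum fun q _ => DifferentiableAt.mul (.fun_sum fun r _ => .fun_sum fun s _ =>
          ((hΦ' j k r s).mul (hh r p)).mul (hh s q)) (hT' i p q)) _
  funext c a m n
  refine nabla3_eq_of_hasDerivAt hΦT c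
    (d := intrinsicGrad (g y)⁻¹ (Φ y) (T y) (nabla4 g Φ y) (nabla3 g T y) c) (fun a m n => ?_) a m n
  obtain ⟨H, H0, hH, e⟩ := exists_inverseMetric_movingFrame hsymm h0 hg c
  have hX := hasDerivAt_pull4_nabla4 (g := g) (fun i j k l => (hΦ i j k l).differentiableAt one_ne_zero) c
  have hY := hasDerivAt_pull3_nabla3 (g := g) (fun i j k => (hT i j k).differentiableAt one_ne_zero) c
  have := ((hY a m n).const_mul (1 / 4)).fun_sub ((hasDerivAt_ip2 hH (hX m n) (hY a)).const_mul (1 / 8))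
  simp only [H0, movingFrame_zero, pull4_one, pull3_one, LinearMap.id_apply, zero_smul,
    add_zero] at this
  refine this.congr_of_eventuallyEq ?_
  filter_upwards [e] with s hs
  rw [hs, pull3_intrinsicTorsion, intrinsicTorsion_eq]

end LeviCivita

/-! ## The covariant derivative of a Cayley form -/

theorem derivation4_mem_of_mem_alternating4 {S : Tensor4} (hS : S ∈ alternating4) (β : Tensor2) :
    derivation4 β S ∈ alternating4 := by
  obtain ⟨h12, h23, h34⟩ := hS
  refine ⟨fun i j k l => ?_, fun i j k l => ?_, fun i j k l => ?_⟩ <;>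
    simp only [derivation4, ← Finset.sum_neg_distrib] <;>
    refine Finset.sum_congr rfl fun p _ => ?_
  · linear_combination β j p * h12 i p k l + β i p * h12 p j k l + β k p * h12 i j p l
      + β l p * h12 i j k p
  · linear_combination β i p * h23 p j k l + β k p * h23 i j p l + β j p * h23 i p k l
      + β l p * h23 i j k p
  · linear_combination β i p * h34 p j k l + β j p * h34 i p k l + β l p * h34 i j k p
      + β k p * h34 i j p l

theorem pderiv_neg (a : Fin 8) (f : R8 → ℝ) (y : R8) :
    pderiv a (fun z => -f z) y = -pderiv a f y := by
  simp [pderiv]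

theorem nabla4_eq_sub (g : R8 → Matrix (Fin 8) (Fin 8) ℝ) (S : R8 → Tensor4) (y : R8) (a : Fin 8) :
    nabla4 g S y a = (fun i j k l => pderiv a (fun z => S z i j k l) y) -
      derivation4 (fun i p => connectionMatrix g a y i p) (S y) := rfl

theorem nabla4_mem_alternating4 (g : R8 → Matrix (Fin 8) (Fin 8) ℝ) {S : R8 → Tensor4}
    (hS : ∀ z, S z ∈ alternating4) (y : R8) (a : Fin 8) : nabla4 g S y a ∈ alternating4 := by
  rw [nabla4_eq_sub]
  refine sub_mem ⟨fun i j k l => ?_, fun i j k l => ?_, fun i j k l => ?_⟩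
    (derivation4_mem_of_mem_alternating4 (hS y) _)
  · simp only [(hS _).1 i j k l, pderiv_neg]
  · simp only [(hS _).2.1 i j k l, pderiv_neg]
  · simp only [(hS _).2.2 i j k l, pderiv_neg]

theorem nabla3_swap23 (g : R8 → Matrix (Fin 8) (Fin 8) ℝ) {T : R8 → Tensor3}
    (hT : ∀ z i j k, T z j i k = -T z i j k) (y : R8) (a i j k) :
    nabla3 g T y a j i k = -nabla3 g T y a i j k := by
  simp only [nabla3, hT _ i j k, pderiv_neg, neg_sub', ← Finset.sum_neg_distrib]
  refine congrArg _ (Finset.sum_congr rfl fun p _ => ?_)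
  rw [hT y i p k, hT y p j k, hT y i j p]
  ring

theorem nabla3_swap34 (g : R8 → Matrix (Fin 8) (Fin 8) ℝ) {T : R8 → Tensor3}
    (hT : ∀ z i j k, T z i k j = -T z i j k) (y : R8) (a i j k) :
    nabla3 g T y a i k j = -nabla3 g T y a i j k := by
  simp only [nabla3, hT _ i j k, pderiv_neg, neg_sub', ← Finset.sum_neg_distrib]
  refine congrArg _ (Finset.sum_congr rfl fun p _ => ?_)
  rw [hT y p j k, hT y i j p, hT y i p k]
  ring

theorem pull4_mul (A : Matrix (Fin 8) (Fin 8) ℝ) (X Y : Tensor2) (k l i j) :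
    pull4 A (fun k l i j => X k i * Y l j) k l i j = pull2 A X k i * pull2 A Y l j := by
  rw [pull4_apply, pull2_apply, pull2_apply]
  simp only [Finset.sum_mul]
  simp only [Finset.mul_sum]
  refine Finset.sum_congr rfl fun p _ => ?_
  rw [Finset.sum_comm]
  refine Finset.sum_congr rfl fun r _ => Finset.sum_congr rfl fun q _ =>
    Finset.sum_congr rfl fun s _ => ?_
  ring

theorem pull4_mul' (A : Matrix (Fin 8) (Fin 8) ℝ) (X Y : Tensor2) (k l i j) :
    pull4 A (fun k l i j => X k j * Y l i) k l i j = pull2 A X k j * pull2 A Y l i := by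
  rw [pull4_swap34 A fun k l i j => X k i * Y l j]
  exact pull4_mul A X Y k l j i

/-- A smooth field of Cayley forms on an open subset of `ℝ⁸`. -/
structure IsCayleyOn (ψ : R8 → R8 [⋀^Fin 4]→L[ℝ] ℝ) (U : Set R8) : Prop where
  isOpen : IsOpen U
  contDiffOn : ContDiffOn ℝ ∞ ψ U
  isCayleyForm : ∀ z ∈ U, IsCayleyForm (ψ z)

theorem IsCayleyForm.det_metricMatrix_ne_zero {φ : R8 [⋀^Fin 4]→L[ℝ] ℝ} (hφ : IsCayleyForm φ) :
    (metricMatrix φ).det ≠ 0 := fun h0 => by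
  have := congrArg Matrix.det hφ.metricMatrix_mul_inv
  simp [h0] at this

theorem contractLast_one (Φ S : Tensor4) (a b i j) :
    contractLast 1 Φ S a b i j = ∑ p, ∑ q, Φ i j p q * S a b p q := by
  simp [contractLast, ip2, dot2, dot1, pairing_apply, pull2_one]

/-- `contract_two` carried to coordinates; the metric is the tensor whose components in the adapted
frame are the Kronecker symbol. -/
theorem IsFrame.contractLast_self {φ : R8 [⋀^Fin 4]→L[ℝ] ℝ} {A B : Matrix (Fin 8) (Fin 8) ℝ}
    (h : IsFrame φ A B) : contractLast (metricMatrix φ)⁻¹ (comp4 φ) (comp4 φ) =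
      (6 : ℝ) • ((fun k l i j => metricMatrix φ k i * metricMatrix φ l j)
        - fun k l i j => metricMatrix φ k j * metricMatrix φ l i) - (4 : ℝ) • comp4 φ := by
  refine pull4_injective A B h.mul_eq_one ?_
  have e : (metricMatrix φ)⁻¹ = B.transpose * 1 * B := by
    rw [h.inv_metricMatrix, transpose_mul_one_mul]
  have e1 : ∀ i j, pull2 B (fun i j => metricMatrix φ i j) i j = kron i j := fun i j => by
    rw [pull2_eq_mul, h.metricMatrix_eq]
    have : Matrix.of (fun i j => (A * A.transpose) i j) = A * A.transpose := rfl
    have hBA := mul_eq_one_comm.1 h.mul_eq_one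
    rw [this, ← Matrix.mul_assoc, hBA, Matrix.one_mul, ← Matrix.transpose_mul, hBA,
      Matrix.transpose_one]
    simp [Matrix.one_apply, kron]
  have hφ := h.isSpinTensor
  rw [e, pull4_contractLast, map_sub, map_smul, map_smul, map_sub]
  obtain ⟨φ', hφ'⟩ : ∃ φ', φ' = pull4 B (comp4 φ) := ⟨_, rfl⟩
  rw [← hφ'] at hφ ⊢
  funext k l i j
  rw [contractLast_one, hφ.contract_two]
  simp only [Pi.sub_apply, Pi.smul_apply, smul_eq_mul, pull4_mul B (fun i j => metricMatrix φ i j)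
    (fun i j => metricMatrix φ i j), pull4_mul' B (fun i j => metricMatrix φ i j)
    (fun i j => metricMatrix φ i j), e1]
  rw [hφ.pair_swap i j k l, kron_comm i k, kron_comm j l, kron_comm i l, kron_comm j k]
  ring

namespace IsCayleyOn

variable {ψ : R8 → R8 [⋀^Fin 4]→L[ℝ] ℝ} {U : Set R8} (h : IsCayleyOn ψ U) {y : R8} (hy : y ∈ U)
include h hy

theorem eventually_mem : ∀ᶠ z in nhds y, z ∈ U := h.isOpen.mem_nhds hy

theorem contDiffAt : ContDiffAt ℝ ∞ ψ y := h.contDiffOn.contDiffAt (h.isOpen.mem_nhds hy)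

theorem contDiffAt_comp4 (i j k l) : ContDiffAt ℝ ∞ (fun z => comp4 (ψ z) i j k l) y :=
  (ContinuousAlternatingMap.apply ℝ R8 ℝ
    ![stdVec i, stdVec j, stdVec k, stdVec l]).contDiff.contDiffAt.comp y (h.contDiffAt hy)

theorem contDiffAt_inverseMetric (i j) :
    ContDiffAt ℝ ∞ (fun z => (metricMatrix (ψ z))⁻¹ i j) y := by
  obtain ⟨F, hF⟩ := IsSpinTensor.exists_inverseMetric i j
  have e : ∀ z ∈ U, F (comp4 (ψ z)) = (metricMatrix (ψ z))⁻¹ i j ∧ ContDiffAt ℝ ∞ F (comp4 (ψ z)) :=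
    fun z hz => by
      obtain ⟨A, B, hAB, -⟩ := (h.isCayleyForm z hz).exists_isFrame
      rw [hAB.inv_metricMatrix]
      exact hF A B _ hAB.mul_eq_one hAB.isSpinTensor
  have hc : ContDiffAt ℝ ∞ (fun z => comp4 (ψ z)) y :=
    contDiffAt_pi.2 fun i => contDiffAt_pi.2 fun j => contDiffAt_pi.2 fun k => contDiffAt_pi.2 fun l =>
      h.contDiffAt_comp4 hy i j k l
  refine (ContDiffAt.comp y (e y hy).2 hc).congr_of_eventuallyEq ?_
  filter_upwards [h.eventually_mem hy] with z hz
  exact (e z hz).1.symm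

theorem contDiffAt_metric (i j) : ContDiffAt ℝ ∞ (fun z => metricMatrix (ψ z) i j) y := by
  have hd := (h.isCayleyForm y hy).metricMatrix_mul_inv
  refine (contDiffAt_matrix_inv (f := fun z => (metricMatrix (ψ z))⁻¹)
    (h.contDiffAt_inverseMetric hy) (fun h0 => ?_) i j).congr_of_eventuallyEq ?_
  · have := congrArg Matrix.det hd
    simp [h0] at this
  · filter_upwards [h.eventually_mem hy] with z hz
    rw [Matrix.nonsing_inv_nonsing_inv _
      (isUnit_iff_ne_zero.2 (h.isCayleyForm z hz).det_metricMatrix_ne_zero)]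

/-- The covariant derivative of `contractLast_self`, with `∇g = 0`. It is the linearised identity
assumed in `derivation4_tripleContraction`. -/
theorem nabla4_contraction (c : Fin 8) :
    contractLast (metricMatrix (ψ y))⁻¹ (nabla4 (fun z => metricMatrix (ψ z)) (fun z => comp4 (ψ z)) y c)
        (comp4 (ψ y))
      + contractLast (metricMatrix (ψ y))⁻¹ (comp4 (ψ y))
        (nabla4 (fun z => metricMatrix (ψ z)) (fun z => comp4 (ψ z)) y c) =
      (-4 : ℝ) • nabla4 (fun z => metricMatrix (ψ z)) (fun z => comp4 (ψ z)) y c := by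
  have hs : ∀ z i j, metricMatrix (ψ z) i j = metricMatrix (ψ z) j i := fun z => metricMatrix_comm _
  have hd := (h.isCayleyForm y hy).det_metricMatrix_ne_zero
  have hg := fun i j => (h.contDiffAt_metric hy i j).of_le (by simp : (1 : WithTop ℕ∞) ≤ ∞)
  have hP := fun i j k l => (h.contDiffAt_comp4 hy i j k l).of_le (by simp : (1 : WithTop ℕ∞) ≤ ∞)
  have hg' := fun i j => (hg i j).differentiableAt one_ne_zero
  have hP' := fun i j k l => (hP i j k l).differentiableAt one_ne_zero
  have e : ∀ z ∈ U, contractLast (metricMatrix (ψ z))⁻¹ (comp4 (ψ z)) (comp4 (ψ z)) =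
      (6 : ℝ) • ((fun k l i j => metricMatrix (ψ z) k i * metricMatrix (ψ z) l j)
        - fun k l i j => metricMatrix (ψ z) k j * metricMatrix (ψ z) l i) - (4 : ℝ) • comp4 (ψ z) :=
    fun z hz => by
      obtain ⟨A, B, hAB, -⟩ := (h.isCayleyForm z hz).exists_isFrame
      exact hAB.contractLast_self
  have hD : ∀ k l i j, DifferentiableAt ℝ
      (fun z => contractLast (metricMatrix (ψ z))⁻¹ (comp4 (ψ z)) (comp4 (ψ z)) k l i j) y :=
    fun k l i j => by
      have : DifferentiableAt ℝ (fun z => 6 * (metricMatrix (ψ z) k i * metricMatrix (ψ z) l j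
          - metricMatrix (ψ z) k j * metricMatrix (ψ z) l i) - 4 * comp4 (ψ z) k l i j) y :=
        ((((hg' k i).mul (hg' l j)).sub ((hg' k j).mul (hg' l i))).const_mul 6).sub
          ((hP' k l i j).const_mul 4)
      refine this.congr_of_eventuallyEq ?_
      filter_upwards [h.eventually_mem hy] with z hz
      rw [e z hz]
      rfl
  funext k l i j
  have e1 := nabla4_contractLast hs hd hg hP hP hD c k l i j
  refine e1.symm.trans (nabla4_eq_of_hasDerivAt hD c
    (d := (-4 : ℝ) • nabla4 (fun z => metricMatrix (ψ z)) (fun z => comp4 (ψ z)) y c)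
    (fun k l i j => ?_) k l i j)
  -- In the moving frame the products of two metrics have derivative zero, so only the term `-4 Φ`
  -- is left on the right.
  have hG := fun i j => hasDerivAt_metric_movingFrame hs hd hg c i j
  have hX := hasDerivAt_pull4_nabla4 (g := fun z => metricMatrix (ψ z)) hP' c k l i j
  have := (((((hG k i).fun_mul (hG l j)).fun_sub ((hG k j).fun_mul (hG l i))).const_mul 6).fun_sub
    (hX.const_mul 4))
  refine (this.congr_deriv ?_).congr_of_eventuallyEq ?_
  · simp
  · have hl : Filter.Tendsto (fun s : ℝ => y + s • stdVec c) (nhds 0) (nhds y) := by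
      have : Continuous fun s : ℝ => y + s • stdVec c := by fun_prop
      simpa using this.tendsto 0
    filter_upwards [hl.eventually (h.eventually_mem hy)] with s hs
    rw [e _ hs, map_sub, map_smul, map_smul, map_sub]
    simp only [Pi.sub_apply, Pi.smul_apply, smul_eq_mul,
      pull4_mul _ (fun i j => metricMatrix (ψ (y + s • stdVec c)) i j)
        (fun i j => metricMatrix (ψ (y + s • stdVec c)) i j),
      pull4_mul' _ (fun i j => metricMatrix (ψ (y + s • stdVec c)) i j)
        (fun i j => metricMatrix (ψ (y + s • stdVec c)) i j), pull2_eq_mul]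
    rfl

end IsCayleyOn

/-! ## The torsion 3-form at a point -/

theorem pull4_mem_alternating4 (A : Matrix (Fin 8) (Fin 8) ℝ) {S : Tensor4} (hS : S ∈ alternating4) :
    pull4 A S ∈ alternating4 := by
  refine ⟨fun i j k l => ?_, pull4_skew23 A hS.2.1, pull4_skew34 A hS.2.2⟩
  have k1 : pull4 A (fun a b => S b a) i j k l = pull4 A S j i k l := by rw [pull4_swap12 A S]
  rw [← k1, pull4_apply, pull4_apply]
  simp only [← Finset.sum_neg_distrib]
  refine Finset.sum_congr rfl fun p _ => Finset.sum_congr rfl fun q _ =>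
    Finset.sum_congr rfl fun r _ => Finset.sum_congr rfl fun s _ => ?_
  rw [hS.1]; ring

theorem pull5_injective (A B : Matrix (Fin 8) (Fin 8) ℝ) (h : A * B = 1) :
    Function.Injective (pull5 B) := fun X Y e => by
  have k : ∀ X, pull5 A (pull5 B X) = X := fun X => by
    rw [pull5, pull5, pull_pull, h]
    have e : pull4 A ∘ₗ pull4 B = LinearMap.id := LinearMap.ext fun S => by
      rw [LinearMap.comp_apply, pull4_pull4, h, pull4_one]
    rw [e, pull_one_id]
    rfl
  rw [← k X, e, k]

/-- A family of tensors `X_a` which are tangent to the orbit of `φ` comes from a 3-form. -/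
theorem IsSpinTensor.exists_threeForm {φ : Tensor4} (h : IsSpinTensor φ) (B : Matrix (Fin 8) (Fin 8) ℝ)
    {Z : Fin 8 → Tensor4} (hZ : ∀ c, Z c ∈ alternating4)
    (hc : ∀ c i j k l, pairContraction (Z c) φ i j k l + pairContraction (Z c) φ k l i j =
      -4 * Z c i j k l) :
    ∃ t : Tensor3, (∀ i j k, t j i k = -t i j k) ∧ (∀ i j k, t i k j = -t i j k) ∧
      ∀ a, derivation4 (t a) φ = ∑ p, B a p • Z p := by
  have z12 := fun c => (hZ c).1
  have z23 := fun c => (hZ c).2.1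
  have z34 := fun c => (hZ c).2.2
  have zj : ∀ c i j k, Z c i j k j = 0 := fun c i j k => by
    have e1 := z34 c i j k j
    have e2 := z23 c i j j k
    linarith
  -- With the factor 1/24 the family `C` is four times the `Λ²₇`-valued tensor whose action on `φ`
  -- is the given family, since `tripleContraction` inverts that action up to 96.
  let C : Tensor3 := fun a i j => ∑ p, (B a p / 24) * tripleContraction (Z p) φ i j
  have hs : ∀ a i j, C a j i = -C a i j := fun a i j => by
    simp only [C, ← Finset.sum_neg_distrib]
    refine Finset.sum_congr rfl fun p _ => ?_
    rw [tripleContraction_skew (hc p) (zj p)]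
    ring
  have h7 : ∀ a i j, ∑ p, ∑ q, φ i j p q * C a p q = -6 * C a i j := fun a i j => by
    have e : ∀ c, ∑ p, ∑ q, φ i j p q * tripleContraction (Z c) φ p q =
        -6 * tripleContraction (Z c) φ i j := fun c => by
      have := congrFun (congrFun (h.fourProj7_tripleContraction (z12 c) (z23 c) (z34 c) (hc c)) i) j
      simp only [fourProj7, Pi.smul_apply, smul_eq_mul] at this
      linarith
    calc ∑ p, ∑ q, φ i j p q * C a p q
        = ∑ c, (B a c / 24) * ∑ p, ∑ q, φ i j p q * tripleContraction (Z c) φ p q := by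
          simp only [C, Finset.mul_sum]
          rw [sum_rot3, sum_rot3]
          refine Finset.sum_congr rfl fun c _ => Finset.sum_congr rfl fun p _ =>
            Finset.sum_congr rfl fun q _ => ?_
          ring
      _ = _ := by
          simp only [e, C, Finset.mul_sum]
          exact Finset.sum_congr rfl fun c _ => by ring
  refine ⟨threeFormOf φ C, fun i j k => (h.threeFormOf_skew hs i j k).1,
    fun i j k => (h.threeFormOf_skew hs i j k).2, fun a => ?_⟩
  have e1 : derivation4 (fun i j => (1 / 4) * C a i j) φ = ∑ p, B a p • Z p := by
    have e2 : (fun i j => (1 / 4) * C a i j) =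
        ∑ p, (B a p / 96) • tripleContraction (Z p) φ := by
      funext i j
      simp only [C, Finset.mul_sum, Finset.sum_apply, Pi.smul_apply, smul_eq_mul]
      exact Finset.sum_congr rfl fun p _ => by ring
    rw [e2, derivation4_sum]
    refine Finset.sum_congr rfl fun p _ => ?_
    rw [h.derivation4_tripleContraction (z12 p) (z23 p) (z34 p) (hc p)]
    funext i j k l
    simp only [Pi.smul_apply, smul_eq_mul]
    ring
  rw [← e1]
  -- The 3-form and `C/4` have the same projection to `Λ²₇`, so their difference is in `Λ²₂₁` and
  -- annihilates `φ`.
  have e3 : derivation4 (fun i j => threeFormOf φ C a i j - (1 / 4) * C a i j) φ = 0 := by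
    refine h.derivation4_eq_zero ?_
    funext i j
    have k1 := congrFun (congrFun (h.fourProj7_threeFormOf hs h7 a) i) j
    have k2 := h7 a i j
    simp only [fourProj7, mul_sub, Finset.sum_sub_distrib, Pi.zero_apply] at k1 ⊢
    have k3 : ∑ p, ∑ q, φ i j p q * (1 / 4 * C a p q) = (1 / 4) * (-6 * C a i j) := by
      rw [← k2, Finset.mul_sum]
      simp only [Finset.mul_sum]
      exact Finset.sum_congr rfl fun p _ => Finset.sum_congr rfl fun q _ => by ring
    rw [k3]
    linarith
  funext i j k l
  have := congrFun (congrFun (congrFun (congrFun e3 i) j) k) l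
  simp only [derivation4, sub_mul, Pi.zero_apply, Finset.sum_add_distrib, Finset.sum_sub_distrib] at this ⊢
  linarith

/-- The 3-form `τ` satisfies the torsion equation at `y`. -/
def HasTorsionAt (ψ : R8 → R8 [⋀^Fin 4]→L[ℝ] ℝ) (y : R8) (τ : R8 [⋀^Fin 3]→L[ℝ] ℝ) : Prop :=
  ∀ a, nabla4 (fun z => metricMatrix (ψ z)) (fun z => comp4 (ψ z)) y a =
    derivation4 (raise1 (metricMatrix (ψ y))⁻¹ (comp3 τ) a) (comp4 (ψ y))

/-- The torsion equation in terms of the exterior derivative and adapted bases. -/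
def IsExteriorTorsion (ψ : R8 → R8 [⋀^Fin 4]→L[ℝ] ℝ) (y : R8) (τ : R8 [⋀^Fin 3]→L[ℝ] ℝ) : Prop :=
  ∀ b : Module.Basis (Fin 8) ℝ R8, IsAdaptedBasis (ψ y) b → ∀ p q i j k,
    extDeriv ψ y ![b p, b q, b i, b j, b k] =
      alternate5 (fun a => derivation4 (fun i j => τ ![b a, b i, b j]) stdPhi) p q i j k

/-- A term with `γ` symmetric in the direction of differentiation and the index it acts on cancels
in the alternation. For the Christoffel symbols this is the equality of `dΦ` and the alternation of
`∇Φ`. -/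
theorem alternate5_derivation4_of_symm {φ : Tensor4} (hφ : φ ∈ alternating4) {γ : Tensor3}
    (hγ : ∀ a i m, γ a i m = γ i a m) (a b i j k) :
    alternate5 (fun a => derivation4 (γ a) φ) a b i j k = 0 := by
  obtain ⟨h12, h23, h34⟩ := hφ
  simp only [alternate5, derivation4, ← Finset.sum_add_distrib, ← Finset.sum_sub_distrib]
  refine Finset.sum_eq_zero fun p _ => ?_
  rw [hγ b a, hγ i a, hγ j a, hγ k a, hγ i b, hγ j b, hγ k b, hγ j i, hγ k i, hγ k j]
  have e1 : ∀ x y z, φ x y p z = φ p x y z := fun x y z => by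
    rw [h23 x p y z, h12 p x y z, neg_neg]
  have e2 : ∀ x y z, φ x y z p = -φ p x y z := fun x y z => by
    rw [h34 x y p z, e1]
  have e0 : ∀ x y z, φ x p y z = -φ p x y z := fun x y z => h12 p x y z
  simp only [e0, e1, e2]
  ring

theorem IsFrame.hasTorsionAt_iff {ψ : R8 → R8 [⋀^Fin 4]→L[ℝ] ℝ} {y : R8}
    {A B : Matrix (Fin 8) (Fin 8) ℝ} (hAB : IsFrame (ψ y) A B) {τ : R8 [⋀^Fin 3]→L[ℝ] ℝ} :
    HasTorsionAt ψ y τ ↔ ∀ a,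
      pull5 B (nabla4 (fun z => metricMatrix (ψ z)) (fun z => comp4 (ψ z)) y) a =
        derivation4 (pull3 B (comp3 τ) a) stdPhi := by
  have e : ∀ a, pull5 B (fun a => derivation4 (raise1 (metricMatrix (ψ y))⁻¹ (comp3 τ) a)
      (comp4 (ψ y))) a = derivation4 (pull3 B (comp3 τ) a) stdPhi := fun a => by
    rw [hAB.inv_metricMatrix, pull5_derivation4, hAB.pull4_eq]
  constructor
  · intro ht a
    rw [← e, funext ht]
  · intro ht a
    have := @pull5_injective A B hAB.mul_eq_one
      (nabla4 (fun z => metricMatrix (ψ z)) (fun z => comp4 (ψ z)) y)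
      (fun a => derivation4 (raise1 (metricMatrix (ψ y))⁻¹ (comp3 τ) a) (comp4 (ψ y)))
      (funext fun a => by rw [ht, ← e])
    exact congrFun this a

theorem fderiv_fourForm_apply {ψ : R8 → R8 [⋀^Fin 4]→L[ℝ] ℝ} {y : R8} (hψ : DifferentiableAt ℝ ψ y)
    (w : Fin 4 → R8) (u : R8) : fderiv ℝ (fun z => ψ z w) y u = fderiv ℝ ψ y u w := by
  have := ((ContinuousAlternatingMap.apply ℝ R8 ℝ w).hasFDerivAt.comp y hψ.hasFDerivAt).fderiv
  exact congrArg (fun f : R8 →L[ℝ] ℝ => f u) this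

theorem fderiv_eq_pull5 {ψ : R8 → R8 [⋀^Fin 4]→L[ℝ] ℝ} {y : R8} (hψ : DifferentiableAt ℝ ψ y)
    (b : Fin 8 → R8) (a i j k l) : fderiv ℝ ψ y (b a) ![b i, b j, b k, b l] =
      pull5 (compMatrix b) (fun a i j k l => pderiv a (fun z => comp4 (ψ z) i j k l) y) a i j k l := by
  have e : ∀ p, (fun i j k l => pderiv p (fun z => comp4 (ψ z) i j k l) y) =
      comp4 (fderiv ℝ ψ y (stdVec p)) := fun p => by
    funext i j k l
    exact fderiv_fourForm_apply hψ _ _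
  rw [pull5_apply]
  simp only [e, Finset.sum_apply, Pi.smul_apply, ← apply_eq_pull4]
  conv_lhs => rw [eq_sum_stdVec (b a), map_sum]
  simp [compMatrix]

theorem extDeriv_eq_alternate5_pderiv {ψ : R8 → R8 [⋀^Fin 4]→L[ℝ] ℝ} {y : R8}
    (hψ : DifferentiableAt ℝ ψ y) (b : Fin 8 → R8) (p q i j k) :
    extDeriv ψ y ![b p, b q, b i, b j, b k] = alternate5 (pull5 (compMatrix b)
      (fun a i j k l => pderiv a (fun z => comp4 (ψ z) i j k l) y)) p q i j k := by
  rw [extDeriv_apply hψ, Fin.sum_univ_five]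
  have e0 : (0 : Fin 5).removeNth ![b p, b q, b i, b j, b k] = ![b q, b i, b j, b k] := by
    funext m; fin_cases m <;> rfl
  have e1 : (1 : Fin 5).removeNth ![b p, b q, b i, b j, b k] = ![b p, b i, b j, b k] := by
    funext m; fin_cases m <;> rfl
  have e2 : (2 : Fin 5).removeNth ![b p, b q, b i, b j, b k] = ![b p, b q, b j, b k] := by
    funext m; fin_cases m <;> rfl
  have e3 : (3 : Fin 5).removeNth ![b p, b q, b i, b j, b k] = ![b p, b q, b i, b k] := by
    funext m; fin_cases m <;> rfl
  have e4 : (4 : Fin 5).removeNth ![b p, b q, b i, b j, b k] = ![b p, b q, b i, b j] := by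
    funext m; fin_cases m <;> rfl
  rw [e0, e1, e2, e3, e4]
  simp only [fderiv_fourForm_apply hψ, alternate5, ← fderiv_eq_pull5 hψ]
  simp
  ring

theorem alternate5_sub (X Y : Fin 8 → Tensor4) (a b i j k) :
    alternate5 (X - Y) a b i j k = alternate5 X a b i j k - alternate5 Y a b i j k := by
  simp only [alternate5, Pi.sub_apply]
  ring

theorem IsFrame.alternate5_pull5_derivation4 {φ : R8 [⋀^Fin 4]→L[ℝ] ℝ} {A B : Matrix (Fin 8) (Fin 8) ℝ}
    (hAB : IsFrame φ A B) {γ : Fin 8 → Matrix (Fin 8) (Fin 8) ℝ} (hγ : ∀ a i m, γ a i m = γ i a m)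
    (a b i j k) : alternate5 (pull5 B fun a => derivation4 (fun i p => γ a i p) (comp4 φ)) a b i j k = 0 := by
  let γ' : Tensor3 := fun a => ∑ p, B a p • fun i m => (B * γ p * A) i m
  have e : (pull5 B fun a => derivation4 (fun i p => γ a i p) (comp4 φ)) =
      fun a => derivation4 (γ' a) stdPhi := by
    funext a
    rw [pull5_apply, derivation4_sum]
    refine Finset.sum_congr rfl fun p _ => congrArg _ ?_
    rw [← hAB.pull4_eq, ← pull4_derivation4 B (K := γ p)]
    rw [Matrix.mul_assoc (B * γ p), hAB.mul_eq_one, Matrix.mul_one]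
  rw [e]
  refine alternate5_derivation4_of_symm ?_ (fun a i m => ?_) a b i j k
  · rw [← hAB.pull4_eq]
    exact pull4_mem_alternating4 B (comp4_mem_alternating4 φ)
  · simp only [γ', Finset.sum_apply, Pi.smul_apply, smul_eq_mul, Matrix.mul_apply, Finset.mul_sum,
      Finset.sum_mul]
    rw [Finset.sum_comm, Finset.sum_comm (f := fun p r => ∑ q, B i p * (B a q * γ p q r * A r m))]
    refine Finset.sum_congr rfl fun r _ => ?_
    rw [Finset.sum_comm]
    refine Finset.sum_congr rfl fun p _ => Finset.sum_congr rfl fun q _ => ?_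
    rw [hγ p q]
    ring

namespace IsCayleyOn

variable {ψ : R8 → R8 [⋀^Fin 4]→L[ℝ] ℝ} {U : Set R8} (h : IsCayleyOn ψ U) {y : R8} (hy : y ∈ U)
include h hy

/-- `nabla4_contraction`, written in an adapted frame, is the hypothesis of `exists_threeForm`. The
resulting tensor is carried back to coordinates with the inverse frame. -/
theorem exists_hasTorsionAt : ∃ τ, HasTorsionAt ψ y τ := by
  obtain ⟨A, B, hAB, -⟩ := (h.isCayleyForm y hy).exists_isFrame
  obtain ⟨X, hX⟩ : ∃ X, X = nabla4 (fun z => metricMatrix (ψ z)) (fun z => comp4 (ψ z)) y := ⟨_, rfl⟩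
  have hXa : ∀ c, X c ∈ alternating4 := fun c => by
    rw [hX]
    exact nabla4_mem_alternating4 _ (fun z => comp4_mem_alternating4 _) y c
  have hXc : ∀ c, contractLast 1 (pull4 B (X c)) stdPhi + contractLast 1 stdPhi (pull4 B (X c)) =
      (-4 : ℝ) • pull4 B (X c) := fun c => by
    have e : (metricMatrix (ψ y))⁻¹ = B.transpose * 1 * B := by
      rw [hAB.inv_metricMatrix, transpose_mul_one_mul]
    rw [← hAB.pull4_eq, ← pull4_contractLast, ← pull4_contractLast, ← map_add, ← map_smul, ← e, hX,
      h.nabla4_contraction hy c]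
  obtain ⟨t, t12, t23, ht⟩ := isSpinTensor_stdPhi.exists_threeForm B
    (Z := fun c => pull4 B (X c)) (fun c => pull4_mem_alternating4 B (hXa c)) fun c i j k l => by
      have := congrFun (congrFun (congrFun (congrFun (hXc c) i) j) k) l
      simp only [Pi.add_apply, Pi.smul_apply, smul_eq_mul, contractLast_one] at this
      rw [← this, add_comm]
      simp only [pairContraction, mul_comm]
  obtain ⟨τ, hτ⟩ := exists_comp3_eq (t := pull3 A t) (pull3_skew12 A fun a i j => t12 a i j)
    (pull3_skew23 A t23)
  refine ⟨τ, hAB.hasTorsionAt_iff.2 fun a => ?_⟩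
  rw [hτ, pull3_pull3, mul_eq_one_comm.1 hAB.mul_eq_one, pull3_one, LinearMap.id_apply, ht, ← hX,
    pull5_apply]

theorem extDeriv_eq_alternate5 (b : Module.Basis (Fin 8) ℝ R8) (hb : IsAdaptedBasis (ψ y) b) (p q i j k) :
    extDeriv ψ y ![b p, b q, b i, b j, b k] = alternate5 (pull5 (compMatrix b)
      (nabla4 (fun z => metricMatrix (ψ z)) (fun z => comp4 (ψ z)) y)) p q i j k := by
  have hd : DifferentiableAt ℝ ψ y := (h.contDiffAt hy).differentiableAt (by simp)
  have hs : ∀ z i j, metricMatrix (ψ z) i j = metricMatrix (ψ z) j i := fun z => metricMatrix_comm _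
  have e : nabla4 (fun z => metricMatrix (ψ z)) (fun z => comp4 (ψ z)) y =
      (fun a i j k l => pderiv a (fun z => comp4 (ψ z) i j k l) y) - fun a => derivation4
        (fun i p => connectionMatrix (fun z => metricMatrix (ψ z)) a y i p) (comp4 (ψ y)) := rfl
  rw [extDeriv_eq_alternate5_pderiv hd, e, LinearMap.map_sub, alternate5_sub,
    (isFrame_of_isAdaptedBasis hb).alternate5_pull5_derivation4, sub_zero]
  exact fun a i m => christoffel_comm hs m a i

theorem hasTorsionAt_isExteriorTorsion {τ} (hτ : HasTorsionAt ψ y τ) : IsExteriorTorsion ψ y τ := by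
  intro b hb p q i j k
  rw [h.extDeriv_eq_alternate5 hy b hb,
    funext ((isFrame_of_isAdaptedBasis hb).hasTorsionAt_iff.1 hτ)]
  have e : ∀ a, (fun i j => τ ![b a, b i, b j]) = pull3 (compMatrix b) (comp3 τ) a := fun a =>
    funext fun i => funext fun j => apply_eq_pull3 τ b a i j
  simp only [e]

/-- The difference of two solutions has zero alternation in an adapted frame, so
`eq_zero_of_alternate5` applies. -/
theorem isExteriorTorsion_unique {τ τ'} (hτ : IsExteriorTorsion ψ y τ) (hτ' : IsExteriorTorsion ψ y τ') :
    τ = τ' := by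
  obtain ⟨b, hb⟩ := h.isCayleyForm y hy
  have hAB := isFrame_of_isAdaptedBasis hb
  refine comp3_injective (pull3_injective _ _ hAB.mul_eq_one ?_)
  have : (fun i j k => τ ![b i, b j, b k] - τ' ![b i, b j, b k]) = 0 := by
    refine isSpinTensor_stdPhi.eq_zero_of_alternate5 (fun i j k => ?_) (fun i j k => ?_)
      fun p q i j k => ?_
    · rw [threeForm_swap12, threeForm_swap12 τ']; ring
    · rw [threeForm_swap23, threeForm_swap23 τ']; ring
    · have := (hτ b hb p q i j k).symm.trans (hτ' b hb p q i j k)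
      simp only [alternate5, derivation4, sub_mul, Finset.sum_add_distrib, Finset.sum_sub_distrib] at this ⊢
      linarith
  funext i j k
  have := congrFun (congrFun (congrFun this i) j) k
  simp only [apply_eq_pull3, Pi.zero_apply] at this
  linarith

/-- An exterior torsion is unique, and a solution of the full torsion equation exists and is one; so
the two notions agree. -/
theorem hasTorsionAt_iff {τ} : HasTorsionAt ψ y τ ↔ IsExteriorTorsion ψ y τ := by
  refine ⟨h.hasTorsionAt_isExteriorTorsion hy, fun hτ => ?_⟩
  obtain ⟨τ', hτ'⟩ := h.exists_hasTorsionAt hy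
  rwa [h.isExteriorTorsion_unique hy hτ (h.hasTorsionAt_isExteriorTorsion hy hτ')]

end IsCayleyOn

/-! ## The torsion 3-form of a field of Cayley forms -/

/-- A change of coordinates commutes with the exterior derivative and maps adapted bases to adapted
bases. No transformation law for Christoffel symbols is needed. -/
theorem IsExteriorTorsion.pullback {ψ ψ' : R8 → R8 [⋀^Fin 4]→L[ℝ] ℝ} {f : R8 → R8} {z : R8}
    (hψ : DifferentiableAt ℝ ψ (f z)) (hf : ContDiffAt ℝ ∞ f z) (L : R8 ≃L[ℝ] R8)
    (hL : fderiv ℝ f z = L)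
    (hψ' : ψ' =ᶠ[nhds z] fun x => (ψ (f x)).compContinuousLinearMap (fderiv ℝ f x))
    {τ : R8 [⋀^Fin 3]→L[ℝ] ℝ} (hτ : IsExteriorTorsion ψ (f z) τ) :
    IsExteriorTorsion ψ' z (τ.compContinuousLinearMap (L : R8 →L[ℝ] R8)) := by
  intro b hb p q i j k
  rw [hψ'.extDeriv_eq, extDeriv_pullback hψ hf (by
    simp only [minSmoothness_of_isRCLikeNormedField]; exact WithTop.coe_le_coe.2 (le_top : (2 : ℕ∞) ≤ ⊤)), hL]
  have e3 : ∀ i j k, τ.compContinuousLinearMap (L : R8 →L[ℝ] R8) ![b i, b j, b k] =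
      τ ![b.map L.toLinearEquiv i, b.map L.toLinearEquiv j, b.map L.toLinearEquiv k] :=
    fun i j k => congrArg τ (by funext m; fin_cases m <;> simp)
  simp only [e3]
  refine Eq.trans (congrArg (extDeriv ψ (f z)) ?_) (hτ (b.map L.toLinearEquiv) (fun i j k l => ?_) p q i j k)
  · funext m; fin_cases m <;> simp
  · rw [← hb i j k l, hψ'.eq_of_nhds, hL]
    refine congrArg (ψ (f z)) ?_
    funext m; fin_cases m <;> simp

theorem contDiffAt_pderiv {f : R8 → ℝ} {y : R8} (hf : ContDiffAt ℝ ∞ f y) (a : Fin 8) :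
    ContDiffAt ℝ ∞ (fun z => pderiv a f z) y :=
  (hf.fderiv_right (m := ∞) (by simp)).clm_apply contDiffAt_const

instance : FiniteDimensional ℝ (R8 [⋀^Fin 3]→L[ℝ] ℝ) :=
  Module.Finite.of_injective comp3L comp3_injective

/-- With a fixed left inverse `L` of `M y`, the endomorphisms `N z = L ∘ M z` are the identity at
`y` and invertible nearby, so `τ = N⁻¹ L X` is smooth. -/
theorem contDiffAt_of_clm_apply_eq {V W : Type*} [NormedAddCommGroup V] [NormedSpace ℝ V]
    [FiniteDimensional ℝ V] [NormedAddCommGroup W] [NormedSpace ℝ W] [FiniteDimensional ℝ W] {U : Set R8}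
    (hU : IsOpen U) {M : R8 → V →ₗ[ℝ] W} {X : R8 → W} {τ : R8 → V}
    (hM : ∀ v, ContDiffOn ℝ ∞ (fun z => M z v) U) (hX : ContDiffOn ℝ ∞ X U)
    (hτ : ∀ z ∈ U, M z (τ z) = X z) {y : R8} (hy : y ∈ U) (hinj : Function.Injective (M y)) :
    ContDiffAt ℝ ∞ τ y := by
  have : CompleteSpace V := FiniteDimensional.complete ℝ V
  obtain ⟨L, hL⟩ := LinearMap.exists_leftInverse_of_injective (M y) (LinearMap.ker_eq_bot.2 hinj)
  let N : R8 → V →L[ℝ] V := fun z => LinearMap.toContinuousLinearMap (L ∘ₗ M z)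
  have hLc : ContDiff ℝ ∞ L := (LinearMap.toContinuousLinearMap L).contDiff
  have hN : ContDiffAt ℝ ∞ N y :=
    (contDiffOn_clm_apply.2 fun v => hLc.comp_contDiffOn (hM v)).contDiffAt (hU.mem_nhds hy)
  have hNy : N y = (ContinuousLinearEquiv.refl ℝ V : V →L[ℝ] V) := by
    ext v
    exact LinearMap.congr_fun hL v
  have hinv : ContDiffAt ℝ ∞ (fun z => (N z).inverse) y := by
    have := contDiffAt_map_inverse (𝕜 := ℝ) (n := ∞) (ContinuousLinearEquiv.refl ℝ V)
    rw [← hNy] at this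
    exact this.comp y hN
  refine (hinv.clm_apply (hLc.contDiffAt.comp y (hX.contDiffAt (hU.mem_nhds hy)))).congr_of_eventuallyEq ?_
  have hev := hN.continuousAt.eventually (hNy ▸ (ContinuousLinearEquiv.refl ℝ V).nhds)
  filter_upwards [hev, hU.mem_nhds hy] with z ⟨e, he⟩ hz
  have h1 : N z (τ z) = L (X z) := congrArg L (hτ z hz)
  rw [Function.comp_apply, ← h1, ← he, ContinuousLinearMap.inverse_equiv]
  simp

namespace IsCayleyOn

variable {ψ : R8 → R8 [⋀^Fin 4]→L[ℝ] ℝ} {U : Set R8} (h : IsCayleyOn ψ U)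
include h

theorem contDiffAt_christoffel {y : R8} (hy : y ∈ U) (k i j) :
    ContDiffAt ℝ ∞ (fun z => christoffel (fun z => metricMatrix (ψ z)) k i j z) y := by
  simp only [christoffel]
  have hg := fun a i j => contDiffAt_pderiv (h.contDiffAt_metric hy i j) a
  exact contDiffAt_const.mul (.sum fun l _ => (h.contDiffAt_inverseMetric hy k l).mul
    (((hg i j l).add (hg j i l)).sub (hg l i j)))

theorem contDiffAt_nabla4 {y : R8} (hy : y ∈ U) (a i j k l) : ContDiffAt ℝ ∞
    (fun z => nabla4 (fun z => metricMatrix (ψ z)) (fun z => comp4 (ψ z)) z a i j k l) y := by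
  simp only [nabla4]
  have hP := h.contDiffAt_comp4 hy
  have hΓ := h.contDiffAt_christoffel hy
  exact (contDiffAt_pderiv (hP i j k l) a).sub (.sum fun p _ =>
    ((((hΓ p a i).mul (hP p j k l)).add ((hΓ p a j).mul (hP i p k l))).add
      ((hΓ p a k).mul (hP i j p l))).add ((hΓ p a l).mul (hP i j k p)))

theorem contDiffAt_of_hasTorsionAt {τ : R8 → R8 [⋀^Fin 3]→L[ℝ] ℝ}
    (hτ : ∀ z ∈ U, HasTorsionAt ψ z (τ z)) {y : R8} (hy : y ∈ U) : ContDiffAt ℝ ∞ τ y := by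
  let M : R8 → (R8 [⋀^Fin 3]→L[ℝ] ℝ) →ₗ[ℝ] (Fin 8 → Tensor4) := fun z =>
    { toFun := fun σ a => derivation4 (raise1 (metricMatrix (ψ z))⁻¹ (comp3 σ) a) (comp4 (ψ z))
      map_add' := fun σ σ' => by
        funext a i j k l
        have : comp3 (σ + σ') = comp3 σ + comp3 σ' := rfl
        simp only [this, derivation4, raise1, Pi.add_apply, add_mul, Finset.sum_add_distrib]
        ring
      map_smul' := fun r σ => by
        funext a i j k l
        have : comp3 (r • σ) = r • comp3 σ := rfl
        simp only [this, derivation4, raise1, Pi.smul_apply, smul_eq_mul, RingHom.id_apply,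
          Finset.mul_sum, mul_assoc, Finset.sum_mul, Finset.sum_add_distrib, mul_add] }
  refine contDiffAt_of_clm_apply_eq h.isOpen (M := M)
    (X := nabla4 (fun z => metricMatrix (ψ z)) (fun z => comp4 (ψ z))) (fun σ z hz => ?_)
    (fun z hz => ?_) (fun z hz => (funext (hτ z hz)).symm) hy ?_
  · refine ContDiffAt.contDiffWithinAt ?_
    refine contDiffAt_pi.2 fun a => contDiffAt_pi.2 fun i => contDiffAt_pi.2 fun j =>
      contDiffAt_pi.2 fun k => contDiffAt_pi.2 fun l => ?_
    have hP := h.contDiffAt_comp4 hz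
    have hr : ∀ i p, ContDiffAt ℝ ∞ (fun z => raise1 (metricMatrix (ψ z))⁻¹ (comp3 σ) a i p) z :=
      fun i p => .sum fun r _ => contDiffAt_const.mul (h.contDiffAt_inverseMetric hz r p)
    change ContDiffAt ℝ ∞ (fun z => derivation4 (raise1 (metricMatrix (ψ z))⁻¹ (comp3 σ) a)
      (comp4 (ψ z)) i j k l) z
    simp only [derivation4]
    exact .sum fun p _ => ((((hr i p).mul (hP p j k l)).add ((hr j p).mul (hP i p k l))).add
      ((hr k p).mul (hP i j p l))).add ((hr l p).mul (hP i j k p))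
  · exact (contDiffAt_pi.2 fun a => contDiffAt_pi.2 fun i => contDiffAt_pi.2 fun j =>
      contDiffAt_pi.2 fun k => contDiffAt_pi.2 fun l =>
        h.contDiffAt_nabla4 hz a i j k l).contDiffWithinAt
  · intro σ σ' e
    -- Adding an element of the kernel to the torsion gives another solution, so uniqueness of the
    -- torsion is injectivity of the system.
    have hs : HasTorsionAt ψ y (τ y + (σ - σ')) := fun a => by
      have e1 : M y (τ y + (σ - σ')) = M y (τ y) := by
        rw [map_add, map_sub, e, sub_self, add_zero]
      rw [hτ y hy]
      exact (congrFun e1 a).symm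
    have := h.isExteriorTorsion_unique hy (h.hasTorsionAt_isExteriorTorsion hy hs)
      (h.hasTorsionAt_isExteriorTorsion hy (hτ y hy))
    simpa [sub_eq_zero] using this

end IsCayleyOn

/-! ## Second derivatives -/

theorem pderiv_comm {f : R8 → ℝ} {y : R8} (hf : ContDiffAt ℝ ∞ f y) (a b : Fin 8) :
    pderiv b (fun z => pderiv a f z) y = pderiv a (fun z => pderiv b f z) y := by
  have hd : DifferentiableAt ℝ (fderiv ℝ f) y :=
    (hf.fderiv_right (m := ∞) (by simp)).differentiableAt (by simp)
  have e : ∀ a b, pderiv b (fun z => pderiv a f z) y =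
      fderiv ℝ (fderiv ℝ f) y (stdVec b) (stdVec a) := fun a b => by
    have := (hd.hasFDerivAt.clm_apply (hasFDerivAt_const (stdVec a) y)).fderiv
    exact (congrArg (fun L : R8 →L[ℝ] ℝ => L (stdVec b)) this).trans (by simp)
  rw [e, e]
  refine hf.isSymmSndFDerivAt ?_ _ _
  simp only [minSmoothness_of_isRCLikeNormedField]
  exact WithTop.coe_le_coe.2 (le_top : (2 : ℕ∞) ≤ ⊤)

theorem hasDerivAt_derivation4 {K : ℝ → Matrix (Fin 8) (Fin 8) ℝ} {S : ℝ → Tensor4}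
    {K' : Matrix (Fin 8) (Fin 8) ℝ} {S' : Tensor4} {x : ℝ}
    (hK : ∀ i j, HasDerivAt (fun s => K s i j) (K' i j) x)
    (hS : ∀ i j k l, HasDerivAt (fun s => S s i j k l) (S' i j k l) x) (i j k l) :
    HasDerivAt (fun s => derivation4 (fun i p => K s i p) (S s) i j k l)
      (derivation4 (fun i p => K' i p) (S x) i j k l + derivation4 (fun i p => K x i p) S' i j k l)
      x := by
  simp only [derivation4, ← Finset.sum_add_distrib]
  refine HasDerivAt.fun_sum fun p _ => ?_
  refine (((((hK i p).fun_mul (hS p j k l)).fun_add ((hK j p).fun_mul (hS i p k l))).fun_add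
    ((hK k p).fun_mul (hS i j p l))).fun_add ((hK l p).fun_mul (hS i j k p))).congr_deriv ?_
  ring

theorem derivation4_derivation4_sub (K K' : Matrix (Fin 8) (Fin 8) ℝ) (S : Tensor4) :
    derivation4 (fun i p => K i p) (derivation4 (fun i p => K' i p) S) -
      derivation4 (fun i p => K' i p) (derivation4 (fun i p => K i p) S) =
    derivation4 (fun i p => (K * K' - K' * K) i p) S := by
  have e : derivation4 (fun i p => (K * K' - K' * K) i p) S =
      derivation4 (fun i p => (K * K') i p) S - derivation4 (fun i p => (K' * K) i p) S := by
    funext i j k l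
    simp only [derivation4, Pi.sub_apply, Matrix.sub_apply, sub_mul, ← Finset.sum_sub_distrib]
    exact Finset.sum_congr rfl fun p _ => by ring
  rw [e]
  simp only [derivation4_eq_mixedPull, LinearMap.map_add, mixedPull_mixedPull, Matrix.one_mul, Matrix.mul_one]
  abel

theorem pderiv_eq_of_hasDerivAt {f : R8 → ℝ} {y : R8} (hf : DifferentiableAt ℝ f y) (b : Fin 8)
    {F : ℝ → ℝ} {d : ℝ} (hF : HasDerivAt F d 0)
    (e : ∀ᶠ s : ℝ in nhds 0, f (y + s • stdVec b) = F s) : pderiv b f y = d :=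
  (hasDerivAt_line hf b).unique (hF.congr_of_eventuallyEq e)

theorem eventually_line {y : R8} {p : R8 → Prop} (hp : ∀ᶠ z in nhds y, p z) (b : Fin 8) :
    ∀ᶠ s : ℝ in nhds 0, p (y + s • stdVec b) := by
  have hc : Continuous fun s : ℝ => y + s • stdVec b := by fun_prop
  have hl : Filter.Tendsto (fun s : ℝ => y + s • stdVec b) (nhds 0) (nhds y) := by
    simpa using hc.tendsto 0
  exact hl.eventually hp

/-- The matrix of partial derivatives of the entries of a matrix. -/
noncomputable def pderivMatrix (b : Fin 8) (K : R8 → Matrix (Fin 8) (Fin 8) ℝ) (y : R8) :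
    Matrix (Fin 8) (Fin 8) ℝ := Matrix.of fun i j => pderiv b (fun z => K z i j) y

theorem hasDerivAt_pderivMatrix {K : R8 → Matrix (Fin 8) (Fin 8) ℝ} {y : R8}
    (hK : ∀ i j, ContDiffAt ℝ ∞ (fun z => K z i j) y) (b i j) :
    HasDerivAt (fun s : ℝ => K (y + s • stdVec b) i j) (pderivMatrix b K y i j) 0 :=
  hasDerivAt_line ((hK i j).differentiableAt (by simp)) b

theorem pderivMatrix_mul {K L : R8 → Matrix (Fin 8) (Fin 8) ℝ} {y : R8}
    (hK : ∀ i j, ContDiffAt ℝ ∞ (fun z => K z i j) y) (hL : ∀ i j, ContDiffAt ℝ ∞ (fun z => L z i j) y)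
    (b) : pderivMatrix b (fun z => K z * L z) y = pderivMatrix b K y * L y + K y * pderivMatrix b L y := by
  ext i j
  have hKL : DifferentiableAt ℝ (fun z => (K z * L z) i j) y := by
    simp only [Matrix.mul_apply]
    exact .fun_sum fun p _ => ((hK i p).differentiableAt (by simp)).mul
      ((hL p j).differentiableAt (by simp))
  refine pderiv_eq_of_hasDerivAt hKL b (hasDerivAt_matrix_mul (hasDerivAt_pderivMatrix hK b)
    (hasDerivAt_pderivMatrix hL b) i j) (.of_forall fun s => rfl) |>.trans ?_
  simp

theorem pderivMatrix_add {K L : R8 → Matrix (Fin 8) (Fin 8) ℝ} {y : R8}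
    (hK : ∀ i j, ContDiffAt ℝ ∞ (fun z => K z i j) y) (hL : ∀ i j, ContDiffAt ℝ ∞ (fun z => L z i j) y)
    (b) : pderivMatrix b (fun z => K z + L z) y = pderivMatrix b K y + pderivMatrix b L y := by
  ext i j
  exact pderiv_eq_of_hasDerivAt (((hK i j).differentiableAt (by simp)).add
    ((hL i j).differentiableAt (by simp))) b ((hasDerivAt_pderivMatrix hK b i j).add
    (hasDerivAt_pderivMatrix hL b i j)) (.of_forall fun s => rfl)

theorem pderivMatrix_transpose (K : R8 → Matrix (Fin 8) (Fin 8) ℝ) (y : R8) (b) :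
    pderivMatrix b (fun z => (K z).transpose) y = (pderivMatrix b K y).transpose := rfl

/-- Two derivatives of a tensor with `∂_a P = η_a · P` commute only if the curvature of `η`
annihilates `P`. -/
theorem derivation4_curvature_eq_zero {P : R8 → Tensor4} {η : Fin 8 → R8 → Matrix (Fin 8) (Fin 8) ℝ}
    {y : R8} (hP : ∀ i j k l, ContDiffAt ℝ ∞ (fun z => P z i j k l) y)
    (hη : ∀ a i j, ContDiffAt ℝ ∞ (fun z => η a z i j) y)
    (h : ∀ᶠ z in nhds y, ∀ a i j k l, pderiv a (fun z => P z i j k l) z =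
      derivation4 (fun i p => η a z i p) (P z) i j k l) (a b) :
    derivation4 (fun i p => (pderivMatrix b (η a) y - pderivMatrix a (η b) y + η a y * η b y
      - η b y * η a y) i p) (P y) = 0 := by
  have hP1 := h.self_of_nhds
  -- Differentiating `∂_a P = η_a · P` once more leaves `∂_b η_a · P` and the composite `η_a · (η_b
  -- · P)`. Exchanging `a` and `b` makes the commutator appear.
  have e : ∀ a b i j k l, pderiv b (fun z => pderiv a (fun z => P z i j k l) z) y =
      derivation4 (fun i p => pderivMatrix b (η a) y i p) (P y) i j k l +
      derivation4 (fun i p => η a y i p) (derivation4 (fun i p => η b y i p) (P y)) i j k l :=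
    fun a b i j k l => by
      have hS : ∀ i j k l, HasDerivAt (fun s : ℝ => P (y + s • stdVec b) i j k l)
          (derivation4 (fun i p => η b y i p) (P y) i j k l) 0 := fun i j k l => by
        rw [← hP1]
        exact hasDerivAt_line ((hP i j k l).differentiableAt (by simp)) b
      have := hasDerivAt_derivation4 (hasDerivAt_pderivMatrix (hη a) b) hS i j k l
      refine (pderiv_eq_of_hasDerivAt ((contDiffAt_pderiv (hP i j k l) a).differentiableAt (by simp))
        b this ?_).trans (by simp)
      filter_upwards [eventually_line h b] with s hs
      exact hs a i j k l
  funext i j k l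
  have e1 := (e a b i j k l).symm.trans ((pderiv_comm (hP i j k l) a b).trans (e b a i j k l))
  have e2 := congrFun (congrFun (congrFun (congrFun
    (derivation4_derivation4_sub (η a y) (η b y) (P y)) i) j) k) l
  simp only [Pi.sub_apply] at e2
  have e3 : derivation4 (fun i p => (pderivMatrix b (η a) y - pderivMatrix a (η b) y + η a y * η b y
      - η b y * η a y) i p) (P y) i j k l =
      derivation4 (fun i p => pderivMatrix b (η a) y i p) (P y) i j k l
      - derivation4 (fun i p => pderivMatrix a (η b) y i p) (P y) i j k l
      + derivation4 (fun i p => (η a y * η b y - η b y * η a y) i p) (P y) i j k l := by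
    simp only [derivation4, Matrix.sub_apply, Matrix.add_apply, ← Finset.sum_sub_distrib,
      ← Finset.sum_add_distrib]
    exact Finset.sum_congr rfl fun p _ => by ring
  rw [e3, ← e2, Pi.zero_apply, Pi.zero_apply, Pi.zero_apply, Pi.zero_apply]
  linarith

/-! ## The Riemann tensor -/

section Riemann

variable {g : R8 → Matrix (Fin 8) (Fin 8) ℝ} {y : R8}

/-- The curvature of the connection, as an endomorphism. -/
noncomputable def curvatureMatrix (g : R8 → Matrix (Fin 8) (Fin 8) ℝ) (y : R8) (a b : Fin 8) :
    Matrix (Fin 8) (Fin 8) ℝ :=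
  pderivMatrix b (connectionMatrix g a) y - pderivMatrix a (connectionMatrix g b) y
    + connectionMatrix g a y * connectionMatrix g b y
    - connectionMatrix g b y * connectionMatrix g a y

theorem riemann_eq (a b i j) : riemann g y a b i j = (curvatureMatrix g y a b * g y) i j := by
  simp only [riemann, Matrix.mul_apply, curvatureMatrix, pderivMatrix, connectionMatrix,
    Matrix.sub_apply, Matrix.add_apply, Matrix.of_apply, Finset.sum_sub_distrib]
  refine Finset.sum_congr rfl fun p _ => ?_
  rw [add_sub_assoc]
  refine congrArg (· * _) (congrArg₂ (· + ·) rfl (congrArg₂ (· - ·) ?_ ?_)) <;>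
    exact Finset.sum_congr rfl fun q _ => mul_comm _ _

theorem riemann_swap12 (a b i j) : riemann g y b a i j = -riemann g y a b i j := by
  simp only [riemann, ← Finset.sum_neg_distrib]
  refine Finset.sum_congr rfl fun p _ => ?_
  simp only [Finset.sum_sub_distrib]
  ring

variable (hsymm : ∀ z i j, g z i j = g z j i)

include hsymm in
theorem riemann_bianchi (a b i j) :
    riemann g y a b i j + riemann g y b i a j + riemann g y i a b j = 0 := by
  simp only [riemann, ← Finset.sum_add_distrib]
  refine Finset.sum_eq_zero fun p _ => ?_
  have c : ∀ i j, christoffel g p i j = christoffel g p j i := fun i j => funext fun z =>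
    christoffel_comm (y := z) hsymm p i j
  have c' : ∀ q i j, christoffel g q i j y = christoffel g q j i y := fun q i j =>
    christoffel_comm hsymm q i j
  rw [c b a, c i a, c i b]
  simp only [Finset.sum_sub_distrib, c' _ b a, c' _ i a, c' _ i b]
  ring

variable (hg : ∀ i j, ContDiffAt ℝ ∞ (fun z => g z i j) y) (h0 : (g y).det ≠ 0)
  (hev : ∀ᶠ z in nhds y, (g z).det ≠ 0)

include hg h0 in
theorem contDiffAt_connectionMatrix (a i j) :
    ContDiffAt ℝ ∞ (fun z => connectionMatrix g a z i j) y := by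
  have hd := fun a i j => contDiffAt_pderiv (hg i j) a
  have hi := contDiffAt_matrix_inv hg h0
  simp only [connectionMatrix, Matrix.of_apply, christoffel]
  exact contDiffAt_const.mul (.sum fun l _ => (hi j l).mul (((hd a i l).add (hd i a l)).sub (hd l a i)))

include hsymm hg h0 hev

/-- Since `∂_a g = Γ_a g + (Γ_a g)ᵀ`, the symmetry of the second derivatives of `g` says that the
curvature endomorphism is skew with respect to `g`. -/
theorem riemann_swap34 (a b i j) : riemann g y a b j i = -riemann g y a b i j := by
  have hT : ∀ z, (g z).transpose = g z := fun z => by ext i j; exact hsymm z j i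
  have hΓ := contDiffAt_connectionMatrix hg h0
  have hmul : ∀ a i j, ContDiffAt ℝ ∞ (fun z => (connectionMatrix g a z * g z) i j) y := fun a i j => by
    simp only [Matrix.mul_apply]
    exact .sum fun p _ => (hΓ a i p).mul (hg p j)
  have e : ∀ᶠ z in nhds y, ∀ a, pderivMatrix a g z =
      connectionMatrix g a z * g z + (connectionMatrix g a z * g z).transpose := by
    filter_upwards [hev] with z hz a
    ext i j
    refine (pderiv_metric hsymm hz a i j).trans ?_
    simp only [Finset.sum_add_distrib, Matrix.add_apply, Matrix.transpose_apply, Matrix.mul_apply,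
      connectionMatrix, Matrix.of_apply, hsymm z i]
  have e0 := e.self_of_nhds
  have e1 : ∀ a b i j, pderiv b (fun z => pderiv a (fun z => g z i j) z) y =
      (pderivMatrix b (connectionMatrix g a) y * g y + connectionMatrix g a y * pderivMatrix b g y +
      (pderivMatrix b (connectionMatrix g a) y * g y
        + connectionMatrix g a y * pderivMatrix b g y).transpose) i j := fun a b i j => by
    rw [← pderivMatrix_mul (hΓ a) hg, ← pderivMatrix_transpose,
      ← pderivMatrix_add (L := fun z => (connectionMatrix g a z * g z).transpose) (hmul a)
        fun i j => hmul a j i]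
    have k : (fun z => pderiv a (fun z => g z i j) z) =ᶠ[nhds y] fun z =>
        (connectionMatrix g a z * g z + (connectionMatrix g a z * g z).transpose) i j := by
      filter_upwards [e] with z hz
      exact congrFun (congrFun (hz a) i) j
    exact congrArg (fun L : R8 →L[ℝ] ℝ => L (stdVec b)) (k.fderiv_eq (𝕜 := ℝ))
  have e2 : curvatureMatrix g y a b * g y + (curvatureMatrix g y a b * g y).transpose = 0 := by
    have e3 : pderivMatrix b (connectionMatrix g a) y * g y + connectionMatrix g a y * pderivMatrix b g y +
        (pderivMatrix b (connectionMatrix g a) y * g y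
          + connectionMatrix g a y * pderivMatrix b g y).transpose =
        pderivMatrix a (connectionMatrix g b) y * g y + connectionMatrix g b y * pderivMatrix a g y +
        (pderivMatrix a (connectionMatrix g b) y * g y
          + connectionMatrix g b y * pderivMatrix a g y).transpose := by
      ext i j
      rw [← e1, ← e1]
      exact pderiv_comm (hg i j) a b
    rw [e0, e0] at e3
    simp only [Matrix.transpose_add, Matrix.transpose_mul, Matrix.transpose_transpose, hT] at e3
    rw [← sub_eq_zero] at e3 ⊢
    refine Eq.trans ?_ e3
    simp only [curvatureMatrix, Matrix.transpose_add, Matrix.transpose_sub, Matrix.transpose_mul, hT]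
    noncomm_ring
  have := congrFun (congrFun e2 i) j
  simp only [Matrix.add_apply, Matrix.transpose_apply, Matrix.zero_apply, ← riemann_eq] at this
  linarith

theorem riemann_mem_curvatureTensors : riemann g y ∈ curvatureTensors := by
  have h12 := fun a b c d => riemann_swap12 (g := g) (y := y) a b c d
  have h34 := riemann_swap34 hsymm hg h0 hev
  have hb := riemann_bianchi (y := y) hsymm
  -- The Bianchi identity at hand is cyclic in the first three indices, so `pair_symm_of_bianchi` is
  -- applied with the order of the indices reversed.
  have hp : ∀ a b c d, riemann g y a b c d = riemann g y c d a b := fun a b c d => by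
    have := pair_symm_of_bianchi (S := fun a b c d => riemann g y d c b a)
      (fun a b c d => h34 d c b a) (fun a b c d => h12 d c b a)
      (fun a b c d => by linarith [hb d c b a]) d c b a
    exact this.trans rfl
  refine ⟨fun a b c d => ?_, fun a b c d => ?_, hp, fun a b c d => ?_⟩
  · linarith [h12 a b c d]
  · linarith [h34 a b c d]
  · rw [hp a b c d, hp a c d b, hp a d b c]
    linarith [hb c d b a, h34 c d a b, h34 d b a c, h34 b c a d]

end Riemann

/-! ## The curvature equation -/

section Torsion

variable {g : R8 → Matrix (Fin 8) (Fin 8) ℝ} {y : R8} {P : R8 → Tensor4} {t : R8 → Tensor3}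

theorem pderivMatrix_eq_nabla3 (a b : Fin 8) : pderivMatrix b (fun z => Matrix.of (t z a)) y =
    Matrix.of (nabla3 g t y b a) + ∑ p, christoffel g p b a y • Matrix.of (t y p)
      + connectionMatrix g b y * Matrix.of (t y a)
      + Matrix.of (t y a) * (connectionMatrix g b y).transpose := by
  ext i j
  simp only [pderivMatrix, nabla3, Matrix.add_apply, Matrix.of_apply, Matrix.mul_apply,
    connectionMatrix, Matrix.transpose_apply, Matrix.sum_apply, Matrix.smul_apply, smul_eq_mul,
    Finset.sum_add_distrib, mul_comm (t y a i _)]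
  ring

variable (hsymm : ∀ z i j, g z i j = g z j i)
  (hg : ∀ i j, ContDiffAt ℝ ∞ (fun z => g z i j) y) (h0 : (g y).det ≠ 0)
include hsymm hg h0

theorem pderivMatrix_inverseMetric (b : Fin 8) : pderivMatrix b (fun z => (g z)⁻¹) y =
    -((connectionMatrix g b y).transpose * (g y)⁻¹ + (g y)⁻¹ * connectionMatrix g b y) := by
  ext i j
  exact pderiv_inverseMetric hsymm h0 (fun i j => (hg i j).of_le (by simp)) b i j

/-- The expression is the curvature of `η_a = Γ_a + t_a g⁻¹`, which annihilates `P` by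
`derivation4_curvature_eq_zero`. The products of `Γ` with `t` turn partial derivatives of `t` into
covariant ones and cancel those of `g⁻¹`. -/
theorem derivation4_riemann_add_eq_zero (hP : ∀ i j k l, ContDiffAt ℝ ∞ (fun z => P z i j k l) y)
    (ht : ∀ i j k, ContDiffAt ℝ ∞ (fun z => t z i j k) y)
    (hev : ∀ᶠ z in nhds y, ∀ a, nabla4 g P z a = derivation4 (raise1 (g z)⁻¹ (t z) a) (P z)) (a b) :
    derivation4 (fun i p => ((Matrix.of (riemann g y a b) + Matrix.of (nabla3 g t y b a)
      - Matrix.of (nabla3 g t y a b) + Matrix.of (t y a) * (g y)⁻¹ * Matrix.of (t y b)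
      - Matrix.of (t y b) * (g y)⁻¹ * Matrix.of (t y a)) * (g y)⁻¹) i p) (P y) = 0 := by
  have hΓ := contDiffAt_connectionMatrix hg h0
  have hh := contDiffAt_matrix_inv hg h0
  have htm : ∀ a i j, ContDiffAt ℝ ∞ (fun z => (Matrix.of (t z a)) i j) y := fun a i j => ht a i j
  have hθ : ∀ a i j, ContDiffAt ℝ ∞ (fun z => (Matrix.of (t z a) * (g z)⁻¹) i j) y := fun a i j => by
    simp only [Matrix.mul_apply]
    exact .sum fun p _ => (htm a i p).mul (hh p j)
  let η : Fin 8 → R8 → Matrix (Fin 8) (Fin 8) ℝ := fun a z =>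
    connectionMatrix g a z + Matrix.of (t z a) * (g z)⁻¹
  have key := derivation4_curvature_eq_zero (η := η) hP (fun a i j => (hΓ a i j).add (hθ a i j)) (by
    filter_upwards [hev] with z hz a i j k l
    have e := congrFun (congrFun (congrFun (congrFun (hz a) i) j) k) l
    rw [nabla4_eq_sub] at e
    simp only [Pi.sub_apply, sub_eq_iff_eq_add] at e
    rw [e]
    simp only [derivation4, η, raise1, Matrix.add_apply, Matrix.mul_apply, Matrix.of_apply,
      ← Finset.sum_add_distrib]
    exact Finset.sum_congr rfl fun p _ => by ring) a b
  have hu := isUnit_iff_ne_zero.2 h0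
  have hR : Matrix.of (riemann g y a b) * (g y)⁻¹ = curvatureMatrix g y a b := by
    have : Matrix.of (riemann g y a b) = curvatureMatrix g y a b * g y := by
      ext i j; exact riemann_eq a b i j
    rw [this, Matrix.mul_assoc, Matrix.mul_nonsing_inv _ hu, Matrix.mul_one]
  have hη : ∀ a b, pderivMatrix b (η a) y = pderivMatrix b (connectionMatrix g a) y +
      (pderivMatrix b (fun z => Matrix.of (t z a)) y * (g y)⁻¹ +
        Matrix.of (t y a) * pderivMatrix b (fun z => (g z)⁻¹) y) := fun a b => by
    rw [← pderivMatrix_mul (htm a) hh]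
    exact pderivMatrix_add (hΓ a) (hθ a) b
  -- The Christoffel terms in the index `a` of `t_a` are symmetric in `a` and `b` and cancel on
  -- antisymmetrisation.
  have hσ : ∑ p, christoffel g p a b y • Matrix.of (t y p) =
      ∑ p, christoffel g p b a y • Matrix.of (t y p) :=
    Finset.sum_congr rfl fun p _ => by rw [christoffel_comm hsymm]
  rw [hη, hη, pderivMatrix_eq_nabla3 (g := g), pderivMatrix_eq_nabla3 (g := g),
    pderivMatrix_inverseMetric hsymm hg h0, pderivMatrix_inverseMetric hsymm hg h0, hσ] at key
  refine Eq.trans (congrArg (fun K : Matrix (Fin 8) (Fin 8) ℝ => derivation4 (fun i p => K i p) (P y)) ?_) key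
  rw [Matrix.sub_mul, Matrix.add_mul, Matrix.sub_mul, Matrix.add_mul, hR, curvatureMatrix]
  simp only [η]
  noncomm_ring

end Torsion

/-- A 2-form whose endomorphism annihilates a Cayley form lies in `Λ²₂₁`. -/
theorem IsFrame.fourPi7_eq_zero {φ : R8 [⋀^Fin 4]→L[ℝ] ℝ} {A B : Matrix (Fin 8) (Fin 8) ℝ}
    (hAB : IsFrame φ A B) {L : Tensor4} (hL : ∀ a b i j, L a b j i = -L a b i j)
    (h0 : ∀ a b, derivation4 (fun i p => (Matrix.of (L a b) * (metricMatrix φ)⁻¹) i p) (comp4 φ) = 0) :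
    fourPi7 (metricMatrix φ)⁻¹ (comp4 φ) L = 0 := by
  have hd : ∀ p q, derivation4 (pull2 B (L p q)) stdPhi = 0 := fun p q => by
    have e : pull2 B (L p q) = fun i j => (B * Matrix.of (L p q) * B.transpose) i j := by
      funext i j; exact pull2_eq_mul B (L p q) i j
    have hK : B * (Matrix.of (L p q) * (metricMatrix φ)⁻¹) =
        (B * Matrix.of (L p q) * B.transpose) * B := by
      rw [hAB.inv_metricMatrix]; simp only [Matrix.mul_assoc]
    rw [e, ← hAB.pull4_eq, ← pull4_derivation4 B hK, h0, pull4_zero]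
  have hd2 : ∀ a b, derivation4 (pull4 B L a b) stdPhi = 0 := fun a b => by
    have e : pull4 B L a b = ∑ p, B a p • ∑ q, B b q • pull2 B (L p q) := by
      simp only [pull4, pull3, pull_apply, Finset.sum_apply, Pi.smul_apply]
    have e1 : ∀ p, derivation4 (∑ q, B b q • pull2 B (L p q)) stdPhi = 0 := fun p => by
      rw [derivation4_sum]; simp [hd]
    rw [e, derivation4_sum]
    simp [e1]
  have e : (metricMatrix φ)⁻¹ = B.transpose * 1 * B := by
    rw [hAB.inv_metricMatrix, transpose_mul_one_mul]
  refine pull4_injective A B hAB.mul_eq_one ?_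
  rw [e, pull4_fourPi7, pull4_zero, hAB.pull4_eq]
  have hs := pull4_skew34 B hL
  obtain ⟨S, hS⟩ : ∃ S, S = pull4 B L := ⟨_, rfl⟩
  rw [← hS] at hs hd2 ⊢
  funext a b i j
  have k := isSpinTensor_stdPhi.tripleContraction_derivation4 (hs a b)
  rw [hd2] at k
  have k2 := congrFun (congrFun k i) j
  simp only [tripleContraction, fourProj7, Pi.zero_apply, zero_mul, Finset.sum_const_zero,
    Pi.smul_apply, smul_eq_mul] at k2
  rw [fourPi7_eq]
  simp only [Pi.sub_apply, Pi.smul_apply, smul_eq_mul, contractLast_one, Pi.zero_apply]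
  linarith

theorem contractLast_add (h : Matrix (Fin 8) (Fin 8) ℝ) (Φ S S' : Tensor4) :
    contractLast h Φ (S + S') = contractLast h Φ S + contractLast h Φ S' := by
  funext a b i j
  exact LinearMap.map_add _ _ _

theorem contractLast_sub (h : Matrix (Fin 8) (Fin 8) ℝ) (Φ S S' : Tensor4) :
    contractLast h Φ (S - S') = contractLast h Φ S - contractLast h Φ S' := by
  funext a b i j
  exact LinearMap.map_sub _ _ _

theorem ip2_swap (h : Matrix (Fin 8) (Fin 8) ℝ) (X Y : Tensor2) :
    ip2 h (fun i j => X j i) Y = ip2 h X fun i j => Y j i := by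
  simp only [ip2_apply]
  rw [Finset.sum_comm]
  refine Finset.sum_congr rfl fun p _ => Finset.sum_congr rfl fun q _ => ?_
  rw [Finset.sum_comm]
  refine congrArg (· * _) (Finset.sum_congr rfl fun r _ => Finset.sum_congr rfl fun s _ => ?_)
  ring

/-- The part of the torsion curvature which is quadratic in the torsion. -/
theorem contractLast_torsionSquare_swap (h : Matrix (Fin 8) (Fin 8) ℝ) {Φ : Tensor4}
    (hΦ : Φ ∈ alternating4) (T : Tensor3) (hh : ∀ i j, h i j = h j i) :
    contractLast h Φ (fun a b i j => torsionSquare h T b i a j) =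
      -contractLast h Φ (fun a b i j => torsionSquare h T a i b j) := by
  have hc : ∀ u v : Fin 8 → ℝ, ip1 h u v = ip1 h v u := fun u v => by
    simp only [ip1, LinearMap.comp_apply, dot1, pairing_apply, pull1_apply, LinearMap.mul_apply',
      Finset.sum_mul, Matrix.transpose_apply]
    rw [Finset.sum_comm]
    refine Finset.sum_congr rfl fun p _ => Finset.sum_congr rfl fun q _ => ?_
    rw [hh p q]; ring
  funext a b i j
  simp only [contractLast, torsionSquare, Pi.neg_apply]
  have e : (fun p q => ip1 h (T b p) (T a q)) = fun p q => ip1 h (T a q) (T b p) :=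
    funext fun p => funext fun q => hc _ _
  have e2 : (fun p q => Φ i j q p) = -Φ i j := funext fun p => funext fun q => hΦ.2.2 i j p q
  rw [e, ← ip2_swap h (Φ i j) fun p q => ip1 h (T a p) (T b q), e2]
  simp

namespace IsCayleyOn

variable {ψ : R8 → R8 [⋀^Fin 4]→L[ℝ] ℝ} {U : Set R8} (h : IsCayleyOn ψ U) {y : R8} (hy : y ∈ U)
include h hy

theorem eventually_det_ne_zero : ∀ᶠ z in nhds y, (metricMatrix (ψ z)).det ≠ 0 := by
  filter_upwards [h.eventually_mem hy] with z hz
  exact (h.isCayleyForm z hz).det_metricMatrix_ne_zero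

theorem riemann_mem_curvatureTensors : riemann (fun z => metricMatrix (ψ z)) y ∈ curvatureTensors :=
  _root_.riemann_mem_curvatureTensors (fun _ => metricMatrix_comm _) (h.contDiffAt_metric hy)
    (h.isCayleyForm y hy).det_metricMatrix_ne_zero (h.eventually_det_ne_zero hy)

variable {τ : R8 → R8 [⋀^Fin 3]→L[ℝ] ℝ} (hτ : ∀ z ∈ U, HasTorsionAt ψ z (τ z))
include hτ

theorem contDiffAt_comp3 (i j k) : ContDiffAt ℝ ∞ (fun z => comp3 (τ z) i j k) y :=
  (ContinuousAlternatingMap.apply ℝ R8 ℝ ![stdVec i, stdVec j, stdVec k]).contDiff.contDiffAt.comp y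
    (h.contDiffAt_of_hasTorsionAt hτ hy)

/-- The curvature of `Γ + T` annihilates `Φ` and is skew, so its projection to `Λ²₇` vanishes.
Solving for the term with the Riemann tensor gives the formula. -/
theorem fourPi7_riemann : fourPi7 (metricMatrix (ψ y))⁻¹ (comp4 (ψ y))
      (riemann (fun z => metricMatrix (ψ z)) y) =
    torsionCurvature (metricMatrix (ψ y))⁻¹ (comp4 (ψ y)) (comp3 (τ y))
      (nabla3 (fun z => metricMatrix (ψ z)) (fun z => comp3 (τ z)) y) := by
  obtain ⟨A, B, hAB, -⟩ := (h.isCayleyForm y hy).exists_isFrame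
  have hs : ∀ z i j, metricMatrix (ψ z) i j = metricMatrix (ψ z) j i := fun z => metricMatrix_comm _
  have hd := (h.isCayleyForm y hy).det_metricMatrix_ne_zero
  have key := derivation4_riemann_add_eq_zero hs (h.contDiffAt_metric hy) hd (h.contDiffAt_comp4 hy)
    (h.contDiffAt_comp3 hy hτ) (by
      filter_upwards [h.eventually_mem hy] with z hz a
      exact hτ z hz a)
  obtain ⟨N, hN⟩ : ∃ N, N = nabla3 (fun z => metricMatrix (ψ z)) (fun z => comp3 (τ z)) y := ⟨_, rfl⟩
  have hN34 : ∀ a i j k, N a i k j = -N a i j k := by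
    rw [hN]
    exact nabla3_swap34 _ (fun z i j k => comp3_swap23 (τ z) i j k) y
  obtain ⟨R, hR⟩ : ∃ R, R = riemann (fun z => metricMatrix (ψ z)) y := ⟨_, rfl⟩
  have hRm : R ∈ curvatureTensors := hR ▸ h.riemann_mem_curvatureTensors hy
  rw [← hN, ← hR] at key ⊢
  obtain ⟨H, hH⟩ : ∃ H, H = (metricMatrix (ψ y))⁻¹ := ⟨_, rfl⟩
  have hHs : ∀ i j, H i j = H j i := fun i j => by
    rw [hH, hAB.inv_metricMatrix, Matrix.mul_apply, Matrix.mul_apply]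
    exact Finset.sum_congr rfl fun p _ => mul_comm _ _
  have ht12 := comp3_swap12 (τ y)
  have ht23 := comp3_swap23 (τ y)
  obtain ⟨t, ht⟩ : ∃ t, t = comp3 (τ y) := ⟨_, rfl⟩
  rw [← ht] at key ht12 ht23 ⊢
  -- Composition of endomorphisms contracts the last index of the first factor with the first index
  -- of the second; skewness of `t` turns this into `T_{ai}^p T_{bjp}` with a minus sign.
  have hts : ∀ a b i j, (Matrix.of (t a) * H * Matrix.of (t b)) i j = -torsionSquare H t a i b j := by
    intro a b i j
    simp only [torsionSquare, ip1, LinearMap.comp_apply, dot1, pairing_apply, pull1_apply,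
      LinearMap.mul_apply', Matrix.transpose_apply, Matrix.mul_apply, Matrix.of_apply,
      ← Finset.sum_neg_distrib]
    refine Finset.sum_congr rfl fun p _ => ?_
    rw [ht23 b j p]
    ring
  have hmat : ∀ a b, Matrix.of (R a b) + Matrix.of (N b a) - Matrix.of (N a b)
      + Matrix.of (t a) * H * Matrix.of (t b) - Matrix.of (t b) * H * Matrix.of (t a) =
      Matrix.of ((R + (fun a b => N b a) - N - (fun a b i j => torsionSquare H t a i b j) +
        fun a b i j => torsionSquare H t b i a j : Tensor4) a b) := fun a b => by
    ext i j
    simp only [Matrix.sub_apply, Matrix.add_apply, hts, Matrix.of_apply, Pi.add_apply, Pi.sub_apply]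
    ring
  have hts2 : ∀ a b i j, torsionSquare H t a j b i = torsionSquare H t b i a j := fun a b i j => by
    simp only [torsionSquare, ip1, LinearMap.comp_apply, dot1, pairing_apply, pull1_apply,
      LinearMap.mul_apply', Matrix.transpose_apply, Finset.sum_mul]
    rw [Finset.sum_comm]
    refine Finset.sum_congr rfl fun p _ => Finset.sum_congr rfl fun q _ => ?_
    rw [hHs p q]; ring
  have h0 := hAB.fourPi7_eq_zero (L := R + (fun a b => N b a) - N
    - (fun a b i j => torsionSquare H t a i b j) + fun a b i j => torsionSquare H t b i a j)
    (fun a b i j => by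
      simp only [Pi.add_apply, Pi.sub_apply, hN34 b a i j, hN34 a b i j, hts2 a b i j,
        hts2 b a i j, hRm.2.1 a b j i]
      ring) (fun a b => by rw [← hmat, hH]; exact key a b)
  -- The two quadratic terms have opposite contractions with `Φ`, so their halves combine into the
  -- single term with coefficient -1.
  have hc := contractLast_torsionSquare_swap H (comp4_mem_alternating4 (ψ y)) t hHs
  rw [← hH] at h0 ⊢
  rw [fourPi7_eq, contractLast_add, contractLast_sub, contractLast_sub, contractLast_add, hc] at h0
  rw [fourPi7_eq, torsionCurvature_eq, ← sub_eq_zero, ← h0]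
  funext a b i j
  simp only [Pi.add_apply, Pi.sub_apply, Pi.smul_apply, Pi.neg_apply, smul_eq_mul]
  ring

end IsCayleyOn

/-! ## The curvature of a field of Cayley forms -/

/-- A linear map that recovers the part of a curvature tensor orthogonal to the `168` part. -/
def IsOrthogonalPart (φ : R8 [⋀^Fin 4]→L[ℝ] ℝ) (F : Tensor4 →ₗ[ℝ] Tensor4) : Prop :=
  ∀ R ∈ curvatureTensors,
    (∃ W ∈ part168 (metricMatrix φ)⁻¹ (comp4 φ),
      R = F (fourPi7 (metricMatrix φ)⁻¹ (comp4 φ) R) + W) ∧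
    ∀ W ∈ part168 (metricMatrix φ)⁻¹ (comp4 φ),
      tensorInner (metricMatrix φ)⁻¹ (F (fourPi7 (metricMatrix φ)⁻¹ (comp4 φ) R)) W = 0

theorem IsCayleyForm.exists_isOrthogonalPart {φ : R8 [⋀^Fin 4]→L[ℝ] ℝ} (hφ : IsCayleyForm φ) :
    ∃ F, IsOrthogonalPart φ F := by
  obtain ⟨A, B, hAB, -⟩ := hφ.exists_isFrame
  obtain ⟨F, hF⟩ := exists_orthogonalPart hAB.mul_eq_one (Φ := comp4 φ)
  refine ⟨F, ?_⟩
  rw [IsOrthogonalPart, hAB.inv_metricMatrix]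
  exact hF

open Classical in
/-- The part of the curvature orthogonal to the `168` part, as a function of the torsion. -/
noncomputable def orthogonalPart (φ : R8 [⋀^Fin 4]→L[ℝ] ℝ) : Tensor4 →ₗ[ℝ] Tensor4 :=
  -- The choice is made from the value of the form alone, so the map is the same at all points of
  -- all manifolds where this value occurs.
  if h : ∃ F, IsOrthogonalPart φ F then h.choose else 0

theorem IsCayleyForm.isOrthogonalPart {φ : R8 [⋀^Fin 4]→L[ℝ] ℝ} (hφ : IsCayleyForm φ) :
    IsOrthogonalPart φ (orthogonalPart φ) := by
  have h := hφ.exists_isOrthogonalPart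
  rw [orthogonalPart, dif_pos h]
  exact h.choose_spec

namespace IsCayleyOn

variable {ψ : R8 → R8 [⋀^Fin 4]→L[ℝ] ℝ} {U : Set R8} (h : IsCayleyOn ψ U) {y : R8} (hy : y ∈ U)
  {τ : R8 → R8 [⋀^Fin 3]→L[ℝ] ℝ} (hτ : ∀ z ∈ U, HasTorsionAt ψ z (τ z))
include h hy hτ

local notation "𝐠" => fun z => metricMatrix (ψ z)
local notation "𝐡" => (metricMatrix (ψ y))⁻¹
local notation "𝐏" => comp4 (ψ y)
local notation "𝐭" => comp3 (τ y)
local notation "𝐍" => nabla3 (fun z => metricMatrix (ψ z)) (fun z => comp3 (τ z)) y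

theorem ricci_eq : ricci 𝐠 y = -(1 / 2 : ℝ) • symPart (phiGradT 𝐡 𝐏 𝐍)
    + (1 / 2 : ℝ) • symPart (phiCurlT 𝐡 𝐏 𝐍) + contractTT 𝐡 𝐭 + symPart (phiTT 𝐡 𝐏 𝐭) := by
  obtain ⟨A, B, hAB, -⟩ := (h.isCayleyForm y hy).exists_isFrame
  have hR := h.riemann_mem_curvatureTensors hy
  have hS := h.fourPi7_riemann hy hτ
  have n23 := nabla3_swap23 𝐠 (fun z i j k => comp3_swap12 (τ z) i j k) y
  have n34 := nabla3_swap34 𝐠 (fun z i j k => comp3_swap23 (τ z) i j k) y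
  unfold ricci
  rw [hAB.inv_metricMatrix] at hS ⊢
  exact ricciContraction_of_frame hAB.mul_eq_one hAB.isSpinTensor (comp3_swap12 (τ y)) n23 n34 hR hS

theorem scalarCurvature_eq : scalarCurvature 𝐠 y =
    -(∑ a, ∑ b, ∑ c, ∑ d, raise4 𝐡 𝐏 a b c d * 𝐍 a b c d)
      + ∑ a, ∑ b, ∑ c, raise3 𝐡 𝐭 a b c * 𝐭 a b c
      + ∑ a, ∑ b, ∑ c, ∑ d, ∑ p, raise4 𝐡 𝐏 a b c d * raise1 𝐡 𝐭 a b p * 𝐭 c d p := by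
  obtain ⟨A, B, hAB, -⟩ := (h.isCayleyForm y hy).exists_isFrame
  have hR := h.riemann_mem_curvatureTensors hy
  have hS := h.fourPi7_riemann hy hτ
  have n23 := nabla3_swap23 𝐠 (fun z i j k => comp3_swap12 (τ z) i j k) y
  have n34 := nabla3_swap34 𝐠 (fun z i j k => comp3_swap23 (τ z) i j k) y
  unfold scalarCurvature ricci
  rw [hAB.inv_metricMatrix] at hS ⊢
  exact scalarCurvature_of_frame hAB.isSpinTensor (comp3_swap12 (τ y)) n23 n34 hR hS

theorem divergence_eq (m n) : 4 * ∑ a, ∑ c, 𝐡 a c * nabla3 𝐠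
      (fun z => intrinsicTorsion (metricMatrix (ψ z))⁻¹ (comp4 (ψ z)) (comp3 (τ z))) y c a m n =
    (1 / 2) * skewPart (phiGradT 𝐡 𝐏 𝐍) m n - (3 / 2) * skewPart (phiCurlT 𝐡 𝐏 𝐍) m n
      - 3 * skewPart (phiTT 𝐡 𝐏 𝐭) m n := by
  obtain ⟨A, B, hAB, -⟩ := (h.isCayleyForm y hy).exists_isFrame
  have hR := h.riemann_mem_curvatureTensors hy
  have hS := h.fourPi7_riemann hy hτ
  have n23 := nabla3_swap23 𝐠 (fun z i j k => comp3_swap12 (τ z) i j k) y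
  have n34 := nabla3_swap34 𝐠 (fun z i j k => comp3_swap23 (τ z) i j k) y
  have hI := nabla3_intrinsicTorsion (g := 𝐠) (fun z => metricMatrix_comm _)
    (h.isCayleyForm y hy).det_metricMatrix_ne_zero
    (fun i j => (h.contDiffAt_metric hy i j).of_le (by simp))
    (fun i j k l => (h.contDiffAt_comp4 hy i j k l).of_le (by simp))
    (fun i j k => (h.contDiffAt_comp3 hy hτ i j k).of_le (by simp))
  rw [hI, funext (hτ y hy)]
  rw [hAB.inv_metricMatrix] at hS ⊢
  exact divergence_of_frame hAB.mul_eq_one hAB.isSpinTensor (comp3_swap12 (τ y)) (comp3_swap23 (τ y))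
    n23 n34 hR hS m n

omit hτ in
theorem part168_le_weylTensors : part168 𝐡 𝐏 ≤ weylTensors 𝐡 := by
  obtain ⟨A, B, hAB, -⟩ := (h.isCayleyForm y hy).exists_isFrame
  rw [hAB.inv_metricMatrix]
  exact part168_le_weylTensors_of_frame hAB.mul_eq_one hAB.isSpinTensor

omit hτ in
theorem finrank_part168 : Module.finrank ℝ (part168 𝐡 𝐏) = 168 := by
  obtain ⟨A, B, hAB, -⟩ := (h.isCayleyForm y hy).exists_isFrame
  rw [hAB.inv_metricMatrix]
  exact finrank_part168_of_frame hAB.mul_eq_one hAB.isSpinTensor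

theorem exists_riemann_eq_add : ∃ W ∈ part168 𝐡 𝐏,
    riemann 𝐠 y = orthogonalPart (ψ y) (torsionCurvature 𝐡 𝐏 𝐭 𝐍) + W ∧
      ∀ W' ∈ part168 𝐡 𝐏, tensorInner 𝐡 (orthogonalPart (ψ y) (torsionCurvature 𝐡 𝐏 𝐭 𝐍)) W' = 0 := by
  have := (h.isCayleyForm y hy).isOrthogonalPart _ (h.riemann_mem_curvatureTensors hy)
  rw [h.fourPi7_riemann hy hτ] at this
  obtain ⟨⟨W, hW, e⟩, h2⟩ := this
  exact ⟨W, hW, e, h2⟩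

omit hy hτ in
-- If `dΦ = 0`, the zero form is an exterior torsion, hence the torsion. Every term of the Ricci
-- formula then vanishes.
theorem hasTorsionAt_zero_of_extDeriv (hc : ∀ z ∈ U, extDeriv ψ z = 0) {z : R8} (hz : z ∈ U) :
    HasTorsionAt ψ z 0 := by
  refine (h.hasTorsionAt_iff hz).2 fun b _ p q i j k => ?_
  rw [hc z hz]
  simp [alternate5, derivation4]

omit hτ in
theorem ricci_eq_zero_of_extDeriv (hc : ∀ z ∈ U, extDeriv ψ z = 0) (a b) : ricci 𝐠 y a b = 0 := by
  rw [h.ricci_eq hy (τ := fun _ => 0) fun z hz => h.hasTorsionAt_zero_of_extDeriv hc hz]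
  have e : comp3 0 = 0 := rfl
  have e2 : nabla3 𝐠 (fun _ => comp3 0) y = 0 := by
    funext a i j k
    simp [nabla3, e, pderiv]
  rw [e2, e]
  simp [symPart, phiGradT, phiCurlT, contractTT, phiTT]

end IsCayleyOn

/-! ## Forms on a manifold in charts -/

section Charts

variable {M : Type*} [TopologicalSpace M] [ChartedSpace R8 M]

/-- The derivative of the inverse of a chart. -/
noncomputable def chartDeriv (e : OpenPartialHomeomorph M R8) (y : R8) : R8 →L[ℝ] R8 :=
  mfderiv (𝓡 8) (𝓡 8) e.symm y

/-- The value of a form, as a form on the model space. -/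
def modelForm {k : ℕ} (α : FormField M k) (x : M) : R8 [⋀^Fin k]→L[ℝ] ℝ := α x

theorem inChart_eq {k : ℕ} (e : OpenPartialHomeomorph M R8) (α : FormField M k) (y : R8) :
    inChart e α y = (modelForm α (e.symm y)).compContinuousLinearMap (chartDeriv e y) := rfl

variable {e e' : OpenPartialHomeomorph M R8}
  (he : e ∈ IsManifold.maximalAtlas (𝓡 8) ∞ M) (he' : e' ∈ IsManifold.maximalAtlas (𝓡 8) ∞ M)
include he

theorem mdifferentiable_of_mem_maximalAtlas : e.MDifferentiable (𝓡 8) (𝓡 8) :=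
  ⟨(contMDiffOn_of_mem_maximalAtlas he).mdifferentiableOn (by simp),
    (contMDiffOn_symm_of_mem_maximalAtlas he).mdifferentiableOn (by simp)⟩

theorem exists_chartDeriv_eq {y : R8} (hy : y ∈ e.target) :
    ∃ L : R8 ≃L[ℝ] R8, chartDeriv e y = L :=
  ⟨(mdifferentiable_of_mem_maximalAtlas he).symm.mfderiv hy, rfl⟩

theorem isCayleyOn_inChart {Φ : FormField M 4} (hΦ : IsCayleyField Φ) :
    IsCayleyOn (inChart e Φ) e.target := by
  refine ⟨e.open_target, hΦ.1 e he, fun y hy => ?_⟩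
  obtain ⟨L, hL⟩ := exists_chartDeriv_eq he hy
  rw [inChart_eq, hL]
  exact IsCayleyForm.comp_equiv (φ := modelForm Φ (e.symm y)) (hΦ.2 (e.symm y)) L

include he'

theorem contDiffAt_transition {y : R8} (hy : y ∈ e.target) (hy' : e.symm y ∈ e'.source) :
    ContDiffAt ℝ ∞ (fun z => e' (e.symm z)) y :=
  ((contMDiffAt_of_mem_maximalAtlas he' hy').comp y
    (contMDiffAt_symm_of_mem_maximalAtlas he hy)).contDiffAt

theorem chartDeriv_transition {y : R8} (hy : y ∈ e.target) (hy' : e.symm y ∈ e'.source) :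
    chartDeriv e y = (chartDeriv e' (e' (e.symm y))).comp (fderiv ℝ (fun z => e' (e.symm z)) y) := by
  have h1 : HasMFDerivAt (𝓡 8) (𝓡 8) e'.symm (e' (e.symm y)) _ :=
    ((mdifferentiable_of_mem_maximalAtlas he').mdifferentiableAt_symm (e'.map_source hy')).hasMFDerivAt
  have h2 := ((contDiffAt_transition he he' hy hy').differentiableAt (by simp)).hasFDerivAt.hasMFDerivAt
  have h3 := HasMFDerivAt.comp y h1 h2
  refine HasMFDerivAt.mfderiv (h3.congr_of_eventuallyEq ?_)
  have hc : ContinuousAt e.symm y := e.continuousAt_symm hy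
  filter_upwards [hc.eventually (e'.open_source.mem_nhds hy')] with z hz
  exact (e'.left_inv hz).symm

theorem inChart_transition {k : ℕ} (α : FormField M k) {y : R8} (hy : y ∈ e.target)
    (hy' : e.symm y ∈ e'.source) : inChart e α y =
      (inChart e' α (e' (e.symm y))).compContinuousLinearMap (fderiv ℝ (fun z => e' (e.symm z)) y) := by
  rw [inChart_eq, inChart_eq, e'.left_inv hy', chartDeriv_transition he he' hy hy']
  rfl

theorem exists_fderiv_transition_eq {y : R8} (hy : y ∈ e.target) (hy' : e.symm y ∈ e'.source) :
    ∃ L : R8 ≃L[ℝ] R8, fderiv ℝ (fun z => e' (e.symm z)) y = L := by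
  obtain ⟨L, hL⟩ := exists_chartDeriv_eq he hy
  obtain ⟨L', hL'⟩ := exists_chartDeriv_eq he' (e'.map_source hy')
  refine ⟨L.trans L'.symm, ?_⟩
  have := chartDeriv_transition he he' hy hy'
  rw [hL, hL'] at this
  ext1 v
  have hv := congrArg (fun K : R8 →L[ℝ] R8 => L'.symm (K v)) this
  simpa using hv.symm

end Charts

section TorsionForm

variable {M : Type*} [TopologicalSpace M] [ChartedSpace R8 M] [IsManifold (𝓡 8) ∞ M]
  {Φ : FormField M 4}

omit [IsManifold (𝓡 8) ∞ M] in
theorem isTorsionForm_iff {T : FormField M 3} : IsTorsionForm Φ T ↔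
    ∀ e ∈ IsManifold.maximalAtlas (𝓡 8) ∞ M, ∀ y ∈ e.target,
      HasTorsionAt (inChart e Φ) y (inChart e T y) := by
  have h : ∀ (e : OpenPartialHomeomorph M R8) y a, torsionAction (chartMetric e Φ y)⁻¹ (chartT e T y) (chartPhi e Φ y) a =
      derivation4 (raise1 (chartMetric e Φ y)⁻¹ (chartT e T y) a) (chartPhi e Φ y) := fun e y a =>
    torsionAction_eq_derivation4 (comp4_mem_alternating4 _) a
  constructor
  · intro hT e he y hy a
    refine Eq.trans ?_ (h e y a)
    funext i j k l
    exact hT e he y hy a i j k l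
  · intro hT e he y hy a i j k l
    rw [h]
    exact congrFun (congrFun (congrFun (congrFun (hT e he y hy a) i) j) k) l

variable (hΦ : IsCayleyField Φ)
include hΦ

/-- The form found in one chart around `x` is moved to the tangent space. In any other chart its
expression is the pull-back under the transition map, which is again an exterior torsion and
therefore solves the torsion equation. -/
theorem exists_torsion_at (x : M) : ∃ τ : R8 [⋀^Fin 3]→L[ℝ] ℝ,
    ∀ e ∈ IsManifold.maximalAtlas (𝓡 8) ∞ M, x ∈ e.source →
      HasTorsionAt (inChart e Φ) (e x) (τ.compContinuousLinearMap (chartDeriv e (e x))) := by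
  have he' : chartAt R8 x ∈ IsManifold.maximalAtlas (𝓡 8) ∞ M := IsManifold.chart_mem_maximalAtlas x
  obtain ⟨e', hx', he'⟩ : ∃ e' : OpenPartialHomeomorph M R8, x ∈ e'.source ∧
    e' ∈ IsManifold.maximalAtlas (𝓡 8) ∞ M := ⟨_, mem_chart_source R8 x, he'⟩
  have hC' := isCayleyOn_inChart he' hΦ
  obtain ⟨τ, hτ⟩ := hC'.exists_hasTorsionAt (e'.map_source hx')
  obtain ⟨L', hL'⟩ := exists_chartDeriv_eq he' (e'.map_source hx')
  refine ⟨τ.compContinuousLinearMap (L'.symm : R8 →L[ℝ] R8), fun e he hx => ?_⟩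
  have hy := e.map_source hx
  have hxy : e.symm (e x) = x := e.left_inv hx
  have hy' : e.symm (e x) ∈ e'.source := hxy.symm ▸ hx'
  obtain ⟨L, hL⟩ := exists_fderiv_transition_eq he he' hy hy'
  rw [(isCayleyOn_inChart he hΦ).hasTorsionAt_iff hy]
  have e1 : (τ.compContinuousLinearMap (L'.symm : R8 →L[ℝ] R8)).compContinuousLinearMap
      (chartDeriv e (e x)) = τ.compContinuousLinearMap (L : R8 →L[ℝ] R8) := by
    rw [chartDeriv_transition he he' hy hy', hxy, hL', hL]
    ext v
    refine congrArg τ (funext fun m => ?_)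
    simp
  rw [e1]
  have e2 : e' (e.symm (e x)) = e' x := by rw [hxy]
  refine IsExteriorTorsion.pullback (f := fun z => e' (e.symm z)) (ψ := inChart e' Φ) ?_
    (contDiffAt_transition he he' hy hy') L hL ?_ ?_
  · refine (hC'.contDiffAt ?_).differentiableAt (by simp)
    exact e'.map_source hy'
  · have hc : ContinuousAt e.symm (e x) := e.continuousAt_symm hy
    filter_upwards [hc.eventually (e'.open_source.mem_nhds hy'), e.open_target.mem_nhds hy] with z hz hz'
    exact inChart_transition he he' Φ hz' hz
  · simp only [e2]
    exact (hC'.hasTorsionAt_iff (e'.map_source hx')).1 hτ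

theorem exists_isTorsionForm : ∃ T : FormField M 3, IsTorsionForm Φ T := by
  choose T hT using exists_torsion_at hΦ
  refine ⟨T, isTorsionForm_iff.2 fun e he _ hy => ?_⟩
  have := hT (e.symm _) e he (e.map_target hy)
  rw [e.right_inv hy] at this
  exact this

omit [IsManifold (𝓡 8) ∞ M] in
theorem IsTorsionForm.isSmoothForm {T : FormField M 3} (hT : IsTorsionForm Φ T) : IsSmoothForm T :=
  fun e he _ hy => ((isCayleyOn_inChart he hΦ).contDiffAt_of_hasTorsionAt
    (fun z hz => isTorsionForm_iff.1 hT e he z hz) hy).contDiffWithinAt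

theorem IsTorsionForm.unique {T T' : FormField M 3} (hT : IsTorsionForm Φ T)
    (hT' : IsTorsionForm Φ T') : T = T' := by
  funext x
  obtain ⟨e, hx, he⟩ : ∃ e : OpenPartialHomeomorph M R8, x ∈ e.source ∧
    e ∈ IsManifold.maximalAtlas (𝓡 8) ∞ M :=
    ⟨_, mem_chart_source R8 x, IsManifold.chart_mem_maximalAtlas x⟩
  have hC := isCayleyOn_inChart he hΦ
  have hy := e.map_source hx
  obtain ⟨L, hL⟩ := exists_chartDeriv_eq he hy
  have k := hC.isExteriorTorsion_unique hy
    (hC.hasTorsionAt_isExteriorTorsion hy (isTorsionForm_iff.1 hT e he _ hy))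
    (hC.hasTorsionAt_isExteriorTorsion hy (isTorsionForm_iff.1 hT' e he _ hy))
  rw [inChart_eq, inChart_eq, hL, e.left_inv hx] at k
  have k2 : modelForm T x = modelForm T' x := by
    ext v
    have := congrArg (fun τ : R8 [⋀^Fin 3]→L[ℝ] ℝ => τ fun m => L.symm (v m)) k
    simpa [Function.comp_def] using this
  exact k2

end TorsionForm

theorem mainTheorem8 :
    -- the part of the curvature orthogonal to `168` is a universal function `F` of the torsion
    ∃ F : (R8 [⋀^Fin 4]→L[ℝ] ℝ) → (Tensor4 →ₗ[ℝ] Tensor4),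
      ∀ (M : Type*) [TopologicalSpace M] [ChartedSpace R8 M] [IsManifold (𝓡 8) ∞ M]
        (Φ : FormField M 4), IsCayleyField Φ →
        -- existence and uniqueness of the torsion 3-form
        (∃ T : FormField M 3, IsTorsionForm Φ T ∧ IsSmoothForm T) ∧
        (∀ T T' : FormField M 3, IsTorsionForm Φ T → IsTorsionForm Φ T' → T = T') ∧
        (∀ T : FormField M 3, IsTorsionForm Φ T →
          ∀ e ∈ IsManifold.maximalAtlas (𝓡 8) ∞ M, ∀ y ∈ e.target,
            let g := chartMetric e Φ
            let h := (chartMetric e Φ y)⁻¹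
            let P := chartPhi e Φ y
            let t := chartT e T y
            let N := chartNablaT e Φ T y
            -- the scalar curvature
            scalarCurvature g y =
              -(∑ a, ∑ b, ∑ c, ∑ d, raise4 h P a b c d * N a b c d)
                + ∑ a, ∑ b, ∑ c, raise3 h t a b c * t a b c
                + ∑ a, ∑ b, ∑ c, ∑ d, ∑ p, raise4 h P a b c d * raise1 h t a b p * t c d p ∧
            -- the Ricci tensor
            (∀ a b, ricci g y a b =
              -(1 / 2) * symPart (phiGradT h P N) a b + (1 / 2) * symPart (phiCurlT h P N) a b
                + contractTT h t a b + symPart (phiTT h P t) a b) ∧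
            -- the divergence of the torsion
            (∀ m n, 4 * chartDivTorsion e Φ T y m n =
              (1 / 2) * skewPart (phiGradT h P N) m n - (3 / 2) * skewPart (phiCurlT h P N) m n
                - 3 * skewPart (phiTT h P t) m n) ∧
            -- the part of the Riemann tensor in `Λ² ⊗ Λ²₇`
            fourPi7 h P (riemann g y) = torsionCurvature h P t N ∧
            -- the `168` part consists of Weyl tensors, and the rest is determined by the torsion
            part168 h P ≤ weylTensors h ∧
            Module.finrank ℝ (part168 h P) = 168 ∧
            ∃ W ∈ part168 h P,
              riemann g y = F (inChart e Φ y) (torsionCurvature h P t N) + W ∧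
              ∀ W' ∈ part168 h P,
                tensorInner h (F (inChart e Φ y) (torsionCurvature h P t N)) W' = 0) ∧
        -- closed Cayley forms have Ricci-flat metrics
        (IsClosedForm Φ →
          ∀ e ∈ IsManifold.maximalAtlas (𝓡 8) ∞ M, ∀ y ∈ e.target, ∀ a b,
            ricci (chartMetric e Φ) y a b = 0) := by
  refine ⟨orthogonalPart, fun M _ _ _ Φ hΦ => ⟨?_, ?_, fun T hT e he y hy => ?_, ?_⟩⟩
  · obtain ⟨T, hT⟩ := exists_isTorsionForm hΦ
    exact ⟨T, hT, hT.isSmoothForm hΦ⟩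
  · exact fun T T' hT hT' => hT.unique hΦ hT'
  · have hC := isCayleyOn_inChart he hΦ
    have hτ := isTorsionForm_iff.1 hT e he
    exact ⟨hC.scalarCurvature_eq hy hτ, fun a b => congrFun (congrFun (hC.ricci_eq hy hτ) a) b,
      hC.divergence_eq hy hτ, hC.fourPi7_riemann hy hτ, hC.part168_le_weylTensors hy,
      hC.finrank_part168 hy, hC.exists_riemann_eq_add hy hτ⟩
  · exact fun hc e he y hy => (isCayleyOn_inChart he hΦ).ricci_eq_zero_of_extDeriv hy (hc e he)
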